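/- **Conventions.** For a finite field $\mathbb F_q$, the whole-field univariate multiplicity code $\mathsf{MULT}^{(1)}_{q,s}(d)$ is the set of all words $(P^{(<s)}(a))_{a\in\mathbb F_q}$, where $P\in\mathbb F_q[X]$ has degree at most $d$, $P^{(<s)}(a)=(P(a),P^{(1)}(a),\dots,P^{(s-1)}(a))\in\mathbb F_q^s$, and $P^{(i)}$ is the $i$-th Hasse derivative, i.e. $P(X+Z)=\sum_i P^{(i)}(X)Z^i$. For a word $c$ and lists $S=(S_a)_a$ of subsets of the alphabet, $\mathrm{dist}(c,S)$ is the fraction of coordinates $a$ with $c_a\notin S_a$. A code is $(\alpha,\ell,L)$-list-recoverable if for all lists $S_a$ of size at most $\ell$ there are at most $L$ codewords $c$ with $\mathrm{dist}(c,S)\le\alpha$. **Theorem.** There are an absolute constant $C>0$ and one randomized algorithm such that the following holds. Let $\delta>0$, let $q$ be a prime, let $s,d,\ell$ be nonnegative integers with $s<q$, $d<(1-\delta)sq$ and $1\le\ell<\delta^2s/16$, and let $0\le\alpha<\frac1{2s}$. (The degree $d$ may exceed $q$.) 1. $\mathsf{MULT}^{(1)}_{q,s}(d)$ is $(\alpha,\ell,L)$-list-recoverable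 for some integer $L\le \ell^{\,C s\log_2 s}\cdot s^{\,C}$. 2. Given $q,s,d,\ell$, the admissible number $\lfloor\alpha q\rfloor$ of errors, and lists $S_a\subseteq\mathbb F_q^s$ of size at most $\ell$ for $a\in\mathbb F_q$, the algorithm always halts within $\left(q\cdot \ell^{\,s\log_2 s}\right)^{C}$ steps and, with probability at least $0.99$, outputs exactly the list, without repetition, of all polynomials $P\in\mathbb F_q[X]$ of degree at most $d$ with $\mathrm{dist}\big((P^{(<s)}(a))_{a},S\big)\le\alpha$. Here an algorithm is a program for a random access machine with finitely many registers and arrays holding natural numbers, whose unit-cost steps are constants, addition, truncated subtraction, indirect reading and writing, tests for zero, and drawing a uniformly random element of $\{0,\dots,y\}$ for the content $y$ of a register. -/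

import Mathlib

open scoped Polynomial ENNReal

/-! ### Codes and list recovery -/

/-- Relative distance of a word `c` from a sequence of lists `S`: the fraction of coordinates `i`
with `c i ∉ S i`. -/
noncomputable def listDist {ι A : Type*} [Fintype ι] [DecidableEq A]
    (c : ι → A) (S : ι → Finset A) : ℝ :=
  ((Finset.univ.filter (fun i => c i ∉ S i)).card : ℝ) / (Fintype.card ι : ℝ)

/-- A code `C ⊆ A^ι` is `(α, ℓ, L)`-list-recoverable if for all input lists of size at most `ℓ`
at most `L` codewords are at relative distance at most `α` from the lists. -/
def ListRecoverable {ι A : Type*} [Fintype ι] [DecidableEq A]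
    (C : Set (ι → A)) (α : ℝ) (ℓ L : ℕ) : Prop :=
  ∀ S : ι → Finset A, (∀ i, (S i).card ≤ ℓ) →
    {c : ι → A | c ∈ C ∧ listDist c S ≤ α}.encard ≤ (L : ℕ∞)

/-- Whole-field multiplicity encoding: `P ↦ (a ↦ (P(a), P⁽¹⁾(a), …, P⁽ˢ⁻¹⁾(a)))`,
with Hasse derivatives. -/
noncomputable def multEnc {F : Type*} [Field F] (s : ℕ) (P : F[X]) : F → Fin s → F :=
  fun a i => (Polynomial.hasseDeriv (i : ℕ) P).eval a

/-- The whole-field univariate multiplicity code of order `s` and degree `d` over `F`. -/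
def multCode (F : Type*) [Field F] (s d : ℕ) : Set (F → Fin s → F) :=
  {c | ∃ P : F[X], P.natDegree ≤ d ∧ multEnc s P = c}

/-! ### Randomized random access machines

Programs act on registers `x₀, x₁, …` and arrays `A₀, A₁, …`, all holding natural numbers (a program
mentions only finitely many registers and arrays; arrays have unbounded length). Every elementary
step costs one unit. The only arithmetic operations are addition and truncated
subtraction, so that `T` steps can only produce numbers of `O(T)` bits more than the input
and the unit-cost measure is polynomially related to Turing machine time. -/

/-- Programs. -/
inductive Prog : Type
  /-- `x := n` -/
  | const (x n : ℕ)
  /-- `x := y + z` -/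
  | add (x y z : ℕ)
  /-- `x := max (y - z) 0` -/
  | sub (x y z : ℕ)
  /-- `x := A_b[y]` -/
  | load (x b y : ℕ)
  /-- `A_b[x] := y` -/
  | store (b x y : ℕ)
  /-- `x :=` a fresh uniformly random element of `{0, 1, …, y}` -/
  | rand (x y : ℕ)
  /-- first `p`, then `p'` -/
  | seq (p p' : Prog)
  /-- if `x ≠ 0` then `p` else `p'` -/
  | ite (x : ℕ) (p p' : Prog)
  /-- while `x ≠ 0` do `p` -/
  | loop (x : ℕ) (p : Prog)

/-- Contents of the registers and of the arrays. -/
structure Store where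
  /-- `reg x` is the content of register `x`. -/
  reg : ℕ → ℕ
  /-- `arr b n` is the content of cell `n` of array `b`. -/
  arr : ℕ → ℕ → ℕ

/-- Write `v` into register `x`. -/
def Store.setReg (σ : Store) (x v : ℕ) : Store :=
  { σ with reg := Function.update σ.reg x v }

/-- Write `v` into cell `n` of array `b`. -/
def Store.setArr (σ : Store) (b n v : ℕ) : Store :=
  { σ with arr := Function.update σ.arr b (Function.update (σ.arr b) n v) }

/-- A configuration: the stack of program parts still to be executed, and the store. -/
structure Config where
  /-- what is still to be executed, in this order; the machine has halted when it is empty -/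
  todo : List Prog
  /-- the current store -/
  store : Store

/-- One step of the machine, as a probability distribution on the next configuration. A machine
that has halted does not move. -/
noncomputable def Config.step : Config → PMF Config
  | ⟨[], σ⟩ => PMF.pure ⟨[], σ⟩
  | ⟨Prog.const x n :: k, σ⟩ => PMF.pure ⟨k, σ.setReg x n⟩
  | ⟨Prog.add x y z :: k, σ⟩ => PMF.pure ⟨k, σ.setReg x (σ.reg y + σ.reg z)⟩
  | ⟨Prog.sub x y z :: k, σ⟩ => PMF.pure ⟨k, σ.setReg x (σ.reg y - σ.reg z)⟩
  | ⟨Prog.load x b y :: k, σ⟩ => PMF.pure ⟨k, σ.setReg x (σ.arr b (σ.reg y))⟩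
  | ⟨Prog.store b x y :: k, σ⟩ => PMF.pure ⟨k, σ.setArr b (σ.reg x) (σ.reg y)⟩
  | ⟨Prog.rand x y :: k, σ⟩ =>
      (PMF.uniformOfFintype (Fin (σ.reg y + 1))).map (fun v => ⟨k, σ.setReg x (v : ℕ)⟩)
  | ⟨Prog.seq p p' :: k, σ⟩ => PMF.pure ⟨p :: p' :: k, σ⟩
  | ⟨Prog.ite x p p' :: k, σ⟩ => PMF.pure ⟨(if σ.reg x ≠ 0 then p else p') :: k, σ⟩
  | ⟨Prog.loop x p :: k, σ⟩ =>
      PMF.pure ⟨if σ.reg x ≠ 0 then p :: Prog.loop x p :: k else k, σ⟩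

/-- Distribution of the configuration after `T` steps. -/
noncomputable def Config.run : ℕ → Config → PMF Config
  | 0, c => PMF.pure c
  | T + 1, c => c.step.bind (Config.run T)

/-- Started on `σ`, the program `p` halts within `T` steps for every outcome of its random choices,
and with probability at least `ρ` its final store satisfies `Good`. -/
def Prog.SolvesWithin (p : Prog) (σ : Store) (T : ℕ) (ρ : ℝ≥0∞) (Good : Store → Prop) : Prop :=
  (∀ c ∈ (Config.run T ⟨[p], σ⟩).support, c.todo = []) ∧
    ρ ≤ (Config.run T ⟨[p], σ⟩).toOuterMeasure {c | Good c.store}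

/-! ### Input and output of list-recovery programs

Elements of `𝔽_q = ZMod q` are represented by the numbers `0, …, q - 1`. -/

/-- The store in which a list-recovery program is started: registers `0, …, 4` hold
`q`, `s`, `d`, `ℓ` and the number `e` of admissible errors. The lists `w a`, of at most `ℓ` symbols
each, are in arrays `0` and `1`: cell `(a * ℓ + k) * s + i` of array `0` holds coordinate `i` of
the `k`-th symbol of `w a`, cell `a` of array `1` holds the length of `w a`. Everything else is
`0`. -/
def inputStore (q s d ℓ e : ℕ) (w : ZMod q → List (Fin s → ZMod q)) : Store where
  reg x := [q, s, d, ℓ, e].getD x 0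
  arr b n :=
    if b = 0 then
      if h : 0 < s ∧ n < q * ℓ * s then
        ((w ((n / (ℓ * s) : ℕ) : ZMod q)).getD (n / s % ℓ) 0 ⟨n % s, Nat.mod_lt n h.1⟩).val
      else 0
    else if b = 1 then
      if n < q then (w (n : ZMod q)).length else 0
    else 0

/-- The store `σ` displays the list `Ps` of polynomials of degree at most `d`: register `0` holds
its length, and cell `k * (d + 1) + j` of array `0` holds the coefficient of `X ^ j` in the `k`-th
polynomial, for `j = 0, …, d`. -/
def Displays {q : ℕ} (d : ℕ) (Ps : List (ZMod q)[X]) (σ : Store) : Prop :=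
  σ.reg 0 = Ps.length ∧
    ∀ (k : Fin Ps.length) (j : ℕ), j ≤ d →
      σ.arr 0 ((k : ℕ) * (d + 1) + j) = ((Ps.get k).coeff j).val

/-- The store `σ` displays, without repetition, exactly the polynomials of degree at most `d` whose
encoding is at relative distance at most `α` from the lists `w`. -/
def ListsAll (q s d : ℕ) [Fact q.Prime] (α : ℝ) (w : ZMod q → List (Fin s → ZMod q))
    (σ : Store) : Prop :=
  ∃ Ps : List (ZMod q)[X], Ps.Nodup ∧
    (∀ P : (ZMod q)[X],
      P ∈ Ps ↔ P.natDegree ≤ d ∧ listDist (multEnc s P) (fun a => (w a).toFinset) ≤ α) ∧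
    Displays d Ps σ

/-! Fix the lists, of size at most `ℓ`, and let `e` be the number of admissible errors.
Interpolation gives nonzero differential operators `(P, λ) ↦ λ A + ∑_{i < r} B_i P⁽ⁱ⁾`, with `r`
about `(s - d / q) / 4`, `deg A < N` and `deg B_i < m = N - d`, such that for `λ = 1` the result
vanishes to order `g = s + 1 - r` at each point of the field as soon as the jet of `P` there is a
listed symbol. They exist because `ℓ < δ² s / 16` makes the `N + r m` unknowns outnumber the `q ℓ g`
conditions. With `N = (q - e) g`, an admissible `P` produces a polynomial of degree below `N` having
`N` zeros with multiplicity, that is, zero (`diffOp_eq_zero_of_isSolution`).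

So the admissible polynomials lie in a translate of the space `V` solving the homogeneous equations.
As `d` may exceed `q`, the dimension of `V` is only bounded by `r s`, but `V` is thin: its nonzero
elements have fewer than `r` degrees modulo `q` (`thin_solutionSpace`). Indeed the Hasse-Wronskian
of polynomials with distinct degrees modulo the characteristic is nonzero, its top coefficient being
essentially a Vandermonde determinant in these degrees (`det_wronskianMatrix_ne_zero`); `r` such
elements of `V` would force all `B_i`, and then `A`, to vanish.

The central estimate (`Thin.sum_finrank_le`) says that imposing a zero of order `s` at a uniformly
random point shrinks the dimension of a thin space by a factor `1 - 1 / s` on average. A subspace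
`U` spanned by elements of least degree in each residue class controls the dimension of `V`, while
the zeros of its Wronskian bound how often elements of `U` vanish to high order. Thinness passes to
subspaces, so this can be iterated over `t = 6 s b` points, where `s < 2 ^ b`. The expected
remaining dimension is then small even compared with the probability that all `t` points are free of
errors, since `e ≤ q / (2 s)`. Hence at least a fraction `2 ^ (-(6 b + 1))` of the point tuples
consists of agreement points of `P` and leaves no freedom in `V`; guessing the list entries too
costs a factor `ℓ ^ t`. A tuple of symbols isolates at most one admissible polynomial, so there are
at most `2 ^ (6 b + 1) ℓ ^ t` of them (`card_solutions_le`).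

The algorithm makes the same argument constructive. It solves the linear systems by elimination,
draws many random tuples of symbols, adds for each the corresponding agreement conditions, and tests
all multiples of the remaining vectors. Tested output is always correct, and a union bound over the
admissible polynomials shows that with probability 0.99 none is missed (`card_tapes_ge`). To control
machine steps, the deterministic parts are written in a small structured language whose loops are
bounded by registers they do not change; a compiler with proved correctness and cost yields a
running time polynomial in the largest such bound (`Cmd.compile_correct`, `Cmd.exists_time_le`). -/

open Polynomial

/-! ### Running programs without random choices -/

theorem Config.run_add (m n : ℕ) (c : Config) :
    Config.run (m + n) c = (Config.run m c).bind (Config.run n) := by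
  induction m generalizing c with
  | zero => simp [Config.run]
  | succ m ih =>
    rw [Nat.succ_add]
    simp only [Config.run, PMF.bind_bind]
    congr 1
    funext c'
    exact ih c'

/-- `p` takes the store `σ` to `σ'` in exactly `n` steps, without random choices. -/
def Prog.Runs (p : Prog) (σ σ' : Store) (n : ℕ) : Prop :=
  ∀ k, Config.run n ⟨p :: k, σ⟩ = PMF.pure ⟨k, σ'⟩

/-- `p`, started on `σ`, takes at most `n` steps to a store satisfying `Q`. -/
def Prog.Reaches (p : Prog) (σ : Store) (n : ℕ) (Q : Store → Prop) : Prop :=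
  ∃ m ≤ n, ∃ σ', p.Runs σ σ' m ∧ Q σ'

namespace Prog

theorem Runs.of_step {p : Prog} {σ σ' : Store}
    (h : ∀ k, Config.step ⟨p :: k, σ⟩ = PMF.pure ⟨k, σ'⟩) : p.Runs σ σ' 1 := by
  intro k
  simp [Config.run, h]

theorem Runs.seq {p p' : Prog} {σ σ' σ'' : Store} {m n : ℕ} (h : p.Runs σ σ' m)
    (h' : p'.Runs σ' σ'' n) : (Prog.seq p p').Runs σ σ'' (1 + (m + n)) := by
  intro k
  rw [Config.run_add]
  simp only [Config.run, Config.step, PMF.bind_pure, PMF.pure_bind]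
  rw [Config.run_add, h, PMF.pure_bind, h']

theorem Runs.ite {x : ℕ} {p p' : Prog} {σ σ' : Store} {n : ℕ}
    (h : (if σ.reg x ≠ 0 then p else p').Runs σ σ' n) : (Prog.ite x p p').Runs σ σ' (1 + n) := by
  intro k
  rw [Config.run_add]
  simp only [Config.run, Config.step, PMF.bind_pure, PMF.pure_bind]
  rw [h]

theorem Runs.loop_zero {x : ℕ} {p : Prog} {σ : Store} (h : σ.reg x = 0) :
    (Prog.loop x p).Runs σ σ 1 := by
  intro k
  simp [Config.run, Config.step, h]

theorem Runs.loop_succ {x : ℕ} {p : Prog} {σ σ' σ'' : Store} {m n : ℕ} (h : σ.reg x ≠ 0)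
    (hp : p.Runs σ σ' m) (hl : (Prog.loop x p).Runs σ' σ'' n) :
    (Prog.loop x p).Runs σ σ'' (1 + (m + n)) := by
  intro k
  rw [Config.run_add]
  simp only [Config.run, Config.step, PMF.bind_pure, PMF.pure_bind, h, ne_eq, not_false_eq_true,
    if_true]
  rw [Config.run_add, hp, PMF.pure_bind, hl]

variable {σ : Store} {Q R : Store → Prop}

theorem Reaches.mono {p : Prog} {m n : ℕ} (h : p.Reaches σ m Q) (hmn : m ≤ n)
    (hQ : ∀ τ, Q τ → R τ) : p.Reaches σ n R := by
  obtain ⟨k, hk, τ, h1, h2⟩ := h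
  exact ⟨k, hk.trans hmn, τ, h1, hQ _ h2⟩

theorem Reaches.le {p : Prog} {m n : ℕ} (h : p.Reaches σ m Q) (hmn : m ≤ n) : p.Reaches σ n Q :=
  h.mono hmn fun _ => id

theorem reaches_const {x n : ℕ} (h : Q (σ.setReg x n)) : (Prog.const x n).Reaches σ 1 Q :=
  ⟨1, le_rfl, _, Runs.of_step fun _ => rfl, h⟩

theorem reaches_add {x y z : ℕ} (h : Q (σ.setReg x (σ.reg y + σ.reg z))) :
    (Prog.add x y z).Reaches σ 1 Q :=
  ⟨1, le_rfl, _, Runs.of_step fun _ => rfl, h⟩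

theorem reaches_sub {x y z : ℕ} (h : Q (σ.setReg x (σ.reg y - σ.reg z))) :
    (Prog.sub x y z).Reaches σ 1 Q :=
  ⟨1, le_rfl, _, Runs.of_step fun _ => rfl, h⟩

theorem reaches_load {x b y : ℕ} (h : Q (σ.setReg x (σ.arr b (σ.reg y)))) :
    (Prog.load x b y).Reaches σ 1 Q :=
  ⟨1, le_rfl, _, Runs.of_step fun _ => rfl, h⟩

theorem reaches_store {b x y : ℕ} (h : Q (σ.setArr b (σ.reg x) (σ.reg y))) :
    (Prog.store b x y).Reaches σ 1 Q :=
  ⟨1, le_rfl, _, Runs.of_step fun _ => rfl, h⟩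

theorem reaches_seq {p p' : Prog} {m n : ℕ}
    (h : p.Reaches σ m fun τ => p'.Reaches τ n Q) : (Prog.seq p p').Reaches σ (m + n + 1) Q := by
  obtain ⟨k, hk, τ, h1, k', hk', τ', h1', h2⟩ := h
  exact ⟨_, by omega, τ', h1.seq h1', h2⟩

theorem reaches_ite {x : ℕ} {p p' : Prog} {n : ℕ}
    (h : (if σ.reg x ≠ 0 then p else p').Reaches σ n Q) :
    (Prog.ite x p p').Reaches σ (n + 1) Q := by
  obtain ⟨k, hk, τ, h1, h2⟩ := h
  exact ⟨_, by omega, τ, h1.ite, h2⟩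

/-- A loop counting register `x` down from `N` to `0`, with invariant `I`. -/
theorem reaches_countdown {x : ℕ} {p : Prog} (N c : ℕ) (I : ℕ → Store → Prop)
    (h0 : I 0 σ) (hx : ∀ i τ, I i τ → i ≤ N → τ.reg x = N - i)
    (hp : ∀ i τ, i < N → I i τ → p.Reaches τ c (I (i + 1))) :
    (Prog.loop x p).Reaches σ (N * (c + 1) + 1) (I N) := by
  suffices H : ∀ j i τ, i + j = N → I i τ → (Prog.loop x p).Reaches τ (j * (c + 1) + 1) (I N) from
    H N 0 σ (by omega) h0
  intro j
  induction j with
  | zero =>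
    intro i τ hi hI
    obtain rfl : i = N := by omega
    exact ⟨1, by omega, τ, Runs.loop_zero (by simpa using hx _ _ hI le_rfl), hI⟩
  | succ j ih =>
    intro i τ hi hI
    obtain ⟨m, hm, τ', h1, h2⟩ := hp i τ (by omega) hI
    obtain ⟨n, hn, τ'', h3, h4⟩ := ih (i + 1) τ' (by omega) h2
    refine ⟨_, ?_, τ'', Runs.loop_succ ?_ h1 h3, h4⟩
    · rw [Nat.succ_mul]; omega
    · rw [hx i τ hI (by omega)]; omega

end Prog

/-! ### A structured language -/

/-- Arithmetic expressions, with bounded sums. The multiplication clamps its first factor by a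
register, and the quotient is clamped by a register; this bounds the cost of their evaluation. -/
inductive AExp : Type
  | var (x : ℕ)
  | reg (x : ℕ)
  | lit (n : ℕ)
  | add (a b : AExp)
  | sub (a b : AExp)
  | mul (n : ℕ) (a b : AExp)
  | div (n : ℕ) (a b : AExp)
  | get (b : ℕ) (a : AExp)
  | sum (x n : ℕ) (a : AExp)

/-- Commands. `loop x n p` executes `p` for all values of the local variable `x` below the content
of register `n`. -/
inductive Cmd : Type
  | skip
  | set (x : ℕ) (a : AExp)
  | put (b : ℕ) (i a : AExp)
  | seq (p p' : Cmd)
  | ite (a : AExp) (p p' : Cmd)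
  | loop (x n : ℕ) (p : Cmd)

/-- Value of an expression; `v` assigns values to the local variables. -/
def AExp.eval (σ : Store) : (ℕ → ℕ) → AExp → ℕ
  | v, var x => v x
  | _, reg x => σ.reg x
  | _, lit n => n
  | v, add a b => a.eval σ v + b.eval σ v
  | v, sub a b => a.eval σ v - b.eval σ v
  | v, mul n a b => min (a.eval σ v) (σ.reg n) * b.eval σ v
  | v, div n a b =>
      ∑ i ∈ Finset.range (σ.reg n), (1 - ((i + 1) * b.eval σ v - a.eval σ v))
  | v, get b a => σ.arr b (a.eval σ v)
  | v, sum x n a => ∑ i ∈ Finset.range (σ.reg n), a.eval σ (Function.update v x i)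

/-- `f (N - 1) ∘ ⋯ ∘ f 0`. -/
def iterUpTo {α : Type*} (f : ℕ → α → α) : ℕ → α → α
  | 0, a => a
  | n + 1, a => f n (iterUpTo f n a)

/-- Effect of a command on the store. -/
def Cmd.exec : (ℕ → ℕ) → Cmd → Store → Store
  | _, skip, σ => σ
  | v, set x a, σ => σ.setReg x (a.eval σ v)
  | v, put b i a, σ => σ.setArr b (i.eval σ v) (a.eval σ v)
  | v, seq p p', σ => p'.exec v (p.exec v σ)
  | v, ite a p p', σ => if a.eval σ v ≠ 0 then p.exec v σ else p'.exec v σ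
  | v, loop x n p, σ => iterUpTo (fun i τ => p.exec (Function.update v x i) τ) (σ.reg n) σ

/-! ### Compilation -/

/-- The number of registers available to commands. -/
def userRegs : ℕ := 40

/-- The register of a local variable. -/
def varReg (x : ℕ) : ℕ := userRegs + 2 * x

/-- Temporary registers. -/
def tmpReg (k : ℕ) : ℕ := userRegs + 2 * k + 1

/-- Compiled expression; the value is left in `tmpReg k`. -/
def AExp.compile : ℕ → AExp → Prog
  | k, var x => .seq (.const (tmpReg k) 0) (.add (tmpReg k) (tmpReg k) (varReg x))
  | k, reg x => .seq (.const (tmpReg k) 0) (.add (tmpReg k) (tmpReg k) x)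
  | k, lit n => .const (tmpReg k) n
  | k, add a b => .seq (a.compile k) (.seq (b.compile (k + 1))
      (.add (tmpReg k) (tmpReg k) (tmpReg (k + 1))))
  | k, sub a b => .seq (a.compile k) (.seq (b.compile (k + 1))
      (.sub (tmpReg k) (tmpReg k) (tmpReg (k + 1))))
  | k, mul n a b => .seq (a.compile k) (.seq (b.compile (k + 1))
      (.seq (.sub (tmpReg (k + 2)) (tmpReg k) n)
      (.seq (.sub (tmpReg k) (tmpReg k) (tmpReg (k + 2)))
      (.seq (.const (tmpReg (k + 2)) 0)
      (.seq (.const (tmpReg (k + 3)) 1)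
      (.seq (.loop (tmpReg k)
        (.seq (.add (tmpReg (k + 2)) (tmpReg (k + 2)) (tmpReg (k + 1)))
          (.sub (tmpReg k) (tmpReg k) (tmpReg (k + 3)))))
      (.add (tmpReg k) (tmpReg k) (tmpReg (k + 2)))))))))
  | k, div n a b => .seq (a.compile k) (.seq (b.compile (k + 1))
      (.seq (.const (tmpReg (k + 2)) 0)
      (.seq (.const (tmpReg (k + 3)) 0)
      (.seq (.const (tmpReg (k + 4)) 1)
      (.seq (.add (tmpReg (k + 5)) n (tmpReg (k + 2)))
      (.seq (.loop (tmpReg (k + 5))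
        (.seq (.add (tmpReg (k + 2)) (tmpReg (k + 2)) (tmpReg (k + 1)))
        (.seq (.sub (tmpReg (k + 6)) (tmpReg (k + 2)) (tmpReg k))
        (.seq (.sub (tmpReg (k + 6)) (tmpReg (k + 4)) (tmpReg (k + 6)))
        (.seq (.add (tmpReg (k + 3)) (tmpReg (k + 3)) (tmpReg (k + 6)))
        (.sub (tmpReg (k + 5)) (tmpReg (k + 5)) (tmpReg (k + 4))))))))
      (.seq (.const (tmpReg k) 0)
      (.add (tmpReg k) (tmpReg k) (tmpReg (k + 3))))))))))
  | k, get b a => .seq (a.compile k) (.load (tmpReg k) b (tmpReg k))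
  | k, sum x n a => .seq (.const (tmpReg k) 0)
      (.seq (.add (tmpReg (k + 1)) n (tmpReg k))
      (.loop (tmpReg (k + 1))
        (.seq (.sub (varReg x) n (tmpReg (k + 1)))
        (.seq (a.compile (k + 2))
        (.seq (.add (tmpReg k) (tmpReg k) (tmpReg (k + 2)))
        (.seq (.const (tmpReg (k + 2)) 1)
        (.sub (tmpReg (k + 1)) (tmpReg (k + 1)) (tmpReg (k + 2)))))))))

/-- Compiled command, using the temporary registers from `k` on. -/
def Cmd.compile : ℕ → Cmd → Prog
  | k, skip => .const (tmpReg k) 0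
  | k, set x a => .seq (a.compile k) (.seq (.const (tmpReg (k + 1)) 0)
      (.add x (tmpReg k) (tmpReg (k + 1))))
  | k, put b i a => .seq (i.compile k) (.seq (a.compile (k + 1))
      (.store b (tmpReg k) (tmpReg (k + 1))))
  | k, seq p p' => .seq (p.compile k) (p'.compile k)
  | k, ite a p p' => .seq (a.compile k) (.ite (tmpReg k) (p.compile k) (p'.compile k))
  | k, loop x n p => .seq (.const (tmpReg k) 0)
      (.seq (.add (tmpReg k) n (tmpReg k))
      (.loop (tmpReg k)
        (.seq (.sub (varReg x) n (tmpReg k))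
        (.seq (p.compile (k + 1))
        (.seq (.const (tmpReg (k + 1)) 1)
        (.sub (tmpReg k) (tmpReg k) (tmpReg (k + 1))))))))

/-- Cost bound for an expression whose bound registers are at most `Z`. -/
def AExp.time (Z : ℕ) : AExp → ℕ
  | var _ | reg _ | lit _ => 3
  | add a b | sub a b => a.time Z + b.time Z + 3
  | mul _ a b => a.time Z + b.time Z + (Z * 4 + 20)
  | div _ a b => a.time Z + b.time Z + (Z * 12 + 30)
  | get _ a => a.time Z + 2
  | sum _ _ a => Z * (a.time Z + 10) + 10

/-- Cost bound for a command whose bound registers are at most `Z`. -/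
def Cmd.time (Z : ℕ) : Cmd → ℕ
  | skip => 1
  | set _ a => a.time Z + 5
  | put _ i a => i.time Z + a.time Z + 5
  | seq p p' => p.time Z + p'.time Z + 1
  | ite a p p' => a.time Z + p.time Z + p'.time Z + 5
  | loop _ _ p => Z * (p.time Z + 10) + 10

/-- The local variables are among `sc`, without shadowing, the bound registers are among `ps`. -/
def AExp.ok (ps : List ℕ) : List ℕ → AExp → Bool
  | sc, var x => decide (x ∈ sc)
  | _, reg x => decide (x < userRegs)
  | _, lit _ => true
  | sc, add a b | sc, sub a b => a.ok ps sc && b.ok ps sc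
  | sc, mul n a b | sc, div n a b => decide (n ∈ ps) && a.ok ps sc && b.ok ps sc
  | sc, get _ a => a.ok ps sc
  | sc, sum x n a => decide (n ∈ ps) && decide (x ∉ sc) && a.ok ps (x :: sc)

/-- As `AExp.ok`; moreover the registers in `ps` are not written. -/
def Cmd.ok (ps : List ℕ) : List ℕ → Cmd → Bool
  | _, skip => true
  | sc, set x a => decide (x < userRegs) && decide (x ∉ ps) && a.ok ps sc
  | sc, put _ i a => i.ok ps sc && a.ok ps sc
  | sc, seq p p' => p.ok ps sc && p'.ok ps sc
  | sc, ite a p p' => a.ok ps sc && p.ok ps sc && p'.ok ps sc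
  | sc, loop x n p => decide (n ∈ ps) && decide (x ∉ sc) && p.ok ps (x :: sc)

/-- `τ` implements the store `σ` and the values `v` of the local variables in `sc`. -/
structure Implements (sc : List ℕ) (v : ℕ → ℕ) (σ τ : Store) : Prop where
  arr : τ.arr = σ.arr
  reg : ∀ x < userRegs, τ.reg x = σ.reg x
  var : ∀ x ∈ sc, τ.reg (varReg x) = v x

/-! ### Correctness and cost of the compiler. -/

section regs

variable {k j x y : ℕ}

@[simp] theorem tmpReg_inj : tmpReg k = tmpReg j ↔ k = j := by unfold tmpReg; omega
@[simp] theorem varReg_inj : varReg x = varReg y ↔ x = y := by unfold varReg; omega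
@[simp] theorem varReg_ne_tmpReg : varReg x ≠ tmpReg k := by unfold varReg tmpReg; omega
@[simp] theorem tmpReg_ne_varReg : tmpReg k ≠ varReg x := by unfold varReg tmpReg; omega
theorem ne_tmpReg_of_lt (h : x < userRegs) : x ≠ tmpReg k := by unfold tmpReg; omega
theorem ne_varReg_of_lt (h : x < userRegs) : x ≠ varReg k := by unfold varReg; omega

end regs

theorem Store.setReg_reg (σ : Store) (x v y : ℕ) :
    (σ.setReg x v).reg y = if y = x then v else σ.reg y := by
  simp [Store.setReg, Function.update_apply]

@[simp] theorem Store.setReg_arr (σ : Store) (x v : ℕ) : (σ.setReg x v).arr = σ.arr := rfl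

@[simp] theorem Store.setArr_reg (σ : Store) (b n v : ℕ) : (σ.setArr b n v).reg = σ.reg := rfl

/-- Nothing but temporary registers from `k` on changes. -/
structure SameBelow (k : ℕ) (sc : List ℕ) (τ τ' : Store) : Prop where
  arr : τ'.arr = τ.arr
  reg : ∀ x < userRegs, τ'.reg x = τ.reg x
  tmp : ∀ j < k, τ'.reg (tmpReg j) = τ.reg (tmpReg j)
  var : ∀ x ∈ sc, τ'.reg (varReg x) = τ.reg (varReg x)

theorem SameBelow.refl (k : ℕ) (sc : List ℕ) (τ : Store) : SameBelow k sc τ τ :=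
  ⟨rfl, fun _ _ => rfl, fun _ _ => rfl, fun _ _ => rfl⟩

theorem SameBelow.trans {k : ℕ} {sc : List ℕ} {τ τ' τ'' : Store} (h : SameBelow k sc τ τ')
    (h' : SameBelow k sc τ' τ'') : SameBelow k sc τ τ'' :=
  ⟨h'.arr.trans h.arr, fun x hx => (h'.reg x hx).trans (h.reg x hx),
    fun x hx => (h'.tmp x hx).trans (h.tmp x hx), fun x hx => (h'.var x hx).trans (h.var x hx)⟩

theorem SameBelow.mono {k j : ℕ} {sc sc' : List ℕ} {τ τ' : Store} (h : SameBelow k sc τ τ')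
    (hj : j ≤ k) (hs : sc' ⊆ sc) : SameBelow j sc' τ τ' :=
  ⟨h.arr, h.reg, fun x hx => h.tmp x (by omega), fun x hx => h.var x (hs hx)⟩

theorem SameBelow.setTmp {k j : ℕ} {sc : List ℕ} {τ τ' : Store} (h : SameBelow k sc τ τ')
    (hj : k ≤ j) (n : ℕ) : SameBelow k sc τ (τ'.setReg (tmpReg j) n) := by
  refine ⟨h.arr, fun x hx => ?_, fun x hx => ?_, fun x hx => ?_⟩
  · rw [Store.setReg_reg, if_neg (ne_tmpReg_of_lt hx), h.reg x hx]
  · rw [Store.setReg_reg, if_neg (by simp; omega), h.tmp x hx]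
  · rw [Store.setReg_reg, if_neg (by simp), h.var x hx]

theorem SameBelow.setVar {k x : ℕ} {sc : List ℕ} {τ τ' : Store} (h : SameBelow k sc τ τ')
    (hx : x ∉ sc) (n : ℕ) : SameBelow k sc τ (τ'.setReg (varReg x) n) := by
  refine ⟨h.arr, fun y hy => ?_, fun y hy => ?_, fun y hy => ?_⟩
  · rw [Store.setReg_reg, if_neg (ne_varReg_of_lt hy), h.reg y hy]
  · rw [Store.setReg_reg, if_neg (by simp), h.tmp y hy]
  · rw [Store.setReg_reg, if_neg (by simp; rintro rfl; exact hx hy), h.var y hy]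

theorem Implements.same {k : ℕ} {sc : List ℕ} {v : ℕ → ℕ} {σ τ τ' : Store}
    (h : Implements sc v σ τ) (h' : SameBelow k sc τ τ') : Implements sc v σ τ' :=
  ⟨h'.arr.trans h.arr, fun x hx => (h'.reg x hx).trans (h.reg x hx),
    fun x hx => (h'.var x hx).trans (h.var x hx)⟩

-- Temporaries are used as a stack: evaluation at level `k` leaves everything below `k` intact, so a
-- left operand survives the evaluation of the right one. Absence of shadowing lets a sum overwrite
-- the register of its own variable without harming an enclosing scope.
open Prog in
theorem AExp.compile_correct {ps : List ℕ} (hps : ∀ n ∈ ps, n < userRegs) {Z : ℕ} {σ : Store}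
    (hZ : ∀ n ∈ ps, σ.reg n ≤ Z) (a : AExp) :
    ∀ (k : ℕ) (sc : List ℕ) (v : ℕ → ℕ) (τ : Store), a.ok ps sc → Implements sc v σ τ →
      (a.compile k).Reaches τ (a.time Z)
        fun τ' => SameBelow k sc τ τ' ∧ τ'.reg (tmpReg k) = a.eval σ v := by
  induction a with
  | var x =>
    intro k sc v τ hok h
    refine Reaches.le (reaches_seq (m := 1) (n := 1) (reaches_const (reaches_add
      ⟨((SameBelow.refl ..).setTmp le_rfl _).setTmp le_rfl _, ?_⟩))) le_rfl
    simp only [AExp.ok, decide_eq_true_eq] at hok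
    simp [Store.setReg_reg, AExp.eval, h.var x hok]
  | reg x =>
    intro k sc v τ hok h
    refine Reaches.le (reaches_seq (m := 1) (n := 1) (reaches_const (reaches_add
      ⟨((SameBelow.refl ..).setTmp le_rfl _).setTmp le_rfl _, ?_⟩))) le_rfl
    simp only [AExp.ok, decide_eq_true_eq] at hok
    simp [Store.setReg_reg, AExp.eval, h.reg x hok, ne_tmpReg_of_lt hok]
  | lit n =>
    intro k sc v τ hok h
    exact Reaches.le (reaches_const ⟨(SameBelow.refl ..).setTmp le_rfl _,
      by simp [Store.setReg_reg, AExp.eval]⟩) (by simp [AExp.time])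
  | add a b iha ihb =>
    intro k sc v τ hok h
    simp only [AExp.ok, Bool.and_eq_true] at hok
    refine Reaches.le (reaches_seq (m := a.time Z) (n := b.time Z + 1 + 1)
      (Reaches.mono (iha k sc v τ hok.1 h) le_rfl ?_)) (by simp [AExp.time]; omega)
    rintro τ1 ⟨h1, e1⟩
    refine reaches_seq (Reaches.mono (ihb (k + 1) sc v τ1 hok.2 (h.same h1)) le_rfl ?_)
    rintro τ2 ⟨h2, e2⟩
    refine reaches_add ⟨(h1.trans (h2.mono (by omega) (by simp))).setTmp le_rfl _, ?_⟩
    simp [Store.setReg_reg, AExp.eval, e2, h2.tmp k (by omega), e1]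
  | sub a b iha ihb =>
    intro k sc v τ hok h
    simp only [AExp.ok, Bool.and_eq_true] at hok
    refine Reaches.le (reaches_seq (m := a.time Z) (n := b.time Z + 1 + 1)
      (Reaches.mono (iha k sc v τ hok.1 h) le_rfl ?_)) (by simp [AExp.time]; omega)
    rintro τ1 ⟨h1, e1⟩
    refine reaches_seq (Reaches.mono (ihb (k + 1) sc v τ1 hok.2 (h.same h1)) le_rfl ?_)
    rintro τ2 ⟨h2, e2⟩
    refine reaches_sub ⟨(h1.trans (h2.mono (by omega) (by simp))).setTmp le_rfl _, ?_⟩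
    simp [Store.setReg_reg, AExp.eval, e2, h2.tmp k (by omega), e1]
  | get b a iha =>
    intro k sc v τ hok h
    simp only [AExp.ok] at hok
    refine Reaches.le (reaches_seq (m := a.time Z) (n := 1)
      (Reaches.mono (iha k sc v τ hok h) le_rfl ?_)) (by simp [AExp.time])
    rintro τ1 ⟨h1, e1⟩
    refine reaches_load ⟨h1.setTmp le_rfl _, ?_⟩
    simp [Store.setReg_reg, AExp.eval, e1, h1.arr, h.arr]
  | mul n a b iha ihb =>
    intro k sc v τ hok h
    simp only [AExp.ok, Bool.and_eq_true, decide_eq_true_eq] at hok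
    obtain ⟨⟨hn, hoka⟩, hokb⟩ := hok
    refine Reaches.le (reaches_seq (m := a.time Z)
      (n := b.time Z + (1 + (1 + (1 + (1 + ((Z * 4 + 1) + 1 + 1) + 1) + 1) + 1) + 1) + 1)
      (Reaches.mono (iha k sc v τ hoka h) le_rfl ?_)) (by simp [AExp.time]; omega)
    rintro τ1 ⟨h1, e1⟩
    refine reaches_seq (Reaches.mono (ihb (k + 1) sc v τ1 hokb (h.same h1)) le_rfl ?_)
    rintro τ2 ⟨h2, e2⟩
    have h12 := h1.trans (h2.mono (Nat.le_succ k) (List.Subset.refl sc))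
    have e1' := (h2.tmp k (by omega)).trans e1
    have en : τ2.reg n = σ.reg n := (h12.reg n (hps n hn)).trans (h.reg n (hps n hn))
    -- The clamp is obtained by two truncated subtractions: `A - (A - n) = min A n`. Multiplication
    -- is then repeated addition, with at most `Z` rounds.
    refine reaches_seq (reaches_sub (reaches_seq (reaches_sub (reaches_seq (reaches_const
      (reaches_seq (reaches_const (reaches_seq (m := Z * 4 + 1) (n := 1) ?_))))))))
    set A := a.eval σ v
    set Bv := b.eval σ v
    refine Reaches.mono (reaches_countdown (min A (σ.reg n)) 3
      (fun i τ' => SameBelow k sc τ τ' ∧ τ'.reg (tmpReg k) = min A (σ.reg n) - i ∧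
        τ'.reg (tmpReg (k + 1)) = Bv ∧ τ'.reg (tmpReg (k + 2)) = i * Bv ∧
        τ'.reg (tmpReg (k + 3)) = 1) ?_ (fun i τ' hI _ => hI.2.1) ?_) ?_ ?_
    · refine ⟨(((h12.setTmp (by omega) _).setTmp (by omega) _).setTmp (by omega) _).setTmp
        (by omega) _, ?_, ?_, ?_, ?_⟩ <;>
        simp [Store.setReg_reg, e1', e2, en]
      omega
    · rintro i τ' - ⟨hs, g0, g1, g2, g3⟩
      refine Reaches.le (reaches_seq (m := 1) (n := 1) (reaches_add (reaches_sub
        ⟨(hs.setTmp (by omega) _).setTmp (by omega) _, ?_, ?_, ?_, ?_⟩))) le_rfl <;>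
        simp [Store.setReg_reg, g0, g1, g2, g3]
      · omega
      · ring
    · have := hZ n hn
      have : min A (σ.reg n) ≤ Z := by omega
      omega
    · rintro τ' ⟨hs, g0, g1, g2, g3⟩
      refine reaches_add ⟨hs.setTmp le_rfl _, ?_⟩
      simp [Store.setReg_reg, g0, g2, AExp.eval, A, Bv]
  | div n a b iha ihb =>
    intro k sc v τ hok h
    simp only [AExp.ok, Bool.and_eq_true, decide_eq_true_eq] at hok
    obtain ⟨⟨hn, hoka⟩, hokb⟩ := hok
    refine Reaches.le (reaches_seq (m := a.time Z)
      (n := b.time Z + (1 + (1 + (1 + (1 + ((Z * 12 + 1) + (1 + 1 + 1) + 1) + 1) + 1) + 1) + 1) + 1)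
      (Reaches.mono (iha k sc v τ hoka h) le_rfl ?_)) (by simp [AExp.time]; omega)
    rintro τ1 ⟨h1, e1⟩
    refine reaches_seq (Reaches.mono (ihb (k + 1) sc v τ1 hokb (h.same h1)) le_rfl ?_)
    rintro τ2 ⟨h2, e2⟩
    have h12 := h1.trans (h2.mono (Nat.le_succ k) (List.Subset.refl sc))
    have e1' := (h2.tmp k (by omega)).trans e1
    have en : τ2.reg n = σ.reg n := (h12.reg n (hps n hn)).trans (h.reg n (hps n hn))
    refine reaches_seq (reaches_const (reaches_seq (reaches_const (reaches_seq (reaches_const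
      (reaches_seq (reaches_add (reaches_seq (m := Z * 12 + 1) (n := 1 + 1 + 1) ?_))))))))
    set A := a.eval σ v
    set Bv := b.eval σ v
    -- Register `k + 2` runs through the multiples of the divisor, and register `k + 3` counts those
    -- not exceeding the dividend.
    refine Reaches.mono (reaches_countdown (σ.reg n) 9
      (fun i τ' => SameBelow k sc τ τ' ∧ τ'.reg (tmpReg k) = A ∧
        τ'.reg (tmpReg (k + 1)) = Bv ∧ τ'.reg (tmpReg (k + 2)) = i * Bv ∧
        τ'.reg (tmpReg (k + 3)) = ∑ j ∈ Finset.range i, (1 - ((j + 1) * Bv - A)) ∧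
        τ'.reg (tmpReg (k + 4)) = 1 ∧ τ'.reg (tmpReg (k + 5)) = σ.reg n - i)
      ?_ (fun i τ' hI _ => hI.2.2.2.2.2.2) ?_) ?_ ?_
    · refine ⟨(((h12.setTmp (by omega) _).setTmp (by omega) _).setTmp (by omega) _).setTmp
        (by omega) _, ?_, ?_, ?_, ?_, ?_, ?_⟩ <;>
        simp [Store.setReg_reg, e1', e2, en, ne_tmpReg_of_lt (hps n hn)]
    · rintro i τ' - ⟨hs, g0, g1, g2, g3, g4, g5⟩
      refine Reaches.le (reaches_seq (m := 1) (reaches_add (reaches_seq (m := 1) (reaches_sub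
        (reaches_seq (m := 1) (reaches_sub (reaches_seq (m := 1) (n := 1) (reaches_add (reaches_sub
        ⟨((((hs.setTmp (by omega) _).setTmp (by omega) _).setTmp (by omega) _).setTmp
          (by omega) _).setTmp (by omega) _, ?_, ?_, ?_, ?_, ?_, ?_⟩))))))))) le_rfl <;>
        simp [Store.setReg_reg, g0, g1, g2, g3, g4, g5, Finset.sum_range_succ]
      · ring
      · rw [Nat.succ_mul]
      · omega
    · have := hZ n hn
      omega
    · rintro τ' ⟨hs, g0, g1, g2, g3, g4, g5⟩
      refine reaches_seq (reaches_const (reaches_add ⟨(hs.setTmp le_rfl _).setTmp le_rfl _, ?_⟩))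
      simp [Store.setReg_reg, g3, AExp.eval, A, Bv]
  | sum x n a iha =>
    intro k sc v τ hok h
    simp only [AExp.ok, Bool.and_eq_true, decide_eq_true_eq] at hok
    obtain ⟨⟨hn, hx⟩, hok⟩ := hok
    have en : τ.reg n = σ.reg n := h.reg n (hps n hn)
    refine Reaches.mono (reaches_seq (m := 1) (reaches_const (reaches_seq (m := 1) (reaches_add
      (reaches_countdown (σ.reg n) (a.time Z + 8)
      (fun i τ' => SameBelow k sc τ τ' ∧
        τ'.reg (tmpReg k) = ∑ j ∈ Finset.range i, a.eval σ (Function.update v x j) ∧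
        τ'.reg (tmpReg (k + 1)) = σ.reg n - i)
      ?_ (fun i τ' hI _ => hI.2.2) ?_))))) ?_ ?_
    · refine ⟨((SameBelow.refl ..).setTmp (by omega) _).setTmp (by omega) _, ?_, ?_⟩ <;>
        simp [Store.setReg_reg, en, ne_tmpReg_of_lt (hps n hn)]
    · rintro i τ1 hi ⟨hs, g0, g1⟩
      have en1 : τ1.reg n = σ.reg n := (hs.reg n (hps n hn)).trans en
      -- The counter runs downwards, so its difference to the bound is the upward index `i`.
      have himp : Implements (x :: sc) (Function.update v x i) σ
          (τ1.setReg (varReg x) (τ1.reg n - τ1.reg (tmpReg (k + 1)))) := by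
        have hi' := (h.same hs)
        refine ⟨hi'.arr, fun y hy => ?_, fun y hy => ?_⟩
        · rw [Store.setReg_reg, if_neg (ne_varReg_of_lt hy), hi'.reg y hy]
        · rw [Store.setReg_reg]
          by_cases hxy : y = x
          · subst hxy
            simp [en1, g1]; omega
          · rw [if_neg (by simpa using hxy), Function.update_of_ne hxy]
            exact hi'.var y (by simpa [hxy] using hy)
      refine Reaches.le (reaches_seq (m := 1) (reaches_sub (reaches_seq (n := 1 + (1 + 1 + 1) + 1)
        (Reaches.mono (iha (k + 2) (x :: sc) _ _ hok himp) le_rfl ?_)))) ?_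
      · rintro τ2 ⟨h2, e2⟩
        have h2' := (hs.setVar hx (τ1.reg n - τ1.reg (tmpReg (k + 1)))).trans
          (h2.mono (show k ≤ k + 2 by omega) (List.subset_cons_self x sc))
        have t0 := h2.tmp k (by omega)
        have t1 := h2.tmp (k + 1) (by omega)
        rw [Store.setReg_reg, if_neg (by simp)] at t0 t1
        refine reaches_seq (reaches_add (reaches_seq (reaches_const (reaches_sub
          ⟨((h2'.setTmp (by omega) _).setTmp (by omega) _).setTmp (by omega) _, ?_, ?_⟩)))) <;>
          simp [Store.setReg_reg, e2, t0, t1, g0, g1, Finset.sum_range_succ]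
        omega
      · omega
    · have := hZ n hn
      have : σ.reg n * (a.time Z + 8 + 1) ≤ Z * (a.time Z + 10) := Nat.mul_le_mul this (by omega)
      simp only [AExp.time]
      omega
    · rintro τ' ⟨hs, g0, -⟩
      exact ⟨hs, by simp [g0, AExp.eval]⟩

-- Registers serving as loop bounds are never written, so one number `Z` bounds all loops throughout
-- the execution. The loop counter sits in temporary `k`, and the body works from `k + 1` on, which
-- protects it.
open Prog in
theorem Cmd.compile_correct {ps : List ℕ} (hps : ∀ n ∈ ps, n < userRegs) {Z : ℕ} (p : Cmd) :
    ∀ (k : ℕ) (sc : List ℕ) (v : ℕ → ℕ) (σ τ : Store), (∀ n ∈ ps, σ.reg n ≤ Z) → p.ok ps sc →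
      Implements sc v σ τ →
      (p.compile k).Reaches τ (p.time Z) fun τ' => Implements sc v (p.exec v σ) τ' ∧
        (∀ n ∈ ps, (p.exec v σ).reg n = σ.reg n) ∧
        ∀ j < k, τ'.reg (tmpReg j) = τ.reg (tmpReg j) := by
  induction p with
  | skip =>
    intro k sc v σ τ hZ hok h
    refine reaches_const ⟨h.same ((SameBelow.refl k ..).setTmp le_rfl _), fun _ _ => rfl,
      fun j hj => ?_⟩
    simp [Store.setReg_reg]; omega
  | set x a =>
    intro k sc v σ τ hZ hok h
    simp only [Cmd.ok, Bool.and_eq_true, decide_eq_true_eq] at hok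
    obtain ⟨⟨hx, hxp⟩, hok⟩ := hok
    refine Reaches.le (reaches_seq (m := a.time Z) (n := 1 + 1 + 1)
      (Reaches.mono (AExp.compile_correct hps hZ a k sc v τ hok h) le_rfl ?_))
      (by simp only [Cmd.time]; omega)
    rintro τ1 ⟨h1, e1⟩
    refine reaches_seq (reaches_const (reaches_add ⟨?_, fun n hn => ?_, fun j hj => ?_⟩))
    · have h2 := h.same (h1.setTmp (Nat.le_succ k) 0)
      refine ⟨h2.arr, fun y hy => ?_, fun y hy => ?_⟩
      · simp only [Store.setReg_reg, Cmd.exec]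
        simp [e1]
        split_ifs
        · rfl
        · exact absurd ‹_› (ne_tmpReg_of_lt hy)
        · exact (h.same h1).reg y hy
      · rw [Store.setReg_reg, if_neg (ne_varReg_of_lt hx).symm, h2.var y hy]
    · simp only [Cmd.exec, Store.setReg_reg]
      rw [if_neg]; rintro rfl; exact hxp hn
    · rw [Store.setReg_reg, if_neg (ne_tmpReg_of_lt hx).symm, Store.setReg_reg,
        if_neg (by simp; omega), h1.tmp j hj]
  | put b i a =>
    intro k sc v σ τ hZ hok h
    simp only [Cmd.ok, Bool.and_eq_true] at hok
    refine Reaches.le (reaches_seq (m := i.time Z) (n := a.time Z + 1 + 1)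
      (Reaches.mono (AExp.compile_correct hps hZ i k sc v τ hok.1 h) le_rfl ?_))
      (by simp only [Cmd.time]; omega)
    rintro τ1 ⟨h1, e1⟩
    refine reaches_seq (Reaches.mono
      (AExp.compile_correct hps hZ a (k + 1) sc v τ1 hok.2 (h.same h1)) le_rfl ?_)
    rintro τ2 ⟨h2, e2⟩
    have h12 := h1.trans (h2.mono (Nat.le_succ k) (List.Subset.refl sc))
    have hi := h.same h12
    refine reaches_store ⟨⟨?_, hi.reg, hi.var⟩, fun n hn => rfl, h12.tmp⟩
    simp [Store.setArr, Cmd.exec, hi.arr, e2, h2.tmp k (by omega), e1]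
  | seq p p' ih ih' =>
    intro k sc v σ τ hZ hok h
    simp only [Cmd.ok, Bool.and_eq_true] at hok
    refine Reaches.le (reaches_seq (m := p.time Z) (n := p'.time Z)
      (Reaches.mono (ih k sc v σ τ hZ hok.1 h) le_rfl ?_)) le_rfl
    rintro τ1 ⟨h1, e1, t1⟩
    refine Reaches.mono (ih' k sc v _ τ1 (fun n hn => by rw [e1 n hn]; exact hZ n hn) hok.2 h1)
      le_rfl ?_
    rintro τ2 ⟨h2, e2, t2⟩
    exact ⟨h2, fun n hn => (e2 n hn).trans (e1 n hn), fun j hj => (t2 j hj).trans (t1 j hj)⟩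
  | ite a p p' ih ih' =>
    intro k sc v σ τ hZ hok h
    simp only [Cmd.ok, Bool.and_eq_true] at hok
    refine Reaches.le (reaches_seq (m := a.time Z) (n := (p.time Z + p'.time Z) + 1)
      (Reaches.mono (AExp.compile_correct hps hZ a k sc v τ hok.1.1 h) le_rfl ?_))
      (by simp only [Cmd.time]; omega)
    rintro τ1 ⟨h1, e1⟩
    refine reaches_ite ?_
    by_cases h0 : a.eval σ v = 0
    · rw [if_neg (by simp [e1, h0])]
      refine Reaches.mono (ih' k sc v σ τ1 hZ hok.2 (h.same h1)) (by omega) ?_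
      rintro τ2 ⟨h2, e2, t2⟩
      simp only [Cmd.exec, h0, ne_eq, not_true_eq_false, if_false]
      exact ⟨h2, e2, fun j hj => (t2 j hj).trans (h1.tmp j hj)⟩
    · rw [if_pos (by simp [e1, h0])]
      refine Reaches.mono (ih k sc v σ τ1 hZ hok.1.2 (h.same h1)) (by omega) ?_
      rintro τ2 ⟨h2, e2, t2⟩
      simp only [Cmd.exec, ne_eq, h0, not_false_eq_true, if_true]
      exact ⟨h2, e2, fun j hj => (t2 j hj).trans (h1.tmp j hj)⟩
  | loop x n p ih =>
    intro k sc v σ τ hZ hok h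
    simp only [Cmd.ok, Bool.and_eq_true, decide_eq_true_eq] at hok
    obtain ⟨⟨hn, hx⟩, hok⟩ := hok
    have en : τ.reg n = σ.reg n := h.reg n (hps n hn)
    set X : ℕ → Store := fun i =>
      iterUpTo (fun i τ => p.exec (Function.update v x i) τ) i σ with hX
    refine Reaches.le (reaches_seq (m := 1) (reaches_const (reaches_seq (m := 1) (reaches_add
      (Reaches.mono (reaches_countdown (σ.reg n) (p.time Z + 6)
      (fun i τ' => Implements sc v (X i) τ' ∧ (∀ m ∈ ps, (X i).reg m = σ.reg m) ∧
        (∀ j < k, τ'.reg (tmpReg j) = τ.reg (tmpReg j)) ∧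
        τ'.reg (tmpReg k) = σ.reg n - i)
      ?_ (fun i τ' hI _ => hI.2.2.2) ?_) le_rfl ?_))))) ?_
    · have hs : SameBelow k sc τ ((τ.setReg (tmpReg k) 0).setReg (tmpReg k)
          ((τ.setReg (tmpReg k) 0).reg n + (τ.setReg (tmpReg k) 0).reg (tmpReg k))) :=
        ((SameBelow.refl ..).setTmp le_rfl _).setTmp le_rfl _
      refine ⟨h.same hs, fun _ _ => rfl, hs.tmp, ?_⟩
      simp [Store.setReg_reg, en, ne_tmpReg_of_lt (hps n hn)]
    · rintro i τ1 hi ⟨himp, hp, ht, hk⟩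
      have en1 : τ1.reg n = σ.reg n := (himp.reg n (hps n hn)).trans (hp n hn)
      have himp' : Implements (x :: sc) (Function.update v x i) (X i)
          (τ1.setReg (varReg x) (τ1.reg n - τ1.reg (tmpReg k))) := by
        refine ⟨himp.arr, fun y hy => ?_, fun y hy => ?_⟩
        · rw [Store.setReg_reg, if_neg (ne_varReg_of_lt hy), himp.reg y hy]
        · rw [Store.setReg_reg]
          by_cases hxy : y = x
          · subst hxy
            simp [en1, hk]; omega
          · rw [if_neg (by simpa using hxy), Function.update_of_ne hxy]
            exact himp.var y (by simpa [hxy] using hy)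
      refine Reaches.le (reaches_seq (m := 1) (n := p.time Z + (1 + 1 + 1) + 1) (reaches_sub
        (reaches_seq
        (Reaches.mono (ih (k + 1) (x :: sc) _ (X i) _
          (fun m hm => by rw [hp m hm]; exact hZ m hm) hok himp') le_rfl ?_)))) (by omega)
      rintro τ2 ⟨h2, e2, t2⟩
      have hs2 : SameBelow k sc τ2 ((τ2.setReg (tmpReg (k + 1)) 1).setReg (tmpReg k)
          ((τ2.setReg (tmpReg (k + 1)) 1).reg (tmpReg k)
            - (τ2.setReg (tmpReg (k + 1)) 1).reg (tmpReg (k + 1)))) :=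
        ((SameBelow.refl ..).setTmp (by omega) _).setTmp le_rfl _
      have h2' : Implements sc v (X (i + 1)) τ2 := by
        refine ⟨h2.arr, h2.reg, fun y hy => ?_⟩
        have hxy : y ≠ x := by rintro rfl; exact hx hy
        rw [h2.var y (List.mem_cons_of_mem _ hy), Function.update_of_ne hxy]
      refine reaches_seq (reaches_const (reaches_sub ⟨h2'.same hs2,
        fun m hm => (e2 m hm).trans (hp m hm), fun j hj => ?_, ?_⟩))
      · rw [hs2.tmp j hj, t2 j (by omega), Store.setReg_reg, if_neg (by simp), ht j hj]
      · have := t2 k (by omega)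
        rw [Store.setReg_reg, if_neg (by simp)] at this
        simp [Store.setReg_reg, this, hk]; omega
    · rintro τ' ⟨h1, h2, h3, -⟩
      exact ⟨h1, h2, h3⟩
    · have := hZ n hn
      have : σ.reg n * (p.time Z + 6 + 1) ≤ Z * (p.time Z + 10) := Nat.mul_le_mul this (by omega)
      simp only [Cmd.time]
      omega

/-- The expression is fixed, so its nesting depth is a constant, and each bounded sum raises the
degree in `Z` by one. -/
theorem AExp.exists_time_le (a : AExp) : ∃ K D : ℕ, ∀ Z, a.time Z ≤ K * (Z + 1) ^ D := by
  have key : ∀ {K K' D D' c : ℕ} (Z x y : ℕ), x ≤ K * (Z + 1) ^ D → y ≤ K' * (Z + 1) ^ D' →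
      x + y + (Z * c + c) ≤ (K + K' + c) * (Z + 1) ^ (D + D' + 1) := by
    intro K K' D D' c Z x y hx hy
    have h1 : (Z + 1) ^ D ≤ (Z + 1) ^ (D + D' + 1) := Nat.pow_le_pow_right (by omega) (by omega)
    have h2 : (Z + 1) ^ D' ≤ (Z + 1) ^ (D + D' + 1) := Nat.pow_le_pow_right (by omega) (by omega)
    have h3 : (Z + 1) ^ 1 ≤ (Z + 1) ^ (D + D' + 1) := Nat.pow_le_pow_right (by omega) (by omega)
    have h4 := Nat.mul_le_mul_left K h1
    have h5 := Nat.mul_le_mul_left K' h2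
    have h6 := Nat.mul_le_mul_left c h3
    calc x + y + (Z * c + c) ≤ K * (Z + 1) ^ (D + D' + 1) + K' * (Z + 1) ^ (D + D' + 1)
          + c * (Z + 1) ^ (D + D' + 1) := by
          have : Z * c + c = c * (Z + 1) ^ 1 := by ring
          omega
      _ = _ := by ring
  induction a with
  | var _ | reg _ | lit _ => exact ⟨3, 0, fun Z => by simp [AExp.time]⟩
  | add a b iha ihb | sub a b iha ihb =>
    obtain ⟨K, D, h⟩ := iha
    obtain ⟨K', D', h'⟩ := ihb
    refine ⟨K + K' + 3, D + D' + 1, fun Z => le_trans ?_ (key Z _ _ (h Z) (h' Z))⟩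
    simp only [AExp.time]; omega
  | mul _ a b iha ihb =>
    obtain ⟨K, D, h⟩ := iha
    obtain ⟨K', D', h'⟩ := ihb
    refine ⟨K + K' + 20, D + D' + 1, fun Z => le_trans ?_ (key Z _ _ (h Z) (h' Z))⟩
    simp only [AExp.time]; omega
  | div _ a b iha ihb =>
    obtain ⟨K, D, h⟩ := iha
    obtain ⟨K', D', h'⟩ := ihb
    refine ⟨K + K' + 30, D + D' + 1, fun Z => le_trans ?_ (key Z _ _ (h Z) (h' Z))⟩
    simp only [AExp.time]; omega
  | get _ a iha =>
    obtain ⟨K, D, h⟩ := iha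
    refine ⟨K + 0 + 2, D + 0 + 1, fun Z => le_trans ?_ (key Z _ 0 (h Z) (Nat.zero_le _))⟩
    simp only [AExp.time]; omega
  | sum _ _ a iha =>
    obtain ⟨K, D, h⟩ := iha
    refine ⟨K + 10, D + 1, fun Z => ?_⟩
    have h1 : (Z + 1) ^ 1 ≤ (Z + 1) ^ (D + 1) := Nat.pow_le_pow_right (by omega) (by omega)
    have h2 : Z * a.time Z ≤ (Z + 1) * (K * (Z + 1) ^ D) := Nat.mul_le_mul (by omega) (h Z)
    calc Z * (a.time Z + 10) + 10 = Z * a.time Z + 10 * (Z + 1) ^ 1 := by ring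
      _ ≤ (Z + 1) * (K * (Z + 1) ^ D) + 10 * (Z + 1) ^ (D + 1) := by gcongr
      _ = _ := by ring

theorem Cmd.exists_time_le (p : Cmd) : ∃ K D : ℕ, ∀ Z, p.time Z ≤ K * (Z + 1) ^ D := by
  have key : ∀ {K K' K'' D D' D'' : ℕ} (Z x y z : ℕ), x ≤ K * (Z + 1) ^ D →
      y ≤ K' * (Z + 1) ^ D' → z ≤ K'' * (Z + 1) ^ D'' →
      x + y + z + 5 ≤ (K + K' + K'' + 5) * (Z + 1) ^ (D + D' + D'') := by
    intro K K' K'' D D' D'' Z x y z hx hy hz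
    have h1 : (Z + 1) ^ D ≤ (Z + 1) ^ (D + D' + D'') := Nat.pow_le_pow_right (by omega) (by omega)
    have h2 : (Z + 1) ^ D' ≤ (Z + 1) ^ (D + D' + D'') := Nat.pow_le_pow_right (by omega) (by omega)
    have h3 : (Z + 1) ^ D'' ≤ (Z + 1) ^ (D + D' + D'') :=
      Nat.pow_le_pow_right (by omega) (by omega)
    have h4 := Nat.mul_le_mul_left K h1
    have h5 := Nat.mul_le_mul_left K' h2
    have h6 := Nat.mul_le_mul_left K'' h3
    have h7 : 1 ≤ (Z + 1) ^ (D + D' + D'') := Nat.one_le_pow _ _ (by omega)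
    calc x + y + z + 5 ≤ K * (Z + 1) ^ (D + D' + D'') + K' * (Z + 1) ^ (D + D' + D'')
          + K'' * (Z + 1) ^ (D + D' + D'') + 5 * (Z + 1) ^ (D + D' + D'') := by omega
      _ = _ := by ring
  induction p with
  | skip => exact ⟨1, 0, fun Z => by simp [Cmd.time]⟩
  | set x a =>
    obtain ⟨K, D, h⟩ := a.exists_time_le
    refine ⟨K + 0 + 0 + 5, D + 0 + 0, fun Z => le_trans ?_
      (key (K' := 0) (K'' := 0) (D' := 0) (D'' := 0) Z _ 0 0 (h Z) (Nat.zero_le _) (Nat.zero_le _))⟩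
    simp only [Cmd.time]; omega
  | put b i a =>
    obtain ⟨K, D, h⟩ := i.exists_time_le
    obtain ⟨K', D', h'⟩ := a.exists_time_le
    refine ⟨K + K' + 0 + 5, D + D' + 0, fun Z => le_trans ?_
      (key (K'' := 0) (D'' := 0) Z _ _ 0 (h Z) (h' Z) (Nat.zero_le _))⟩
    simp only [Cmd.time]; omega
  | seq p p' ih ih' =>
    obtain ⟨K, D, h⟩ := ih
    obtain ⟨K', D', h'⟩ := ih'
    refine ⟨K + K' + 0 + 5, D + D' + 0, fun Z => le_trans ?_
      (key (K'' := 0) (D'' := 0) Z _ _ 0 (h Z) (h' Z) (Nat.zero_le _))⟩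
    simp only [Cmd.time]; omega
  | ite a p p' ih ih' =>
    obtain ⟨K, D, h⟩ := ih
    obtain ⟨K', D', h'⟩ := ih'
    obtain ⟨K'', D'', h''⟩ := a.exists_time_le
    refine ⟨K'' + K + K' + 5, D'' + D + D', fun Z => le_trans ?_
      (key Z _ _ _ (h'' Z) (h Z) (h' Z))⟩
    simp only [Cmd.time]; omega
  | loop _ _ p ih =>
    obtain ⟨K, D, h⟩ := ih
    refine ⟨K + 10, D + 1, fun Z => ?_⟩
    have h1 : (Z + 1) ^ 1 ≤ (Z + 1) ^ (D + 1) := Nat.pow_le_pow_right (by omega) (by omega)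
    have h2 : Z * p.time Z ≤ (Z + 1) * (K * (Z + 1) ^ D) := Nat.mul_le_mul (by omega) (h Z)
    calc Z * (p.time Z + 10) + 10 = Z * p.time Z + 10 * (Z + 1) ^ 1 := by ring
      _ ≤ (Z + 1) * (K * (Z + 1) ^ D) + 10 * (Z + 1) ^ (D + 1) := by gcongr
      _ = _ := by ring

/-! ### Wronskians with Hasse derivatives and multiplicities of zeros. -/

section Wronskian

variable {K : Type*} [Field K]

theorem coeff_prod_of_natDegree_le_sum {ι : Type*} (S : Finset ι) (f : ι → K[X]) (e : ι → ℕ)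
    (h : ∀ i ∈ S, (f i).natDegree ≤ e i) :
    (∏ i ∈ S, f i).coeff (∑ i ∈ S, e i) = ∏ i ∈ S, (f i).coeff (e i) := by
  classical
  induction S using Finset.induction_on with
  | empty => simp
  | insert a S ha ih =>
    rw [Finset.prod_insert ha, Finset.sum_insert ha, Finset.prod_insert ha,
      coeff_mul_add_eq_of_natDegree_le (h a (by simp))
        ((natDegree_prod_le _ _).trans (Finset.sum_le_sum fun i hi => h i (by simp [hi]))),
      ih fun i hi => h i (by simp [hi])]

theorem natDegree_det_le_sum {ι : Type*} [Fintype ι] [DecidableEq ι] (A : Matrix ι ι K[X])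
    (e : ι → ℕ) (h : ∀ i j, (A i j).natDegree ≤ e i) : A.det.natDegree ≤ ∑ i, e i := by
  rw [Matrix.det_apply]
  refine natDegree_sum_le_of_forall_le _ _ fun σ _ => ?_
  refine (natDegree_smul_le _ _).trans ((natDegree_prod_le _ _).trans ?_)
  rw [← Equiv.sum_comp σ e]
  exact Finset.sum_le_sum fun i _ => h _ _

/-- Each term of the Leibniz expansion picks one entry per row, so its coefficient at the total
degree bound is the product of the coefficients at the row bounds. -/
theorem coeff_det_sum {ι : Type*} [Fintype ι] [DecidableEq ι] (A : Matrix ι ι K[X])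
    (e : ι → ℕ) (h : ∀ i j, (A i j).natDegree ≤ e i) :
    A.det.coeff (∑ i, e i) = (Matrix.of fun i j => (A i j).coeff (e i)).det := by
  rw [Matrix.det_apply, Matrix.det_apply, finsetSum_coeff]
  refine Finset.sum_congr rfl fun σ _ => ?_
  rw [coeff_smul]
  congr 1
  rw [← Equiv.sum_comp σ e, coeff_prod_of_natDegree_le_sum _ _ _ fun i _ => h _ _]
  rfl

/-- The falling factorials are monic of degrees `0, 1, …`, so their values at the `e i` have the
Vandermonde determinant. They equal `j!` times the binomial coefficients, whence the determinant
here is a factor of a nonzero one. -/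
theorem det_choose_ne_zero {p : ℕ} [Fact p.Prime] [CharP K p] {n : ℕ} (e : Fin n → ℕ)
    (he : Function.Injective fun i => e i % p) :
    (Matrix.of fun i j : Fin n => ((e i).choose j : K)).det ≠ 0 := by
  have hv : (Matrix.vandermonde fun i => (e i : K)).det ≠ 0 := by
    rw [Matrix.det_vandermonde_ne_zero_iff]
    intro i j hij
    exact he ((CharP.natCast_eq_natCast K p).mp hij)
  rw [Matrix.det_eval_matrixOfPolynomials_eq_det_vandermonde _ (fun j => descPochhammer K j)
    (fun j => descPochhammer_natDegree K j) fun j => monic_descPochhammer K j] at hv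
  have : (Matrix.of fun i j : Fin n => eval (e i : K) (descPochhammer K j))
      = Matrix.of fun i j : Fin n => ((j : ℕ).factorial : K) *
          (Matrix.of fun i j : Fin n => ((e i).choose j : K)) i j := by
    ext i j
    simp only [Matrix.of_apply]
    rw [descPochhammer_eval_eq_descFactorial, Nat.descFactorial_eq_factorial_mul_choose,
      Nat.cast_mul]
  rw [this, Matrix.det_mul_row] at hv
  exact right_ne_zero_of_mul hv

/-- The Wronskian matrix of polynomials, with Hasse derivatives. -/
noncomputable def wronskianMatrix {ι : Type*} {n : ℕ} (f : ι → K[X]) : Matrix ι (Fin n) K[X] :=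
  Matrix.of fun i j => hasseDeriv (j : ℕ) (f i)

theorem natDegree_det_wronskianMatrix_le {n : ℕ} (f : Fin n → K[X]) :
    (wronskianMatrix f).det.natDegree ≤ ∑ i, (f i).natDegree :=
  natDegree_det_le_sum _ _ fun _ _ => (natDegree_hasseDeriv_le _ _).trans (Nat.sub_le _ _)

theorem det_wronskianMatrix_ne_zero {p : ℕ} [Fact p.Prime] [CharP K p] {n : ℕ}
    (f : Fin n → K[X]) (hf : ∀ i, f i ≠ 0)
    (he : Function.Injective fun i => (f i).natDegree % p) : (wronskianMatrix f).det ≠ 0 := by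
  intro h0
  -- The factor `X ^ j` compensates the loss of degree in column `j`: now every entry of row `i` has
  -- degree at most `deg (f i)`, and its coefficient there is the leading coefficient of `f i` times
  -- `(deg (f i)).choose j`.
  have h1 : (Matrix.of fun i j : Fin n => (X : K[X]) ^ (j : ℕ) * wronskianMatrix f i j).det = 0 := by
    rw [Matrix.det_mul_row (fun j : Fin n => (X : K[X]) ^ (j : ℕ)), h0, mul_zero]
  have h2 := coeff_det_sum
    (Matrix.of fun i j : Fin n => (X : K[X]) ^ (j : ℕ) * wronskianMatrix f i j)
    (fun i => (f i).natDegree) (by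
      intro i j
      simp only [Matrix.of_apply, wronskianMatrix]
      by_cases hj : (j : ℕ) ≤ (f i).natDegree
      · refine natDegree_mul_le.trans ?_
        have := natDegree_hasseDeriv_le (f i) (j : ℕ)
        rw [natDegree_X_pow]
        omega
      · rw [hasseDeriv_eq_zero_of_lt_natDegree _ _ (by omega)]
        simp)
  rw [h1, coeff_zero] at h2
  have h3 : (Matrix.of fun i j : Fin n =>
      ((Matrix.of fun i j : Fin n => (X : K[X]) ^ (j : ℕ) * wronskianMatrix f i j) i j).coeff
        (f i).natDegree) = Matrix.of fun i j : Fin n => (f i).leadingCoeff *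
          (Matrix.of fun i j : Fin n => (((f i).natDegree).choose j : K)) i j := by
    ext i j
    simp only [Matrix.of_apply, wronskianMatrix]
    rw [coeff_X_pow_mul']
    split_ifs with hj
    · rw [hasseDeriv_coeff, Nat.sub_add_cancel hj, mul_comm]
      rfl
    · rw [Nat.choose_eq_zero_of_lt (by omega)]
      simp
  rw [h3, Matrix.det_mul_column] at h2
  refine mul_ne_zero ?_ (det_choose_ne_zero _ he) h2.symm
  exact Finset.prod_ne_zero_iff.mpr fun i _ => leadingCoeff_ne_zero.mpr (hf i)

theorem X_sub_C_pow_dvd_iff_hasseDeriv (a : K) (k : ℕ) (P : K[X]) :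
    (X - C a) ^ k ∣ P ↔ ∀ j < k, (hasseDeriv j P).eval a = 0 := by
  rw [X_sub_C_pow_dvd_iff, ← taylor_apply, X_pow_dvd_iff]
  simp only [taylor_coeff]

theorem X_sub_C_pow_dvd_hasseDeriv {a : K} {k : ℕ} {P : K[X]} (h : (X - C a) ^ k ∣ P) (j : ℕ) :
    (X - C a) ^ (k - j) ∣ hasseDeriv j P := by
  rw [X_sub_C_pow_dvd_iff_hasseDeriv] at h ⊢
  intro i hi
  have := LinearMap.congr_fun (hasseDeriv_comp (R := K) i j) P
  simp only [LinearMap.comp_apply, LinearMap.smul_apply] at this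
  rw [this, eval_smul, h _ (by omega), smul_zero]

/-- Powers of distinct linear factors are coprime, so their product divides `P`. -/
theorem sum_le_natDegree_of_dvd {S : Finset K} {m : K → ℕ} {P : K[X]} (hP : P ≠ 0)
    (h : ∀ a ∈ S, (X - C a) ^ m a ∣ P) : ∑ a ∈ S, m a ≤ P.natDegree := by
  have hd : ∏ a ∈ S, (X - C a) ^ m a ∣ P := by
    refine Finset.prod_dvd_of_coprime ?_ h
    intro a _ b _ hab
    exact (pairwise_coprime_X_sub_C Function.injective_id hab).pow
  refine le_trans (le_of_eq ?_) (natDegree_le_of_dvd hd hP)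
  rw [natDegree_prod_of_monic _ _ fun a _ => (monic_X_sub_C a).pow _]
  simp

/-- The jet of order `s` at `a`. -/
noncomputable def jet (s : ℕ) (a : K) : K[X] →ₗ[K] (Fin s → K) :=
  LinearMap.pi fun i => (leval a).comp (hasseDeriv (i : ℕ))

theorem jet_apply (s : ℕ) (a : K) (P : K[X]) (i : Fin s) :
    jet s a P i = (hasseDeriv (i : ℕ) P).eval a := rfl

theorem mem_ker_jet {s : ℕ} {a : K} {P : K[X]} :
    P ∈ LinearMap.ker (jet s a) ↔ (X - C a) ^ s ∣ P := by
  rw [X_sub_C_pow_dvd_iff_hasseDeriv, LinearMap.mem_ker]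
  constructor
  · intro h j hj
    exact congrFun h ⟨j, hj⟩
  · intro h
    ext i
    exact h i i.2

/-- A basis of a subspace adapted to the intersection with another one. -/
theorem exists_family_adapted {E : Type*} [AddCommGroup E] [Module K E] {n : ℕ} (U W : Submodule K E)
    [FiniteDimensional K U] (hU : Module.finrank K U = n) :
    ∃ h : Fin n → E, U ≤ Submodule.span K (Set.range h) ∧
      ∃ S : Finset (Fin n), S.card = Module.finrank K ↥(U ⊓ W) ∧ ∀ i ∈ S, h i ∈ W := by
  obtain ⟨T, hT⟩ := Submodule.exists_isCompl (W.comap U.subtype)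
  have hdim := Submodule.finrank_add_eq_of_isCompl hT
  have hk : Module.finrank K ↥(W.comap U.subtype) = Module.finrank K ↥(U ⊓ W) := by
    rw [← Submodule.map_comap_subtype]
    exact (LinearEquiv.finrank_eq
      (Submodule.equivMapOfInjective _ U.injective_subtype _))
  set k := Module.finrank K ↥(W.comap U.subtype)
  let b1 := Module.finBasis K ↥(W.comap U.subtype)
  let b2 := Module.finBasis K ↥T
  let e : Fin k ⊕ Fin (Module.finrank K T) ≃ Fin n :=
    finSumFinEquiv.trans (finCongr (by omega))
  let g : Fin k ⊕ Fin (Module.finrank K T) → E :=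
    Sum.elim (fun i => ((b1 i : U) : E)) (fun i => ((b2 i : U) : E))
  refine ⟨g ∘ e.symm, ?_, Finset.univ.image fun i : Fin k => e (Sum.inl i), ?_, ?_⟩
  · intro x hx
    rw [EquivLike.range_comp]
    obtain ⟨y, z, hyz, -⟩ := Submodule.existsUnique_add_of_isCompl hT ⟨x, hx⟩
    have hx' : x = ((y : U) : E) + ((z : U) : E) := by
      rw [← Submodule.coe_add, hyz]
    rw [hx']
    refine Submodule.add_mem _ ?_ ?_
    · have := congrArg (fun w : ↥(W.comap U.subtype) => ((w : U) : E)) (b1.sum_repr y)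
      rw [← this]
      push_cast
      exact Submodule.sum_mem _ fun i _ => Submodule.smul_mem _ _
        (Submodule.subset_span ⟨Sum.inl i, rfl⟩)
    · have := congrArg (fun w : ↥T => ((w : U) : E)) (b2.sum_repr z)
      rw [← this]
      push_cast
      exact Submodule.sum_mem _ fun i _ => Submodule.smul_mem _ _
        (Submodule.subset_span ⟨Sum.inr i, rfl⟩)
  · rw [Finset.card_image_of_injective _ fun i j h => Sum.inl_injective (e.injective h),
      Finset.card_univ, Fintype.card_fin, hk]
  · intro i hi
    obtain ⟨j, -, rfl⟩ := Finset.mem_image.mp hi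
    simp only [Function.comp_apply, Equiv.symm_apply_apply, g, Sum.elim_inl]
    exact (b1 j).2

/-- Changing the family by constant coefficients multiplies the Wronskian by a constant. For a
family adapted to the jet kernel, every row of an element vanishing to order `s` consists of
derivatives of order below `n`, so it retains zeros of order `s + 1 - n`. -/
theorem dvd_det_wronskianMatrix {n s : ℕ} (f : Fin n → K[X]) (hf : LinearIndependent K f) (a : K) :
    (X - C a) ^ (Module.finrank K ↥(Submodule.span K (Set.range f) ⊓ LinearMap.ker (jet s a))
      * (s + 1 - n)) ∣ (wronskianMatrix f).det := by
  have : FiniteDimensional K (Submodule.span K (Set.range f)) :=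
    FiniteDimensional.span_of_finite K (Set.finite_range f)
  obtain ⟨h, hspan, S, hS, hSW⟩ := exists_family_adapted (Submodule.span K (Set.range f))
    (LinearMap.ker (jet s a)) (by rw [finrank_span_eq_card hf, Fintype.card_fin])
  have hM : ∀ i, ∃ c : Fin n → K, ∑ j, c j • h j = f i := fun i =>
    (Submodule.mem_span_range_iff_exists_fun K).mp (hspan (Submodule.subset_span ⟨i, rfl⟩))
  choose M hM using hM
  have hW : wronskianMatrix f = (Matrix.of fun i j => C (M i j)) * (wronskianMatrix (n := n) h) := by
    ext1 i j
    simp only [wronskianMatrix, Matrix.mul_apply, Matrix.of_apply, ← hM i, map_sum, map_smul]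
    simp only [smul_eq_C_mul]
  rw [hW, Matrix.det_mul]
  refine Dvd.dvd.mul_left ?_ _
  set v : Fin n → K[X] := fun i => if i ∈ S then (X - C a) ^ (s + 1 - n) else 1
  have hfac : ∀ i j : Fin n, v i ∣ wronskianMatrix (n := n) h i j := by
    intro i j
    by_cases hi : i ∈ S
    · simp only [v, hi, if_true, wronskianMatrix, Matrix.of_apply]
      refine (pow_dvd_pow _ ?_).trans
        (X_sub_C_pow_dvd_hasseDeriv (mem_ker_jet.mp (hSW i hi)) (j : ℕ))
      have := j.2
      omega
    · simp [v, hi]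
  choose A hA using hfac
  have hdet : (wronskianMatrix (n := n) h).det = (∏ i, v i) * (Matrix.of A).det := by
    rw [← Matrix.det_mul_column]
    congr 1
    ext1 i j
    exact hA i j
  rw [hdet]
  refine Dvd.dvd.mul_right (dvd_of_eq ?_) _
  simp only [v]
  rw [Finset.prod_ite_mem, Finset.univ_inter, Finset.prod_const, hS, ← pow_mul, mul_comm]

/-- A relation with constant coefficients is inherited by all derivatives, hence would be a relation
between the rows of the nonsingular Wronskian matrix. -/
theorem linearIndependent_of_natDegree_mod_injective {p : ℕ} [Fact p.Prime] [CharP K p] {n : ℕ}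
    (f : Fin n → K[X]) (hf : ∀ i, f i ≠ 0)
    (he : Function.Injective fun i => (f i).natDegree % p) : LinearIndependent K f := by
  have hW := det_wronskianMatrix_ne_zero f hf he
  rw [Fintype.linearIndependent_iff]
  intro g hg
  by_contra! hne
  apply hW
  refine Matrix.exists_vecMul_eq_zero_iff.mp ⟨fun i => C (g i), ?_, ?_⟩
  · obtain ⟨i, hi⟩ := hne
    intro h
    exact hi (C_eq_zero.mp (congrFun h i))
  · ext1 j
    have := congrArg (hasseDeriv (j : ℕ)) hg
    simp only [map_sum, map_smul, map_zero] at this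
    simp only [smul_eq_C_mul] at this
    simpa [Matrix.vecMul, dotProduct, wronskianMatrix] using this

/-- Polynomials with distinct degrees modulo the characteristic vanish to high order in few points
only. -/
theorem sum_finrank_inf_ker_jet_le [Fintype K] {p : ℕ} [Fact p.Prime] [CharP K p] {n s : ℕ}
    (f : Fin n → K[X]) (hf : ∀ i, f i ≠ 0)
    (he : Function.Injective fun i => (f i).natDegree % p) :
    ∑ a : K, Module.finrank K ↥(Submodule.span K (Set.range f) ⊓ LinearMap.ker (jet s a))
      * (s + 1 - n) ≤ ∑ i, (f i).natDegree := by
  have hli := linearIndependent_of_natDegree_mod_injective f hf he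
  refine le_trans ?_ (natDegree_det_wronskianMatrix_le f)
  exact sum_le_natDegree_of_dvd (det_wronskianMatrix_ne_zero f hf he)
    fun a _ => dvd_det_wronskianMatrix f hli a

end Wronskian

/-! ### Thin spaces and the contraction of their dimension. -/

section Thin

variable {K : Type*} [Field K]

/-- No `r` nonzero elements of `V` have distinct degrees modulo `p`. -/
def Thin (p r : ℕ) (V : Submodule K K[X]) : Prop :=
  ∀ f : Fin r → K[X], (∀ i, f i ∈ V ∧ f i ≠ 0) →
    ¬ Function.Injective fun i => (f i).natDegree % p

theorem Thin.mono {p r : ℕ} {V W : Submodule K K[X]} (h : Thin p r V) (hW : W ≤ V) : Thin p r W :=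
  fun f hf => h f fun i => ⟨hW (hf i).1, (hf i).2⟩

open Classical in
/-- The degrees, at most `d`, of nonzero elements of `V`. -/
noncomputable def degreeSet (d : ℕ) (V : Submodule K K[X]) : Finset ℕ :=
  (Finset.range (d + 1)).filter fun e => ∃ f ∈ V, f ≠ 0 ∧ f.natDegree = e

theorem mem_degreeSet {d e : ℕ} {V : Submodule K K[X]} :
    e ∈ degreeSet d V ↔ e ≤ d ∧ ∃ f ∈ V, f ≠ 0 ∧ f.natDegree = e := by
  simp [degreeSet]

/-- A nonzero element has a nonzero coefficient at its own degree, so the coefficients at the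
degrees that occur determine it. -/
theorem finrank_le_card_degreeSet {d : ℕ} {V : Submodule K K[X]} (hV : ∀ f ∈ V, f.natDegree ≤ d) :
    FiniteDimensional K V ∧ Module.finrank K V ≤ (degreeSet d V).card := by
  let φ : V →ₗ[K] (degreeSet d V → K) :=
    (LinearMap.pi fun e : degreeSet d V => lcoeff K (e : ℕ)).comp V.subtype
  have hφ : Function.Injective φ := by
    rw [← LinearMap.ker_eq_bot, LinearMap.ker_eq_bot']
    intro f hf
    by_contra hne
    have hne' : (f : K[X]) ≠ 0 := fun h => hne (Subtype.ext h)
    have := congrFun hf ⟨_, mem_degreeSet.mpr ⟨hV f f.2, f, f.2, hne', rfl⟩⟩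
    exact hne' (leadingCoeff_eq_zero.mp this)
  have := FiniteDimensional.of_injective φ hφ
  refine ⟨this, (LinearMap.finrank_le_finrank_of_injective hφ).trans ?_⟩
  simp

/-- Take an element of least degree in each residue class that occurs. The degrees in a class differ
from the least one by multiples of `p`, which bounds their number, and the number of degrees bounds
the dimension. -/
theorem exists_family_degrees {p d : ℕ} {V : Submodule K K[X]}
    (hV : ∀ f ∈ V, f.natDegree ≤ d) :
    ∃ (n : ℕ) (f : Fin n → K[X]), (∀ i, f i ∈ V ∧ f i ≠ 0) ∧
      (Function.Injective fun i => (f i).natDegree % p) ∧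
      Module.finrank K V ≤ ∑ i, ((d - (f i).natDegree) / p + 1) := by
  classical
  set R := (degreeSet d V).image (· % p) with hR
  have hmin : ∀ c : R, ∃ f ∈ V, f ≠ 0 ∧ f.natDegree % p = c ∧
      ∀ g ∈ V, g ≠ 0 → g.natDegree % p = c → f.natDegree ≤ g.natDegree := by
    rintro ⟨c, hc⟩
    have hex : ∃ e, ∃ f ∈ V, f ≠ 0 ∧ f.natDegree = e ∧ e % p = c := by
      obtain ⟨e, he, hec⟩ := Finset.mem_image.mp hc
      obtain ⟨-, f, hf, hf0, rfl⟩ := mem_degreeSet.mp he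
      exact ⟨_, f, hf, hf0, rfl, hec⟩
    obtain ⟨f, hf, hf0, hfe, hfc⟩ := Nat.find_spec hex
    refine ⟨f, hf, hf0, hfe ▸ hfc, fun g hg hg0 hgc => ?_⟩
    rw [hfe]
    exact Nat.find_min' hex ⟨g, hg, hg0, rfl, hgc⟩
  choose F hFV hF0 hFc hFmin using hmin
  refine ⟨R.card, fun i => F (R.equivFin.symm i), fun i => ⟨hFV _, hF0 _⟩, ?_, ?_⟩
  · intro i j hij
    simp only [hFc] at hij
    exact R.equivFin.symm.injective (Subtype.ext hij)
  · rw [Equiv.sum_comp R.equivFin.symm fun c => (d - (F c).natDegree) / p + 1]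
    refine (finrank_le_card_degreeSet hV).2.trans ?_
    rw [Finset.card_eq_sum_card_image (· % p), ← Finset.sum_coe_sort]
    refine Finset.sum_le_sum fun c _ => ?_
    rw [← Finset.card_range ((d - (F c).natDegree) / p + 1)]
    refine Finset.card_le_card_of_injOn (fun e => (e - (F c).natDegree) / p) ?_ ?_
    · intro e he
      obtain ⟨he, -⟩ := Finset.mem_filter.mp he
      simp only [Finset.coe_range, Set.mem_Iio, Nat.lt_succ_iff]
      exact Nat.div_le_div_right (Nat.sub_le_sub_right (mem_degreeSet.mp he).1 _)
    · have key : ∀ e ∈ (degreeSet d V).filter fun e => e % p = c,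
          e = (F c).natDegree + p * ((e - (F c).natDegree) / p) := by
        intro e he
        obtain ⟨he, hec⟩ := Finset.mem_filter.mp he
        obtain ⟨-, g, hg, hg0, rfl⟩ := mem_degreeSet.mp he
        have hle := hFmin c g hg hg0 hec
        have hmod : (F c).natDegree ≡ g.natDegree [MOD p] := (hFc c).trans hec.symm
        rw [Nat.mul_div_cancel' ((Nat.modEq_iff_dvd' hle).mp hmod)]
        omega
      intro e he e' he' hee
      rw [key e he, key e' he']
      simp only at hee
      rw [hee]

theorem Thin.exists_family {p r d : ℕ} {V : Submodule K K[X]} (h : Thin p r V)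
    (hV : ∀ f ∈ V, f.natDegree ≤ d) :
    ∃ (n : ℕ) (f : Fin n → K[X]), n < r ∧ (∀ i, f i ∈ V ∧ f i ≠ 0) ∧
      (Function.Injective fun i => (f i).natDegree % p) ∧
      Module.finrank K V ≤ ∑ i, ((d - (f i).natDegree) / p + 1) := by
  obtain ⟨n, f, hf, he, hd⟩ := exists_family_degrees (p := p) hV
  refine ⟨n, f, ?_, hf, he, hd⟩
  by_contra! hn
  exact h (fun i => f (Fin.castLE hn i)) (fun i => hf _)
    fun i j hij => Fin.castLE_injective hn (he hij)

theorem Thin.finrank_le {p r d s : ℕ} (hp : 0 < p) {V : Submodule K K[X]} (h : Thin p r V)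
    (hV : ∀ f ∈ V, f.natDegree ≤ d) (hd : d < s * p) : Module.finrank K V ≤ r * s := by
  obtain ⟨n, f, hn, hf, he, hle⟩ := h.exists_family hV
  refine hle.trans ((Finset.sum_le_card_nsmul _ _ s fun i _ => ?_).trans ?_)
  · have : (d - (f i).natDegree) / p < s := by
      rw [Nat.div_lt_iff_lt_mul hp]; omega
    omega
  · simp only [Finset.card_univ, Fintype.card_fin, smul_eq_mul]
    exact Nat.mul_le_mul_right s hn.le

theorem finrank_inf_ker_add_finrank_map {E E' : Type*} [AddCommGroup E] [Module K E]
    [AddCommGroup E'] [Module K E'] (f : E →ₗ[K] E') (V : Submodule K E) [FiniteDimensional K V] :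
    Module.finrank K ↥(V ⊓ LinearMap.ker f) + Module.finrank K ↥(V.map f) = Module.finrank K V := by
  have h := LinearMap.finrank_range_add_finrank_ker (f.domRestrict V)
  rw [LinearMap.range_domRestrict, LinearMap.ker_domRestrict] at h
  rw [← h, add_comm, ← Submodule.map_comap_subtype]
  congr 1
  exact (LinearEquiv.finrank_eq (Submodule.equivMapOfInjective _ V.injective_subtype _)).symm

/-- Prescribing a zero of order `s` at a random point contracts the dimension of a thin space by
a factor `1 - 1 / s` on average. -/
theorem Thin.sum_finrank_le [Fintype K] {p r d s : ℕ} [Fact p.Prime] [CharP K p]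
    (hK : Fintype.card K = p) {V : Submodule K K[X]} (h : Thin p r V)
    (hV : ∀ f ∈ V, f.natDegree ≤ d) (hr : 0 < r) (hrd : d + 4 * r * p ≤ s * p) :
    s * ∑ a : K, Module.finrank K ↥(V ⊓ LinearMap.ker (jet s a))
      ≤ (s - 1) * p * Module.finrank K V := by
  have hp : 0 < p := (Fact.out : p.Prime).pos
  have := (finrank_le_card_degreeSet hV).1
  obtain ⟨n, f, hn, hf, he, hle⟩ := h.exists_family hV
  have hUa := sum_finrank_inf_ker_jet_le (s := s) f (fun i => (hf i).2) he
  set U := Submodule.span K (Set.range f) with hU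
  have hUV : U ≤ V := Submodule.span_le.mpr (by rintro _ ⟨i, rfl⟩; exact (hf i).1)
  have : FiniteDimensional K U := Submodule.finiteDimensional_of_le hUV
  have hUn : Module.finrank K U = n := by
    have hli := linearIndependent_of_natDegree_mod_injective f (fun i => (hf i).2) he
    rw [finrank_span_eq_card hli, Fintype.card_fin]
  set D := Module.finrank K V
  set G := s + 1 - n with hG
  have hrs : 4 * r ≤ s := by
    have : 4 * r * p ≤ s * p := by omega
    exact Nat.le_of_mul_le_mul_right this hp
  -- The rank of the jet map on `V` is at least its rank on `U`, so passing to the kernel costs `V`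
  -- at least as many dimensions as `U`. In `U` the remaining dimension is controlled by the
  -- Wronskian.
  have hpt : ∀ a : K, Module.finrank K ↥(V ⊓ LinearMap.ker (jet s a)) + n
      ≤ D + Module.finrank K ↥(U ⊓ LinearMap.ker (jet s a)) := by
    intro a
    have h1 := finrank_inf_ker_add_finrank_map (jet s a) V
    have h2 := finrank_inf_ker_add_finrank_map (jet s a) U
    have h3 : Module.finrank K ↥(U.map (jet s a)) ≤ Module.finrank K ↥(V.map (jet s a)) :=
      Submodule.finrank_mono (Submodule.map_mono hUV)
    omega
  set x := ∑ a : K, Module.finrank K ↥(V ⊓ LinearMap.ker (jet s a))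
  set y := ∑ a : K, Module.finrank K ↥(U ⊓ LinearMap.ker (jet s a)) with hy
  have hxy : x + p * n ≤ p * D + y := by
    have := Finset.sum_le_sum fun a (_ : a ∈ (Finset.univ : Finset K)) => hpt a
    simpa [Finset.sum_add_distrib, hK] using this
  rw [← Finset.sum_mul, ← hy] at hUa
  -- Summed over `i` and divided by `G`, this becomes `p D + s y ≤ s p n`, which is exactly the
  -- saving of `p D` needed at the end.
  have hterm : ∀ i : Fin n, G * (p * ((d - (f i).natDegree) / p + 1)) + s * (f i).natDegree
      ≤ G * (s * p) := by
    intro i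
    have hed : (f i).natDegree ≤ d := hV _ (hf i).1
    have h1 : p * ((d - (f i).natDegree) / p) ≤ d - (f i).natDegree := Nat.mul_div_le _ _
    have hi : 0 < n := i.pos
    generalize (f i).natDegree = e at *
    generalize (d - e) / p = z at *
    obtain ⟨u, hu⟩ : ∃ u, s = G + u ∧ u + 2 ≤ r := ⟨n - 1, by omega, by omega⟩
    obtain ⟨hu, hur⟩ := hu
    have h2 : p * (z + 1) + e ≤ d + p := by
      have : p * (z + 1) = p * z + p := by ring
      omega
    have h3 : G * (p * (z + 1)) + G * e ≤ G * (d + p) := by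
      rw [← mul_add]; exact Nat.mul_le_mul_left G h2
    have h4 : u * e ≤ r * (s * p) := Nat.mul_le_mul (by omega) (by omega)
    have h5 : G * (d + p) + G * ((4 * r - 1) * p) ≤ G * (s * p) := by
      rw [← mul_add]
      refine Nat.mul_le_mul_left G ?_
      have : (4 * r - 1) * p + p = 4 * r * p := by
        rw [← Nat.succ_mul]; congr 1; omega
      omega
    -- The slack of `4 r` blocks in the degree pays for the deviation of `G` from `s`: since `n < r
    -- ≤ s / 4`, one has `G ≥ 3 s / 4`, and `4 r - 1 ≥ 3 r`.
    have h6 : r * (s * p) ≤ G * ((4 * r - 1) * p) := by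
      rw [← mul_assoc, ← mul_assoc]
      refine Nat.mul_le_mul_right p ?_
      have h7 : 3 * s ≤ 4 * G := by omega
      have h8 : (3 * s) * (4 * r - 1) ≤ (4 * G) * (4 * r - 1) := Nat.mul_le_mul_right _ h7
      have h9 : (3 * s) * (3 * r) ≤ (3 * s) * (4 * r - 1) := Nat.mul_le_mul_left _ (by omega)
      nlinarith [Nat.zero_le (s * r)]
    calc G * (p * (z + 1)) + s * e = G * (p * (z + 1)) + G * e + u * e := by rw [hu]; ring
      _ ≤ _ := by omega
  have hsum := Finset.sum_le_sum fun i (_ : i ∈ (Finset.univ : Finset (Fin n))) => hterm i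
  rw [Finset.sum_add_distrib, ← Finset.mul_sum, ← Finset.mul_sum, ← Finset.mul_sum,
    Finset.sum_const, Finset.card_univ, Fintype.card_fin, smul_eq_mul] at hsum
  have hG0 : 0 < G := by omega
  have h1 : G * (p * D) + G * (s * y) ≤ G * (s * p * n) := by
    have e1 : G * (p * D) ≤ G * (p * ∑ i, ((d - (f i).natDegree) / p + 1)) := by gcongr
    have e2 : G * (s * y) ≤ s * ∑ i, (f i).natDegree := by
      calc G * (s * y) = s * (y * G) := by ring
        _ ≤ _ := Nat.mul_le_mul_left s hUa
    have e3 : n * (G * (s * p)) = G * (s * p * n) := by ring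
    omega
  rw [← mul_add] at h1
  have h2 := Nat.le_of_mul_le_mul_left h1 hG0
  have h3 := Nat.mul_le_mul_left s hxy
  obtain ⟨s', rfl⟩ : ∃ s', s = s' + 1 := ⟨s - 1, by omega⟩
  simp only [Nat.add_sub_cancel]
  have e4 : (s' + 1) * (x + p * n) = (s' + 1) * x + (s' + 1) * p * n := by ring
  have e5 : (s' + 1) * (p * D + y) = s' * p * D + p * D + (s' + 1) * y := by ring
  omega

/-- The elements of `V` vanishing to order `s` at all points of a tuple. -/
noncomputable def vanishing (s : ℕ) (V : Submodule K K[X]) {t : ℕ} (a : Fin t → K) :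
    Submodule K K[X] :=
  V ⊓ ⨅ i, LinearMap.ker (jet s (a i))

/-- Subspaces of thin spaces are thin with the same parameters, so the one-point estimate applies
again after each point has been imposed. -/
theorem Thin.sum_finrank_vanishing_le [Fintype K] {p r d s : ℕ} [Fact p.Prime] [CharP K p]
    (hK : Fintype.card K = p) (hr : 0 < r) (hrd : d + 4 * r * p ≤ s * p) (t : ℕ) :
    ∀ {V : Submodule K K[X]}, Thin p r V → (∀ f ∈ V, f.natDegree ≤ d) →
    s ^ t * ∑ a : Fin t → K, Module.finrank K ↥(vanishing s V a)
      ≤ ((s - 1) * p) ^ t * Module.finrank K V := by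
  induction t with
  | zero =>
    intro V h hV
    have hz : ∀ a : Fin 0 → K, vanishing s V a = V := fun a => by
      rw [vanishing, iInf_of_isEmpty, sInf_empty, inf_top_eq]
    rw [Finset.sum_congr rfl fun a _ => by rw [hz a]]
    simp
  | succ t ih =>
    intro V h hV
    have hcons : ∀ (a : K) (b : Fin t → K), vanishing s V (Fin.cons a b : Fin (t + 1) → K)
        = vanishing s (V ⊓ LinearMap.ker (jet s a)) b := by
      intro a b
      ext P
      simp only [vanishing, Submodule.mem_inf, Submodule.mem_iInf, Fin.forall_fin_succ,
        Fin.cons_zero, Fin.cons_succ]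
      tauto
    rw [← (Fin.consEquiv fun _ => K).sum_comp, Fintype.sum_prod_type]
    change s ^ (t + 1) * ∑ a : K, ∑ b : Fin t → K,
      Module.finrank K ↥(vanishing s V (Fin.cons a b : Fin (t + 1) → K)) ≤ _
    rw [Finset.sum_congr rfl fun a _ => Finset.sum_congr rfl fun b _ => by rw [hcons a b],
      pow_succ', mul_assoc, Finset.mul_sum]
    calc s * ∑ a : K, s ^ t * ∑ b : Fin t → K,
          Module.finrank K ↥(vanishing s (V ⊓ LinearMap.ker (jet s a)) b)
        ≤ s * ∑ a : K, ((s - 1) * p) ^ t * Module.finrank K ↥(V ⊓ LinearMap.ker (jet s a)) := by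
          refine Nat.mul_le_mul_left _ (Finset.sum_le_sum fun a _ => ?_)
          exact ih (h.mono inf_le_left) fun f hf => hV f hf.1
      _ = ((s - 1) * p) ^ t * (s * ∑ a : K, Module.finrank K ↥(V ⊓ LinearMap.ker (jet s a))) := by
          rw [← Finset.mul_sum]; ring
      _ ≤ ((s - 1) * p) ^ t * ((s - 1) * p * Module.finrank K V) :=
          Nat.mul_le_mul_left _ (h.sum_finrank_le hK hV hr hrd)
      _ = _ := by ring

end Thin

/-! ### Interpolating differential operators and their solution spaces. -/

section Interpolation

variable {K : Type*} [Field K]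

/-- The monomials of the differential operators `λ A + ∑ i, B i * P⁽ⁱ⁾`: the first `N` are those of
`λ A`, each of the following blocks of `m` belongs to one `B i`. -/
noncomputable def opTerm (N m c : ℕ) (P : K[X]) (l : K) : K[X] :=
  if c < N then C l * X ^ c else X ^ ((c - N) % m) * hasseDeriv ((c - N) / m) P

/-- The operator with coefficient vector `Q`. -/
noncomputable def diffOp (N m : ℕ) {n : ℕ} (Q : Fin n → K) (P : K[X]) (l : K) : K[X] :=
  ∑ c, Q c • opTerm N m c P l

theorem opTerm_add (N m c : ℕ) (P P' : K[X]) (l l' : K) :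
    opTerm N m c (P + P') (l + l') = opTerm N m c P l + opTerm N m c P' l' := by
  unfold opTerm
  split_ifs
  · rw [C_add, add_mul]
  · rw [map_add, mul_add]

theorem opTerm_smul (N m c : ℕ) (P : K[X]) (l z : K) :
    opTerm N m c (z • P) (z * l) = z • opTerm N m c P l := by
  unfold opTerm
  split_ifs
  · rw [C_mul, mul_assoc, smul_eq_C_mul]
  · rw [map_smul, mul_smul_comm]

theorem diffOp_add (N m : ℕ) {n : ℕ} (Q : Fin n → K) (P P' : K[X]) (l l' : K) :
    diffOp N m Q (P + P') (l + l') = diffOp N m Q P l + diffOp N m Q P' l' := by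
  simp only [diffOp, opTerm_add, smul_add, Finset.sum_add_distrib]

theorem diffOp_smul (N m : ℕ) {n : ℕ} (Q : Fin n → K) (P : K[X]) (l z : K) :
    diffOp N m Q (z • P) (z * l) = z • diffOp N m Q P l := by
  simp only [diffOp, opTerm_smul, Finset.smul_sum]
  exact Finset.sum_congr rfl fun c _ => smul_comm _ _ _

theorem diffOp_sum (N m : ℕ) {n : ℕ} (Q : Fin n → K) {ι : Type*} (S : Finset ι) (P : ι → K[X])
    (l : ι → K) : diffOp N m Q (∑ i ∈ S, P i) (∑ i ∈ S, l i)
      = ∑ i ∈ S, diffOp N m Q (P i) (l i) := by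
  classical
  induction S using Finset.induction_on with
  | empty =>
    have := diffOp_smul N m Q (0 : K[X]) 0 0
    simpa using this
  | insert a S ha ih => rw [Finset.sum_insert ha, Finset.sum_insert ha, Finset.sum_insert ha,
      diffOp_add, ih]

/-- The relation `N = d + m` balances the two kinds of terms: `deg A < N` and `deg B_i + deg P < m +
d`. -/
theorem natDegree_diffOp_lt {N m d n : ℕ} (hm : 0 < m) (hN : N = d + m) (Q : Fin n → K) {P : K[X]}
    (hP : P.natDegree ≤ d) (l : K) : (diffOp N m Q P l).natDegree < N := by
  suffices h : (diffOp N m Q P l).natDegree ≤ N - 1 by omega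
  refine natDegree_sum_le_of_forall_le _ _ fun c _ => (natDegree_smul_le _ _).trans ?_
  unfold opTerm
  split_ifs with hc
  · refine (natDegree_C_mul_X_pow_le _ _).trans ?_
    omega
  · refine natDegree_mul_le.trans ?_
    rw [natDegree_X_pow]
    have h1 := natDegree_hasseDeriv_le P ((c - N) / m)
    have h2 : ((c : ℕ) - N) % m < m := Nat.mod_lt _ hm
    generalize ((c : ℕ) - N) % m = x at *
    generalize ((c : ℕ) - N) / m = y at *
    omega

theorem coeff_sum_smul_X_pow {ι : Type*} (S : Finset ι) (w : ι → K) (e : ι → ℕ)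
    (he : Set.InjOn e S) {i : ι} (hi : i ∈ S) : (∑ j ∈ S, w j • (X : K[X]) ^ e j).coeff (e i) = w i := by
  rw [finsetSum_coeff, Finset.sum_eq_single_of_mem i hi]
  · simp
  · intro j hj hji
    rw [coeff_smul, coeff_X_pow, if_neg fun h => hji (he hj hi h.symm), smul_zero]

/-- The solutions of degree at most `d` of the homogeneous equations. -/
def solutionSpace (N m d : ℕ) {n : ℕ} (S : Submodule K (Fin n → K)) : Submodule K K[X] where
  carrier := {P | P.natDegree ≤ d ∧ ∀ Q ∈ S, diffOp N m Q P 0 = 0}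
  add_mem' := by
    rintro P P' ⟨h, hQ⟩ ⟨h', hQ'⟩
    refine ⟨(natDegree_add_le _ _).trans (max_le h h'), fun Q hS => ?_⟩
    have := diffOp_add N m Q P P' 0 0
    rw [add_zero] at this
    rw [this, hQ Q hS, hQ' Q hS, add_zero]
  zero_mem' := by
    refine ⟨by simp, fun Q _ => ?_⟩
    have := diffOp_smul N m Q (0 : K[X]) 0 0
    simpa using this
  smul_mem' := by
    rintro z P ⟨h, hQ⟩
    refine ⟨(natDegree_smul_le _ _).trans h, fun Q hS => ?_⟩
    have := diffOp_smul N m Q P 0 z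
    rw [mul_zero] at this
    rw [this, hQ Q hS, smul_zero]

/-- For `r` elements of distinct degrees modulo `p`, the homogeneous equations say that the vector
of the `B_i` is killed by a nonsingular Wronskian matrix. What then remains of the operator is `A`,
and the inhomogeneous solution `P` shows that it vanishes too; the existence of `P` is essential
here. -/
theorem thin_solutionSpace {p : ℕ} [Fact p.Prime] [CharP K p] {N m d r n : ℕ} (hm : 0 < m)
    (hn : n = N + r * m) {S : Submodule K (Fin n → K)} (hS : S ≠ ⊥) {P : K[X]}
    (hP : ∀ Q ∈ S, diffOp N m Q P 1 = 0) : Thin p r (solutionSpace N m d S) := by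
  intro f hf he
  obtain ⟨Q, hQS, hQ⟩ := Submodule.exists_mem_ne_zero_of_ne_bot hS
  have hW := det_wronskianMatrix_ne_zero f (fun i => (hf i).2) he
  classical
  have hdiv : ∀ c : Fin n, ((c : ℕ) - N) / m < r ∨ (c : ℕ) < N := by
    intro c
    by_cases hc : (c : ℕ) < N
    · exact Or.inr hc
    · left
      have := c.2
      rw [Nat.div_lt_iff_lt_mul hm]
      omega
  let T : Finset (Fin n) := Finset.univ.filter fun c => ¬ (c : ℕ) < N
  let B : Fin r → K[X] := fun i =>
    ∑ c ∈ T.filter fun c : Fin n => ((c : ℕ) - N) / m = i, Q c • (X : K[X]) ^ (((c : ℕ) - N) % m)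
  have hB : B = 0 := by
    by_contra hB
    -- Row `k` of the matrix applied to `B` is the operator applied to `(f k, 0)`, after grouping
    -- the monomials by the order of the derivative.
    refine hW (Matrix.exists_mulVec_eq_zero_iff.mp ⟨B, hB, ?_⟩)
    ext1 k
    have h0 := (hf k).1.2 Q hQS
    have h1 : diffOp N m Q (f k) 0
        = ∑ c ∈ T, Q c • ((X : K[X]) ^ (((c : ℕ) - N) % m) * hasseDeriv (((c : ℕ) - N) / m) (f k)) := by
      rw [diffOp, Finset.sum_filter]
      refine Finset.sum_congr rfl fun c _ => ?_
      unfold opTerm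
      by_cases hc : (c : ℕ) < N <;> simp [hc]
    have h2 : ∀ c ∈ T, ((c : ℕ) - N) / m ∈ Finset.range r := by
      intro c hc
      rcases hdiv c with h | h
      · exact Finset.mem_range.mpr h
      · exact absurd h (Finset.mem_filter.mp hc).2
    rw [h0, ← Finset.sum_fiberwise_of_maps_to h2] at h1
    rw [Matrix.mulVec, dotProduct, Pi.zero_apply, h1, Finset.sum_range]
    refine Finset.sum_congr rfl fun i _ => ?_
    rw [wronskianMatrix, Matrix.of_apply, Finset.mul_sum]
    refine Finset.sum_congr rfl fun c hc => ?_
    rw [(Finset.mem_filter.mp hc).2, mul_smul_comm, mul_comm]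
  have hQ2 : ∀ c : Fin n, N ≤ c → Q c = 0 := by
    intro c hc
    have hr : ((c : ℕ) - N) / m < r := (hdiv c).resolve_right (by omega)
    have h1 := congrFun hB ⟨_, hr⟩
    have hmem : c ∈ T.filter fun c' : Fin n => ((c' : ℕ) - N) / m = ((c : ℕ) - N) / m := by
      simp [T, hc]
    have h2 := coeff_sum_smul_X_pow (T.filter fun c' : Fin n => ((c' : ℕ) - N) / m = ((c : ℕ) - N) / m) Q
      (fun c' : Fin n => ((c' : ℕ) - N) % m) (by
        intro x hx y hy hxy
        simp only [T, Finset.coe_filter, Finset.mem_filter, Finset.mem_univ, true_and,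
          Set.mem_ofPred_eq, not_lt] at hx hy
        have e1 := Nat.div_add_mod ((x : ℕ) - N) m
        have e2 := Nat.div_add_mod ((y : ℕ) - N) m
        simp only at hxy
        rw [hx.2, hxy] at e1
        rw [hy.2] at e2
        apply Fin.ext
        omega) hmem
    rw [← h2]
    change (B ⟨_, hr⟩).coeff _ = 0
    rw [h1]
    simp
  apply hQ
  ext c
  by_cases hc : (c : ℕ) < N
  · have h0 := hP Q hQS
    have h1 : diffOp N m Q P 1 = ∑ c ∈ Finset.univ.filter fun c : Fin n => (c : ℕ) < N,
        Q c • (X : K[X]) ^ (c : ℕ) := by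
      rw [diffOp, Finset.sum_filter]
      refine Finset.sum_congr rfl fun c _ => ?_
      by_cases hc : (c : ℕ) < N
      · simp [opTerm, hc]
      · simp [hc, hQ2 c (by omega)]
    have h2 := coeff_sum_smul_X_pow (Finset.univ.filter fun c : Fin n => (c : ℕ) < N) Q
      (fun c : Fin n => (c : ℕ)) (fun x _ y _ h => Fin.ext h) (i := c) (by simp [hc])
    rw [← h2, ← h1, h0]
    simp
  · exact hQ2 c (by omega)

/-- The value at `a` of the `i`-th Hasse derivative of `X ^ u`. -/
def hasseMonomial (u : ℕ) (a : K) (i : ℕ) : K := (u.choose i : K) * a ^ (u - i)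

theorem eval_hasseDeriv_X_pow (u : ℕ) (a : K) (i : ℕ) :
    (hasseDeriv i ((X : K[X]) ^ u)).eval a = hasseMonomial u a i := by
  rw [← monomial_one_right_eq_X_pow, hasseDeriv_monomial, eval_monomial, mul_one, hasseMonomial]

theorem hasseMonomial_one (u i : ℕ) : hasseMonomial u (1 : K) i = u.choose i := by
  simp [hasseMonomial]

/-- The coefficient at `c` of the linear form `Q ↦ j`-th Hasse derivative at `a` of
`diffOp Q P 1`, when `P` has the derivatives `y` at `a`. -/
def symbolForm (N m : ℕ) (a : K) (y : ℕ → K) (j c : ℕ) : K :=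
  if c < N then hasseMonomial c a j
  else ∑ k ∈ Finset.range (j + 1), hasseMonomial ((c - N) % m) a k *
    (hasseMonomial ((c - N) / m + (j - k)) 1 ((c - N) / m) * y ((c - N) / m + (j - k)))

/-- The product rule and the composition rule involve derivatives of `P` of order at most `(r - 1) +
(g - 1) = s - 1`. This is why `g + r = s + 1`: the conditions only depend on the symbol, not on `P`.
-/
theorem eval_hasseDeriv_opTerm {N m r g s : ℕ} (hg : g + r = s + 1) {a : K} {y : ℕ → K} {P : K[X]}
    (hP : ∀ i < s, (hasseDeriv i P).eval a = y i) {j c : ℕ} (hj : j < g)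
    (hc : c < N ∨ (c - N) / m < r) :
    (hasseDeriv j (opTerm N m c P 1)).eval a = symbolForm N m a y j c := by
  unfold opTerm symbolForm
  split_ifs with h
  · rw [C_1, one_mul, eval_hasseDeriv_X_pow]
  · rw [hasseDeriv_mul, eval_finsetSum, Finset.Nat.sum_antidiagonal_eq_sum_range_succ_mk]
    refine Finset.sum_congr rfl fun k hk => ?_
    have hk := Finset.mem_range.mp hk
    have hr := hc.resolve_left h
    have := LinearMap.congr_fun (hasseDeriv_comp (R := K) (j - k) ((c - N) / m)) P
    simp only [LinearMap.comp_apply, LinearMap.smul_apply] at this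
    rw [eval_mul, eval_hasseDeriv_X_pow, this, eval_smul, hP _ (by omega), hasseMonomial_one,
      nsmul_eq_mul, add_comm (j - k)]
    congr 3
    rw [← Nat.choose_symm_add]

theorem eval_hasseDeriv_diffOp {N m r g s n : ℕ} (hm : 0 < m) (hn : n = N + r * m)
    (hg : g + r = s + 1) {a : K} {y : ℕ → K}
    {P : K[X]} (hP : ∀ i < s, (hasseDeriv i P).eval a = y i) {j : ℕ} (hj : j < g)
    (Q : Fin n → K) :
    (hasseDeriv j (diffOp N m Q P 1)).eval a = ∑ c : Fin n, symbolForm N m a y j c * Q c := by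
  rw [diffOp, map_sum, eval_finsetSum]
  refine Finset.sum_congr rfl fun c _ => ?_
  rw [map_smul, eval_smul, eval_hasseDeriv_opTerm hg hP hj, smul_eq_mul, mul_comm]
  by_cases hc : (c : ℕ) < N
  · exact Or.inl hc
  · right
    rw [Nat.div_lt_iff_lt_mul hm]
    have := c.2
    omega

/-- The polynomial with coefficients `p 0, …, p d`. -/
noncomputable def polyOf {d : ℕ} (p : Fin (d + 2) → K) : K[X] :=
  ∑ u : Fin (d + 1), p u.castSucc • (X : K[X]) ^ (u : ℕ)

theorem natDegree_polyOf_le {d : ℕ} (p : Fin (d + 2) → K) : (polyOf p).natDegree ≤ d :=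
  natDegree_sum_le_of_forall_le _ _ fun u _ =>
    (natDegree_smul_le _ _).trans ((natDegree_X_pow_le _).trans (by omega))

theorem coeff_polyOf {d : ℕ} (p : Fin (d + 2) → K) (u : Fin (d + 1)) :
    (polyOf p).coeff u = p u.castSucc :=
  coeff_sum_smul_X_pow Finset.univ (fun u : Fin (d + 1) => p u.castSucc) (fun u => (u : ℕ))
    (fun _ _ _ _ h => Fin.ext h) (Finset.mem_univ u)

/-- The coefficient at `u` of the linear form on `(P, l)` which is the coefficient of `X ^ k` in
`diffOp Q P l`; the number `l` is the coordinate `d + 1`. -/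
def equationForm (N m d : ℕ) {n : ℕ} (Q : Fin n → K) (k u : ℕ) : K :=
  if u ≤ d then ∑ c : Fin n, if (c : ℕ) < N then 0 else
    if u - ((c : ℕ) - N) / m + ((c : ℕ) - N) % m = k then
      Q c * hasseMonomial u 1 (((c : ℕ) - N) / m) else 0
  else ∑ c : Fin n, if (c : ℕ) = k then Q c else 0

/-- By joint linearity in `(P, l)` it suffices to treat monomials. In `equationForm` the truncated
exponent `u - i` for `u < i` does no harm, because the binomial coefficient is then zero. -/
theorem coeff_diffOp {N m d n k : ℕ} (hk : k < N) (Q : Fin n → K) (p : Fin (d + 2) → K) :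
    (diffOp N m Q (polyOf p) (p (Fin.last _))).coeff k
      = ∑ u : Fin (d + 2), equationForm N m d Q k u * p u := by
  have h0 : diffOp N m Q (polyOf p) (p (Fin.last _))
      = (∑ u : Fin (d + 1), p u.castSucc • diffOp N m Q ((X : K[X]) ^ (u : ℕ)) 0)
        + p (Fin.last _) • diffOp N m Q 0 1 := by
    have h1 := diffOp_add N m Q (polyOf p) 0 0 (p (Fin.last _))
    rw [add_zero, zero_add] at h1
    have h2 := diffOp_smul N m Q 0 1 (p (Fin.last _))
    rw [smul_zero, mul_one] at h2
    have h3 := diffOp_sum N m Q (Finset.univ : Finset (Fin (d + 1)))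
      (fun u : Fin (d + 1) => p u.castSucc • (X : K[X]) ^ (u : ℕ)) (fun u => p u.castSucc * 0)
    simp only [diffOp_smul] at h3
    rw [h1, h2, ← h3]
    simp [polyOf]
  rw [h0, coeff_add, finsetSum_coeff, Fin.sum_univ_castSucc (n := d + 1)]
  congr 1
  · refine Finset.sum_congr rfl fun u _ => ?_
    rw [coeff_smul, smul_eq_mul, mul_comm]
    congr 1
    rw [equationForm, if_pos (by simp; omega), diffOp, finsetSum_coeff]
    refine Finset.sum_congr rfl fun c _ => ?_
    rw [coeff_smul, opTerm]
    split_ifs with h1 h2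
    · simp
    · rw [← monomial_one_right_eq_X_pow (R := K) u, hasseDeriv_monomial, ← monomial_one_right_eq_X_pow,
        monomial_mul_monomial, coeff_monomial, if_pos (by simpa [add_comm] using h2),
        hasseMonomial_one]
      simp
    · rw [← monomial_one_right_eq_X_pow (R := K) u, hasseDeriv_monomial, ← monomial_one_right_eq_X_pow,
        monomial_mul_monomial, coeff_monomial, if_neg (by simpa [add_comm] using h2), smul_zero]
  · rw [coeff_smul, smul_eq_mul, mul_comm]
    congr 1
    rw [equationForm, if_neg (by simp), diffOp, finsetSum_coeff]
    refine Finset.sum_congr rfl fun c _ => ?_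
    rw [coeff_smul, opTerm]
    by_cases h1 : (c : ℕ) < N
    · simp only [h1, if_true, C_1, one_mul, coeff_X_pow]
      by_cases h2 : (c : ℕ) = k
      · simp [h2]
      · simp [h2, Ne.symm h2]
    · simp [h1, show ¬ (c : ℕ) = k by omega]

end Interpolation

/-! ### Isolation of solutions and the bound on their number. -/

section Counting

/-- The linear form with the coefficients `φ 0, …, φ (n - 1)`. -/
def linForm {K : Type*} [Field K] {n : ℕ} (φ : ℕ → K) : (Fin n → K) →ₗ[K] K :=
  ∑ c : Fin n, φ c • LinearMap.proj c

theorem linForm_apply {K : Type*} [Field K] {n : ℕ} (φ : ℕ → K) (v : Fin n → K) :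
    linForm φ v = ∑ c : Fin n, φ c * v c := by
  simp [linForm, LinearMap.sum_apply]

/-- The relations between the parameters of the code and those of the decoder: the code has order
`s` and degree `d` over the field with `q` elements, lists have size `l`, there are at most `e`
errors; the differential equation has `r` unknown coefficients of degree less than `m` and an
inhomogeneity of degree less than `N`, and is satisfied to order `g`; tuples of `t` points are
sampled. -/
structure DecoderParams (q s d l e r g N m b t : ℕ) : Prop where
  r_pos : 0 < r
  degree : d + 4 * r * q ≤ s * q
  order : g + r = s + 1
  total : N = (q - e) * g
  block : N = d + m
  m_pos : 0 < m
  unknowns : q * l * g < N + r * m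
  errors : 2 * s * e ≤ q
  s_lt : s < 2 ^ b
  length : t = 6 * s * b
  l_pos : 0 < l

variable {q s d l e r g N m b t : ℕ} [Fact q.Prime]

/-- `P` has degree at most `d` and agrees with the lists up to `e` errors; the `k`-th symbol of the
list at `a` is `y (a * l + k)`. -/
def IsSolution (s d l e : ℕ) (y : ℕ → ℕ → ZMod q) (P : (ZMod q)[X]) : Prop :=
  P.natDegree ≤ d ∧ ∃ G : Finset (ZMod q), q ≤ G.card + e ∧
    ∀ a ∈ G, ∃ k < l, ∀ i < s, (hasseDeriv i P).eval a = y (a.val * l + k) i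

/-- The coefficient vectors of the interpolating differential equations. -/
def interpolants (q : ℕ) [Fact q.Prime] (l g N m n : ℕ) (y : ℕ → ℕ → ZMod q) :
    Submodule (ZMod q) (Fin n → ZMod q) :=
  LinearMap.ker (LinearMap.pi fun xj : Fin (q * l) × Fin g =>
    linForm (n := n) (symbolForm N m (((xj.1 : ℕ) / l : ℕ) : ZMod q) (y xj.1) xj.2))

theorem mem_interpolants {n : ℕ} {y : ℕ → ℕ → ZMod q} {Q : Fin n → ZMod q} :
    Q ∈ interpolants q l g N m n y ↔ ∀ x < q * l, ∀ j < g,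
      linForm (symbolForm N m ((x / l : ℕ) : ZMod q) (y x) j) Q = 0 := by
  rw [interpolants, LinearMap.mem_ker]
  constructor
  · intro h x hx j hj
    exact congrFun h (⟨x, hx⟩, ⟨j, hj⟩)
  · intro h
    ext xj
    exact h _ xj.1.2 _ xj.2.2

theorem interpolants_ne_bot (hp : DecoderParams q s d l e r g N m b t) (y : ℕ → ℕ → ZMod q) :
    interpolants q l g N m (N + r * m) y ≠ ⊥ := by
  refine LinearMap.ker_ne_bot_of_finrank_lt ?_
  simpa using hp.unknowns

/-- At each of at least `q - e` agreement points the result has a zero of order `g`, altogether `N =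
(q - e) g` zeros, but its degree is below `N`. -/
theorem diffOp_eq_zero_of_isSolution (hp : DecoderParams q s d l e r g N m b t)
    {y : ℕ → ℕ → ZMod q} {P : (ZMod q)[X]} (hP : IsSolution s d l e y P)
    {Q : Fin (N + r * m) → ZMod q} (hQ : Q ∈ interpolants q l g N m (N + r * m) y) :
    diffOp N m Q P 1 = 0 := by
  obtain ⟨hd, G, hG, hk⟩ := hP
  by_contra h0
  have hlt := natDegree_diffOp_lt hp.m_pos hp.block Q hd 1
  have hdvd : ∀ a ∈ G, (X - C a) ^ g ∣ diffOp N m Q P 1 := by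
    intro a ha
    obtain ⟨k, hkl, hy⟩ := hk a ha
    rw [X_sub_C_pow_dvd_iff_hasseDeriv]
    intro j hj
    rw [eval_hasseDeriv_diffOp hp.m_pos rfl hp.order hy hj, ← linForm_apply]
    have hx : a.val * l + k < q * l := by
      have := ZMod.val_lt a
      calc a.val * l + k < (a.val + 1) * l := by rw [Nat.succ_mul]; omega
        _ ≤ q * l := Nat.mul_le_mul_right l this
    have h1 := mem_interpolants.mp hQ _ hx j hj
    have h2 : (a.val * l + k) / l = a.val := by
      rw [mul_comm, Nat.mul_add_div (by omega), Nat.div_eq_of_lt hkl, add_zero]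
    rwa [h2, ZMod.natCast_zmod_val] at h1
  have h1 := sum_le_natDegree_of_dvd h0 hdvd
  rw [Finset.sum_const, smul_eq_mul] at h1
  have h2 : (q - e) * g ≤ G.card * g := Nat.mul_le_mul_right g (by omega)
  rw [← hp.total] at h2
  omega

theorem DecoderParams.r_le (hp : DecoderParams q s d l e r g N m b t) : 4 * r ≤ s := by
  have h : 4 * r * q ≤ s * q := by have := hp.degree; omega
  exact Nat.le_of_mul_le_mul_right h (Fact.out : q.Prime).pos

theorem DecoderParams.b_pos (hp : DecoderParams q s d l e r g N m b t) : 0 < b := by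
  have h1 := hp.s_lt
  have h2 := hp.r_le
  have h3 := hp.r_pos
  rcases Nat.eq_zero_or_pos b with rfl | h
  · rw [pow_zero] at h1; omega
  · exact h

/-- `P` is the only solution consistent with the symbols `x`. -/
def Isolates (s d l g r N m : ℕ) (y : ℕ → ℕ → ZMod q) (P : (ZMod q)[X]) {t : ℕ}
    (x : Fin t → Fin (q * l)) : Prop :=
  (∀ c, ∀ i < s, (hasseDeriv i P).eval ((((x c : ℕ) / l : ℕ)) : ZMod q) = y (x c) i) ∧
    vanishing s (solutionSpace N m d (interpolants q l g N m (N + r * m) y))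
      (fun c => ((((x c : ℕ) / l : ℕ)) : ZMod q)) = ⊥

/-- The difference of two such solutions solves the homogeneous equations and vanishes to order `s`
at all sampled points. -/
theorem eq_of_isolates (hp : DecoderParams q s d l e r g N m b t)
    {y : ℕ → ℕ → ZMod q} {P P' : (ZMod q)[X]} (hP : IsSolution s d l e y P)
    (hP' : IsSolution s d l e y P') {x : Fin t → Fin (q * l)}
    (h : Isolates s d l g r N m y P x) (h' : Isolates s d l g r N m y P' x) : P = P' := by
  rw [← sub_eq_zero, ← Submodule.mem_bot (R := ZMod q), ← h.2]
  refine ⟨⟨(natDegree_sub_le _ _).trans (max_le hP.1 hP'.1), fun Q hQ => ?_⟩, ?_⟩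
  · have h1 := diffOp_eq_zero_of_isSolution hp hP hQ
    have h2 := diffOp_eq_zero_of_isSolution hp hP' hQ
    have h3 := diffOp_add N m Q (P - P') P' 0 1
    rw [sub_add_cancel, zero_add, h1, h2, add_zero] at h3
    exact h3.symm
  · rw [SetLike.mem_coe, Submodule.mem_iInf]
    intro c
    rw [LinearMap.mem_ker]
    ext i
    rw [jet_apply, map_sub, eval_sub, h.1 c i i.2, h'.1 c i i.2, sub_self]
    rfl

/-- Bernoulli's inequality for the reciprocal `1 + 1 / (n - 1)` of the base. -/
theorem pow_half_le (n : ℕ) (hn : 0 < n) : (1 - 1 / (n : ℝ)) ^ n ≤ 1 / 2 := by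
  rcases Nat.lt_or_ge n 2 with h | h
  · obtain rfl : n = 1 := by omega
    norm_num
  · have hn' : (2 : ℝ) ≤ n := by exact_mod_cast h
    have h1 : 1 + (n : ℝ) * (1 / (n - 1)) ≤ (1 + 1 / ((n : ℝ) - 1)) ^ n :=
      one_add_mul_le_pow (by have : (0:ℝ) ≤ 1 / (n - 1) := by apply div_nonneg <;> linarith
                             linarith) n
    have h2 : (1 - 1 / (n : ℝ)) * (1 + 1 / ((n : ℝ) - 1)) = 1 := by
      have : (n : ℝ) - 1 ≠ 0 := by linarith
      field_simp
      ring
    have h3 : (1 - 1 / (n : ℝ)) ^ n * (1 + 1 / ((n : ℝ) - 1)) ^ n = 1 := by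
      rw [← mul_pow, h2, one_pow]
    have h4 : (2 : ℝ) ≤ (1 + 1 / ((n : ℝ) - 1)) ^ n := by
      refine le_trans ?_ h1
      rw [mul_one_div, show (2 : ℝ) = 1 + 1 by norm_num]
      gcongr
      rw [le_div_iff₀ (by linarith)]
      linarith
    have h5 : (0 : ℝ) ≤ (1 - 1 / (n : ℝ)) ^ n := by
      apply pow_nonneg
      rw [sub_nonneg, div_le_one (by linarith)]
      linarith
    nlinarith

/-- Bernoulli's inequality with exponent `s` gives `1 / 2`, which is then squared. -/
theorem le_pow_two_mul (s : ℕ) (hs : 0 < s) : 1 / 4 ≤ (1 - 1 / (2 * s : ℝ)) ^ (2 * s) := by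
  have hs' : (1 : ℝ) ≤ s := by exact_mod_cast hs
  have h1 : 1 + (s : ℝ) * (-(1 / (2 * s))) ≤ (1 + -(1 / (2 * s : ℝ))) ^ s := by
    refine one_add_mul_le_pow ?_ s
    have : 1 / (2 * s : ℝ) ≤ 1 := by rw [div_le_one (by linarith)]; linarith
    linarith
  have h2 : 1 + (s : ℝ) * (-(1 / (2 * s))) = 1 / 2 := by field_simp; ring
  rw [h2, ← sub_eq_add_neg] at h1
  rw [mul_comm 2 s, pow_mul]
  nlinarith

/-- Put `u = 1 - 1 / (2 s)`. A random tuple avoids the errors with probability at least `u ^ t`. By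
the contraction estimate and `1 - 1 / s ≤ u ^ 2`, it leaves a nonzero space with probability at most
`u ^ (2 t) s ^ 2`, and `t` is chosen so that this is at most half of `u ^ t`. -/
theorem card_filter_vanishing_ge (hp : DecoderParams q s d l e r g N m b t)
    {V : Submodule (ZMod q) (ZMod q)[X]} (hV : ∀ f ∈ V, f.natDegree ≤ d) (hT : Thin q r V)
    {G : Finset (ZMod q)} (hG : q ≤ G.card + e) [DecidablePred fun a : Fin t → ZMod q =>
      (∀ c, a c ∈ G) ∧ vanishing s V a = ⊥] :
    q ^ t ≤ 2 ^ (6 * b + 1) * (Finset.univ.filter fun a : Fin t → ZMod q =>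
      (∀ c, a c ∈ G) ∧ vanishing s V a = ⊥).card := by
  classical
  have hq := (Fact.out : q.Prime).pos
  have hs : 0 < s := by have := hp.r_le; have := hp.r_pos; omega
  have hdim : Module.finrank (ZMod q) V ≤ s * s := by
    refine (hT.finrank_le hq hV ?_).trans (Nat.mul_le_mul_right s (by have := hp.r_le; omega))
    have h1 := hp.degree
    have : 0 < 4 * r * q := by have := hp.r_pos; positivity
    omega
  have hsum := hT.sum_finrank_vanishing_le (s := s) (ZMod.card q) hp.r_pos hp.degree t hV
  set A := Finset.univ.filter fun a : Fin t → ZMod q => (∀ c, a c ∈ G) ∧ vanishing s V a = ⊥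
  set Bd := Finset.univ.filter fun a : Fin t → ZMod q => vanishing s V a ≠ ⊥ with hBd
  -- Markov's inequality: a nonzero space has dimension at least one.
  have hbad : Bd.card ≤ ∑ a : Fin t → ZMod q, Module.finrank (ZMod q) ↥(vanishing s V a) := by
    rw [hBd, Finset.card_filter]
    refine Finset.sum_le_sum fun a _ => ?_
    split_ifs with h
    · have hfin := (finrank_le_card_degreeSet hV).1
      have : FiniteDimensional (ZMod q) ↥(vanishing s V a) :=
        Submodule.finiteDimensional_of_le inf_le_left
      exact Nat.one_le_iff_ne_zero.mpr fun h0 => h (Submodule.finrank_eq_zero.mp h0)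
    · exact Nat.zero_le _
  have hcover : G.card ^ t ≤ A.card + Bd.card := by
    have h1 : (Fintype.piFinset fun _ : Fin t => G).card = G.card ^ t := by simp
    rw [← h1]
    refine (Finset.card_le_card ?_).trans (Finset.card_union_le A Bd)
    intro a ha
    rw [Fintype.mem_piFinset] at ha
    by_cases h : vanishing s V a = ⊥
    · exact Finset.mem_union_left _ (by simp [A, h, ha])
    · exact Finset.mem_union_right _ (by simp [Bd, h])
  have hbad' : s ^ t * Bd.card ≤ ((s - 1) * q) ^ t * (s * s) :=
    (Nat.mul_le_mul_left _ hbad).trans (hsum.trans (Nat.mul_le_mul_left _ hdim))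
  have hs' : (1 : ℝ) ≤ s := by exact_mod_cast hs
  have hq' : (0 : ℝ) < q := by exact_mod_cast hq
  set u : ℝ := 1 - 1 / (2 * s : ℝ) with hu
  have hu0 : 0 ≤ u := by
    rw [hu, sub_nonneg, div_le_one (by linarith)]
    linarith
  have h1 : ((q : ℝ) * u) ^ t ≤ A.card + Bd.card := by
    have h2 : (q : ℝ) * u ≤ G.card := by
      have h3 : (2 * s * e : ℝ) ≤ q := by exact_mod_cast hp.errors
      have h4 : (q : ℝ) ≤ G.card + e := by exact_mod_cast hG
      have h5 : (e : ℝ) ≤ q * (1 / (2 * s)) := by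
        rw [mul_one_div, le_div_iff₀ (by linarith)]; linarith
      rw [hu, mul_sub, mul_one]
      linarith
    exact (pow_le_pow_left₀ (by positivity) h2 t).trans (by exact_mod_cast hcover)
  have h2 : (Bd.card : ℝ) ≤ (q : ℝ) ^ t * (u ^ t * u ^ t) * (s * s) := by
    have h3 : (s : ℝ) ^ t * Bd.card ≤ ((s - 1) * q) ^ t * (s * s) := by
      have : ((s - 1 : ℕ) : ℝ) = s - 1 := by rw [Nat.cast_sub hs]; simp
      rw [← this]
      exact_mod_cast hbad'
    have h4 : ((s : ℝ) - 1) ≤ s * (u * u) := by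
      have : (s : ℝ) * (u * u) = s - 1 + 1 / (4 * s) := by
        rw [hu]; field_simp; ring
      rw [this]
      have : (0 : ℝ) ≤ 1 / (4 * s) := by positivity
      linarith
    have h5 : (s : ℝ) ^ t * Bd.card ≤ s ^ t * ((q : ℝ) ^ t * (u ^ t * u ^ t) * (s * s)) := by
      refine h3.trans ?_
      calc ((s - 1 : ℝ) * q) ^ t * (s * s) ≤ (s * (u * u) * q) ^ t * (s * s) := by
            have : (0 : ℝ) ≤ s - 1 := by linarith
            gcongr
        _ = _ := by rw [mul_pow, mul_pow, mul_pow]; ring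
    exact le_of_mul_le_mul_left h5 (by positivity)
  have hut : u ^ t = (u ^ (2 * s)) ^ (3 * b) := by
    rw [← pow_mul, hp.length]; congr 1; ring
  -- From `u ^ (2 s) ≤ 1 / 2` and `t = 6 s b` one gets `u ^ t ≤ 2 ^ (-3 b)`, while `s ^ 2 ≤ 2 ^ (2
  -- b)`.
  have h3 : u ^ t * (s * s) ≤ 1 / 2 := by
    have h4 : u ^ (2 * s) ≤ 1 / 2 := by
      have := pow_half_le (2 * s) (by omega)
      rw [hu]
      push_cast at this
      exact this
    have h5 : u ^ t ≤ (1 / 2) ^ (3 * b) := by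
      rw [hut]
      exact pow_le_pow_left₀ (by positivity) h4 _
    have h6 : (s : ℝ) ≤ 2 ^ b := by exact_mod_cast hp.s_lt.le
    have h7 : (2 : ℝ) ≤ 2 ^ b := by
      calc (2 : ℝ) = 2 ^ 1 := by norm_num
        _ ≤ 2 ^ b := pow_le_pow_right₀ (by norm_num) hp.b_pos
    calc u ^ t * (s * s) ≤ (1 / 2) ^ (3 * b) * (2 ^ b * 2 ^ b) := by gcongr
      _ = 1 / 2 ^ b := by
        rw [one_div, inv_pow, one_div, mul_comm 3 b, pow_mul]
        field_simp
      _ ≤ 1 / 2 := by gcongr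
  -- Here the lower bound `u ^ (2 s) ≥ 1 / 4` is raised to the power `3 b`.
  have h4 : (1 / 2 : ℝ) ^ (6 * b) ≤ u ^ t := by
    have := le_pow_two_mul s hs
    rw [hut, show 6 * b = 2 * (3 * b) by ring, pow_mul]
    refine pow_le_pow_left₀ (by positivity) ?_ _
    rw [hu]
    norm_num at this ⊢
    exact this
  have h5 : (q : ℝ) ^ t * u ^ t ≤ 2 * A.card := by
    rw [mul_pow] at h1
    have : (q : ℝ) ^ t * (u ^ t * u ^ t) * (s * s) ≤ q ^ t * u ^ t * (1 / 2) := by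
      calc (q : ℝ) ^ t * (u ^ t * u ^ t) * (s * s) = q ^ t * u ^ t * (u ^ t * (s * s)) := by ring
        _ ≤ _ := by gcongr
    linarith
  have h6 : (q : ℝ) ^ t ≤ 2 ^ (6 * b + 1) * A.card := by
    calc (q : ℝ) ^ t = 2 ^ (6 * b) * (q ^ t * (1 / 2) ^ (6 * b)) := by
          rw [one_div, inv_pow]; field_simp
      _ ≤ 2 ^ (6 * b) * (q ^ t * u ^ t) := by gcongr
      _ ≤ 2 ^ (6 * b) * (2 * A.card) := by gcongr
      _ = _ := by ring
  exact_mod_cast h6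

/-- Every good tuple of agreement points lifts injectively to a tuple of symbols, by selecting the
list entry with which `P` agrees. The factor `l ^ t` is the price of guessing these entries. -/
theorem card_isolates_ge (hp : DecoderParams q s d l e r g N m b t)
    {y : ℕ → ℕ → ZMod q} {P : (ZMod q)[X]} (hP : IsSolution s d l e y P)
    [DecidablePred fun x : Fin t → Fin (q * l) => Isolates s d l g r N m y P x] :
    (q * l) ^ t ≤ 2 ^ (6 * b + 1) * l ^ t *
      (Finset.univ.filter fun x : Fin t → Fin (q * l) => Isolates s d l g r N m y P x).card := by
  classical
  obtain ⟨G, hG, hk⟩ := hP.2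
  set V := solutionSpace N m d (interpolants q l g N m (N + r * m) y)
  have hT : Thin q r V := thin_solutionSpace hp.m_pos rfl (interpolants_ne_bot hp y)
    fun Q hQ => diffOp_eq_zero_of_isSolution hp hP hQ
  have h1 := card_filter_vanishing_ge hp (fun f (hf : f ∈ V) => hf.1) hT hG
  have h2 : (Finset.univ.filter fun a : Fin t → ZMod q =>
      (∀ c, a c ∈ G) ∧ vanishing s V a = ⊥).card ≤
      (Finset.univ.filter fun x : Fin t → Fin (q * l) => Isolates s d l g r N m y P x).card := by
    have hk' : ∀ a : ZMod q, ∃ k < l, a ∈ G → ∀ i < s,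
        (hasseDeriv i P).eval a = y (a.val * l + k) i := by
      intro a
      by_cases ha : a ∈ G
      · obtain ⟨k, hkl, h⟩ := hk a ha
        exact ⟨k, hkl, fun _ => h⟩
      · exact ⟨0, hp.l_pos, fun h => absurd h ha⟩
    choose κ hκl hκ using hk'
    have hx : ∀ a : ZMod q, a.val * l + κ a < q * l := by
      intro a
      have := ZMod.val_lt a
      have := hκl a
      calc a.val * l + κ a < (a.val + 1) * l := by rw [Nat.succ_mul]; omega
        _ ≤ q * l := Nat.mul_le_mul_right l (by omega)
    have hdiv : ∀ a : ZMod q, (((a.val * l + κ a) / l : ℕ) : ZMod q) = a := by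
      intro a
      rw [mul_comm, Nat.mul_add_div hp.l_pos, Nat.div_eq_of_lt (hκl a), add_zero,
        ZMod.natCast_zmod_val]
    refine Finset.card_le_card_of_injOn (fun a c => ⟨(a c).val * l + κ (a c), hx _⟩) ?_ ?_
    · intro a ha
      simp only [Finset.coe_filter, Finset.mem_univ, true_and, Set.mem_ofPred_eq] at ha ⊢
      refine ⟨fun c i hi => ?_, ?_⟩
      · simp only [hdiv]
        exact hκ _ (ha.1 c) i hi
      · simp only [hdiv]
        exact ha.2
    · intro a _ a' _ h
      ext1 c
      have := congrArg Fin.val (congrFun h c)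
      rw [← hdiv (a c), ← hdiv (a' c)]
      simp only at this
      rw [this]
  calc (q * l) ^ t = l ^ t * q ^ t := by rw [mul_pow, mul_comm]
    _ ≤ l ^ t * (2 ^ (6 * b + 1) * _) := Nat.mul_le_mul_left _ (h1.trans (Nat.mul_le_mul_left _ h2))
    _ = _ := by ring

/-- The sets of tuples isolating different solutions are disjoint, and each is a substantial part of
all `(q l) ^ t` tuples. -/
theorem card_solutions_le (hp : DecoderParams q s d l e r g N m b t)
    {y : ℕ → ℕ → ZMod q} (F : Finset (ZMod q)[X]) (hF : ∀ P ∈ F, IsSolution s d l e y P) :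
    F.card ≤ 2 ^ (6 * b + 1) * l ^ t := by
  classical
  have hq := (Fact.out : q.Prime).pos
  have hql : 0 < (q * l) ^ t := by have := hp.l_pos; positivity
  set I : (ZMod q)[X] → Finset (Fin t → Fin (q * l)) := fun P =>
    Finset.univ.filter fun x => Isolates s d l g r N m y P x
  have h1 : ∑ P ∈ F, (I P).card ≤ (q * l) ^ t := by
    rw [← Finset.card_biUnion]
    · refine (Finset.card_le_univ _).trans ?_
      simp
    · intro P hP P' hP' hne
      rw [Function.onFun, Finset.disjoint_left]
      intro x hx hx'
      exact hne (eq_of_isolates hp (hF P hP) (hF P' hP') (Finset.mem_filter.mp hx).2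
        (Finset.mem_filter.mp hx').2)
  have h2 : F.card * (q * l) ^ t ≤ 2 ^ (6 * b + 1) * l ^ t * ∑ P ∈ F, (I P).card := by
    rw [Finset.mul_sum, ← smul_eq_mul, ← Finset.sum_const]
    exact Finset.sum_le_sum fun P hP => card_isolates_ge hp (hF P hP)
  exact Nat.le_of_mul_le_mul_right (h2.trans (Nat.mul_le_mul_left _ h1)) hql

end Counting

/-! ### Semantics of commands -/

theorem iterUpTo_induct {α : Type*} {f : ℕ → α → α} {n : ℕ} {a : α} (I : ℕ → α → Prop)
    (h0 : I 0 a) (hs : ∀ i < n, ∀ b, I i b → I (i + 1) (f i b)) : I n (iterUpTo f n a) := by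
  suffices H : ∀ m ≤ n, I m (iterUpTo f m a) from H n le_rfl
  intro m
  induction m with
  | zero => exact fun _ => h0
  | succ m ih => exact fun hm => hs m hm _ (ih (by omega))

/-- The arrays written by a command. -/
def Cmd.writes : Cmd → List ℕ
  | skip => []
  | set _ _ => []
  | put b _ _ => [b]
  | seq p p' => p.writes ++ p'.writes
  | ite _ p p' => p.writes ++ p'.writes
  | loop _ _ p => p.writes

theorem Cmd.exec_arr_of_notMem (p : Cmd) {b : ℕ} (hb : b ∉ p.writes) :
    ∀ (v : ℕ → ℕ) (σ : Store), (p.exec v σ).arr b = σ.arr b := by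
  induction p with
  | skip => exact fun _ _ => rfl
  | set x a => exact fun _ _ => rfl
  | put c i a =>
    intro v σ
    simp only [writes, List.mem_singleton] at hb
    simp [exec, Store.setArr, hb]
  | seq p p' ih ih' =>
    intro v σ
    simp only [writes, List.mem_append, not_or] at hb
    rw [exec, ih' hb.2, ih hb.1]
  | ite a p p' ih ih' =>
    intro v σ
    simp only [writes, List.mem_append, not_or] at hb
    rw [exec]
    split_ifs
    · exact ih hb.1 v σ
    · exact ih' hb.2 v σ
  | loop x n p ih =>
    intro v σ
    rw [exec]
    exact iterUpTo_induct (fun _ τ => τ.arr b = σ.arr b) rfl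
      fun i _ τ h => (ih hb _ τ).trans h

/-- The registers written by a command. -/
def Cmd.sets : Cmd → List ℕ
  | skip => []
  | set x _ => [x]
  | put _ _ _ => []
  | seq p p' => p.sets ++ p'.sets
  | ite _ p p' => p.sets ++ p'.sets
  | loop _ _ p => p.sets

theorem Cmd.exec_reg_of_notMem (p : Cmd) {x : ℕ} (hx : x ∉ p.sets) :
    ∀ (v : ℕ → ℕ) (σ : Store), (p.exec v σ).reg x = σ.reg x := by
  induction p with
  | skip => exact fun _ _ => rfl
  | set y a =>
    intro v σ
    simp only [sets, List.mem_singleton] at hx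
    rw [exec, Store.setReg_reg, if_neg hx]
  | put c i a => exact fun _ _ => rfl
  | seq p p' ih ih' =>
    intro v σ
    simp only [sets, List.mem_append, not_or] at hx
    rw [exec, ih' hx.2, ih hx.1]
  | ite a p p' ih ih' =>
    intro v σ
    simp only [sets, List.mem_append, not_or] at hx
    rw [exec]
    split_ifs
    · exact ih hx.1 v σ
    · exact ih' hx.2 v σ
  | loop y n p ih =>
    intro v σ
    rw [exec]
    exact iterUpTo_induct (fun _ τ => τ.reg x = σ.reg x) rfl
      fun i _ τ h => (ih hx _ τ).trans h

/-- Overwrite the first `n` cells of array `b` by `f`. -/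
def Store.fillArr (σ : Store) (b n : ℕ) (f : ℕ → ℕ) : Store :=
  { σ with arr := Function.update σ.arr b fun j => if j < n then f j else σ.arr b j }

@[simp] theorem Store.fillArr_reg (σ : Store) (b n : ℕ) (f : ℕ → ℕ) :
    (σ.fillArr b n f).reg = σ.reg := rfl

theorem Store.fillArr_arr (σ : Store) (b n : ℕ) (f : ℕ → ℕ) (c j : ℕ) :
    (σ.fillArr b n f).arr c j = if c = b ∧ j < n then f j else σ.arr c j := by
  by_cases h : c = b
  · subst h
    simp [Store.fillArr]
  · simp [Store.fillArr, h]

theorem Store.fillArr_arr_of_ne (σ : Store) (b n : ℕ) (f : ℕ → ℕ) {c : ℕ} (h : c ≠ b) :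
    (σ.fillArr b n f).arr c = σ.arr c := by
  simp [Store.fillArr, h]

/-- `A_b[x] := e` for all `x` below the content of register `n`. -/
def Cmd.fill (x n b : ℕ) (e : AExp) : Cmd := .loop x n (.put b (.var x) e)

/-- The expression is evaluated in the partially filled array. Thus an entry may refer to earlier
entries, as in the table of derivatives, or to its own old value, as in the in-place update of an
elimination step. -/
theorem Cmd.exec_fill {v : ℕ → ℕ} {x n b : ℕ} {e : AExp} {σ : Store} (f : ℕ → ℕ)
    (h : ∀ i < σ.reg n, e.eval (σ.fillArr b i f) (Function.update v x i) = f i) :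
    (Cmd.fill x n b e).exec v σ = σ.fillArr b (σ.reg n) f := by
  refine iterUpTo_induct (fun i τ => τ = σ.fillArr b i f) ?_ ?_
  · simp [Store.fillArr]
  · rintro i hi τ rfl
    simp only [exec, AExp.eval, Function.update_self, h i hi]
    simp only [Store.setArr, Store.fillArr, Store.mk.injEq, true_and, Function.update_self,
      Function.update_idem]
    congr 1
    funext j
    rw [Function.update_apply]
    split_ifs <;> first | rfl | omega | (subst_vars; rfl)

/-! ### Arithmetic -/

namespace AExp

/-- Remainder; register `5` holds a bound for the quotient. -/
def mod (a b : AExp) : AExp := .sub a (.mul 5 (.div 5 a b) b)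

/-- `1` if `a < b` and `0` otherwise. -/
def lt (a b : AExp) : AExp := .sub (.lit 1) (.sub (.add a (.lit 1)) b)

/-- `1` if `a ≤ b` and `0` otherwise. -/
def le (a b : AExp) : AExp := .sub (.lit 1) (.sub a b)

/-- The absolute value of the difference. -/
def dist (a b : AExp) : AExp := .add (.sub a b) (.sub b a)

/-- `1` if `a ≠ 0` and `0` otherwise. -/
def sgn (a : AExp) : AExp := .sub (.lit 1) (.sub (.lit 1) a)

variable {σ : Store} {v : ℕ → ℕ} {a b : AExp}

/-- The summand with index `i` is `1` exactly for `(i + 1) y ≤ x`, that is, for `i < x / y`; the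
clamp must be large enough for the range to contain all these indices. -/
theorem eval_div (hb : 0 < b.eval σ v) (h : a.eval σ v / b.eval σ v ≤ σ.reg 5) :
    (AExp.div 5 a b).eval σ v = a.eval σ v / b.eval σ v := by
  simp only [eval]
  generalize a.eval σ v = x at *
  generalize b.eval σ v = y at *
  rw [Finset.sum_congr rfl (g := fun i => if i < x / y then 1 else 0)]
  · rw [Finset.sum_boole]
    have : (Finset.range (σ.reg 5)).filter (fun i => i < x / y) = Finset.range (x / y) := by
      ext i; simp; omega
    simp [this]
  · intro i _
    have : i < x / y ↔ (i + 1) * y ≤ x := by rw [← Nat.le_div_iff_mul_le hb]; rfl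
    split_ifs with hi <;> omega

theorem eval_mod (hb : 0 < b.eval σ v) (h : a.eval σ v / b.eval σ v ≤ σ.reg 5) :
    (mod a b).eval σ v = a.eval σ v % b.eval σ v := by
  rw [mod, eval, eval, eval_div hb h, min_eq_left h, Nat.mod_eq_sub_div_mul]

theorem eval_mul (h : a.eval σ v ≤ σ.reg 5) :
    (AExp.mul 5 a b).eval σ v = a.eval σ v * b.eval σ v := by
  rw [eval, min_eq_left h]

theorem eval_lt : (lt a b).eval σ v = if a.eval σ v < b.eval σ v then 1 else 0 := by
  simp only [lt, eval]; split_ifs <;> omega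

theorem eval_le : (le a b).eval σ v = if a.eval σ v ≤ b.eval σ v then 1 else 0 := by
  simp only [le, eval]; split_ifs <;> omega

theorem eval_sgn : (sgn a).eval σ v = if a.eval σ v = 0 then 0 else 1 := by
  simp only [sgn, eval]; split_ifs <;> omega

theorem eval_dist_eq_zero : (dist a b).eval σ v = 0 ↔ a.eval σ v = b.eval σ v := by
  simp only [dist, eval]; omega

theorem eval_lt_mul (h : 1 ≤ σ.reg 5) (c : AExp) : (AExp.mul 5 (lt a b) c).eval σ v
    = if a.eval σ v < b.eval σ v then c.eval σ v else 0 := by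
  rw [eval_mul (by rw [eval_lt]; split_ifs <;> omega), eval_lt]
  split_ifs <;> simp

theorem eval_le_mul (h : 1 ≤ σ.reg 5) (c : AExp) : (AExp.mul 5 (le a b) c).eval σ v
    = if a.eval σ v ≤ b.eval σ v then c.eval σ v else 0 := by
  rw [eval_mul (by rw [eval_le]; split_ifs <;> omega), eval_le]
  split_ifs <;> simp

theorem eval_sgn_mul (h : 1 ≤ σ.reg 5) (c : AExp) : (AExp.mul 5 (sgn a) c).eval σ v
    = if a.eval σ v = 0 then 0 else c.eval σ v := by
  rw [eval_mul (by rw [eval_sgn]; split_ifs <;> omega), eval_sgn]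
  split_ifs <;> simp

end AExp

/-! ### Elimination -/

section Elimination

variable {K : Type*} [Field K]

/-- One elimination step intersects the span of a family with the kernel of a linear form. -/
theorem span_eliminate {E : Type*} [AddCommGroup E] [Module K E] {ι : Type*} (b : ι → E)
    (φ : E →ₗ[K] K) (z : K) (w : E) (h : (∃ i, z = φ (b i) ∧ w = b i ∧ z ≠ 0) ∨
      ((∀ i, φ (b i) = 0) ∧ z = 1 ∧ w = 0)) :
    Submodule.span K (Set.range fun i => z • b i - φ (b i) • w)
      = Submodule.span K (Set.range b) ⊓ LinearMap.ker φ := by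
  have hz : z ≠ 0 := by
    rcases h with ⟨i, -, -, h⟩ | ⟨-, rfl, -⟩
    exacts [h, one_ne_zero]
  have hw : w ∈ Submodule.span K (Set.range b) := by
    rcases h with ⟨i, -, rfl, -⟩ | ⟨-, -, rfl⟩
    exacts [Submodule.subset_span ⟨i, rfl⟩, zero_mem _]
  have hφw : ∀ i, z * φ (b i) = φ (b i) * φ w := by
    intro i
    rcases h with ⟨j, rfl, rfl, -⟩ | ⟨h, -, -⟩
    · ring
    · rw [h]; ring
  apply le_antisymm
  · refine Submodule.span_le.mpr ?_
    rintro _ ⟨i, rfl⟩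
    refine ⟨Submodule.sub_mem _ (Submodule.smul_mem _ _ (Submodule.subset_span ⟨i, rfl⟩))
      (Submodule.smul_mem _ _ hw), ?_⟩
    rw [SetLike.mem_coe, LinearMap.mem_ker, map_sub, map_smul, map_smul, smul_eq_mul, smul_eq_mul,
      hφw, sub_self]
  · rintro x ⟨hx, hx0⟩
    -- The map `x ↦ z x - φ(x) w` carries the old span into the new one, and on the kernel of `φ` it
    -- is multiplication by `z ≠ 0`.
    have key : ∀ x ∈ Submodule.span K (Set.range b), z • x - φ x • w
        ∈ Submodule.span K (Set.range fun i => z • b i - φ (b i) • w) := by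
      intro x hx
      induction hx using Submodule.span_induction with
      | mem x hx =>
        obtain ⟨i, rfl⟩ := hx
        exact Submodule.subset_span ⟨i, rfl⟩
      | zero => simp
      | add x y _ _ hx hy =>
        have := Submodule.add_mem _ hx hy
        rw [map_add]
        convert this using 1
        module
      | smul c x _ hx =>
        have := Submodule.smul_mem _ c hx
        rw [map_smul]
        convert this using 1
        rw [smul_eq_mul]
        module
    have h1 := key x hx
    rw [LinearMap.mem_ker.mp hx0, zero_smul, sub_zero] at h1
    exact (Submodule.smul_mem_iff _ hz).mp h1

/-- The rows of a square matrix stored in a linear array. -/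
def rowsOf (n : ℕ) (γ : ℕ → K) : Fin n → Fin n → K := fun i u => γ (i * n + u)

end Elimination

namespace Cmd

/-- Replace the family stored in array `G`, `n` rows of length `n`, by a family spanning the
subspace on which the linear form stored in array `5` vanishes; `nn` is the register holding
the square of the content of register `n`. -/
def eliminate (n nn G : ℕ) : Cmd :=
  .seq (fill 10 n 6 (.mod (.sum 11 n (.mul 5 (.get 5 (.var 11))
    (.get G (.add (.mul 5 (.var 10) (.reg n)) (.var 11))))) (.reg 0)))
  (.seq (.set 26 (.lit 0))
  (.seq (.loop 10 n (.ite (.get 6 (.var 10)) (.set 26 (.add (.var 10) (.lit 1))) .skip))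
  (.seq (fill 10 n 7 (.mul 5 (.sgn (.reg 26))
    (.get G (.add (.mul 5 (.sub (.reg 26) (.lit 1)) (.reg n)) (.var 10)))))
  (.seq (.set 28 (.add (.sub (.lit 1) (.reg 26))
    (.mul 5 (.sgn (.reg 26)) (.get 6 (.sub (.reg 26) (.lit 1))))))
  (fill 10 nn G (.mod (.add (.mul 5 (.reg 28) (.get G (.var 10)))
    (.mul 5 (.sub (.reg 0) (.get 6 (.div 5 (.var 10) (.reg n))))
      (.get 7 (.mod (.var 10) (.reg n))))) (.reg 0)))))))

end Cmd

theorem mod_eq_val {q : ℕ} {n : ℕ} {x : ZMod q} (h : (n : ZMod q) = x) : n % q = x.val := by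
  rw [← h, ZMod.val_natCast]

/-- Elimination without division: with pivot value `z` and pivot row `w`, each row `x` becomes `z x
- φ(x) w`. The pivot row itself becomes zero and stays in the array, so the shape of the family is
constant and no rank has to be tracked. -/
theorem Cmd.exec_eliminate {q : ℕ} [Fact q.Prime] {n nn G k Z : ℕ} {σ : Store} {v : ℕ → ℕ}
    {φ γ : ℕ → ZMod q} (h0 : σ.reg 0 = q) (h5 : σ.reg 5 = Z) (hn : σ.reg n = k)
    (hnn : σ.reg nn = k * k) (hn' : n ≠ 26 ∧ n ≠ 28) (hnn' : nn ≠ 26 ∧ nn ≠ 28)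
    (hG : G ≠ 5 ∧ G ≠ 6 ∧ G ≠ 7) (hZ : k * q ≤ Z) (hZ' : k * k + 2 * q ≤ Z)
    (hF : ∀ u < k, σ.arr 5 u = (φ u).val) (hγ : ∀ c < k * k, σ.arr G c = (γ c).val) :
    ∃ γ' : ℕ → ZMod q,
      (∀ c < k * k, ((Cmd.eliminate n nn G).exec v σ).arr G c = (γ' c).val) ∧
      Submodule.span (ZMod q) (Set.range (rowsOf k γ'))
        = Submodule.span (ZMod q) (Set.range (rowsOf k γ)) ⊓ LinearMap.ker (linForm φ) := by
  have hq := (Fact.out : q.Prime).pos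
  have : NeZero q := ⟨hq.ne'⟩
  have hkk : ∀ i < k, ∀ u < k, i * k + u < k * k := by
    intro i hi u hu
    calc i * k + u < (i + 1) * k := by rw [Nat.succ_mul]; omega
      _ ≤ k * k := Nat.mul_le_mul_right k hi
  have hkZ : ∀ i < k, i ≤ Z := by
    intro i hi
    have : k * 1 ≤ k * k := Nat.mul_le_mul_left k (by omega)
    omega
  set ψ : ℕ → ZMod q := fun i => ∑ u ∈ Finset.range k, φ u * γ (i * k + u) with hψ
  -- the values of the form on the rows
  set σ1 := σ.fillArr 6 k fun i => (ψ i).val with hσ1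
  have e1 : (fill 10 n 6 (.mod (.sum 11 n (.mul 5 (.get 5 (.var 11))
      (.get G (.add (.mul 5 (.var 10) (.reg n)) (.var 11))))) (.reg 0))).exec v σ = σ1 := by
    rw [exec_fill (fun i => (ψ i).val), hn]
    intro i hi
    rw [hn] at hi
    have es : (AExp.sum 11 n (.mul 5 (.get 5 (.var 11))
        (.get G (.add (.mul 5 (.var 10) (.reg n)) (.var 11))))).eval
        (σ.fillArr 6 i fun i => (ψ i).val) (Function.update v 10 i)
        = ∑ u ∈ Finset.range k, (φ u).val * (γ (i * k + u)).val := by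
      simp only [AExp.eval, Store.fillArr_reg, hn, h5]
      refine Finset.sum_congr rfl fun u hu => ?_
      have hu := Finset.mem_range.mp hu
      simp only [Function.update_self, ne_eq, Function.update_of_ne, show (10 : ℕ) ≠ 11 by decide,
        not_false_eq_true, Store.fillArr_arr_of_ne _ _ _ _ (show (5 : ℕ) ≠ 6 by decide),
        Store.fillArr_arr_of_ne _ _ _ _ hG.2.1, hF u hu]
      rw [min_eq_left (hkZ i hi), hγ _ (hkk i hi u hu), min_eq_left]
      have := ZMod.val_lt (φ u)
      omega
    have er : (AExp.reg 0).eval (σ.fillArr 6 i fun i => (ψ i).val) (Function.update v 10 i) = q := h0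
    rw [AExp.eval_mod (by rw [er]; exact hq), es, er]
    · exact mod_eq_val (by simp [hψ])
    · rw [es, er, Store.fillArr_reg, h5]
      -- The sum has `k` terms, each at most `q * q`, so the quotient in the reduction modulo `q` is
      -- at most `k * q`.
      refine le_trans (Nat.div_le_of_le_mul ?_) hZ
      calc ∑ u ∈ Finset.range k, (φ u).val * (γ (i * k + u)).val
          ≤ ∑ u ∈ Finset.range k, q * q := Finset.sum_le_sum fun u _ =>
            Nat.mul_le_mul (ZMod.val_lt _).le (ZMod.val_lt _).le
        _ = q * (k * q) := by simp; ring
  -- the pivot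
  obtain ⟨p, hp, e2⟩ : ∃ p : ℕ, ((p = 0 ∧ ∀ i < k, ψ i = 0) ∨ (∃ i < k, p = i + 1 ∧ ψ i ≠ 0)) ∧
      (loop 10 n (.ite (.get 6 (.var 10)) (.set 26 (.add (.var 10) (.lit 1))) .skip)).exec v
        (σ1.setReg 26 0) = σ1.setReg 26 p := by
    have hreg : (σ1.setReg 26 0).reg n = k := by
      rw [Store.setReg_reg, if_neg hn'.1]; exact hn
    rw [exec, hreg]
    -- Register `26` holds the index of the pivot plus one, and `0` while no pivot has been seen;
    -- the last row with a nonzero value wins.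
    have := iterUpTo_induct (f := fun i τ => (Cmd.ite (.get 6 (.var 10))
      (.set 26 (.add (.var 10) (.lit 1))) .skip).exec (Function.update v 10 i) τ) (n := k)
      (a := σ1.setReg 26 0)
      (fun j τ => ∃ p, ((p = 0 ∧ ∀ i < j, ψ i = 0) ∨ (∃ i < j, p = i + 1 ∧ ψ i ≠ 0)) ∧
        τ = σ1.setReg 26 p) ⟨0, Or.inl ⟨rfl, by simp⟩, rfl⟩ ?_
    · exact this
    · rintro j hj τ ⟨p, hp, rfl⟩
      have hval : (AExp.get 6 (.var 10)).eval (σ1.setReg 26 p) (Function.update v 10 j)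
          = (ψ j).val := by
        simp [AExp.eval, hσ1, Store.fillArr_arr, hj]
      simp only [exec, hval]
      by_cases hj0 : ψ j = 0
      · refine ⟨p, ?_, by simp [hj0]⟩
        rcases hp with ⟨rfl, h⟩ | ⟨i, hi, h⟩
        · left
          refine ⟨rfl, fun i hi => ?_⟩
          rcases Nat.lt_succ_iff_lt_or_eq.mp hi with h' | rfl
          exacts [h i h', hj0]
        · exact Or.inr ⟨i, by omega, h⟩
      · refine ⟨j + 1, Or.inr ⟨j, by omega, rfl, hj0⟩, ?_⟩
        rw [if_pos (by simpa using hj0)]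
        simp [AExp.eval, Store.setReg]
  have hp' : p - 1 ≤ Z := by
    rcases hp with ⟨rfl, -⟩ | ⟨i, hi, rfl, -⟩
    · omega
    · have := hkZ i hi; omega
  -- the pivot row
  set w : ℕ → ZMod q := fun u => if p = 0 then 0 else γ ((p - 1) * k + u) with hw
  set z : ZMod q := if p = 0 then 1 else ψ (p - 1) with hz
  set σ2 := (σ1.setReg 26 p).fillArr 7 k fun u => (w u).val with hσ2
  have e3 : (fill 10 n 7 (.mul 5 (.sgn (.reg 26))
      (.get G (.add (.mul 5 (.sub (.reg 26) (.lit 1)) (.reg n)) (.var 10))))).exec v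
      (σ1.setReg 26 p) = σ2 := by
    have hreg : (σ1.setReg 26 p).reg n = k := by
      rw [Store.setReg_reg, if_neg hn'.1]; exact hn
    have hreg5 : (σ1.setReg 26 p).reg 5 = Z := by
      rw [Store.setReg_reg, if_neg (by decide)]; exact h5
    have hreg26 : (σ1.setReg 26 p).reg 26 = p := by
      rw [Store.setReg_reg, if_pos rfl]
    rw [exec_fill (fun i => (w i).val), hreg]
    intro u hu
    rw [hreg] at hu
    rw [AExp.eval_sgn_mul (by rw [Store.fillArr_reg, hreg5]; omega)]
    simp only [AExp.eval, Store.fillArr_reg, hreg, hreg5, hreg26, Function.update_self,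
      Store.fillArr_arr_of_ne _ _ _ _ hG.2.2, hw]
    split_ifs with h
    · simp
    · rw [min_eq_left hp', Store.setReg_arr, hσ1, Store.fillArr_arr_of_ne _ _ _ _ hG.2.1, hγ]
      rcases hp with ⟨rfl, -⟩ | ⟨i, hi, rfl, -⟩
      · exact absurd rfl h
      · exact hkk _ hi u hu
  have e4 : (Cmd.set 28 (.add (.sub (.lit 1) (.reg 26))
      (.mul 5 (.sgn (.reg 26)) (.get 6 (.sub (.reg 26) (.lit 1)))))).exec v σ2
      = σ2.setReg 28 z.val := by
    have hreg5 : σ2.reg 5 = Z := by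
      rw [hσ2, Store.fillArr_reg, Store.setReg_reg, if_neg (by decide)]; exact h5
    have hreg26 : σ2.reg 26 = p := by
      rw [hσ2, Store.fillArr_reg, Store.setReg_reg, if_pos rfl]
    rw [exec]
    congr 1
    rw [AExp.eval, AExp.eval_sgn_mul (by omega)]
    simp only [AExp.eval, hreg26, hz]
    split_ifs with h
    · rw [h, ZMod.val_one'' (Fact.out : q.Prime).one_lt.ne']
    · rw [hσ2, Store.fillArr_arr_of_ne _ _ _ _ (by decide), Store.setReg_arr, hσ1,
        Store.fillArr_arr, if_pos]
      · omega
      · refine ⟨rfl, ?_⟩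
        rcases hp with ⟨rfl, -⟩ | ⟨i, hi, rfl, -⟩
        · exact absurd rfl h
        · simpa using hi
  -- the new rows
  set σ3 := σ2.setReg 28 z.val with hσ3
  -- The update in place is safe: apart from the old value of the cell itself, it only uses the
  -- copies in arrays `6` and `7`.
  set γ' : ℕ → ZMod q := fun c => z * γ c - ψ (c / k) * w (c % k) with hγ'
  have e5 : (fill 10 nn G (.mod (.add (.mul 5 (.reg 28) (.get G (.var 10)))
      (.mul 5 (.sub (.reg 0) (.get 6 (.div 5 (.var 10) (.reg n))))
        (.get 7 (.mod (.var 10) (.reg n))))) (.reg 0))).exec v σ3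
      = σ3.fillArr G (k * k) fun c => (γ' c).val := by
    have hreg : ∀ x, x ≠ 26 → x ≠ 28 → σ3.reg x = σ.reg x := by
      intro x h1 h2
      rw [hσ3, Store.setReg_reg, if_neg h2, hσ2, Store.fillArr_reg, Store.setReg_reg, if_neg h1]
      rfl
    have hreg28 : σ3.reg 28 = z.val := by rw [hσ3, Store.setReg_reg, if_pos rfl]
    have r5 := (hreg 5 (by decide) (by decide)).trans h5
    have r0 := (hreg 0 (by decide) (by decide)).trans h0
    have rn := (hreg n hn'.1 hn'.2).trans hn
    rw [exec_fill (fun c => (γ' c).val), hreg nn hnn'.1 hnn'.2, hnn]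
    intro c hc
    rw [hreg nn hnn'.1 hnn'.2, hnn] at hc
    have hk : 0 < k := by rcases Nat.eq_zero_or_pos k with rfl | h; · simp at hc
                          · exact h
    set τ := σ3.fillArr G c fun c => (γ' c).val with hτ
    set v' := Function.update v 10 c with hv'
    have dk : c / k < k := by rwa [Nat.div_lt_iff_lt_mul hk]
    have mk : c % k < k := Nat.mod_lt _ hk
    have hvar : (AExp.var 10).eval τ v' = c := by simp [AExp.eval, hv']
    have hrn : (AExp.reg n).eval τ v' = k := rn
    have hr0 : (AExp.reg 0).eval τ v' = q := r0
    have t5 : τ.reg 5 = Z := r5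
    have ed : (AExp.div 5 (.var 10) (.reg n)).eval τ v' = c / k := by
      rw [AExp.eval_div (by rw [hrn]; exact hk), hvar, hrn]
      rw [hvar, hrn, t5]
      exact hkZ _ dk
    have em : (AExp.mod (.var 10) (.reg n)).eval τ v' = c % k := by
      rw [AExp.eval_mod (by rw [hrn]; exact hk), hvar, hrn]
      rw [hvar, hrn, t5]
      exact hkZ _ dk
    have a6 : τ.arr 6 (c / k) = (ψ (c / k)).val := by
      rw [hτ, Store.fillArr_arr_of_ne _ _ _ _ hG.2.1.symm, hσ3, Store.setReg_arr, hσ2,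
        Store.fillArr_arr_of_ne _ _ _ _ (by decide), Store.setReg_arr, hσ1, Store.fillArr_arr,
        if_pos ⟨rfl, dk⟩]
    have a7 : τ.arr 7 (c % k) = (w (c % k)).val := by
      rw [hτ, Store.fillArr_arr_of_ne _ _ _ _ hG.2.2.symm, hσ3, Store.setReg_arr, hσ2,
        Store.fillArr_arr, if_pos ⟨rfl, mk⟩]
    have aG : τ.arr G c = (γ c).val := by
      rw [hτ, Store.fillArr_arr, if_neg (by omega), hσ3, Store.setReg_arr, hσ2,
        Store.fillArr_arr_of_ne _ _ _ _ hG.2.2, Store.setReg_arr, hσ1,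
        Store.fillArr_arr_of_ne _ _ _ _ hG.2.1, hγ c hc]
    have hr28 : τ.reg 28 = z.val := hreg28
    have hψq := ZMod.val_lt (ψ (c / k))
    have hzq := ZMod.val_lt z
    have ea : (AExp.add (.mul 5 (.reg 28) (.get G (.var 10)))
        (.mul 5 (.sub (.reg 0) (.get 6 (.div 5 (.var 10) (.reg n))))
        (.get 7 (.mod (.var 10) (.reg n))))).eval τ v'
        = z.val * (γ c).val + (q - (ψ (c / k)).val) * (w (c % k)).val := by
      rw [AExp.eval, AExp.eval_mul, AExp.eval_mul]
      · simp only [AExp.eval] at ed em hvar hr0 ⊢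
        rw [hr0, ed, em, hvar, a6, a7, aG, hr28]
      · simp only [AExp.eval] at ed hr0 ⊢
        rw [hr0, ed, a6, t5]
        omega
      · change τ.reg 28 ≤ _
        rw [hr28, t5]
        omega
    rw [AExp.eval_mod (by rw [hr0]; exact hq), ea, hr0]
    · refine mod_eq_val ?_
      push_cast [Nat.cast_sub hψq.le]
      simp only [ZMod.natCast_zmod_val, ZMod.natCast_self, hγ']
      ring
    · rw [ea, hr0, t5]
      refine le_trans (Nat.div_le_of_le_mul (n := 2 * q) ?_) (by omega)
      have h1 : z.val * (γ c).val ≤ q * q := Nat.mul_le_mul hzq.le (ZMod.val_lt _).le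
      have h2 : (q - (ψ (c / k)).val) * (w (c % k)).val ≤ q * q :=
        Nat.mul_le_mul (Nat.sub_le _ _) (ZMod.val_lt _).le
      calc _ ≤ q * q + q * q := Nat.add_le_add h1 h2
        _ = _ := by ring
  refine ⟨γ', fun c hc => ?_, ?_⟩
  · have : (eliminate n nn G).exec v σ = σ3.fillArr G (k * k) fun c => (γ' c).val := by
      rw [← e5, ← e4, ← e3, ← e2, ← e1]
      rfl
    rw [this, Store.fillArr_arr, if_pos ⟨rfl, hc⟩]
  · have hψ' : ∀ i : Fin k, linForm φ (rowsOf k γ i) = ψ i := by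
      intro i
      rw [linForm_apply]
      simp only [hψ]
      rw [Finset.sum_range]
      rfl
    rw [← span_eliminate (rowsOf k γ) (linForm φ) z (fun u => w u)]
    · congr 2
      funext i u
      have hi : ((i : ℕ) * k + u) / k = i := by
        rw [mul_comm, Nat.mul_add_div (by have := i.2; omega), Nat.div_eq_of_lt u.2, add_zero]
      have hu : ((i : ℕ) * k + u) % k = u := by
        rw [mul_comm, Nat.mul_add_mod, Nat.mod_eq_of_lt u.2]
      simp [rowsOf, hγ', hi, hu, hψ']
    · rcases hp with ⟨rfl, h⟩ | ⟨i, hi, rfl, h⟩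
      · right
        refine ⟨fun i => by rw [hψ', h i i.2], by simp [hz], ?_⟩
        funext u
        simp [hw]
      · left
        refine ⟨⟨i, hi⟩, by rw [hψ']; simp [hz], ?_, by simpa [hz] using h⟩
        funext u
        simp [hw, rowsOf]

/-! ### The decoder -/

theorem mod_range {q n : ℕ} [NeZero q] {ι : Type*} (S : Finset ι) (f : ι → ℕ) (hS : S.card ≤ n)
    (hf : ∀ i ∈ S, f i ≤ q * q) : ∑ i ∈ S, f i ≤ n * q * q := by
  calc ∑ i ∈ S, f i ≤ S.card * (q * q) := by
        rw [← smul_eq_mul]; exact Finset.sum_le_card_nsmul _ _ _ hf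
    _ ≤ n * (q * q) := Nat.mul_le_mul_right _ hS
    _ = _ := by ring

theorem AExp.eval_mod_field {q : ℕ} [Fact q.Prime] {σ : Store} {v : ℕ → ℕ} {a : AExp} {x : ZMod q}
    (h0 : σ.reg 0 = q) (h : a.eval σ v ≤ σ.reg 5 * q) (hx : ((a.eval σ v : ℕ) : ZMod q) = x) :
    (AExp.mod a (.reg 0)).eval σ v = x.val := by
  have hq := (Fact.out : q.Prime).pos
  have er : (AExp.reg 0).eval σ v = q := h0
  rw [eval_mod (by rw [er]; exact hq), er]
  · exact mod_eq_val hx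
  · rw [er]
    exact Nat.div_le_of_le_mul (by rw [mul_comm]; exact h)

/-- Replace the family stored in array `G` by a family spanning the subspace on which the linear
forms given by `e` vanish; variable `12` numbers the forms, variable `13` the coefficients. -/
def Cmd.constrain (c n nn G : ℕ) (e : AExp) : Cmd :=
  .loop 12 c (.seq (fill 13 n 5 e) (eliminate n nn G))

/-- The forms need to be evaluated correctly in all stores differing from the initial one in the
working registers and arrays only. This is the invariant of the loop, each round of which adds one
condition. -/
theorem Cmd.exec_constrain {q : ℕ} [Fact q.Prime] {c n nn G k C Z : ℕ} {σ : Store} {v : ℕ → ℕ}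
    {e : AExp} {Φ : ℕ → ℕ → ZMod q} {γ : ℕ → ZMod q} (h0 : σ.reg 0 = q) (h5 : σ.reg 5 = Z)
    (hn : σ.reg n = k) (hnn : σ.reg nn = k * k) (hc : σ.reg c = C) (hn' : n ≠ 26 ∧ n ≠ 28)
    (hnn' : nn ≠ 26 ∧ nn ≠ 28) (hG : G ≠ 5 ∧ G ≠ 6 ∧ G ≠ 7) (hZ : k * q ≤ Z)
    (hZ' : k * k + 2 * q ≤ Z) (hγ : ∀ c < k * k, σ.arr G c = (γ c).val)
    (he : ∀ j < C, ∀ u < k, ∀ τ : Store, (∀ x, x ≠ 26 → x ≠ 28 → τ.reg x = σ.reg x) →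
      (∀ b, b ∉ [5, 6, 7, G] → τ.arr b = σ.arr b) →
      e.eval τ (Function.update (Function.update v 12 j) 13 u) = (Φ j u).val) :
    ∃ γ' : ℕ → ZMod q,
      (∀ i < k * k, ((Cmd.constrain c n nn G e).exec v σ).arr G i
        = (γ' i).val) ∧
      ∀ p, p ∈ Submodule.span (ZMod q) (Set.range (rowsOf k γ')) ↔
        p ∈ Submodule.span (ZMod q) (Set.range (rowsOf k γ)) ∧ ∀ j < C, linForm (Φ j) p = 0 := by
  rw [constrain, exec, hc]
  have := iterUpTo_induct (f := fun i τ => (Cmd.seq (fill 13 n 5 e) (eliminate n nn G)).exec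
      (Function.update v 12 i) τ) (n := C) (a := σ)
    (fun i τ => (∀ x, x ≠ 26 → x ≠ 28 → τ.reg x = σ.reg x) ∧
      (∀ b, b ∉ [5, 6, 7, G] → τ.arr b = σ.arr b) ∧
      ∃ γ' : ℕ → ZMod q, (∀ i < k * k, τ.arr G i = (γ' i).val) ∧
        ∀ p, p ∈ Submodule.span (ZMod q) (Set.range (rowsOf k γ')) ↔
        p ∈ Submodule.span (ZMod q) (Set.range (rowsOf k γ)) ∧ ∀ j < i, linForm (Φ j) p = 0)
    ⟨fun _ _ _ => rfl, fun _ _ => rfl, γ, hγ, by simp⟩ ?_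
  · exact this.2.2
  · rintro j hj τ ⟨hr, ha, γ1, hγ1, hs⟩
    have hf : (fill 13 n 5 e).exec (Function.update v 12 j) τ
        = τ.fillArr 5 k fun u => (Φ j u).val := by
      rw [exec_fill (fun u => (Φ j u).val), hr n hn'.1 hn'.2, hn]
      intro u hu
      rw [hr n hn'.1 hn'.2, hn] at hu
      refine he j hj u hu _ (fun x h1 h2 => hr x h1 h2) fun b hb => ?_
      rw [Store.fillArr_arr_of_ne _ _ _ _ (by rintro rfl; simp at hb), ha b hb]
    set τ1 := τ.fillArr 5 k fun u => (Φ j u).val with hτ1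
    obtain ⟨γ2, hγ2, hs2⟩ := exec_eliminate (σ := τ1) (v := Function.update v 12 j) (φ := Φ j)
      (γ := γ1) (n := n) (nn := nn) (G := G) (k := k) (Z := Z)
      ((hr 0 (by decide) (by decide)).trans h0) ((hr 5 (by decide) (by decide)).trans h5)
      ((hr n hn'.1 hn'.2).trans hn) ((hr nn hnn'.1 hnn'.2).trans hnn) hn' hnn' hG hZ hZ'
      (fun u hu => by rw [hτ1, Store.fillArr_arr, if_pos ⟨rfl, hu⟩])
      (fun i hi => by rw [hτ1, Store.fillArr_arr_of_ne _ _ _ _ hG.1, hγ1 i hi])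
    have hexec : (Cmd.seq (fill 13 n 5 e) (eliminate n nn G)).exec (Function.update v 12 j) τ
        = (eliminate n nn G).exec (Function.update v 12 j) τ1 := by
      rw [← hf]; rfl
    rw [hexec]
    refine ⟨fun x h1 h2 => ?_, fun b hb => ?_, γ2, hγ2, fun p => ?_⟩
    · rw [exec_reg_of_notMem _ (by simp [sets, eliminate, fill, h1, h2])]
      exact hr x h1 h2
    · simp only [List.mem_cons, List.not_mem_nil, or_false, not_or] at hb
      rw [exec_arr_of_notMem _ (by simp [writes, eliminate, fill, hb]), hτ1,
        Store.fillArr_arr_of_ne _ _ _ _ hb.1]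
      exact ha b (by simp [hb])
    · rw [hs2, Submodule.mem_inf, hs, LinearMap.mem_ker, and_assoc, and_congr_right_iff]
      intro _
      constructor
      · rintro ⟨h1, h2⟩ i hi
        rcases Nat.lt_succ_iff_lt_or_eq.mp hi with h | rfl
        exacts [h1 i h, h2]
      · exact fun h => ⟨fun i hi => h i (by omega), h j (by omega)⟩

/-- Parameters of a run of the decoder; `Z` bounds all products formed, `M` is the number of
trials. -/
structure RunParams where
  (q s d l e r g N m t M Z : ℕ)

/-- Contents of the parameter registers. -/
def RunParams.val (P : RunParams) (i : ℕ) : ℕ :=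
  [P.q, P.s, P.d, P.l, P.e, P.Z, P.r, P.g, P.N, P.m, P.N + P.r * P.m, P.d + 2, P.q * P.l, P.t, P.M,
    P.d + 1, P.q * P.l * P.s, P.N * (P.q * P.s), (P.N + P.r * P.m) * (P.N + P.r * P.m),
    P.q * P.l * P.g, (P.d + 2) * (P.d + 2), (P.N + P.r * P.m) * P.N, P.t * P.s, (P.d + 2) * P.q,
    P.M * P.t, P.q * P.l - 1].getD i 0

/-- The parameter registers hold the parameters. -/
def HasParams (P : RunParams) (σ : Store) : Prop := ∀ i < 26, σ.reg i = P.val i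

/-- Size relations needed for the correctness of the decoder. -/
structure RunParams.Fits (P : RunParams) : Prop where
  s_pos : 0 < P.s
  l_pos : 0 < P.l
  g_pos : 0 < P.g
  N_pos : 0 < P.N
  m_pos : 0 < P.m
  r_pos : 0 < P.r
  order : P.g + P.r = P.s + 1
  block : P.N = P.d + P.m
  s_le : P.s ≤ P.N
  q_le : P.q * P.q ≤ P.Z
  Nq_le : P.N * (P.q * P.s) ≤ P.Z
  inp_le : P.q * P.l * P.s ≤ P.Z
  n1_le : (P.N + P.r * P.m) * (P.N + P.r * P.m) + 2 * P.q ≤ P.Z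
  n1q_le : (P.N + P.r * P.m) * P.q ≤ P.Z
  n2_le : (P.d + 2) * (P.d + 2) + 2 * P.q ≤ P.Z
  n2q_le : (P.d + 2) * P.q ≤ P.Z
  t_le : P.t * P.s ≤ P.Z

/-- The data available to the main part of the decoder: parameters, list lengths, symbols, random
choices, and the table of derivatives of monomials. -/
structure HasData (P : RunParams) [Fact P.q.Prime] (len : ℕ → ℕ) (y : ℕ → ℕ → ZMod P.q)
    (R : ℕ → ℕ) (σ : Store) : Prop where
  params : HasParams P σ
  len : ∀ a < P.q, σ.arr 1 a = len a
  sym : ∀ x < P.q * P.l, ∀ i < P.s, σ.arr 2 (x * P.s + i) = (y x i).val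
  rand : ∀ c < P.M * P.t, σ.arr 3 c = R c
  table : ∀ u < P.N, ∀ a < P.q, ∀ i < P.s,
    σ.arr 4 ((u * P.q + a) * P.s + i) = (hasseMonomial u (a : ZMod P.q) i).val

theorem HasData.of_agree {P : RunParams} [Fact P.q.Prime] {len : ℕ → ℕ} {y : ℕ → ℕ → ZMod P.q}
    {R : ℕ → ℕ} {σ τ : Store} (h : HasData P len y R σ) (hr : ∀ x < 26, τ.reg x = σ.reg x)
    (ha : ∀ b ∈ [1, 2, 3, 4], τ.arr b = σ.arr b) : HasData P len y R τ := by
  refine ⟨fun i hi => (hr i hi).trans (h.params i hi), ?_, ?_, ?_, ?_⟩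
  · rw [ha 1 (by simp)]; exact h.len
  · rw [ha 2 (by simp)]; exact h.sym
  · rw [ha 3 (by simp)]; exact h.rand
  · rw [ha 4 (by simp)]; exact h.table

namespace AExp

/-- Entry of the table of derivatives of monomials. -/
def hasse (u a i : AExp) : AExp :=
  .get 4 (.add (.mul 5 (.add (.mul 5 u (.reg 0)) a) (.reg 1)) i)

/-- Coordinate `i` of the symbol `x`. -/
def symbol (x i : AExp) : AExp := .get 2 (.add (.mul 5 x (.reg 1)) i)

end AExp

/-! ### Evaluation of table entries, symbols and interpolation conditions. -/

section Eval

variable {P : RunParams} [Fact P.q.Prime] {len : ℕ → ℕ} {y : ℕ → ℕ → ZMod P.q} {R : ℕ → ℕ}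
  {σ : Store} {v : ℕ → ℕ}

/-- The index is a number in mixed radix; the size relations keep each first factor below the clamp
in register `5`, so the clamped products are true products. -/
theorem eval_hasse (hP : P.Fits) (h : HasData P len y R σ) {u a i : AExp}
    {u' a' i' : ℕ} (eu : u.eval σ v = u') (ea : a.eval σ v = a') (ei : i.eval σ v = i')
    (hu : u' < P.N) (ha : a' < P.q) (hi : i' < P.s) :
    (AExp.hasse u a i).eval σ v = (hasseMonomial u' (a' : ZMod P.q) i').val := by
  have h0 : σ.reg 0 = P.q := h.params 0 (by decide)
  have h1 : σ.reg 1 = P.s := h.params 1 (by decide)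
  have h5 : σ.reg 5 = P.Z := h.params 5 (by decide)
  have hN : P.N * P.q * 1 ≤ P.N * P.q * P.s := Nat.mul_le_mul_left _ hP.s_pos
  have hN' := hP.Nq_le
  rw [← mul_assoc] at hN'
  have hb : u' * P.q + a' < P.N * P.q := by
    calc u' * P.q + a' < (u' + 1) * P.q := by rw [Nat.succ_mul]; omega
      _ ≤ P.N * P.q := Nat.mul_le_mul_right _ hu
  have hu1 : u' * 1 ≤ u' * P.q := Nat.mul_le_mul_left _ (by omega)
  have e1 : (AExp.mul 5 u (.reg 0)).eval σ v = u' * P.q := by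
    rw [AExp.eval_mul, eu]
    · simp only [AExp.eval, h0]
    · rw [eu, h5]; omega
  have e2 : (AExp.mul 5 (.add (.mul 5 u (.reg 0)) a) (.reg 1)).eval σ v = (u' * P.q + a') * P.s := by
    have eadd : (AExp.add (.mul 5 u (.reg 0)) a).eval σ v = u' * P.q + a' := by
      rw [AExp.eval, e1, ea]
    rw [AExp.eval_mul, eadd]
    · simp only [AExp.eval, h1]
    · rw [eadd, h5]; omega
  rw [AExp.hasse, AExp.eval, AExp.eval, e2, ei, h.table u' hu a' ha i' hi]

theorem eval_symbol (hP : P.Fits) (h : HasData P len y R σ) {x i : AExp}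
    {x' i' : ℕ} (ex : x.eval σ v = x') (ei : i.eval σ v = i')
    (hx : x' < P.q * P.l) (hi : i' < P.s) :
    (AExp.symbol x i).eval σ v = (y x' i').val := by
  have h1 : σ.reg 1 = P.s := h.params 1 (by decide)
  have h5 : σ.reg 5 = P.Z := h.params 5 (by decide)
  have hZ := hP.inp_le
  have hZ' : P.q * P.l * 1 ≤ P.q * P.l * P.s := Nat.mul_le_mul_left _ hP.s_pos
  rw [AExp.symbol, AExp.eval, AExp.eval, AExp.eval_mul, ex, ei]
  · simp only [AExp.eval, h1]
    exact h.sym x' hx i' hi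
  · rw [ex, h5]; omega

theorem eval_div_reg {a : AExp} {n : ℕ} (hn : 0 < σ.reg n) (h : a.eval σ v / σ.reg n ≤ σ.reg 5) :
    (AExp.div 5 a (.reg n)).eval σ v = a.eval σ v / σ.reg n :=
  AExp.eval_div hn h

theorem eval_mod_reg {a : AExp} {n : ℕ} (hn : 0 < σ.reg n) (h : a.eval σ v / σ.reg n ≤ σ.reg 5) :
    (AExp.mod a (.reg n)).eval σ v = a.eval σ v % σ.reg n :=
  AExp.eval_mod hn h

/-- The interpolation conditions; variable `12` numbers the conditions, variable `13` the
coefficients. -/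
def symbolExp : AExp :=
  let x : AExp := .div 5 (.var 12) (.reg 7)
  let j : AExp := .mod (.var 12) (.reg 7)
  let a : AExp := .div 5 x (.reg 3)
  let i : AExp := .div 5 (.sub (.var 13) (.reg 8)) (.reg 9)
  let o : AExp := .mod (.sub (.var 13) (.reg 8)) (.reg 9)
  let i' : AExp := .add i (.sub j (.var 14))
  .add (.mul 5 (.lt (.var 13) (.reg 8)) (.hasse (.var 13) a j))
    (.mul 5 (.le (.reg 8) (.var 13)) (.mod (.sum 14 7 (.mul 5 (.le (.var 14) j)
      (.mul 5 (.hasse o a (.var 14))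
        (.mod (.mul 5 (.hasse i' (.lit 1) i) (.symbol x i')) (.reg 0))))) (.reg 0)))

/-- Condition `k` concerns the symbol `k / g` and the order `k % g`. A bound of a sum has to be a
parameter register, so the convolution runs over all `g` indices and a comparison removes the
superfluous ones. -/
theorem eval_symbolExp (hP : P.Fits) (h : HasData P len y R σ) {k c : ℕ} (hk : v 12 = k)
    (hc : v 13 = c) (hk' : k < P.q * P.l * P.g) (hc' : c < P.N + P.r * P.m) :
    symbolExp.eval σ v
      = (symbolForm P.N P.m ((k / P.g / P.l : ℕ) : ZMod P.q) (y (k / P.g)) (k % P.g) c).val := by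
  have hq := (Fact.out : P.q.Prime).pos
  have hq1 := (Fact.out : P.q.Prime).one_lt
  have : NeZero P.q := ⟨hq.ne'⟩
  have h0 : σ.reg 0 = P.q := h.params 0 (by decide)
  have h3 : σ.reg 3 = P.l := h.params 3 (by decide)
  have h5 : σ.reg 5 = P.Z := h.params 5 (by decide)
  have h7 : σ.reg 7 = P.g := h.params 7 (by decide)
  have h8 : σ.reg 8 = P.N := h.params 8 (by decide)
  have h9 : σ.reg 9 = P.m := h.params 9 (by decide)
  have hgs : P.g ≤ P.s := by have := hP.order; have := hP.r_pos; omega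
  have hZ1 := hP.inp_le
  have hZ2 : P.q * P.l * 1 ≤ P.q * P.l * P.s := Nat.mul_le_mul_left _ hP.s_pos
  have hx : k / P.g < P.q * P.l := by rwa [Nat.div_lt_iff_lt_mul hP.g_pos]
  have ha : k / P.g / P.l < P.q := by rwa [Nat.div_lt_iff_lt_mul hP.l_pos]
  have hj : k % P.g < P.g := Nat.mod_lt _ hP.g_pos
  have hqZ : P.q * 1 ≤ P.q * P.q := Nat.mul_le_mul_left _ hq
  have hqZ' := hP.q_le
  have hn1 : (P.N + P.r * P.m) * 1 ≤ (P.N + P.r * P.m) * (P.N + P.r * P.m) :=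
    Nat.mul_le_mul_left _ (by omega)
  have hn1' := hP.n1_le
  have hi : (c - P.N) / P.m < P.r := by
    rw [Nat.div_lt_iff_lt_mul hP.m_pos]
    have : 0 < P.r * P.m := Nat.mul_pos hP.r_pos hP.m_pos
    omega
  have ho : (c - P.N) % P.m < P.m := Nat.mod_lt _ hP.m_pos
  have hblock := hP.block
  have horder := hP.order
  have hrpos := hP.r_pos
  have ex : ∀ v : ℕ → ℕ, v 12 = k → (AExp.div 5 (.var 12) (.reg 7)).eval σ v = k / P.g := by
    intro v hv
    have e : (AExp.var 12).eval σ v = k := hv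
    rw [eval_div_reg, e, h7] <;> rw [h7]
    · exact hP.g_pos
    · rw [e, h5]; omega
  have ej : ∀ v : ℕ → ℕ, v 12 = k → (AExp.mod (.var 12) (.reg 7)).eval σ v = k % P.g := by
    intro v hv
    have e : (AExp.var 12).eval σ v = k := hv
    rw [eval_mod_reg, e, h7] <;> rw [h7]
    · exact hP.g_pos
    · rw [e, h5]; omega
  have ea : ∀ v : ℕ → ℕ, v 12 = k →
      (AExp.div 5 (.div 5 (.var 12) (.reg 7)) (.reg 3)).eval σ v = k / P.g / P.l := by
    intro v hv
    rw [eval_div_reg, ex v hv, h3] <;> rw [h3]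
    · exact hP.l_pos
    · rw [ex v hv, h5]; omega
  have esub : ∀ v : ℕ → ℕ, v 13 = c → (AExp.sub (.var 13) (.reg 8)).eval σ v = c - P.N := by
    intro v hv
    simp only [AExp.eval, hv, h8]
  have ei : ∀ v : ℕ → ℕ, v 13 = c →
      (AExp.div 5 (.sub (.var 13) (.reg 8)) (.reg 9)).eval σ v = (c - P.N) / P.m := by
    intro v hv
    rw [eval_div_reg, esub v hv, h9] <;> rw [h9]
    · exact hP.m_pos
    · rw [esub v hv, h5]
      exact (Nat.div_le_self _ _).trans (by omega)
  have eo : ∀ v : ℕ → ℕ, v 13 = c →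
      (AExp.mod (.sub (.var 13) (.reg 8)) (.reg 9)).eval σ v = (c - P.N) % P.m := by
    intro v hv
    rw [eval_mod_reg, esub v hv, h9] <;> rw [h9]
    · exact hP.m_pos
    · rw [esub v hv, h5]
      exact (Nat.div_le_self _ _).trans (by omega)
  have h1Z : 1 ≤ σ.reg 5 := by omega
  have evar : (AExp.var 13).eval σ v = c := hc
  have ereg : (AExp.reg 8).eval σ v = P.N := h8
  rw [symbolExp, AExp.eval, AExp.eval_lt_mul h1Z, AExp.eval_le_mul h1Z, evar, ereg, symbolForm]
  by_cases hcN : c < P.N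
  · rw [if_pos hcN, if_neg (by omega), if_pos hcN, add_zero]
    exact eval_hasse hP h evar (ea v hk) (ej v hk) hcN ha (by omega)
  · rw [if_neg hcN, if_pos (by omega), if_neg hcN, zero_add]
    have eterm : ∀ k' < P.g, (AExp.mul 5 (.le (.var 14) (.mod (.var 12) (.reg 7)))
        (.mul 5 (.hasse (.mod (.sub (.var 13) (.reg 8)) (.reg 9))
          (.div 5 (.div 5 (.var 12) (.reg 7)) (.reg 3)) (.var 14))
        (.mod (.mul 5 (.hasse (.add (.div 5 (.sub (.var 13) (.reg 8)) (.reg 9))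
          (.sub (.mod (.var 12) (.reg 7)) (.var 14))) (.lit 1)
          (.div 5 (.sub (.var 13) (.reg 8)) (.reg 9))) (.symbol (.div 5 (.var 12) (.reg 7))
          (.add (.div 5 (.sub (.var 13) (.reg 8)) (.reg 9))
          (.sub (.mod (.var 12) (.reg 7)) (.var 14))))) (.reg 0)))).eval σ
          (Function.update v 14 k')
        = if k' ≤ k % P.g then (hasseMonomial ((c - P.N) % P.m)
            ((k / P.g / P.l : ℕ) : ZMod P.q) k').val *
          (hasseMonomial ((c - P.N) / P.m + (k % P.g - k')) 1 ((c - P.N) / P.m) *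
            y (k / P.g) ((c - P.N) / P.m + (k % P.g - k'))).val else 0 := by
      intro k' hk'
      have u12 : Function.update v 14 k' 12 = k := by rw [Function.update_of_ne (by decide), hk]
      have u13 : Function.update v 14 k' 13 = c := by rw [Function.update_of_ne (by decide), hc]
      have u14 : (AExp.var 14).eval σ (Function.update v 14 k') = k' := by simp [AExp.eval]
      have ei' : (AExp.add (.div 5 (.sub (.var 13) (.reg 8)) (.reg 9))
          (.sub (.mod (.var 12) (.reg 7)) (.var 14))).eval σ (Function.update v 14 k')
          = (c - P.N) / P.m + (k % P.g - k') := by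
        rw [AExp.eval, AExp.eval, ei _ u13, ej _ u12, u14]
      rw [AExp.eval_le_mul h1Z, u14, ej _ u12]
      split_ifs with hle
      · have eh1 := eval_hasse hP h (eo _ u13) (ea _ u12) u14 (by omega) ha (by omega)
        -- Binomial coefficients are read off the table as derivatives of monomials at the point
        -- `1`; the exponent is below `s ≤ N`, hence within the table.
        have eh2 := eval_hasse hP h ei' (AExp.eval.eq_3 σ (Function.update v 14 k') 1) (ei _ u13)
          (by have := hP.s_le; omega) hq1 (by omega)
        have es := eval_symbol hP h (ex _ u12) ei' hx (by omega)
        rw [AExp.eval_mul, eh1, AExp.eval_mod_field (x :=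
          hasseMonomial ((c - P.N) / P.m + (k % P.g - k')) 1 ((c - P.N) / P.m) *
            y (k / P.g) ((c - P.N) / P.m + (k % P.g - k'))) h0]
        · rw [AExp.eval_mul, eh2, es]
          · calc _ ≤ P.q * P.q := Nat.mul_le_mul (ZMod.val_lt _).le (ZMod.val_lt _).le
              _ ≤ _ := Nat.mul_le_mul_right _ (by omega)
          · rw [eh2]
            have := ZMod.val_lt (hasseMonomial ((c - P.N) / P.m + (k % P.g - k'))
              ((1 : ℕ) : ZMod P.q) ((c - P.N) / P.m))
            omega
        · rw [AExp.eval_mul, eh2, es]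
          · simp
          · rw [eh2]
            have := ZMod.val_lt (hasseMonomial ((c - P.N) / P.m + (k % P.g - k'))
              ((1 : ℕ) : ZMod P.q) ((c - P.N) / P.m))
            omega
        · rw [eh1]
          have := ZMod.val_lt (hasseMonomial ((c - P.N) % P.m)
            ((k / P.g / P.l : ℕ) : ZMod P.q) k')
          omega
      · rfl
    have esum : (AExp.sum 14 7 (.mul 5 (.le (.var 14) (.mod (.var 12) (.reg 7)))
        (.mul 5 (.hasse (.mod (.sub (.var 13) (.reg 8)) (.reg 9))
          (.div 5 (.div 5 (.var 12) (.reg 7)) (.reg 3)) (.var 14))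
        (.mod (.mul 5 (.hasse (.add (.div 5 (.sub (.var 13) (.reg 8)) (.reg 9))
          (.sub (.mod (.var 12) (.reg 7)) (.var 14))) (.lit 1)
          (.div 5 (.sub (.var 13) (.reg 8)) (.reg 9))) (.symbol (.div 5 (.var 12) (.reg 7))
          (.add (.div 5 (.sub (.var 13) (.reg 8)) (.reg 9))
          (.sub (.mod (.var 12) (.reg 7)) (.var 14))))) (.reg 0))))).eval σ v
        = ∑ k' ∈ Finset.range P.g, if k' ≤ k % P.g then (hasseMonomial ((c - P.N) % P.m)
            ((k / P.g / P.l : ℕ) : ZMod P.q) k').val *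
          (hasseMonomial ((c - P.N) / P.m + (k % P.g - k')) 1 ((c - P.N) / P.m) *
            y (k / P.g) ((c - P.N) / P.m + (k % P.g - k'))).val else 0 := by
      rw [AExp.eval, h7]
      exact Finset.sum_congr rfl fun k' hk' => eterm k' (Finset.mem_range.mp hk')
    refine AExp.eval_mod_field h0 ?_ ?_
    · rw [esum, h5]
      refine (mod_range (n := P.g) (q := P.q) _ _ (by simp) fun k' _ => ?_).trans
        (Nat.mul_le_mul_right _ ?_)
      · split_ifs
        · exact Nat.mul_le_mul (ZMod.val_lt _).le (ZMod.val_lt _).le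
        · exact Nat.zero_le _
      · have h1 : P.g * P.q ≤ P.N * (P.q * P.s) := by
          have : P.q * 1 ≤ P.q * P.s := Nat.mul_le_mul_left _ hP.s_pos
          have := hP.s_le
          exact Nat.mul_le_mul (by omega) (by omega)
        exact h1.trans hP.Nq_le
    · rw [esum]
      push_cast
      simp only [ZMod.natCast_zmod_val]
      rw [← Finset.sum_filter]
      refine Finset.sum_congr ?_ fun _ _ => rfl
      ext k'
      simp only [Finset.mem_filter, Finset.mem_range]
      omega

end Eval

/-! ### Evaluation of the homogenized equations and of the conditions of a trial. -/

section Eval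

variable {P : RunParams} [Fact P.q.Prime] {len : ℕ → ℕ} {y : ℕ → ℕ → ZMod P.q} {R : ℕ → ℕ}
  {σ : Store} {v : ℕ → ℕ}

/-- The equations of the solution space; variable `12` numbers the equations, variable `13` the
coefficients. -/
def equationExp : AExp :=
  let ρ : AExp := .div 5 (.var 12) (.reg 8)
  let k : AExp := .mod (.var 12) (.reg 8)
  let i : AExp := .div 5 (.sub (.var 14) (.reg 8)) (.reg 9)
  let o : AExp := .mod (.sub (.var 14) (.reg 8)) (.reg 9)
  .add (.mul 5 (.lt (.var 13) (.reg 15)) (.mod (.sum 14 10 (.mul 5 (.le (.reg 8) (.var 14))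
      (.mul 5 (.sub (.lit 1) (.dist (.add (.sub (.var 13) i) o) k))
      (.mul 5 (.get 8 (.add (.mul 5 ρ (.reg 10)) (.var 14))) (.hasse (.var 13) (.lit 1) i)))))
      (.reg 0)))
    (.mul 5 (.le (.reg 15) (.var 13)) (.get 8 (.add (.mul 5 ρ (.reg 10)) k)))

theorem eval_one_sub_dist_mul {a b c : AExp} (h : 1 ≤ σ.reg 5) :
    (AExp.mul 5 (.sub (.lit 1) (.dist a b)) c).eval σ v
      = if a.eval σ v = b.eval σ v then c.eval σ v else 0 := by
  rw [AExp.eval_mul]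
  · simp only [AExp.eval]
    split_ifs with h'
    · rw [AExp.eval_dist_eq_zero.mpr h', Nat.sub_zero, one_mul]
    · have := mt AExp.eval_dist_eq_zero.mp h'
      rw [Nat.sub_eq_zero_of_le (by omega), zero_mul]
  · simp only [AExp.eval]; omega

theorem eval_equationExp (hP : P.Fits) (h : HasData P len y R σ) {γ : ℕ → ZMod P.q}
    (hγ : ∀ i < (P.N + P.r * P.m) * (P.N + P.r * P.m), σ.arr 8 i = (γ i).val)
    {k u : ℕ} (hk : v 12 = k) (hu : v 13 = u) (hu' : u < P.d + 2)
    {ρ : Fin (P.N + P.r * P.m)} {k' : ℕ} (hk' : k' < P.N) (hkρ : k = ρ * P.N + k') :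
    equationExp.eval σ v
      = (equationForm P.N P.m P.d (rowsOf (P.N + P.r * P.m) γ ρ) k' u).val := by
  have hq := (Fact.out : P.q.Prime).pos
  have hq1 := (Fact.out : P.q.Prime).one_lt
  have : NeZero P.q := ⟨hq.ne'⟩
  have h0 : σ.reg 0 = P.q := h.params 0 (by decide)
  have h5 : σ.reg 5 = P.Z := h.params 5 (by decide)
  have h8 : σ.reg 8 = P.N := h.params 8 (by decide)
  have h9 : σ.reg 9 = P.m := h.params 9 (by decide)
  have h10 : σ.reg 10 = P.N + P.r * P.m := h.params 10 (by decide)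
  have h15 : σ.reg 15 = P.d + 1 := h.params 15 (by decide)
  have hqZ : P.q * 1 ≤ P.q * P.q := Nat.mul_le_mul_left _ hq
  have hqZ' := hP.q_le
  have hNpos := hP.N_pos
  have hn1 : (P.N + P.r * P.m) * 1 ≤ (P.N + P.r * P.m) * (P.N + P.r * P.m) :=
    Nat.mul_le_mul_left _ (by omega)
  have hn1' := hP.n1_le
  have hn1q := hP.n1q_le
  have hblock := hP.block
  have horder := hP.order
  have hrpos := hP.r_pos
  have hgpos := hP.g_pos
  have hmpos := hP.m_pos
  have hρ := ρ.2
  have hdiv : k / P.N = ρ := by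
    rw [hkρ, mul_comm, Nat.mul_add_div hNpos, Nat.div_eq_of_lt hk', add_zero]
  have hmod : k % P.N = k' := by
    rw [hkρ, mul_comm, Nat.mul_add_mod, Nat.mod_eq_of_lt hk']
  have h1Z : 1 ≤ σ.reg 5 := by omega
  have eρ : ∀ v : ℕ → ℕ, v 12 = k → (AExp.mul 5 (.div 5 (.var 12) (.reg 8)) (.reg 10)).eval σ v
      = ρ * (P.N + P.r * P.m) := by
    intro v hv
    have e : (AExp.var 12).eval σ v = k := hv
    have e' : (AExp.div 5 (.var 12) (.reg 8)).eval σ v = ρ := by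
      rw [eval_div_reg, e, h8, hdiv] <;> rw [h8]
      · exact hNpos
      · rw [e, h5, hdiv]; omega
    have er : (AExp.reg 10).eval σ v = P.N + P.r * P.m := h10
    rw [AExp.eval_mul, e', er]
    rw [e', h5]; omega
  have ek : ∀ v : ℕ → ℕ, v 12 = k → (AExp.mod (.var 12) (.reg 8)).eval σ v = k' := by
    intro v hv
    have e : (AExp.var 12).eval σ v = k := hv
    rw [eval_mod_reg, e, h8, hmod] <;> rw [h8]
    · exact hNpos
    · rw [e, h5, hdiv]; omega
  have esub : ∀ (v : ℕ → ℕ) c, v 14 = c →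
      (AExp.sub (.var 14) (.reg 8)).eval σ v = c - P.N := by
    intro v c hv
    simp only [AExp.eval, hv, h8]
  have ei : ∀ (v : ℕ → ℕ) c, v 14 = c → c < P.N + P.r * P.m →
      (AExp.div 5 (.sub (.var 14) (.reg 8)) (.reg 9)).eval σ v = (c - P.N) / P.m := by
    intro v c hv hc
    rw [eval_div_reg, esub v c hv, h9] <;> rw [h9]
    · exact hmpos
    · rw [esub v c hv, h5]
      exact (Nat.div_le_self _ _).trans (by omega)
  have eo : ∀ (v : ℕ → ℕ) c, v 14 = c → c < P.N + P.r * P.m →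
      (AExp.mod (.sub (.var 14) (.reg 8)) (.reg 9)).eval σ v = (c - P.N) % P.m := by
    intro v c hv hc
    rw [eval_mod_reg, esub v c hv, h9] <;> rw [h9]
    · exact hmpos
    · rw [esub v c hv, h5]
      exact (Nat.div_le_self _ _).trans (by omega)
  have hidx : ∀ c < P.N + P.r * P.m, ρ * (P.N + P.r * P.m) + c
      < (P.N + P.r * P.m) * (P.N + P.r * P.m) := by
    intro c hc
    calc ρ * (P.N + P.r * P.m) + c < (ρ + 1) * (P.N + P.r * P.m) := by rw [Nat.succ_mul]; omega
      _ ≤ _ := Nat.mul_le_mul_right _ hρ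
  have evar : (AExp.var 13).eval σ v = u := hu
  have ereg : (AExp.reg 15).eval σ v = P.d + 1 := h15
  rw [equationExp, AExp.eval, AExp.eval_lt_mul h1Z, AExp.eval_le_mul h1Z, evar, ereg, equationForm]
  by_cases hud : u ≤ P.d
  · rw [if_pos (by omega), if_neg (by omega), if_pos hud, add_zero]
    have esum : (AExp.sum 14 10 (.mul 5 (.le (.reg 8) (.var 14))
        (.mul 5 (.sub (.lit 1) (.dist (.add (.sub (.var 13)
          (.div 5 (.sub (.var 14) (.reg 8)) (.reg 9))) (.mod (.sub (.var 14) (.reg 8)) (.reg 9)))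
          (.mod (.var 12) (.reg 8))))
        (.mul 5 (.get 8 (.add (.mul 5 (.div 5 (.var 12) (.reg 8)) (.reg 10)) (.var 14)))
          (.hasse (.var 13) (.lit 1) (.div 5 (.sub (.var 14) (.reg 8)) (.reg 9))))))).eval σ v
        = ∑ c ∈ Finset.range (P.N + P.r * P.m), if c < P.N then 0 else
          if u - (c - P.N) / P.m + (c - P.N) % P.m = k' then
            (γ (ρ * (P.N + P.r * P.m) + c)).val * (hasseMonomial u (1 : ZMod P.q) ((c - P.N) / P.m)).val
          else 0 := by
      rw [AExp.eval, h10]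
      refine Finset.sum_congr rfl fun c hc => ?_
      have hc := Finset.mem_range.mp hc
      have u12 : Function.update v 14 c 12 = k := by rw [Function.update_of_ne (by decide), hk]
      have u13 : (AExp.var 13).eval σ (Function.update v 14 c) = u := by
        simpa [AExp.eval] using hu
      have u14 : Function.update v 14 c 14 = c := by simp
      have u14' : (AExp.var 14).eval σ (Function.update v 14 c) = c := u14
      have u8 : (AExp.reg 8).eval σ (Function.update v 14 c) = P.N := h8
      have hi : (c - P.N) / P.m < P.r := by
        rw [Nat.div_lt_iff_lt_mul hmpos]
        have : 0 < P.r * P.m := Nat.mul_pos hrpos hmpos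
        omega
      have ediff : (AExp.add (.sub (.var 13) (.div 5 (.sub (.var 14) (.reg 8)) (.reg 9)))
          (.mod (.sub (.var 14) (.reg 8)) (.reg 9))).eval σ (Function.update v 14 c)
          = u - (c - P.N) / P.m + (c - P.N) % P.m := by
        rw [AExp.eval, AExp.eval, u13, ei _ c u14 hc, eo _ c u14 hc]
      rw [AExp.eval_le_mul h1Z, u8, u14', eval_one_sub_dist_mul h1Z, ediff, ek _ u12]
      by_cases hcN : c < P.N
      · rw [if_neg (by omega), if_pos hcN]
      · rw [if_pos (by omega), if_neg hcN]
        split_ifs with hcond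
        · have eget : (AExp.get 8 (.add (.mul 5 (.div 5 (.var 12) (.reg 8)) (.reg 10))
              (.var 14))).eval σ (Function.update v 14 c)
              = (γ (ρ * (P.N + P.r * P.m) + c)).val := by
            rw [AExp.eval, AExp.eval, eρ _ u12, u14', hγ _ (hidx c hc)]
          rw [AExp.eval_mul, eget, eval_hasse hP h u13
            (AExp.eval.eq_3 σ (Function.update v 14 c) 1) (ei _ c u14 hc) (by omega) hq1
            (by omega), Nat.cast_one]
          rw [eget, h5]
          have := ZMod.val_lt (γ (ρ * (P.N + P.r * P.m) + c))
          omega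
        · rfl
    refine AExp.eval_mod_field h0 ?_ ?_
    · rw [esum, h5]
      refine (mod_range (n := P.N + P.r * P.m) (q := P.q) _ _ (by simp) fun c _ => ?_).trans
        (Nat.mul_le_mul_right _ hn1q)
      split_ifs
      · exact Nat.zero_le _
      · exact Nat.mul_le_mul (ZMod.val_lt _).le (ZMod.val_lt _).le
      · exact Nat.zero_le _
    · rw [esum, Finset.sum_range]
      push_cast
      refine Finset.sum_congr rfl fun c _ => ?_
      split_ifs <;> simp [rowsOf]
  · rw [if_neg (by omega), if_pos (by omega), if_neg hud, zero_add, AExp.eval, AExp.eval,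
      eρ v hk, ek v hk, hγ _ (hidx _ (by omega))]
    rw [Finset.sum_eq_single (⟨k', by omega⟩ : Fin (P.N + P.r * P.m))]
    · simp [rowsOf]
    · intro c _ hc
      rw [if_neg]
      exact fun h => hc (Fin.ext h)
    · simp

/-- The conditions imposed by a trial, the number of which is variable `15`; variable `12` numbers
the conditions, variable `13` the coefficients. -/
def trialExp : AExp :=
  let x : AExp := .get 3 (.add (.mul 5 (.reg 13) (.var 15)) (.div 5 (.var 12) (.reg 1)))
  let i : AExp := .mod (.var 12) (.reg 1)
  .add (.mul 5 (.lt (.var 13) (.reg 15)) (.hasse (.var 13) (.div 5 x (.reg 3)) i))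
    (.mul 5 (.le (.reg 15) (.var 13)) (.mod (.sub (.reg 0) (.symbol x i)) (.reg 0)))

/-- The coefficient at `u` of the form `(P, λ) ↦ P⁽ⁱ⁾(x / l) - λ y`. -/
def agreeForm {K : Type*} [Field K] (d l : ℕ) (y : ℕ → ℕ → K) (x i u : ℕ) : K :=
  if u ≤ d then hasseMonomial u ((x / l : ℕ) : K) i else - y x i

/-- Agreement with a symbol is an affine condition on `P`; the extra coordinate `λ` makes it linear,
so that the elimination for linear forms applies. -/
theorem linForm_agreeForm {K : Type*} [Field K] {d l : ℕ} {y : ℕ → ℕ → K} {x i : ℕ}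
    (p : Fin (d + 2) → K) : linForm (agreeForm d l y x i) p
      = (hasseDeriv i (polyOf p)).eval ((x / l : ℕ) : K) - p (Fin.last _) * y x i := by
  rw [linForm_apply, Fin.sum_univ_castSucc, sub_eq_add_neg]
  congr 1
  · rw [polyOf, map_sum, eval_finsetSum]
    refine Finset.sum_congr rfl fun u _ => ?_
    rw [map_smul, eval_smul, eval_hasseDeriv_X_pow, smul_eq_mul, mul_comm, agreeForm,
      if_pos (by simp; omega), Fin.val_castSucc]
  · rw [agreeForm, if_neg (by simp)]
    ring

theorem eval_trialExp (hP : P.Fits) (h : HasData P len y R σ) (hR : ∀ c < P.M * P.t, R c < P.q * P.l)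
    {τ k u : ℕ} (hτ : v 15 = τ) (hτ' : τ < P.M) (hk : v 12 = k) (hk' : k < P.t * P.s)
    (hu : v 13 = u) (hu' : u < P.d + 2) :
    trialExp.eval σ v = (agreeForm P.d P.l y (R (τ * P.t + k / P.s)) (k % P.s) u).val := by
  have hq := (Fact.out : P.q.Prime).pos
  have : NeZero P.q := ⟨hq.ne'⟩
  have h0 : σ.reg 0 = P.q := h.params 0 (by decide)
  have h1 : σ.reg 1 = P.s := h.params 1 (by decide)
  have h3 : σ.reg 3 = P.l := h.params 3 (by decide)
  have h5 : σ.reg 5 = P.Z := h.params 5 (by decide)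
  have h13 : σ.reg 13 = P.t := h.params 13 (by decide)
  have h15 : σ.reg 15 = P.d + 1 := h.params 15 (by decide)
  have hspos := hP.s_pos
  have hqZ : P.q * 1 ≤ P.q * P.q := Nat.mul_le_mul_left _ hq
  have hqZ' := hP.q_le
  have hts : P.t * 1 ≤ P.t * P.s := Nat.mul_le_mul_left _ hspos
  have hts' := hP.t_le
  have hinp := hP.inp_le
  have hinp' : P.q * P.l * 1 ≤ P.q * P.l * P.s := Nat.mul_le_mul_left _ hspos
  have hblock := hP.block
  have hmpos := hP.m_pos
  have hks : k / P.s < P.t := by rwa [Nat.div_lt_iff_lt_mul hspos]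
  have hrow : τ * P.t + k / P.s < P.M * P.t := by
    calc τ * P.t + k / P.s < (τ + 1) * P.t := by rw [Nat.succ_mul]; omega
      _ ≤ _ := Nat.mul_le_mul_right _ hτ'
  set x := R (τ * P.t + k / P.s) with hx
  have hxlt : x < P.q * P.l := hR _ hrow
  have h1Z : 1 ≤ σ.reg 5 := by omega
  have ek : (AExp.var 12).eval σ v = k := hk
  have ex : (AExp.get 3 (.add (.mul 5 (.reg 13) (.var 15)) (.div 5 (.var 12) (.reg 1)))).eval σ v
      = x := by
    have e1 : (AExp.div 5 (.var 12) (.reg 1)).eval σ v = k / P.s := by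
      rw [eval_div_reg, ek, h1] <;> rw [h1]
      · exact hspos
      · rw [ek, h5]; omega
    have e2 : (AExp.mul 5 (.reg 13) (.var 15)).eval σ v = τ * P.t := by
      rw [AExp.eval_mul]
      · simp only [AExp.eval, h13, hτ, mul_comm]
      · simp only [AExp.eval, h13, h5]; omega
    rw [AExp.eval, AExp.eval, e1, e2, h.rand _ hrow]
  have ei : (AExp.mod (.var 12) (.reg 1)).eval σ v = k % P.s := by
    rw [eval_mod_reg, ek, h1] <;> rw [h1]
    · exact hspos
    · rw [ek, h5]; omega
  have hi : k % P.s < P.s := Nat.mod_lt _ hspos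
  have evar : (AExp.var 13).eval σ v = u := hu
  have ereg : (AExp.reg 15).eval σ v = P.d + 1 := h15
  have er0 : (AExp.reg 0).eval σ v = P.q := h0
  rw [trialExp, AExp.eval, AExp.eval_lt_mul h1Z, AExp.eval_le_mul h1Z, evar, ereg, agreeForm]
  by_cases hud : u ≤ P.d
  · rw [if_pos (by omega), if_neg (by omega), if_pos hud, add_zero]
    refine eval_hasse hP h evar ?_ ei (by omega) ?_ hi
    · rw [eval_div_reg, ex, h3] <;> rw [h3]
      · exact hP.l_pos
      · rw [ex, h5]
        exact (Nat.div_le_self _ _).trans (by omega)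
    · rwa [Nat.div_lt_iff_lt_mul hP.l_pos]
  · rw [if_neg (by omega), if_pos (by omega), if_neg hud, zero_add]
    have es := eval_symbol hP h ex ei hxlt hi
    have hlt := ZMod.val_lt (y x (k % P.s))
    -- The negative of the symbol is represented by `q` minus its value, and the reduction takes
    -- care of the value zero.
    refine AExp.eval_mod_field h0 ?_ ?_
    · rw [AExp.eval, es, er0, h5]
      have : 1 * P.q ≤ P.Z * P.q := Nat.mul_le_mul_right _ (by omega)
      omega
    · rw [AExp.eval, es, er0, Nat.cast_sub hlt.le]
      simp

end Eval

/-! ### The table of derivatives -/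

theorem hasseMonomial_zero {K : Type*} [Field K] (a : K) (i : ℕ) :
    hasseMonomial 0 a i = if i = 0 then 1 else 0 := by
  rcases i with - | i <;> simp [hasseMonomial]

/-- The product rule for `X * X ^ u`, that is, Pascal's rule. -/
theorem hasseMonomial_succ {K : Type*} [Field K] (u : ℕ) (a : K) (i : ℕ) :
    hasseMonomial (u + 1) a i
      = a * hasseMonomial u a i + if i = 0 then 0 else hasseMonomial u a (i - 1) := by
  rcases i with - | i
  · simp [hasseMonomial, pow_succ, mul_comm]
  · rw [if_neg (by omega)]
    simp only [hasseMonomial, Nat.choose_succ_succ, Nat.add_sub_add_right, Nat.add_sub_cancel]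
    rcases Nat.lt_or_ge u (i + 1) with h | h
    · rw [Nat.choose_eq_zero_of_lt h]
      simp
    · obtain ⟨k, rfl⟩ := Nat.exists_eq_add_of_le h
      rw [show i + 1 + k - i = k + 1 by omega, Nat.add_sub_cancel_left]
      push_cast
      ring

/-- Compute the table of derivatives of monomials. -/
def Cmd.table : Cmd :=
  let i : AExp := .mod (.var 10) (.reg 1)
  let a : AExp := .mod (.div 5 (.var 10) (.reg 1)) (.reg 0)
  let u : AExp := .div 5 (.div 5 (.var 10) (.reg 1)) (.reg 0)
  let o : AExp := .sub (.var 10) (.mul 5 (.reg 0) (.reg 1))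
  fill 10 17 4 (.add (.mul 5 (.sgn u) (.mod (.add (.mul 5 a (.get 4 o))
    (.mul 5 (.sgn i) (.get 4 (.sub o (.lit 1))))) (.reg 0))) (.mul 5 (.sub (.lit 1) u)
      (.sub (.lit 1) i)))

/-- Entry `c` of the table of derivatives of monomials. -/
def tableEntry (q s c : ℕ) : ZMod q :=
  (c / s / q).choose (c % s) * ((c / s % q : ℕ) : ZMod q) ^ (c / s / q - c % s)

/-- The recurrence refers to exponent `u - 1` at the same point, in positions `c - q s` and `c - q s
- 1`. Both have been filled earlier, so neither powers nor binomial coefficients are computed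
directly. -/
theorem Cmd.exec_table {P : RunParams} [Fact P.q.Prime] (hP : P.Fits) {σ : Store} {v : ℕ → ℕ}
    (h : HasParams P σ) : table.exec v σ
      = σ.fillArr 4 (P.N * (P.q * P.s)) fun c => (tableEntry P.q P.s c).val := by
  have hq := (Fact.out : P.q.Prime).pos
  have hq1 := (Fact.out : P.q.Prime).one_lt
  have : NeZero P.q := ⟨hq.ne'⟩
  have h0 : σ.reg 0 = P.q := h 0 (by decide)
  have h1 : σ.reg 1 = P.s := h 1 (by decide)
  have h5 : σ.reg 5 = P.Z := h 5 (by decide)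
  have h17 : σ.reg 17 = P.N * (P.q * P.s) := h 17 (by decide)
  have hs := hP.s_pos
  have hqZ : P.q * 1 ≤ P.q * P.q := Nat.mul_le_mul_left _ hq
  have hqZ' := hP.q_le
  have hZ := hP.Nq_le
  rw [table, exec_fill (fun c => (tableEntry P.q P.s c).val), h17]
  intro c hc
  rw [h17] at hc
  set f : ℕ → ℕ := fun c => (tableEntry P.q P.s c).val with hf
  set τ := σ.fillArr 4 c f with hτ
  set v' := Function.update v 10 c with hv'
  have ec : (AExp.var 10).eval τ v' = c := by simp [AExp.eval, hv']
  have r0 : (AExp.reg 0).eval τ v' = P.q := h0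
  have r1 : (AExp.reg 1).eval τ v' = P.s := h1
  have t0 : τ.reg 0 = P.q := h0
  have t1 : τ.reg 1 = P.s := h1
  have t5 : τ.reg 5 = P.Z := h5
  have hcs : c / P.s ≤ c := Nat.div_le_self _ _
  have hcq : c / P.s / P.q ≤ c / P.s := Nat.div_le_self _ _
  have es : (AExp.div 5 (.var 10) (.reg 1)).eval τ v' = c / P.s := by
    rw [eval_div_reg, ec, t1] <;> rw [t1]
    · exact hs
    · rw [ec, t5]; omega
  have ei : (AExp.mod (.var 10) (.reg 1)).eval τ v' = c % P.s := by
    rw [eval_mod_reg, ec, t1] <;> rw [t1]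
    · exact hs
    · rw [ec, t5]; omega
  have ea : (AExp.mod (.div 5 (.var 10) (.reg 1)) (.reg 0)).eval τ v' = c / P.s % P.q := by
    rw [eval_mod_reg, es, t0] <;> rw [t0]
    · exact hq
    · rw [es, t5]; omega
  have eu : (AExp.div 5 (.div 5 (.var 10) (.reg 1)) (.reg 0)).eval τ v' = c / P.s / P.q := by
    rw [eval_div_reg, es, t0] <;> rw [t0]
    · exact hq
    · rw [es, t5]; omega
  have eo : (AExp.sub (.var 10) (.mul 5 (.reg 0) (.reg 1))).eval τ v' = c - P.q * P.s := by
    rw [AExp.eval, ec, AExp.eval_mul (by rw [r0, t5]; omega), r0, r1]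
  have h1Z : 1 ≤ τ.reg 5 := by omega
  have hlast : (AExp.mul 5 (.sub (.lit 1) (.div 5 (.div 5 (.var 10) (.reg 1)) (.reg 0)))
      (.sub (.lit 1) (.mod (.var 10) (.reg 1)))).eval τ v'
      = (1 - c / P.s / P.q) * (1 - c % P.s) := by
    have e1 : ∀ a : AExp, (AExp.sub (.lit 1) a).eval τ v' = 1 - a.eval τ v' := fun _ => rfl
    rw [AExp.eval_mul, e1, e1, ei, eu]
    rw [e1]; omega
  rw [AExp.eval, AExp.eval_sgn_mul h1Z, eu, hlast]
  rcases Nat.eq_zero_or_pos (c / P.s / P.q) with hu | hu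
  · rw [if_pos hu, hu, zero_add, Nat.sub_zero, one_mul, tableEntry, hu]
    have := hasseMonomial_zero (K := ZMod P.q) ((c / P.s % P.q : ℕ) : ZMod P.q) (c % P.s)
    rw [hasseMonomial] at this
    rw [this]
    split_ifs with hi
    · rw [hi, ZMod.val_one'' hq1.ne']
    · rw [ZMod.val_zero]
      omega
  · obtain ⟨u, hu'⟩ : ∃ u, c / P.s / P.q = u + 1 := ⟨_, (Nat.succ_pred_eq_of_pos hu).symm⟩
    rw [if_neg (by omega), Nat.sub_eq_zero_of_le (by omega : 1 ≤ c / P.s / P.q), zero_mul, add_zero]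
    -- the positions of the entries used
    have hge : P.q * P.s ≤ c := by
      have h2 : P.q ≤ c / P.s := by
        have := Nat.div_mul_le_self (c / P.s) P.q
        rw [hu', Nat.succ_mul] at this
        omega
      exact (Nat.mul_le_mul_right _ h2).trans (Nat.div_mul_le_self _ _)
    have hqs : 0 < P.q * P.s := Nat.mul_pos hq hs
    have hd : (c - P.q * P.s) / P.s = c / P.s - P.q := by
      rw [mul_comm, Nat.sub_mul_div]
    have hm : (c - P.q * P.s) % P.s = c % P.s := by
      obtain ⟨k, rfl⟩ := Nat.exists_eq_add_of_le hge
      rw [Nat.add_sub_cancel_left, Nat.add_comm, Nat.add_mul_mod_self_right]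
    have hd2 : (c / P.s - P.q) / P.q = u := by
      have := Nat.sub_mul_div (c / P.s) P.q 1
      rw [mul_one, hu'] at this
      exact this
    have hm2 : (c / P.s - P.q) % P.q = c / P.s % P.q := by
      rw [← Nat.mod_eq_sub_mod]
      by_contra hlt
      rw [Nat.div_eq_of_lt (by omega)] at hu
      omega
    have ha0 : τ.arr 4 (c - P.q * P.s)
        = (hasseMonomial u ((c / P.s % P.q : ℕ) : ZMod P.q) (c % P.s)).val := by
      rw [hτ, Store.fillArr_arr, if_pos ⟨rfl, by omega⟩, hf]
      simp only [tableEntry]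
      rw [hd, hm, hd2, hm2, hasseMonomial]
    have ha1 : c % P.s ≠ 0 → τ.arr 4 (c - P.q * P.s - 1)
        = (hasseMonomial u ((c / P.s % P.q : ℕ) : ZMod P.q) (c % P.s - 1)).val := by
      intro hi
      have e := Nat.div_add_mod (c - P.q * P.s) P.s
      rw [hm, hd] at e
      have hlt := Nat.mod_lt c hs
      have hd3 : (c - P.q * P.s - 1) / P.s = c / P.s - P.q := by
        rw [← e, Nat.add_sub_assoc (by omega), Nat.mul_add_div hs,
          Nat.div_eq_of_lt (show c % P.s - 1 < P.s by omega), add_zero]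
      have hm3 : (c - P.q * P.s - 1) % P.s = c % P.s - 1 := by
        rw [← e, Nat.add_sub_assoc (by omega), Nat.mul_add_mod, Nat.mod_eq_of_lt (by omega)]
      rw [hτ, Store.fillArr_arr, if_pos ⟨rfl, by omega⟩, hf]
      simp only [tableEntry]
      rw [hd3, hm3, hd2, hm2, hasseMonomial]
    have htab : tableEntry P.q P.s c
        = hasseMonomial (u + 1) ((c / P.s % P.q : ℕ) : ZMod P.q) (c % P.s) := by
      rw [tableEntry, hu', hasseMonomial]
    have esum : (AExp.add (.mul 5 (.mod (.div 5 (.var 10) (.reg 1)) (.reg 0))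
        (.get 4 (.sub (.var 10) (.mul 5 (.reg 0) (.reg 1)))))
        (.mul 5 (.sgn (.mod (.var 10) (.reg 1)))
        (.get 4 (.sub (.sub (.var 10) (.mul 5 (.reg 0) (.reg 1))) (.lit 1))))).eval τ v'
        = c / P.s % P.q * (hasseMonomial u ((c / P.s % P.q : ℕ) : ZMod P.q) (c % P.s)).val
          + (if c % P.s = 0 then 0 else
            hasseMonomial u ((c / P.s % P.q : ℕ) : ZMod P.q) (c % P.s - 1)).val := by
      rw [AExp.eval, AExp.eval_sgn_mul h1Z, ei, AExp.eval_mul, ea, AExp.eval, eo, ha0]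
      · congr 1
        split_ifs with hi
        · simp
        · rw [AExp.eval, AExp.eval, eo, AExp.eval.eq_3, ha1 hi]
      · rw [ea, t5]
        have := Nat.mod_lt (c / P.s) hq
        omega
    refine AExp.eval_mod_field t0 ?_ ?_
    · rw [esum, t5]
      have g1 := ZMod.val_lt (hasseMonomial u ((c / P.s % P.q : ℕ) : ZMod P.q) (c % P.s))
      have g2 := ZMod.val_lt (if c % P.s = 0 then 0 else
            hasseMonomial u ((c / P.s % P.q : ℕ) : ZMod P.q) (c % P.s - 1))
      have g3 := Nat.mod_lt (c / P.s) hq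
      have g4 : (c / P.s % P.q + 1) *
          (hasseMonomial u ((c / P.s % P.q : ℕ) : ZMod P.q) (c % P.s)).val ≤ P.q * (P.q - 1) :=
        Nat.mul_le_mul g3 (by omega)
      have g5 : P.q * (P.q - 1) + P.q = P.q * P.q := by
        obtain ⟨k, hk⟩ := Nat.exists_eq_add_of_le' hq
        rw [hk, Nat.add_sub_cancel]; ring
      have g6 : P.q * P.q * 1 ≤ P.Z * P.q := Nat.mul_le_mul hqZ' hq
      rw [Nat.succ_mul] at g4
      omega
    · rw [esum, htab, hasseMonomial_succ]
      push_cast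
      simp

theorem HasData.of_table {P : RunParams} [Fact P.q.Prime] {len : ℕ → ℕ} {y : ℕ → ℕ → ZMod P.q}
    {R : ℕ → ℕ} {σ : Store} (h : HasParams P σ) (hlen : ∀ a < P.q, σ.arr 1 a = len a)
    (hsym : ∀ x < P.q * P.l, ∀ i < P.s, σ.arr 2 (x * P.s + i) = (y x i).val)
    (hrand : ∀ c < P.M * P.t, σ.arr 3 c = R c) : HasData P len y R
      (σ.fillArr 4 (P.N * (P.q * P.s)) fun c => (tableEntry P.q P.s c).val) := by
  refine ⟨h, ?_, ?_, ?_, ?_⟩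
  · rwa [Store.fillArr_arr_of_ne _ _ _ _ (by decide)]
  · rwa [Store.fillArr_arr_of_ne _ _ _ _ (by decide)]
  · rwa [Store.fillArr_arr_of_ne _ _ _ _ (by decide)]
  · intro u hu a ha i hi
    have e1 : ((u * P.q + a) * P.s + i) / P.s = u * P.q + a := by
      rw [mul_comm, Nat.mul_add_div (by omega), Nat.div_eq_of_lt hi, add_zero]
    have e2 : ((u * P.q + a) * P.s + i) % P.s = i := by
      rw [mul_comm, Nat.mul_add_mod, Nat.mod_eq_of_lt hi]
    have e3 : (u * P.q + a) / P.q = u := by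
      rw [mul_comm, Nat.mul_add_div (by omega), Nat.div_eq_of_lt ha, add_zero]
    have e4 : (u * P.q + a) % P.q = a := by
      rw [mul_comm, Nat.mul_add_mod, Nat.mod_eq_of_lt ha]
    rw [Store.fillArr_arr, if_pos, tableEntry, e1, e2, e3, e4, hasseMonomial]
    refine ⟨rfl, ?_⟩
    calc (u * P.q + a) * P.s + i < (u * P.q + a + 1) * P.s := by rw [Nat.succ_mul]; omega
      _ ≤ (u + 1) * P.q * P.s := Nat.mul_le_mul_right _ (by rw [Nat.succ_mul]; omega)
      _ = (u + 1) * (P.q * P.s) := by ring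
      _ ≤ _ := Nat.mul_le_mul_right _ hu

/-! ### The solution space -/

/-- Store the identity matrix in array `G`. -/
def Cmd.identity (n nn G : ℕ) : Cmd :=
  fill 10 nn G (.sub (.lit 1) (.dist (.div 5 (.var 10) (.reg n)) (.mod (.var 10) (.reg n))))

theorem Cmd.exec_identity {q n nn G k : ℕ} [Fact q.Prime] {σ : Store} {v : ℕ → ℕ} (hn : σ.reg n = k)
    (hnn : σ.reg nn = k * k) (h5 : k ≤ σ.reg 5) : (Cmd.identity n nn G).exec v σ
      = σ.fillArr G (k * k) fun c => (if c / k = c % k then 1 else 0 : ZMod q).val := by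
  rw [identity, exec_fill (fun c => (if c / k = c % k then 1 else 0 : ZMod q).val), hnn]
  intro c hc
  rw [hnn] at hc
  have hk : 0 < k := by
    rcases Nat.eq_zero_or_pos k with rfl | h
    · simp at hc
    · exact h
  set τ := σ.fillArr G c fun c => (if c / k = c % k then 1 else 0 : ZMod q).val
  have ec : (AExp.var 10).eval τ (Function.update v 10 c) = c := by simp [AExp.eval]
  have tn : τ.reg n = k := hn
  have t5 : k ≤ τ.reg 5 := h5
  have hdiv : c / k < k := by rwa [Nat.div_lt_iff_lt_mul hk]
  have ed : (AExp.div 5 (.var 10) (.reg n)).eval τ (Function.update v 10 c) = c / k := by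
    rw [eval_div_reg, ec, tn] <;> rw [tn]
    · exact hk
    · rw [ec]; omega
  have em : (AExp.mod (.var 10) (.reg n)).eval τ (Function.update v 10 c) = c % k := by
    rw [eval_mod_reg, ec, tn] <;> rw [tn]
    · exact hk
    · rw [ec]; omega
  have hdist := AExp.eval_dist_eq_zero (σ := τ) (v := Function.update v 10 c)
    (a := .div 5 (.var 10) (.reg n)) (b := .mod (.var 10) (.reg n))
  rw [ed, em] at hdist
  rw [AExp.eval, show (AExp.lit 1).eval τ (Function.update v 10 c) = 1 from rfl]
  split_ifs with h
  · rw [hdist.mpr h, ZMod.val_one'' (Fact.out : q.Prime).one_lt.ne']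
  · have := mt hdist.mp h
    rw [ZMod.val_zero]
    omega

theorem span_rowsOf_identity {K : Type*} [Field K] (n : ℕ) : Submodule.span K (Set.range
    (rowsOf n fun c => if c / n = c % n then (1 : K) else 0)) = ⊤ := by
  rw [eq_top_iff, ← (Pi.basisFun K (Fin n)).span_eq]
  refine Submodule.span_mono ?_
  rintro _ ⟨i, rfl⟩
  refine ⟨i, ?_⟩
  funext u
  have hi : ((i : ℕ) * n + u) / n = i := by
    rw [mul_comm, Nat.mul_add_div (by have := i.2; omega), Nat.div_eq_of_lt u.2, add_zero]
  have hu : ((i : ℕ) * n + u) % n = u := by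
    rw [mul_comm, Nat.mul_add_mod, Nat.mod_eq_of_lt u.2]
  simp only [rowsOf, hi, hu, Pi.basisFun_apply, Pi.single_apply, Fin.ext_iff, eq_comm]

/-! ### Spaces of pairs of a polynomial and a scalar, and candidates. -/

section Spaces

variable {K : Type*} [Field K]

/-- The pairs of a polynomial of degree at most `d` and a scalar which solve the inhomogeneous
equations. -/
def IsPairSolution (N m d : ℕ) {n : ℕ} (S : Submodule K (Fin n → K)) (p : Fin (d + 2) → K) : Prop :=
  ∀ Q ∈ S, diffOp N m Q (polyOf p) (p (Fin.last _)) = 0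

theorem diffOp_eq_zero_of_mem_span {N m n : ℕ} {ι : Type*} {b : ι → Fin n → K} {P : K[X]} {l : K}
    (h : ∀ i, diffOp N m (b i) P l = 0) {Q : Fin n → K}
    (hQ : Q ∈ Submodule.span K (Set.range b)) : diffOp N m Q P l = 0 := by
  have hlin : ∀ Q, diffOp N m Q P l
      = Fintype.linearCombination K (fun c : Fin n => opTerm N m c P l) Q := fun Q => by
    rw [Fintype.linearCombination_apply, diffOp]
  rw [hlin, ← LinearMap.mem_ker]
  refine Submodule.span_le.mpr ?_ hQ
  rintro _ ⟨i, rfl⟩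
  rw [SetLike.mem_coe, LinearMap.mem_ker, ← hlin, h]

/-- The forms `equationForm` for all operators in a family stored in a linear array. -/
def familyForm (N m d n : ℕ) (γ : ℕ → K) (j u : ℕ) : K :=
  if h : j / N < n then equationForm N m d (rowsOf n γ ⟨j / N, h⟩) (j % N) u else 0

/-- The degree bound reduces the vanishing of a polynomial to its coefficients below `N`, and by
linearity in the operator it suffices to treat a spanning family. -/
theorem familyForm_eq_zero_iff {N m d n : ℕ} (hm : 0 < m) (hN : N = d + m) {γ : ℕ → K}
    {p : Fin (d + 2) → K} : (∀ j < n * N, linForm (familyForm N m d n γ j) p = 0) ↔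
      IsPairSolution N m d (Submodule.span K (Set.range (rowsOf n γ))) p := by
  have key : ∀ ρ : Fin n, ∀ k < N, linForm (familyForm N m d n γ (ρ * N + k)) p
      = (diffOp N m (rowsOf n γ ρ) (polyOf p) (p (Fin.last _))).coeff k := by
    intro ρ k hk
    have h1 : (ρ * N + k) / N = ρ := by
      rw [mul_comm, Nat.mul_add_div (by omega), Nat.div_eq_of_lt hk, add_zero]
    have h2 : (ρ * N + k) % N = k := by
      rw [mul_comm, Nat.mul_add_mod, Nat.mod_eq_of_lt hk]
    rw [coeff_diffOp hk, linForm_apply]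
    refine Finset.sum_congr rfl fun u _ => ?_
    rw [familyForm, dif_pos (by rw [h1]; exact ρ.2)]
    simp only [h1, h2]
  constructor
  · intro h Q hQ
    refine diffOp_eq_zero_of_mem_span (fun ρ => ?_) hQ
    ext k
    rw [coeff_zero]
    rcases Nat.lt_or_ge k N with hk | hk
    · rw [← key ρ k hk]
      refine h _ ?_
      calc (ρ : ℕ) * N + k < (ρ + 1) * N := by rw [Nat.succ_mul]; omega
        _ ≤ n * N := Nat.mul_le_mul_right _ ρ.2
    · exact coeff_eq_zero_of_natDegree_lt
        ((natDegree_diffOp_lt hm hN _ (natDegree_polyOf_le p) _).trans_le hk)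
  · intro h j hj
    have hN' : 0 < N := by omega
    have hρ : j / N < n := by rwa [Nat.div_lt_iff_lt_mul hN']
    have h1 := key ⟨j / N, hρ⟩ (j % N) (Nat.mod_lt _ hN')
    rw [h _ (Submodule.subset_span ⟨_, rfl⟩), coeff_zero] at h1
    have h2 : j / N * N + j % N = j := by rw [mul_comm]; exact Nat.div_add_mod j N
    rwa [h2] at h1

/-- The candidates obtained from a family of pairs: all multiples of the first components. -/
noncomputable def candidate (q d : ℕ) (γ : ℕ → K) (c : ℕ) : K[X] :=
  if h : c / q < d + 2 then ((c % q : ℕ) : K) • polyOf (rowsOf (d + 2) γ ⟨c / q, h⟩) else 0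

theorem natDegree_candidate_le (q d : ℕ) (γ : ℕ → K) (c : ℕ) :
    (candidate q d γ c).natDegree ≤ d := by
  rw [candidate]
  split_ifs
  · exact (natDegree_smul_le _ _).trans (natDegree_polyOf_le _)
  · simp

theorem coeff_candidate {q d : ℕ} {γ : ℕ → K} {c u : ℕ} (hc : c / q < d + 2) (hu : u ≤ d) :
    (candidate q d γ c).coeff u = ((c % q : ℕ) : K) * γ (c / q * (d + 2) + u) := by
  rw [candidate, dif_pos hc, coeff_smul, smul_eq_mul]
  congr 1
  exact coeff_polyOf _ ⟨u, by omega⟩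

end Spaces

/-- A family spanning the pairs which solve the equations and agree with the symbols `x` has an
isolated solution among its candidates. -/
theorem exists_candidate_eq {q s d l e r g N m b t : ℕ} [Fact q.Prime]
    (hp : DecoderParams q s d l e r g N m b t) {y : ℕ → ℕ → ZMod q} {P : (ZMod q)[X]}
    (hP : IsSolution s d l e y P) {x : Fin t → Fin (q * l)} (hx : Isolates s d l g r N m y P x)
    {γ : ℕ → ZMod q}
    (hγ : ∀ p, p ∈ Submodule.span (ZMod q) (Set.range (rowsOf (d + 2) γ)) ↔
      IsPairSolution N m d (interpolants q l g N m (N + r * m) y) p ∧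
      ∀ c, ∀ i < s, (hasseDeriv i (polyOf p)).eval (((x c : ℕ) / l : ℕ) : ZMod q)
        = p (Fin.last _) * y (x c) i) :
    ∃ c < (d + 2) * q, candidate q d γ c = P := by
  have hq := (Fact.out : q.Prime).pos
  have : NeZero q := ⟨hq.ne'⟩
  -- The vector of the pair `(P, 1)`. It lies in the span, so the family has a nonzero row.
  let p0 : Fin (d + 2) → ZMod q := fun u => if (u : ℕ) ≤ d then P.coeff u else 1
  have hlast : p0 (Fin.last _) = 1 := by simp [p0]
  have hpoly : polyOf p0 = P := by
    ext k
    rcases Nat.lt_or_ge d k with h | h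
    · rw [coeff_eq_zero_of_natDegree_lt ((natDegree_polyOf_le p0).trans_lt h),
        coeff_eq_zero_of_natDegree_lt (hP.1.trans_lt h)]
    · have := coeff_polyOf p0 ⟨k, by omega⟩
      simpa [p0, h] using this
  have hmem : p0 ∈ Submodule.span (ZMod q) (Set.range (rowsOf (d + 2) γ)) := by
    rw [hγ, IsPairSolution, hpoly, hlast]
    exact ⟨fun Q hQ => diffOp_eq_zero_of_isSolution hp hP hQ, fun c i hi => by
      rw [hx.1 c i hi, one_mul]⟩
  obtain ⟨ρ, hρ⟩ : ∃ ρ, rowsOf (d + 2) γ ρ ≠ 0 := by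
    by_contra! h0
    have h1 : Submodule.span (ZMod q) (Set.range (rowsOf (d + 2) γ)) = ⊥ := by
      rw [Submodule.span_eq_bot]
      rintro _ ⟨ρ, rfl⟩
      exact h0 ρ
    rw [h1, Submodule.mem_bot] at hmem
    rw [hmem] at hlast
    exact zero_ne_one hlast
  set p := rowsOf (d + 2) γ ρ with hpdef
  set z := p (Fin.last _) with hz
  obtain ⟨h1, h2⟩ := (hγ p).mp (Submodule.subset_span ⟨ρ, rfl⟩)
  -- The pair `p - z (P, 1)` has scalar zero, so its polynomial solves the homogeneous equations and
  -- vanishes to order `s` at the sampled points; isolation makes it zero.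
  have hline : polyOf p = z • P := by
    rw [← sub_eq_zero, ← Submodule.mem_bot (R := ZMod q), ← hx.2]
    refine ⟨⟨(natDegree_sub_le _ _).trans (max_le (natDegree_polyOf_le p)
      ((natDegree_smul_le _ _).trans hP.1)), fun Q hQ => ?_⟩, ?_⟩
    · have h3 := diffOp_add N m Q (polyOf p - z • P) (z • P) 0 z
      have h4 := diffOp_smul N m Q P 1 z
      rw [mul_one, diffOp_eq_zero_of_isSolution hp hP hQ, smul_zero] at h4
      rw [sub_add_cancel, zero_add, h1 Q hQ, h4, add_zero] at h3
      exact h3.symm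
    · rw [SetLike.mem_coe, Submodule.mem_iInf]
      intro c
      rw [LinearMap.mem_ker]
      ext i
      rw [jet_apply, map_sub, eval_sub, h2 c i i.2, map_smul, eval_smul, hx.1 c i i.2, smul_eq_mul,
        sub_self]
      rfl
  have hz0 : z ≠ 0 := by
    intro h0
    rw [h0, zero_smul] at hline
    apply hρ
    ext u
    rcases Nat.lt_or_ge d u with hu | hu
    · rw [show u = Fin.last _ by apply Fin.ext; simp; omega, ← hz, h0]
      rfl
    · have h3 := coeff_polyOf p ⟨u, by omega⟩
      rw [hline, coeff_zero] at h3
      exact h3.symm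
  -- All scalars of the field are tried on each row, so the inverse of `z` occurs without having to
  -- be computed.
  refine ⟨ρ * q + (z⁻¹).val, ?_, ?_⟩
  · have := ZMod.val_lt z⁻¹
    calc (ρ : ℕ) * q + (z⁻¹).val < (ρ + 1) * q := by rw [Nat.succ_mul]; omega
      _ ≤ _ := Nat.mul_le_mul_right _ ρ.2
  · have e1 : (ρ * q + (z⁻¹).val) / q = ρ := by
      rw [mul_comm, Nat.mul_add_div hq, Nat.div_eq_of_lt (ZMod.val_lt _), add_zero]
    have e2 : (ρ * q + (z⁻¹).val) % q = (z⁻¹).val := by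
      rw [mul_comm, Nat.mul_add_mod, Nat.mod_eq_of_lt (ZMod.val_lt _)]
    rw [candidate, dif_pos (by rw [e1]; exact ρ.2)]
    simp only [e1, e2, ZMod.natCast_zmod_val]
    rw [← hpdef, hline, smul_smul, inv_mul_cancel₀ hz0, one_smul]

/-! ### Testing candidates -/

section Test

variable {P : RunParams} [Fact P.q.Prime] {len : ℕ → ℕ} {y : ℕ → ℕ → ZMod P.q} {R : ℕ → ℕ}
  {σ : Store} {v : ℕ → ℕ}

theorem AExp.eval_sum_eq_zero {x n : ℕ} {a : AExp} : (AExp.sum x n a).eval σ v = 0 ↔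
    ∀ i < σ.reg n, a.eval σ (Function.update v x i) = 0 := by
  simp [AExp.eval, Finset.sum_eq_zero_iff]

theorem AExp.eval_one_sub {a : AExp} :
    (AExp.sub (.lit 1) a).eval σ v = if a.eval σ v = 0 then 1 else 0 := by
  simp only [AExp.eval]
  split_ifs <;> omega

theorem AExp.eval_lt_mul_one_sub_eq_zero {a b c : AExp} (h : 1 ≤ σ.reg 5) :
    (AExp.mul 5 (.lt a b) (.sub (.lit 1) c)).eval σ v = 0 ↔
      (a.eval σ v < b.eval σ v → c.eval σ v ≠ 0) := by
  rw [AExp.eval_lt_mul h, AExp.eval_one_sub]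
  split_ifs <;> simp_all

/-- The coordinate `var 19` of the encoding at `var 17` of the polynomial in array `11`. -/
def encodingExp : AExp :=
  .mod (.sum 20 15 (.mul 5 (.get 11 (.var 20)) (.hasse (.var 20) (.var 17) (.var 19)))) (.reg 0)

/-- The number of errors of the polynomial in array `11`. -/
def errorsExp : AExp :=
  .sum 17 0 (.sub (.lit 1) (.sum 18 3 (.mul 5 (.lt (.var 18) (.get 1 (.var 17)))
    (.sub (.lit 1) (.sum 19 1 (.dist encodingExp
      (.symbol (.add (.mul 5 (.var 17) (.reg 3)) (.var 18)) (.var 19))))))))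

/-- The symbols at `a` contain the derivatives of `f`. -/
def AgreesAt (P : RunParams) [Fact P.q.Prime] (len : ℕ → ℕ) (y : ℕ → ℕ → ZMod P.q)
    (f : (ZMod P.q)[X]) (a : ℕ) : Prop :=
  ∃ k < len a, ∀ i < P.s, (hasseDeriv i f).eval (a : ZMod P.q) = y (a * P.l + k) i

open Classical in
/-- The polynomials to be output. -/
def IsValid (P : RunParams) [Fact P.q.Prime] (len : ℕ → ℕ) (y : ℕ → ℕ → ZMod P.q)
    (f : (ZMod P.q)[X]) : Prop :=
  f.natDegree ≤ P.d ∧ ((Finset.range P.q).filter fun a => ¬ AgreesAt P len y f a).card ≤ P.e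

theorem eval_hasseDeriv_eq_sum {K : Type*} [Field K] {f : K[X]} {d : ℕ} (hf : f.natDegree ≤ d)
    (i : ℕ) (a : K) : (hasseDeriv i f).eval a
      = ∑ u ∈ Finset.range (d + 1), f.coeff u * hasseMonomial u a i := by
  conv_lhs => rw [f.as_sum_range' (d + 1) (by omega)]
  rw [map_sum, eval_finsetSum]
  refine Finset.sum_congr rfl fun u _ => ?_
  rw [hasseDeriv_monomial, eval_monomial, hasseMonomial]
  ring

theorem eval_encodingExp (hP : P.Fits) (h : HasData P len y R σ) {f : (ZMod P.q)[X]}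
    (hf : f.natDegree ≤ P.d) (hc : ∀ u ≤ P.d, σ.arr 11 u = (f.coeff u).val) {a i : ℕ}
    (ha : v 17 = a) (ha' : a < P.q) (hi : v 19 = i) (hi' : i < P.s) :
    encodingExp.eval σ v = ((hasseDeriv i f).eval (a : ZMod P.q)).val := by
  have : NeZero P.q := ⟨(Fact.out : P.q.Prime).pos.ne'⟩
  have h0 : σ.reg 0 = P.q := h.params 0 (by decide)
  have h5 : σ.reg 5 = P.Z := h.params 5 (by decide)
  have h15 : σ.reg 15 = P.d + 1 := h.params 15 (by decide)
  have hqZ : P.q * 1 ≤ P.q * P.q := Nat.mul_le_mul_left _ (by omega)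
  have hqZ' := hP.q_le
  have hblock := hP.block
  have hmpos := hP.m_pos
  have esum : (AExp.sum 20 15 (.mul 5 (.get 11 (.var 20))
      (.hasse (.var 20) (.var 17) (.var 19)))).eval σ v
      = ∑ u ∈ Finset.range (P.d + 1), (f.coeff u).val * (hasseMonomial u (a : ZMod P.q) i).val := by
    rw [AExp.eval, h15]
    refine Finset.sum_congr rfl fun u hu => ?_
    have hu := Finset.mem_range.mp hu
    have e1 : (AExp.get 11 (.var 20)).eval σ (Function.update v 20 u) = (f.coeff u).val := by
      simp only [AExp.eval, Function.update_self]
      exact hc u (by omega)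
    have := ZMod.val_lt (f.coeff u)
    rw [AExp.eval_mul (by rw [e1, h5]; omega), e1, eval_hasse hP h (u' := u) (a' := a) (i' := i)]
    · simp [AExp.eval]
    · simpa [AExp.eval] using ha
    · simpa [AExp.eval] using hi
    · omega
    · exact ha'
    · exact hi'
  refine AExp.eval_mod_field h0 ?_ ?_
  · rw [esum, h5]
    refine (mod_range (n := P.d + 1) (q := P.q) _ _ (by simp) fun u _ =>
      Nat.mul_le_mul (ZMod.val_lt _).le (ZMod.val_lt _).le).trans (Nat.mul_le_mul_right _ ?_)
    exact (Nat.mul_le_mul_right _ (by omega)).trans hP.n2q_le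
  · rw [esum, eval_hasseDeriv_eq_sum hf]
    simp

open Classical in
-- A sum of natural numbers vanishes if and only if all summands do, and `1 - x` tests for zero;
-- nesting the two expresses the alternating quantifiers of disagreement with a list.
theorem eval_errorsExp (hP : P.Fits) (h : HasData P len y R σ) (hl : ∀ a < P.q, len a ≤ P.l)
    {f : (ZMod P.q)[X]} (hf : f.natDegree ≤ P.d) (hc : ∀ u ≤ P.d, σ.arr 11 u = (f.coeff u).val) :
    errorsExp.eval σ v = ((Finset.range P.q).filter fun a => ¬ AgreesAt P len y f a).card := by
  have hq := (Fact.out : P.q.Prime).pos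
  have : NeZero P.q := ⟨hq.ne'⟩
  have h0 : σ.reg 0 = P.q := h.params 0 (by decide)
  have h1 : σ.reg 1 = P.s := h.params 1 (by decide)
  have h3 : σ.reg 3 = P.l := h.params 3 (by decide)
  have h5 : σ.reg 5 = P.Z := h.params 5 (by decide)
  have hqZ : P.q * 1 ≤ P.q * P.q := Nat.mul_le_mul_left _ (by omega)
  have hqZ' := hP.q_le
  rw [errorsExp, AExp.eval, h0, Finset.card_filter]
  refine Finset.sum_congr rfl fun a ha => ?_
  have ha := Finset.mem_range.mp ha
  rw [AExp.eval_one_sub]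
  refine if_congr ?_ rfl rfl
  rw [AExp.eval_sum_eq_zero, h3, AgreesAt]
  push Not
  have key : ∀ k < P.l, (AExp.mul 5 (.lt (.var 18) (.get 1 (.var 17)))
      (.sub (.lit 1) (.sum 19 1 (.dist encodingExp
      (.symbol (.add (.mul 5 (.var 17) (.reg 3)) (.var 18)) (.var 19)))))).eval σ
        (Function.update (Function.update v 17 a) 18 k) = 0 ↔
      (k < len a → ∃ i < P.s, (hasseDeriv i f).eval (a : ZMod P.q) ≠ y (a * P.l + k) i) := by
    intro k hk
    have e1 : (AExp.var 18).eval σ (Function.update (Function.update v 17 a) 18 k) = k := by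
      simp [AExp.eval]
    have e2 : (AExp.get 1 (.var 17)).eval σ (Function.update (Function.update v 17 a) 18 k)
        = len a := by
      simpa [AExp.eval] using h.len a ha
    rw [AExp.eval_lt_mul_one_sub_eq_zero (by omega), e1, e2, ne_eq, AExp.eval_sum_eq_zero, h1]
    have e3 : ∀ i < P.s, ((AExp.dist encodingExp (.symbol (.add (.mul 5 (.var 17) (.reg 3))
        (.var 18)) (.var 19))).eval σ
        (Function.update (Function.update (Function.update v 17 a) 18 k) 19 i) = 0 ↔
        (hasseDeriv i f).eval (a : ZMod P.q) = y (a * P.l + k) i) := by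
      intro i hi
      rw [AExp.eval_dist_eq_zero, eval_encodingExp hP h hf hc (a := a) (i := i) (by simp) ha
        (by simp) hi, eval_symbol hP h (x' := a * P.l + k) (i' := i), ZMod.val_injective _ |>.eq_iff]
      · have e4 : (AExp.mul 5 (.var 17) (.reg 3)).eval σ
            (Function.update (Function.update (Function.update v 17 a) 18 k) 19 i) = a * P.l := by
          rw [AExp.eval_mul] <;> simp [AExp.eval, h3, h5]
          omega
        rw [AExp.eval, e4]
        simp [AExp.eval]
      · simp [AExp.eval]
      · calc a * P.l + k < (a + 1) * P.l := by rw [Nat.succ_mul]; omega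
          _ ≤ _ := Nat.mul_le_mul_right _ ha
      · exact hi
    have e5 : (∀ i < P.s, (AExp.dist encodingExp (.symbol (.add (.mul 5 (.var 17) (.reg 3))
        (.var 18)) (.var 19))).eval σ
        (Function.update (Function.update (Function.update v 17 a) 18 k) 19 i) = 0) ↔
        ∀ i < P.s, (hasseDeriv i f).eval (a : ZMod P.q) = y (a * P.l + k) i :=
      forall₂_congr e3
    rw [e5]
    push Not
    rfl
  constructor
  · exact fun H k hk => (key k (hk.trans_le (hl a ha))).mp (H k (hk.trans_le (hl a ha))) hk
  · exact fun H k hk => (key k hk).mpr (H k)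

/-- Array `0` and register `27` hold a list of the elements of `S`. -/
def Collected {q : ℕ} (d : ℕ) (S : Set (ZMod q)[X]) (σ : Store) : Prop :=
  ∃ Ps : List (ZMod q)[X], Ps.Nodup ∧ (∀ f, f ∈ Ps ↔ f ∈ S) ∧ σ.reg 27 = Ps.length ∧
    ∀ (k : ℕ) (hk : k < Ps.length), ∀ j ≤ d, σ.arr 0 (k * (d + 1) + j) = (Ps[k].coeff j).val

/-- `0` if the polynomial in array `11` is not in the list of array `0`. -/
def repeatedExp : AExp :=
  .sum 17 14 (.mul 5 (.lt (.var 17) (.reg 27)) (.sub (.lit 1) (.sum 18 15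
    (.dist (.get 0 (.add (.mul 5 (.reg 15) (.var 17)) (.var 18))) (.get 11 (.var 18))))))

/-- The scan always runs over `M` positions, with a comparison cutting off the unused ones; it
reaches the whole list because its length is at most `M`. -/
theorem eval_repeatedExp (hP : P.Fits) (h : HasParams P σ) {f : (ZMod P.q)[X]}
    (hf : f.natDegree ≤ P.d) (hc : ∀ u ≤ P.d, σ.arr 11 u = (f.coeff u).val)
    {Ps : List (ZMod P.q)[X]} (hM : Ps.length ≤ P.M) (hlen : σ.reg 27 = Ps.length)
    (hdeg : ∀ g ∈ Ps, g.natDegree ≤ P.d) (hPs : ∀ (k : ℕ) (hk : k < Ps.length),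
      ∀ j ≤ P.d, σ.arr 0 (k * (P.d + 1) + j) = (Ps[k].coeff j).val) :
    repeatedExp.eval σ v = 0 ↔ f ∉ Ps := by
  have hq := (Fact.out : P.q.Prime).pos
  have : NeZero P.q := ⟨hq.ne'⟩
  have h5 : σ.reg 5 = P.Z := h 5 (by decide)
  have h14 : σ.reg 14 = P.M := h 14 (by decide)
  have h15 : σ.reg 15 = P.d + 1 := h 15 (by decide)
  have hn2 := hP.n2q_le
  have hn2' : (P.d + 2) * 1 ≤ (P.d + 2) * P.q := Nat.mul_le_mul_left _ hq
  rw [repeatedExp, AExp.eval_sum_eq_zero, h14, List.mem_iff_getElem]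
  push Not
  have key : ∀ k, (AExp.mul 5 (.lt (.var 17) (.reg 27)) (.sub (.lit 1) (.sum 18 15
      (.dist (.get 0 (.add (.mul 5 (.reg 15) (.var 17)) (.var 18))) (.get 11 (.var 18)))))).eval σ
      (Function.update v 17 k) = 0 ↔ ∀ hk : k < Ps.length, Ps[k] ≠ f := by
    intro k
    have e1 : (AExp.var 17).eval σ (Function.update v 17 k) = k := by simp [AExp.eval]
    have e2 : (AExp.reg 27).eval σ (Function.update v 17 k) = Ps.length := hlen
    rw [AExp.eval_lt_mul_one_sub_eq_zero (by omega), e1, e2, ne_eq, AExp.eval_sum_eq_zero, h15]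
    by_cases hk : k < Ps.length
    · have e3 : (∀ i < P.d + 1, (AExp.dist (.get 0 (.add (.mul 5 (.reg 15) (.var 17)) (.var 18)))
          (.get 11 (.var 18))).eval σ (Function.update (Function.update v 17 k) 18 i) = 0) ↔
          Ps[k] = f := by
        have e4 : ∀ i < P.d + 1, ((AExp.dist (.get 0 (.add (.mul 5 (.reg 15) (.var 17)) (.var 18)))
          (.get 11 (.var 18))).eval σ (Function.update (Function.update v 17 k) 18 i) = 0 ↔
          Ps[k].coeff i = f.coeff i) := by
          intro i hi
          have e5 : (AExp.mul 5 (.reg 15) (.var 17)).eval σ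
              (Function.update (Function.update v 17 k) 18 i) = k * (P.d + 1) := by
            rw [AExp.eval_mul] <;> simp [AExp.eval, h15, h5, mul_comm]
            omega
          rw [AExp.eval_dist_eq_zero]
          change σ.arr 0 ((AExp.mul 5 (.reg 15) (.var 17)).eval σ
            (Function.update (Function.update v 17 k) 18 i)
            + Function.update (Function.update v 17 k) 18 i 18)
            = σ.arr 11 (Function.update (Function.update v 17 k) 18 i 18) ↔ _
          rw [e5, Function.update_self, hPs k hk i (by omega), hc i (by omega),
            (ZMod.val_injective _).eq_iff]
        rw [forall₂_congr e4]
        constructor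
        · intro H
          ext i
          rcases Nat.lt_or_ge i (P.d + 1) with hi | hi
          · exact H i hi
          · rw [coeff_eq_zero_of_natDegree_lt ((hdeg _ (List.getElem_mem hk)).trans_lt hi),
              coeff_eq_zero_of_natDegree_lt (hf.trans_lt hi)]
        · rintro H i -
          rw [H]
      rw [e3]
    · simp [hk]
  constructor
  · exact fun H k hk => (key k).mp (H k (hk.trans_le hM)) hk
  · exact fun H k _ => (key k).mpr (H k)

end Test

namespace Cmd

/-- Append the polynomial in array `11` to the list in array `0`. -/
def append : Cmd :=
  .seq (.loop 17 15 (.put 0 (.add (.mul 5 (.reg 15) (.reg 27)) (.var 17)) (.get 11 (.var 17))))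
    (.set 27 (.add (.reg 27) (.lit 1)))

/-- Test the candidate `var 16` of the family in array `10`. -/
def tryCandidate : Cmd :=
  .seq (fill 17 15 11 (.mod (.mul 5 (.mod (.var 16) (.reg 0))
      (.get 10 (.add (.mul 5 (.div 5 (.var 16) (.reg 0)) (.reg 11)) (.var 17)))) (.reg 0)))
    (.ite (.mul 5 (.le errorsExp (.reg 4)) (.sub (.lit 1) repeatedExp)) append .skip)

/-- The trial with number `var 15`. -/
def trial : Cmd :=
  .seq (fill 10 20 10 (.get 9 (.var 10))) (.seq (constrain 22 11 20 10 trialExp)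
    (.loop 16 23 tryCandidate))

/-- The main part of the decoder. -/
def decode : Cmd :=
  .seq table (.seq (identity 10 18 8) (.seq (constrain 19 10 18 8 symbolExp)
    (.seq (identity 11 20 9) (.seq (constrain 21 11 20 9 equationExp)
    (.seq (.set 27 (.lit 0)) (.loop 15 14 trial))))))

theorem decode_ok : decode.ok (List.range 26) [] = true := by rfl

theorem exec_append {σ : Store} {v : ℕ → ℕ} {d c : ℕ} (h15 : σ.reg 15 = d + 1)
    (h5 : d + 1 ≤ σ.reg 5) (h27 : σ.reg 27 = c) : (append.exec v σ).reg 27 = c + 1 ∧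
      ∀ n, (append.exec v σ).arr 0 n
        = if c * (d + 1) ≤ n ∧ n < c * (d + 1) + (d + 1) then σ.arr 11 (n - c * (d + 1))
          else σ.arr 0 n := by
  have key : ∀ τ, τ = (Cmd.loop 17 15 (.put 0 (.add (.mul 5 (.reg 15) (.reg 27)) (.var 17))
      (.get 11 (.var 17)))).exec v σ → τ.reg = σ.reg ∧ τ.arr 11 = σ.arr 11 ∧ ∀ n, τ.arr 0 n
        = if c * (d + 1) ≤ n ∧ n < c * (d + 1) + (d + 1) then σ.arr 11 (n - c * (d + 1))
          else σ.arr 0 n := by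
    rintro _ rfl
    rw [exec, h15]
    refine iterUpTo_induct (fun i (τ : Store) => τ.reg = σ.reg ∧ τ.arr 11 = σ.arr 11 ∧ ∀ n, τ.arr 0 n
        = if c * (d + 1) ≤ n ∧ n < c * (d + 1) + i then σ.arr 11 (n - c * (d + 1))
          else σ.arr 0 n) ⟨rfl, rfl, fun n => by rw [if_neg (by omega)]⟩ ?_
    rintro i hi τ ⟨hr, h11, h0⟩
    have e : (AExp.add (.mul 5 (.reg 15) (.reg 27)) (.var 17)).eval τ (Function.update v 17 i)
        = c * (d + 1) + i := by
      rw [AExp.eval, AExp.eval_mul] <;> simp only [AExp.eval, hr]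
      · rw [h15, h27, Function.update_self, mul_comm]
      · omega
    refine ⟨hr, ?_, fun n => ?_⟩
    · simp only [exec, Store.setArr]
      rw [Function.update_of_ne (by decide), h11]
    · simp only [exec, Store.setArr, Function.update_self, e]
      rw [Function.update_apply, h0 n]
      simp only [AExp.eval, Function.update_self, h11]
      by_cases hn : n = c * (d + 1) + i
      · rw [if_pos hn, if_pos (by omega), hn, Nat.add_sub_cancel_left]
      · rw [if_neg hn]
        exact if_congr (by omega) rfl rfl
  obtain ⟨hr, -, h0⟩ := key _ rfl
  constructor
  · rw [append, exec, exec, Store.setReg_reg, if_pos rfl]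
    simp only [AExp.eval, hr, h27]
  · exact h0

end Cmd

/-! ### Effect of testing candidates, of a single trial, and of the whole decoder. -/

section Trial

variable {P : RunParams} [Fact P.q.Prime] {len : ℕ → ℕ} {y : ℕ → ℕ → ZMod P.q} {R : ℕ → ℕ}
  {σ : Store} {v : ℕ → ℕ}

theorem Collected.congr {q d : ℕ} {S : Set (ZMod q)[X]} {σ τ : Store} (h : Collected d S σ)
    (hr : τ.reg 27 = σ.reg 27) (ha : τ.arr 0 = σ.arr 0) : Collected d S τ := by
  obtain ⟨Ps, h1, h2, h3, h4⟩ := h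
  exact ⟨Ps, h1, h2, hr.trans h3, by rwa [ha]⟩

theorem Collected.append {q d : ℕ} {S : Set (ZMod q)[X]} (h : Collected d S σ)
    {f : (ZMod q)[X]} (hf : f ∉ S) (hc : ∀ u ≤ d, σ.arr 11 u = (f.coeff u).val)
    (h15 : σ.reg 15 = d + 1) (h5 : d + 1 ≤ σ.reg 5) :
    Collected d (insert f S) (Cmd.append.exec v σ) := by
  obtain ⟨Ps, h1, h2, h3, h4⟩ := h
  obtain ⟨hr, h0⟩ := Cmd.exec_append (v := v) h15 h5 h3
  refine ⟨Ps ++ [f], ?_, fun g => ?_, by simpa using hr, fun k hk j hj => ?_⟩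
  · rw [List.nodup_append]
    refine ⟨h1, by simp, ?_⟩
    rintro a ha b hb rfl
    rw [List.mem_singleton.mp hb] at ha
    exact hf ((h2 f).mp ha)
  · simp [h2, or_comm]
  · rw [h0]
    rw [List.length_append, List.length_singleton] at hk
    rcases Nat.lt_succ_iff_lt_or_eq.mp hk with hk' | rfl
    · have : (k + 1) * (d + 1) ≤ Ps.length * (d + 1) := Nat.mul_le_mul_right _ hk'
      rw [Nat.succ_mul] at this
      rw [if_neg (by omega), h4 k hk' j hj, List.getElem_append_left hk']
    · rw [if_pos (by omega), Nat.add_sub_cancel_left, hc j hj, List.getElem_append_right le_rfl]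
      simp

/-- Only valid polynomials not yet listed are appended. So the list stays free of repetitions, and
its length stays below the bound `M` on the number of valid polynomials, which the search for
repetitions relies on. -/
theorem exec_tryCandidate (hP : P.Fits) (h : HasData P len y R σ) (hl : ∀ a < P.q, len a ≤ P.l)
    (hM : ∀ F : Finset (ZMod P.q)[X], (∀ f ∈ F, IsValid P len y f) → F.card ≤ P.M)
    {γ : ℕ → ZMod P.q} (hγ : ∀ i < (P.d + 2) * (P.d + 2), σ.arr 10 i = (γ i).val)
    {S : Set (ZMod P.q)[X]} (hS : Collected P.d S σ) (hS' : ∀ f ∈ S, IsValid P len y f) {c : ℕ}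
    (hv : v 16 = c) (hc : c < (P.d + 2) * P.q) :
    Collected P.d (S ∪ {f | IsValid P len y f ∧ f = candidate P.q P.d γ c})
      (Cmd.tryCandidate.exec v σ) := by
  classical
  have hq := (Fact.out : P.q.Prime).pos
  have : NeZero P.q := ⟨hq.ne'⟩
  have h0 : σ.reg 0 = P.q := h.params 0 (by decide)
  have h4 : σ.reg 4 = P.e := h.params 4 (by decide)
  have h5 : σ.reg 5 = P.Z := h.params 5 (by decide)
  have h11 : σ.reg 11 = P.d + 2 := h.params 11 (by decide)
  have h15 : σ.reg 15 = P.d + 1 := h.params 15 (by decide)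
  have hqZ : P.q * 1 ≤ P.q * P.q := Nat.mul_le_mul_left _ (by omega)
  have hqZ' := hP.q_le
  have hn2 := hP.n2q_le
  have hn2' : (P.d + 2) * 1 ≤ (P.d + 2) * P.q := Nat.mul_le_mul_left _ hq
  set g := candidate P.q P.d γ c with hg
  have hdiv : c / P.q < P.d + 2 := by rwa [Nat.div_lt_iff_lt_mul hq]
  have hfill : (Cmd.fill 17 15 11 (.mod (.mul 5 (.mod (.var 16) (.reg 0))
      (.get 10 (.add (.mul 5 (.div 5 (.var 16) (.reg 0)) (.reg 11)) (.var 17))))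
      (.reg 0))).exec v σ = σ.fillArr 11 (P.d + 1) fun u => (g.coeff u).val := by
    rw [Cmd.exec_fill fun u => (g.coeff u).val, h15]
    intro u hu
    rw [h15] at hu
    set τ := σ.fillArr 11 u fun u => (g.coeff u).val
    set v' := Function.update v 17 u with hv'
    have t0 : τ.reg 0 = P.q := h0
    have t5 : τ.reg 5 = P.Z := h5
    have e16 : (AExp.var 16).eval τ v' = c := by
      simpa [AExp.eval, hv'] using hv
    have ed : (AExp.div 5 (.var 16) (.reg 0)).eval τ v' = c / P.q := by
      rw [eval_div_reg, e16, t0] <;> rw [t0]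
      · exact hq
      · rw [e16, t5]; omega
    have em : (AExp.mod (.var 16) (.reg 0)).eval τ v' = c % P.q := by
      rw [eval_mod_reg, e16, t0] <;> rw [t0]
      · exact hq
      · rw [e16, t5]; omega
    have hlt : c / P.q * (P.d + 2) + u < (P.d + 2) * (P.d + 2) := by
      calc c / P.q * (P.d + 2) + u < (c / P.q + 1) * (P.d + 2) := by rw [Nat.succ_mul]; omega
        _ ≤ _ := Nat.mul_le_mul_right _ hdiv
    have eget : (AExp.get 10 (.add (.mul 5 (.div 5 (.var 16) (.reg 0)) (.reg 11))
        (.var 17))).eval τ v' = (γ (c / P.q * (P.d + 2) + u)).val := by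
      have e1 : (AExp.mul 5 (.div 5 (.var 16) (.reg 0)) (.reg 11)).eval τ v'
          = c / P.q * (P.d + 2) := by
        rw [AExp.eval_mul, ed]
        · exact congrArg _ h11
        · rw [ed, t5]; omega
      have e2 : (AExp.var 17).eval τ v' = u := by simp [AExp.eval, hv']
      rw [AExp.eval, AExp.eval, e1, e2, Store.fillArr_arr_of_ne _ _ _ _ (by decide), hγ _ hlt]
    have hcm := Nat.mod_lt c hq
    have eprod : (AExp.mul 5 (.mod (.var 16) (.reg 0)) (.get 10 (.add (.mul 5 (.div 5 (.var 16)
        (.reg 0)) (.reg 11)) (.var 17)))).eval τ v'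
        = c % P.q * (γ (c / P.q * (P.d + 2) + u)).val := by
      rw [AExp.eval_mul, em, eget]
      rw [em, t5]; omega
    refine AExp.eval_mod_field t0 ?_ ?_
    · rw [eprod, t5]
      exact Nat.mul_le_mul (by omega) (ZMod.val_lt _).le
    · rw [eprod, hg, coeff_candidate hdiv (by omega)]
      simp
  rw [Cmd.tryCandidate, Cmd.exec, hfill]
  set τ := σ.fillArr 11 (P.d + 1) fun u => (g.coeff u).val with hτ
  have hτd : HasData P len y R τ := h.of_agree (fun _ _ => rfl) fun b hb => by
    rw [hτ, Store.fillArr_arr_of_ne _ _ _ _ (by rintro rfl; simp at hb)]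
  have hτS : Collected P.d S τ := hS.congr rfl (Store.fillArr_arr_of_ne _ _ _ _ (by decide))
  have hc11 : ∀ u ≤ P.d, τ.arr 11 u = (g.coeff u).val := fun u hu => by
    rw [hτ, Store.fillArr_arr, if_pos ⟨rfl, by omega⟩]
  have hgd : g.natDegree ≤ P.d := natDegree_candidate_le _ _ _ _
  have eerr := eval_errorsExp (v := v) hP hτd hl hgd hc11
  have hrep : repeatedExp.eval τ v = 0 ↔ g ∉ S := by
    obtain ⟨Ps, h1, h2, h3, h4⟩ := hτS
    rw [← h2 g]
    refine eval_repeatedExp hP hτd.params hgd hc11 ?_ h3 (fun f hf => (hS' f ((h2 f).mp hf)).1) h4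
    rw [← List.toFinset_card_of_nodup h1]
    exact hM _ fun f hf => hS' f ((h2 f).mp (List.mem_toFinset.mp hf))
  have hcond : (AExp.mul 5 (.le errorsExp (.reg 4)) (.sub (.lit 1) repeatedExp)).eval τ v ≠ 0 ↔
      IsValid P len y g ∧ g ∉ S := by
    have e4 : (AExp.reg 4).eval τ v = P.e := h4
    rw [AExp.eval_le_mul (by rw [hτ, Store.fillArr_reg, h5]; omega), AExp.eval_one_sub, eerr, e4,
      ← hrep, IsValid]
    split_ifs <;> simp_all
  rw [Cmd.exec]
  by_cases hval : IsValid P len y g ∧ g ∉ S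
  · rw [if_pos (hcond.mpr hval)]
    have : S ∪ {f | IsValid P len y f ∧ f = g} = insert g S := by
      ext f
      simp only [Set.mem_union, Set.mem_ofPred_eq, Set.mem_insert_iff]
      constructor
      · rintro (h | h)
        exacts [Or.inr h, Or.inl h.2]
      · rintro (rfl | h)
        exacts [Or.inr ⟨hval.1, rfl⟩, Or.inl h]
    rw [this]
    exact hτS.append hval.2 hc11 h15 (by rw [hτ, Store.fillArr_reg, h5]; omega)
  · rw [if_neg (by rwa [hcond])]
    have : S ∪ {f | IsValid P len y f ∧ f = g} = S := by
      ext f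
      simp only [Set.mem_union, Set.mem_ofPred_eq]
      constructor
      · rintro (h | ⟨h, rfl⟩)
        · exact h
        · by_contra h'
          exact hval ⟨h, h'⟩
      · exact Or.inl
    rw [this]
    exact hτS

theorem exec_loop_tryCandidate (hP : P.Fits) (h : HasData P len y R σ)
    (hl : ∀ a < P.q, len a ≤ P.l)
    (hM : ∀ F : Finset (ZMod P.q)[X], (∀ f ∈ F, IsValid P len y f) → F.card ≤ P.M)
    {γ : ℕ → ZMod P.q} (hγ : ∀ i < (P.d + 2) * (P.d + 2), σ.arr 10 i = (γ i).val)
    {S : Set (ZMod P.q)[X]} (hS : Collected P.d S σ) (hS' : ∀ f ∈ S, IsValid P len y f) :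
    Collected P.d (S ∪ {f | IsValid P len y f ∧ ∃ c < (P.d + 2) * P.q, f = candidate P.q P.d γ c})
      ((Cmd.loop 16 23 Cmd.tryCandidate).exec v σ) := by
  have h23 : σ.reg 23 = (P.d + 2) * P.q := h.params 23 (by decide)
  rw [Cmd.exec, h23]
  refine (iterUpTo_induct (fun j τ => (∀ x < 26, τ.reg x = σ.reg x) ∧
    (∀ b ∈ [1, 2, 3, 4, 10], τ.arr b = σ.arr b) ∧ Collected P.d
      (S ∪ {f | IsValid P len y f ∧ ∃ c < j, f = candidate P.q P.d γ c}) τ)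
    ⟨fun _ _ => rfl, fun _ _ => rfl, ?_⟩ ?_).2.2
  · convert hS using 1
    simp
  · rintro j hj τ ⟨hr, ha, hτ⟩
    refine ⟨fun x hx => ?_, fun b hb => ?_, ?_⟩
    · rw [Cmd.exec_reg_of_notMem _ (by
        simp [Cmd.sets, Cmd.tryCandidate, Cmd.fill, Cmd.append]; omega), hr x hx]
    · rw [Cmd.exec_arr_of_notMem _ (by
        simp [Cmd.writes, Cmd.tryCandidate, Cmd.fill, Cmd.append]
        constructor <;> (rintro rfl; simp at hb)), ha b hb]
    · have := exec_tryCandidate (v := Function.update v 16 j) hP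
        (h.of_agree hr fun b hb => ha b (by simp at hb ⊢; omega)) hl hM (γ := γ)
        (by rw [ha 10 (by simp)]; exact hγ) hτ ?_ (c := j) (by simp) hj
      · convert this using 1
        ext f
        simp only [Set.mem_union, Set.mem_ofPred_eq, or_assoc]
        refine or_congr_right ?_
        constructor
        · rintro ⟨h1, c, hc, h2⟩
          rcases Nat.lt_succ_iff_lt_or_eq.mp hc with hc' | rfl
          exacts [Or.inl ⟨h1, c, hc', h2⟩, Or.inr ⟨h1, h2⟩]
        · rintro (⟨h1, c, hc, h2⟩ | ⟨h1, h2⟩)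
          exacts [⟨h1, c, by omega, h2⟩, ⟨h1, j, by omega, h2⟩]
      · rintro f (hf | hf)
        exacts [hS' f hf, hf.1]

/-- The output is complete up to unlucky random choices. -/
theorem exec_trial (hP : P.Fits) (h : HasData P len y R σ) (hl : ∀ a < P.q, len a ≤ P.l)
    (hR : ∀ c < P.M * P.t, R c < P.q * P.l)
    (hM : ∀ F : Finset (ZMod P.q)[X], (∀ f ∈ F, IsValid P len y f) → F.card ≤ P.M)
    {γ : ℕ → ZMod P.q} (hγ : ∀ i < (P.d + 2) * (P.d + 2), σ.arr 9 i = (γ i).val)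
    {S : Set (ZMod P.q)[X]} (hS : Collected P.d S σ) (hS' : ∀ f ∈ S, IsValid P len y f) {j : ℕ}
    (hv : v 15 = j) (hj : j < P.M) :
    ∃ γ' : ℕ → ZMod P.q, (∀ p, p ∈ Submodule.span (ZMod P.q) (Set.range (rowsOf (P.d + 2) γ')) ↔
        p ∈ Submodule.span (ZMod P.q) (Set.range (rowsOf (P.d + 2) γ)) ∧
        ∀ k < P.t * P.s,
          linForm (agreeForm P.d P.l y (R (j * P.t + k / P.s)) (k % P.s)) p = 0) ∧
      Collected P.d
        (S ∪ {f | IsValid P len y f ∧ ∃ c < (P.d + 2) * P.q, f = candidate P.q P.d γ' c})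
        (Cmd.trial.exec v σ) := by
  have h0 : σ.reg 0 = P.q := h.params 0 (by decide)
  have h5 : σ.reg 5 = P.Z := h.params 5 (by decide)
  have h11 : σ.reg 11 = P.d + 2 := h.params 11 (by decide)
  have h20 : σ.reg 20 = (P.d + 2) * (P.d + 2) := h.params 20 (by decide)
  have h22 : σ.reg 22 = P.t * P.s := h.params 22 (by decide)
  -- Each trial works on a copy in array `10`, so the family in array `9` is intact for the next
  -- one.
  have hfill : (Cmd.fill 10 20 10 (.get 9 (.var 10))).exec v σ
      = σ.fillArr 10 ((P.d + 2) * (P.d + 2)) fun i => σ.arr 9 i := by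
    rw [Cmd.exec_fill fun i => σ.arr 9 i, h20]
    intro i _
    simp [AExp.eval, Store.fillArr_arr_of_ne]
  set τ := σ.fillArr 10 ((P.d + 2) * (P.d + 2)) fun i => σ.arr 9 i with hτ
  have hτa : ∀ b, b ≠ 10 → τ.arr b = σ.arr b := fun b hb =>
    Store.fillArr_arr_of_ne _ _ _ _ hb
  obtain ⟨γ', h1, h2⟩ := Cmd.exec_constrain (σ := τ) (v := v) (e := trialExp) (c := 22) (n := 11)
    (nn := 20) (G := 10)
    (Φ := fun k => agreeForm P.d P.l y (R (j * P.t + k / P.s)) (k % P.s)) (γ := γ)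
    h0 h5 h11 h20 h22 (by decide) (by decide) (by decide) hP.n2q_le hP.n2_le
    (fun c hc => by rw [hτ, Store.fillArr_arr, if_pos ⟨rfl, hc⟩, hγ c hc]) (by
      intro k hk u hu τ' hr ha
      refine eval_trialExp hP (h.of_agree (fun x hx => ?_) fun b hb => ?_) hR (τ := j) ?_ hj
        ?_ hk ?_ hu
      · exact hr x (by omega) (by omega)
      · rw [ha b (by rintro h; simp at hb h; omega), hτa b (by simp at hb; omega)]
      · simpa using hv
      · simp
      · simp)
  refine ⟨γ', h2, ?_⟩
  rw [Cmd.trial, Cmd.exec, Cmd.exec, hfill]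
  refine exec_loop_tryCandidate hP (h.of_agree (fun x hx => ?_) fun b hb => ?_) hl hM h1
    (hS.congr ?_ ?_) hS'
  · rw [Cmd.exec_reg_of_notMem _ (by
      simp [Cmd.sets, Cmd.constrain, Cmd.fill, Cmd.eliminate]; omega)]
    rfl
  · rw [Cmd.exec_arr_of_notMem _ (by
      simp [Cmd.writes, Cmd.constrain, Cmd.fill, Cmd.eliminate]; simp at hb; omega),
      hτa b (by simp at hb; omega)]
  · rw [Cmd.exec_reg_of_notMem _ (by simp [Cmd.sets, Cmd.constrain, Cmd.fill, Cmd.eliminate])]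
    rfl
  · rw [Cmd.exec_arr_of_notMem _ (by simp [Cmd.writes, Cmd.constrain, Cmd.fill, Cmd.eliminate]),
      hτa 0 (by decide)]

end Trial

theorem IsValid.isSolution {P : RunParams} [Fact P.q.Prime] {len : ℕ → ℕ} {y : ℕ → ℕ → ZMod P.q}
    (hl : ∀ a < P.q, len a ≤ P.l) {f : (ZMod P.q)[X]} (hf : IsValid P len y f) :
    IsSolution P.s P.d P.l P.e y f := by
  classical
  have : NeZero P.q := ⟨(Fact.out : P.q.Prime).pos.ne'⟩
  refine ⟨hf.1, Finset.univ.filter fun a : ZMod P.q => AgreesAt P len y f a.val, ?_, fun a ha => ?_⟩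
  · have h1 := Finset.card_filter_add_card_filter_not (s := (Finset.univ : Finset (ZMod P.q)))
      (fun a : ZMod P.q => AgreesAt P len y f a.val)
    rw [Finset.card_univ, ZMod.card] at h1
    have h2 : (Finset.univ.filter fun a : ZMod P.q => ¬ AgreesAt P len y f a.val).card
        ≤ ((Finset.range P.q).filter fun a => ¬ AgreesAt P len y f a).card := by
      refine Finset.card_le_card_of_injOn ZMod.val (fun a ha => ?_)
        (ZMod.val_injective _).injOn
      simp only [Finset.coe_filter, Finset.mem_univ, true_and, Set.mem_ofPred_eq,
        Finset.mem_range] at ha ⊢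
      exact ⟨ZMod.val_lt a, ha⟩
    have h3 := hf.2
    omega
  · obtain ⟨k, hk, h⟩ := (Finset.mem_filter.mp ha).2
    refine ⟨k, hk.trans_le (hl _ (ZMod.val_lt a)), fun i hi => ?_⟩
    rw [← h i hi, ZMod.natCast_zmod_val]

/-- Soundness holds for every tape, since each polynomial is tested before it is listed.
Completeness is asserted only for those polynomials that are isolated by one of the `M` blocks of
the tape. -/
theorem exec_decode {P : RunParams} [Fact P.q.Prime] {b : ℕ}
    (hp : DecoderParams P.q P.s P.d P.l P.e P.r P.g P.N P.m b P.t) (hP : P.Fits) {len : ℕ → ℕ}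
    {y : ℕ → ℕ → ZMod P.q} {R : ℕ → ℕ} {σ : Store} {v : ℕ → ℕ} (h : HasParams P σ)
    (hlen : ∀ a < P.q, σ.arr 1 a = len a)
    (hsym : ∀ x < P.q * P.l, ∀ i < P.s, σ.arr 2 (x * P.s + i) = (y x i).val)
    (hrand : ∀ c < P.M * P.t, σ.arr 3 c = R c) (hl : ∀ a < P.q, len a ≤ P.l)
    (hR : ∀ c < P.M * P.t, R c < P.q * P.l)
    (hM : ∀ F : Finset (ZMod P.q)[X], (∀ f ∈ F, IsValid P len y f) → F.card ≤ P.M) :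
    ∃ S : Set (ZMod P.q)[X], Collected P.d S (Cmd.decode.exec v σ) ∧ (∀ f ∈ S, IsValid P len y f) ∧
      ∀ f, IsValid P len y f → ∀ j < P.M, ∀ x : Fin P.t → Fin (P.q * P.l),
        (∀ c, (x c : ℕ) = R (j * P.t + c)) → Isolates P.s P.d P.l P.g P.r P.N P.m y f x →
        f ∈ S := by
  have hn1 : (P.N + P.r * P.m) * 1 ≤ (P.N + P.r * P.m) * (P.N + P.r * P.m) :=
    Nat.mul_le_mul_left _ (by have := hP.N_pos; omega)
  have hn1Z := hP.n1_le
  have hn2 : (P.d + 2) * 1 ≤ (P.d + 2) * (P.d + 2) := Nat.mul_le_mul_left _ (by omega)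
  have hn2Z := hP.n2_le
  -- the table
  set σ1 := Cmd.table.exec v σ with hσ1
  have d1 : HasData P len y R σ1 := by
    rw [hσ1, Cmd.exec_table hP h]
    exact HasData.of_table h hlen hsym hrand
  -- the interpolants
  set σ2 := (Cmd.identity 10 18 8).exec v σ1 with hσ2
  have e2 := Cmd.exec_identity (q := P.q) (G := 8) (v := v) (k := P.N + P.r * P.m) (d1.params 10 (by decide))
    (d1.params 18 (by decide)) (by have : σ1.reg 5 = P.Z := d1.params 5 (by decide); omega)
  have d2 : HasData P len y R σ2 := d1.of_agree
    (fun x _ => by rw [hσ2, Cmd.exec_reg_of_notMem _ (by simp [Cmd.sets, Cmd.identity, Cmd.fill])])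
    fun b hb => by
      rw [hσ2, Cmd.exec_arr_of_notMem _ (by
        simp [Cmd.writes, Cmd.identity, Cmd.fill]; simp at hb; omega)]
  obtain ⟨γ1, a3, s3⟩ := Cmd.exec_constrain (σ := σ2) (v := v) (e := symbolExp) (c := 19) (n := 10)
    (k := P.N + P.r * P.m) (C := P.q * P.l * P.g) (Z := P.Z)
    (nn := 18) (G := 8) (γ := fun c => if c / (P.N + P.r * P.m) = c % (P.N + P.r * P.m) then 1 else 0)
    (Φ := fun k => symbolForm P.N P.m ((k / P.g / P.l : ℕ) : ZMod P.q) (y (k / P.g)) (k % P.g))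
    (d2.params 0 (by decide)) (d2.params 5 (by decide)) (d2.params 10 (by decide))
    (d2.params 18 (by decide)) (d2.params 19 (by decide)) (by decide) (by decide) (by decide)
    hP.n1q_le hP.n1_le
    (fun c hc => by
      rw [hσ2, e2, Store.fillArr_arr]
      exact if_pos ⟨rfl, hc⟩)
    (fun k hk u hu τ hr ha => eval_symbolExp hP (d2.of_agree (fun x hx => hr x (by omega) (by omega))
      fun b hb => ha b (by rintro h; simp at hb h; omega)) (by simp) (by simp) hk hu)
  set σ3 := (Cmd.constrain 19 10 18 8 symbolExp).exec v σ2 with hσ3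
  have s3' : Submodule.span (ZMod P.q) (Set.range (rowsOf (P.N + P.r * P.m) γ1))
      = interpolants P.q P.l P.g P.N P.m (P.N + P.r * P.m) y := by
    ext Q
    refine (s3 Q).trans ?_
    rw [mem_interpolants]
    have ht := span_rowsOf_identity (K := ZMod P.q) (P.N + P.r * P.m)
    constructor
    · rintro ⟨-, H⟩ x hx j hj
      have h1 : (x * P.g + j) / P.g = x := by
        rw [mul_comm, Nat.mul_add_div (by omega), Nat.div_eq_of_lt hj, add_zero]
      have h2 : (x * P.g + j) % P.g = j := by
        rw [mul_comm, Nat.mul_add_mod, Nat.mod_eq_of_lt hj]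
      have := H (x * P.g + j) (by
        calc x * P.g + j < (x + 1) * P.g := by rw [Nat.succ_mul]; omega
          _ ≤ _ := Nat.mul_le_mul_right _ hx)
      rwa [h1, h2] at this
    · intro H
      refine ⟨by rw [ht]; trivial, fun k hk => ?_⟩
      exact H _ ((Nat.div_lt_iff_lt_mul hP.g_pos).mpr hk) _ (Nat.mod_lt _ hP.g_pos)
  have d3 : HasData P len y R σ3 := d2.of_agree
    (fun x hx => by
      rw [hσ3, Cmd.exec_reg_of_notMem _ (by
        simp [Cmd.sets, Cmd.constrain, Cmd.fill, Cmd.eliminate]; omega)])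
    fun b hb => by
      rw [hσ3, Cmd.exec_arr_of_notMem _ (by
        simp [Cmd.writes, Cmd.constrain, Cmd.fill, Cmd.eliminate]; simp at hb; omega)]
  -- the pairs solving the equations
  set σ4 := (Cmd.identity 11 20 9).exec v σ3 with hσ4
  have e4 := Cmd.exec_identity (q := P.q) (G := 9) (v := v) (k := P.d + 2) (d3.params 11 (by decide))
    (d3.params 20 (by decide)) (by have : σ3.reg 5 = P.Z := d3.params 5 (by decide); omega)
  have r4 : ∀ x, σ4.reg x = σ3.reg x := fun x => by
    rw [hσ4, Cmd.exec_reg_of_notMem _ (by simp [Cmd.sets, Cmd.identity, Cmd.fill])]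
  have w4 : ∀ b, b ≠ 9 → σ4.arr b = σ3.arr b := fun b hb => by
    rw [hσ4, Cmd.exec_arr_of_notMem _ (by simpa [Cmd.writes, Cmd.identity, Cmd.fill] using hb)]
  have d4 : HasData P len y R σ4 := d3.of_agree (fun x _ => r4 x) fun b hb =>
    w4 b (by simp at hb; omega)
  obtain ⟨γ2, a5, s5⟩ := Cmd.exec_constrain (σ := σ4) (v := v) (e := equationExp) (c := 21)
    (k := P.d + 2) (C := (P.N + P.r * P.m) * P.N) (Z := P.Z)
    (n := 11) (nn := 20) (G := 9)
    (γ := fun c => if c / (P.d + 2) = c % (P.d + 2) then 1 else 0)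
    (Φ := familyForm P.N P.m P.d (P.N + P.r * P.m) γ1)
    (d4.params 0 (by decide)) (d4.params 5 (by decide)) (d4.params 11 (by decide))
    (d4.params 20 (by decide)) (d4.params 21 (by decide)) (by decide) (by decide) (by decide)
    hP.n2q_le hP.n2_le
    (fun c hc => by
      rw [hσ4, e4, Store.fillArr_arr]
      exact if_pos ⟨rfl, hc⟩)
    (fun k hk u hu τ hr ha => by
      have hρ : k / P.N < P.N + P.r * P.m := (Nat.div_lt_iff_lt_mul hP.N_pos).mpr hk
      rw [familyForm, dif_pos hρ]
      exact eval_equationExp hP (d4.of_agree (fun x hx => hr x (by omega) (by omega))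
        fun b hb => ha b (by rintro h; simp at hb h; omega))
        (by
          rw [ha 8 (by decide), w4 8 (by decide)]
          exact a3) (by simp) (by simp) hu
        (k := k) (ρ := ⟨k / P.N, hρ⟩) (k' := k % P.N) (Nat.mod_lt _ hP.N_pos)
        (Nat.div_add_mod' k P.N).symm)
  set σ5 := (Cmd.constrain 21 11 20 9 equationExp).exec v σ4 with hσ5
  have s5' : ∀ p, p ∈ Submodule.span (ZMod P.q) (Set.range (rowsOf (P.d + 2) γ2)) ↔
      IsPairSolution P.N P.m P.d (interpolants P.q P.l P.g P.N P.m (P.N + P.r * P.m) y) p := by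
    intro p
    refine (s5 p).trans ?_
    rw [← s3', ← familyForm_eq_zero_iff hP.m_pos hP.block]
    have ht := span_rowsOf_identity (K := ZMod P.q) (P.d + 2)
    exact ⟨fun H => H.2, fun H => ⟨by rw [ht]; trivial, H⟩⟩
  have d5 : HasData P len y R σ5 := d4.of_agree
    (fun x hx => by
      rw [hσ5, Cmd.exec_reg_of_notMem _ (by
        simp [Cmd.sets, Cmd.constrain, Cmd.fill, Cmd.eliminate]; omega)])
    fun b hb => by
      rw [hσ5, Cmd.exec_arr_of_notMem _ (by
        simp [Cmd.writes, Cmd.constrain, Cmd.fill, Cmd.eliminate]; simp at hb; omega)]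
  -- the trials
  set σ6 := σ5.setReg 27 0 with hσ6
  have hexec : Cmd.decode.exec v σ = (Cmd.loop 15 14 Cmd.trial).exec v σ6 := rfl
  have h14 : σ6.reg 14 = P.M := d5.params 14 (by decide)
  rw [hexec, Cmd.exec, h14]
  have key := iterUpTo_induct (f := fun i τ => Cmd.trial.exec (Function.update v 15 i) τ)
    (n := P.M) (a := σ6) (fun j τ => (∀ x < 26, τ.reg x = σ5.reg x) ∧
    (∀ b ∈ [1, 2, 3, 4, 9], τ.arr b = σ5.arr b) ∧ ∃ S : Set (ZMod P.q)[X], Collected P.d S τ ∧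
      (∀ f ∈ S, IsValid P len y f) ∧ ∀ f, IsValid P len y f → ∀ i < j,
        ∀ x : Fin P.t → Fin (P.q * P.l), (∀ c, (x c : ℕ) = R (i * P.t + c)) →
        Isolates P.s P.d P.l P.g P.r P.N P.m y f x → f ∈ S) ⟨fun x hx => ?_, fun b hb => rfl, ∅,
        ⟨[], by simp, by simp, by simp [hσ6, Store.setReg_reg], by simp⟩, by simp, by simp⟩ ?_
  · exact key.2.2
  · rw [hσ6, Store.setReg_reg, if_neg (by omega)]
  · rintro j hj τ ⟨hr, ha, S, hS, hS', hall⟩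
    refine ⟨fun x hx => ?_, fun b hb => ?_, ?_⟩
    · rw [Cmd.exec_reg_of_notMem _ (by
        simp [Cmd.sets, Cmd.trial, Cmd.tryCandidate, Cmd.append, Cmd.constrain, Cmd.fill,
          Cmd.eliminate]; omega), hr x hx]
    · rw [Cmd.exec_arr_of_notMem _ (by
        simp [Cmd.writes, Cmd.trial, Cmd.tryCandidate, Cmd.append, Cmd.constrain, Cmd.fill,
          Cmd.eliminate]; simp at hb; omega), ha b hb]
    · obtain ⟨γ', hγ', hcol⟩ := exec_trial (v := Function.update v 15 j) hP
        (d5.of_agree hr fun b hb => ha b (by simp at hb ⊢; omega)) hl hR hM (γ := γ2)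
        (by rw [ha 9 (by simp)]; exact a5) hS hS' (j := j) (by simp) hj
      refine ⟨_, hcol, ?_, fun f hf i hi x hx hiso => ?_⟩
      · rintro f (hf | hf)
        exacts [hS' f hf, hf.1]
      · rcases Nat.lt_succ_iff_lt_or_eq.mp hi with hi' | rfl
        · exact Or.inl (hall f hf i hi' x hx hiso)
        · right
          -- The trial imposes `t * s` conditions numbered `c * s + k`; unpacking this index gives
          -- the agreement at all sampled symbols.
          obtain ⟨c, hc, hcand⟩ := exists_candidate_eq hp (hf.isSolution hl) hiso (γ := γ') (by
            intro p
            rw [hγ', s5']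
            refine and_congr_right fun _ => ?_
            constructor
            · intro H c k hk
              have e1 : (c * P.s + k) / P.s = c := by
                rw [mul_comm, Nat.mul_add_div hP.s_pos, Nat.div_eq_of_lt hk, add_zero]
              have e2 : (c * P.s + k) % P.s = k := by
                rw [mul_comm, Nat.mul_add_mod, Nat.mod_eq_of_lt hk]
              have := H (c * P.s + k) (by
                calc c * P.s + k < (c + 1) * P.s := by rw [Nat.succ_mul]; omega
                  _ ≤ _ := Nat.mul_le_mul_right _ c.2)
              rw [linForm_agreeForm, e1, e2, ← hx c, sub_eq_zero] at this
              exact this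
            · intro H k hk
              have hk' : k / P.s < P.t := (Nat.div_lt_iff_lt_mul hP.s_pos).mpr hk
              have := H ⟨k / P.s, hk'⟩ (k % P.s) (Nat.mod_lt _ hP.s_pos)
              rw [linForm_agreeForm, sub_eq_zero, ← hx ⟨k / P.s, hk'⟩]
              exact this)
          exact ⟨hf, c, hc, hcand.symm⟩

/-! ### Computation of the parameters -/

/-- The power of the content of register `0`. -/
def AExp.pow : ℕ → AExp
  | 0 => .lit 1
  | k + 1 => .mul 0 (.reg 0) (pow k)

theorem AExp.eval_pow (σ : Store) (v : ℕ → ℕ) (k : ℕ) : (AExp.pow k).eval σ v = σ.reg 0 ^ k := by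
  induction k with
  | zero => rfl
  | succ k ih => simp [AExp.pow, AExp.eval, ih, pow_succ']

/-- Several assignments. -/
def Cmd.assign : List (ℕ × AExp) → Cmd
  | [] => .skip
  | (x, a) :: l => .seq (.set x a) (assign l)

/-- The registers in `S` have the contents `f`. -/
def AgreesOn (f : ℕ → ℕ) (S : List ℕ) (σ : Store) : Prop := ∀ i ∈ S, σ.reg i = f i

/-- The assignments produce the contents `f`, when the registers in `S` have these contents. -/
def Cmd.Assigns (f : ℕ → ℕ) (v : ℕ → ℕ) : List ℕ → List (ℕ × AExp) → Prop
  | _, [] => True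
  | S, (x, a) :: l => (∀ σ, AgreesOn f S σ → a.eval σ v = f x) ∧ Assigns f v (x :: S) l

theorem Cmd.exec_assign {f v : ℕ → ℕ} : ∀ {l : List (ℕ × AExp)} {S : List ℕ} {σ : Store},
    AgreesOn f S σ → Assigns f v S l → AgreesOn f (l.map Prod.fst ++ S) ((assign l).exec v σ)
  | [], _, _, h, _ => h
  | (x, a) :: l, S, σ, h, ⟨h1, h2⟩ => by
    have h3 : AgreesOn f (x :: S) (σ.setReg x (a.eval σ v)) := by
      intro i hi
      rw [Store.setReg_reg]
      split_ifs with hix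
      · rw [hix, h1 σ h]
      · exact h i (by simpa [hix] using hi)
    intro i hi
    refine exec_assign h3 h2 i ?_
    simp only [List.map_cons, List.cons_append, List.mem_cons, List.mem_append] at hi ⊢
    tauto

namespace Cmd

/-- Compute the clamp. -/
def setClamp : Cmd := .set 5 (.pow 16)

/-- Leave in registers `29` and `30` the first `b` with `s < 2 ^ b`, and `2 ^ b`. -/
def setLength : Cmd :=
  .seq (.set 29 (.lit 0)) (.seq (.set 30 (.lit 1))
    (.loop 10 1 (.ite (.le (.reg 30) (.reg 1)) (.seq (.set 30 (.add (.reg 30) (.reg 30)))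
      (.set 29 (.add (.reg 29) (.lit 1)))) .skip)))

/-- The definitions of the parameters. -/
def paramDefs : List (ℕ × AExp) :=
  [(6, .div 5 (.sub (.mul 5 (.reg 1) (.reg 0)) (.reg 2)) (.mul 5 (.lit 4) (.reg 0))),
    (7, .sub (.add (.reg 1) (.lit 1)) (.reg 6)),
    (8, .mul 5 (.sub (.reg 0) (.reg 4)) (.reg 7)),
    (9, .sub (.reg 8) (.reg 2)),
    (10, .add (.reg 8) (.mul 5 (.reg 6) (.reg 9))),
    (11, .add (.reg 2) (.lit 2)),
    (12, .mul 5 (.reg 0) (.reg 3)),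
    (13, .mul 5 (.mul 5 (.lit 6) (.reg 1)) (.reg 29)),
    (15, .add (.reg 2) (.lit 1)),
    (16, .mul 5 (.reg 12) (.reg 1)),
    (17, .mul 5 (.reg 8) (.mul 5 (.reg 0) (.reg 1))),
    (18, .mul 5 (.reg 10) (.reg 10)),
    (19, .mul 5 (.reg 12) (.reg 7)),
    (20, .mul 5 (.reg 11) (.reg 11)),
    (21, .mul 5 (.reg 10) (.reg 8)),
    (22, .mul 5 (.reg 13) (.reg 1)),
    (23, .mul 5 (.reg 11) (.reg 0)),
    (25, .sub (.reg 12) (.lit 1))]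

/-- Compute the number of trials. -/
def setTrials : Cmd :=
  .seq (.set 30 (.lit 1)) (.seq (.loop 10 13 (.set 30 (.mul 3 (.reg 3) (.reg 30))))
    (assign [(14, .mul 5 (.reg 5) (.reg 30)), (24, .mul 13 (.reg 13) (.reg 14))]))

/-- Copy the symbols. -/
def copyInput : Cmd := fill 10 16 2 (.get 0 (.var 10))

theorem setClamp_ok : setClamp.ok [0] [] = true := rfl

theorem params_ok : (Cmd.seq setLength (assign paramDefs)).ok (List.range 6) [] = true := rfl

theorem setTrials_ok : setTrials.ok [3, 5, 13] [] = true := rfl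

theorem copyInput_ok : copyInput.ok [16] [] = true := rfl

/-- Doubling stops at the first power above `s`, whence `2 ^ b ≤ 2 s`; as `s < 2 ^ s`, a loop of `s`
rounds is long enough. -/
theorem exec_setLength {σ : Store} {v : ℕ → ℕ} (hs : 0 < σ.reg 1) : ∃ b, σ.reg 1 < 2 ^ b ∧
    2 ^ b ≤ 2 * σ.reg 1 ∧ (setLength.exec v σ).reg 29 = b := by
  have key := iterUpTo_induct (f := fun i τ => (Cmd.ite (.le (.reg 30) (.reg 1))
    (.seq (.set 30 (.add (.reg 30) (.reg 30))) (.set 29 (.add (.reg 29) (.lit 1)))) .skip).exec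
      (Function.update v 10 i) τ) (n := σ.reg 1) (a := (σ.setReg 29 0).setReg 30 1)
    (fun i τ => τ.reg 1 = σ.reg 1 ∧ ∃ b, τ.reg 29 = b ∧ τ.reg 30 = 2 ^ b ∧
      2 ^ b ≤ 2 * σ.reg 1 ∧ (σ.reg 1 < 2 ^ b ∨ b = i)) ?_ ?_
  · obtain ⟨-, b, h1, -, h2, h3⟩ := key
    refine ⟨b, ?_, h2, h1⟩
    rcases h3 with h3 | rfl
    exacts [h3, Nat.lt_two_pow_self]
  · refine ⟨by simp [Store.setReg_reg], 0, by simp [Store.setReg_reg], by simp [Store.setReg_reg],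
      by simp; omega, Or.inr rfl⟩
  · rintro i hi τ ⟨h1, b, h29, h30, h2, h3⟩
    have e30 : (AExp.reg 30).eval τ (Function.update v 10 i) = 2 ^ b := h30
    have e1 : (AExp.reg 1).eval τ (Function.update v 10 i) = σ.reg 1 := h1
    simp only [exec, AExp.eval_le, e30, e1]
    by_cases hb : 2 ^ b ≤ σ.reg 1
    · rw [if_pos hb, if_pos one_ne_zero]
      refine ⟨by simp [Store.setReg_reg, h1], b + 1, by simp [Store.setReg_reg, AExp.eval, h29],
        ?_, by rw [pow_succ]; omega, Or.inr ?_⟩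
      · simp [Store.setReg_reg, AExp.eval, h30]
        ring
      · rcases h3 with h3 | h3 <;> omega
    · rw [if_neg hb, if_neg (by simp)]
      exact ⟨h1, b, h29, h30, h2, Or.inl (by omega)⟩

/-- Each definition only uses earlier ones. The clamp by register `5` has no effect, as all first
factors are at most `Z`; most of the work below is to bring these bounds into linear form. -/
theorem assigns_paramDefs {P : RunParams} [Fact P.q.Prime] {b : ℕ} {v : ℕ → ℕ}
    (hp : DecoderParams P.q P.s P.d P.l P.e P.r P.g P.N P.m b P.t) (hP : P.Fits)
    (hr : P.r = (P.s * P.q - P.d) / (4 * P.q)) :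
    Assigns (fun i => if i = 29 then b else P.val i) v [0, 1, 2, 3, 4, 5, 29] paramDefs := by
  have hq := (Fact.out : P.q.Prime).pos
  have hqq : P.q * 1 ≤ P.q * P.q := Nat.mul_le_mul_left _ hq
  have h1 := hP.q_le
  have h2 := hP.Nq_le
  have h3 := hP.inp_le
  have h4 := hP.n1_le
  have h5 := hP.n2_le
  have h6 := hP.t_le
  have hspos := hP.s_pos
  have hNpos := hP.N_pos
  have hqs : 1 * (P.q * P.s) ≤ P.N * (P.q * P.s) := Nat.mul_le_mul_right _ hNpos
  have hss : P.s * 1 ≤ P.s * P.q := Nat.mul_le_mul_left _ hq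
  have hcomm : P.s * P.q = P.q * P.s := mul_comm _ _
  have hN' : P.N * 1 ≤ P.N * (P.q * P.s) := Nat.mul_le_mul_left _ (Nat.mul_pos hq hspos)
  have hql : P.q * P.l * 1 ≤ P.q * P.l * P.s := Nat.mul_le_mul_left _ hspos
  have hn1 : (P.N + P.r * P.m) * 1 ≤ (P.N + P.r * P.m) * (P.N + P.r * P.m) :=
    Nat.mul_le_mul_left _ (by omega)
  have hn2 : (P.d + 2) * 1 ≤ (P.d + 2) * (P.d + 2) := Nat.mul_le_mul_left _ (by omega)
  have ht : P.t * 1 ≤ P.t * P.s := Nat.mul_le_mul_left _ hspos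
  have hlen := hp.length
  have h6s : 6 * P.s * 1 ≤ 6 * P.s * b := Nat.mul_le_mul_left _ hp.b_pos
  have hrle := hp.r_le
  have hblock := hP.block
  have horder := hP.order
  have htot := hp.total
  refine ⟨fun σ hσ => ?_, fun σ hσ => ?_, fun σ hσ => ?_, fun σ hσ => ?_, fun σ hσ => ?_,
    fun σ hσ => ?_, fun σ hσ => ?_, fun σ hσ => ?_, fun σ hσ => ?_, fun σ hσ => ?_,
    fun σ hσ => ?_, fun σ hσ => ?_, fun σ hσ => ?_, fun σ hσ => ?_, fun σ hσ => ?_,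
    fun σ hσ => ?_, fun σ hσ => ?_, fun σ hσ => ?_, trivial⟩ <;>
  have r0 : σ.reg 0 = P.q := hσ 0 (by decide) <;>
  have r1 : σ.reg 1 = P.s := hσ 1 (by decide) <;>
  have r2 : σ.reg 2 = P.d := hσ 2 (by decide) <;>
  have r3 : σ.reg 3 = P.l := hσ 3 (by decide) <;>
  have r4 : σ.reg 4 = P.e := hσ 4 (by decide) <;>
  have r5 : σ.reg 5 = P.Z := hσ 5 (by decide)
  · have e1 : (AExp.sub (.mul 5 (.reg 1) (.reg 0)) (.reg 2)).eval σ v = P.s * P.q - P.d := by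
      simp only [AExp.eval, r0, r1, r2, r5]
      rw [min_eq_left (by omega)]
    have e2 : (AExp.mul 5 (.lit 4) (.reg 0)).eval σ v = 4 * P.q := by
      simp only [AExp.eval, r0, r5]
      rw [min_eq_left (by omega)]
    have hle : (P.s * P.q - P.d) / (4 * P.q) ≤ P.s * P.q - P.d := Nat.div_le_self _ _
    rw [AExp.eval_div, e1, e2]
    · exact hr.symm
    · rw [e2]; omega
    · rw [e1, e2, r5]; omega
  · have r6 : σ.reg 6 = P.r := hσ 6 (by decide)
    simp only [AExp.eval, r1, r6]
    change _ = P.g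
    omega
  · have r7 : σ.reg 7 = P.g := hσ 7 (by decide)
    simp only [AExp.eval, r0, r4, r5, r7]
    rw [min_eq_left (by omega)]
    exact htot.symm
  · have r8 : σ.reg 8 = P.N := hσ 8 (by decide)
    simp only [AExp.eval, r2, r8]
    change _ = P.m
    omega
  · have r6 : σ.reg 6 = P.r := hσ 6 (by decide)
    have r8 : σ.reg 8 = P.N := hσ 8 (by decide)
    have r9 : σ.reg 9 = P.m := hσ 9 (by decide)
    simp only [AExp.eval, r5, r6, r8, r9]
    rw [min_eq_left (by omega)]
    rfl
  · simp only [AExp.eval, r2]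
    rfl
  · simp only [AExp.eval, r0, r3, r5]
    rw [min_eq_left (by omega)]
    rfl
  · have r29 : σ.reg 29 = b := hσ 29 (by decide)
    simp only [AExp.eval, r1, r5, r29]
    rw [min_eq_left (by omega : 6 ≤ P.Z), min_eq_left (by omega)]
    exact hlen.symm
  · simp only [AExp.eval, r2]
    rfl
  · have r12 : σ.reg 12 = P.q * P.l := hσ 12 (by decide)
    simp only [AExp.eval, r1, r5, r12]
    rw [min_eq_left (by omega)]
    rfl
  · have r8 : σ.reg 8 = P.N := hσ 8 (by decide)
    simp only [AExp.eval, r0, r1, r5, r8]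
    rw [min_eq_left (by omega : P.q ≤ P.Z), min_eq_left (by omega)]
    rfl
  · have r10 : σ.reg 10 = P.N + P.r * P.m := hσ 10 (by decide)
    simp only [AExp.eval, r5, r10]
    rw [min_eq_left (by omega)]
    rfl
  · have r7 : σ.reg 7 = P.g := hσ 7 (by decide)
    have r12 : σ.reg 12 = P.q * P.l := hσ 12 (by decide)
    simp only [AExp.eval, r5, r7, r12]
    rw [min_eq_left (by omega)]
    rfl
  · have r11 : σ.reg 11 = P.d + 2 := hσ 11 (by decide)
    simp only [AExp.eval, r5, r11]
    rw [min_eq_left (by omega)]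
    rfl
  · have r8 : σ.reg 8 = P.N := hσ 8 (by decide)
    have r10 : σ.reg 10 = P.N + P.r * P.m := hσ 10 (by decide)
    simp only [AExp.eval, r5, r8, r10]
    rw [min_eq_left (by omega)]
    rfl
  · have r13 : σ.reg 13 = P.t := hσ 13 (by decide)
    simp only [AExp.eval, r1, r5, r13]
    rw [min_eq_left (by omega)]
    rfl
  · have r11 : σ.reg 11 = P.d + 2 := hσ 11 (by decide)
    simp only [AExp.eval, r0, r5, r11]
    rw [min_eq_left (by omega)]
    rfl
  · have r12 : σ.reg 12 = P.q * P.l := hσ 12 (by decide)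
    simp only [AExp.eval, r12]
    rfl

/-- The numbers formed here may exceed `Z`. This causes no loss, because each product is clamped by
the very register that is its first factor. -/
theorem exec_setTrials {P : RunParams} {σ : Store} {v : ℕ → ℕ}
    (hM : P.M = P.Z * P.l ^ P.t) (h : ∀ i < 26, i ≠ 14 → i ≠ 24 → σ.reg i = P.val i) :
    HasParams P (setTrials.exec v σ) := by
  set τ := (Cmd.loop 10 13 (.set 30 (.mul 3 (.reg 3) (.reg 30)))).exec v (σ.setReg 30 1) with hτ
  have r13 : (σ.setReg 30 1).reg 13 = P.t := h 13 (by decide) (by decide) (by decide)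
  have key : (∀ i, i ≠ 30 → τ.reg i = σ.reg i) ∧ τ.reg 30 = P.l ^ P.t := by
    rw [hτ, exec, r13]
    refine iterUpTo_induct (fun j (τ : Store) => (∀ i, i ≠ 30 → τ.reg i = σ.reg i) ∧
      τ.reg 30 = P.l ^ j) ⟨fun i hi => ?_, ?_⟩ ?_
    · rw [Store.setReg_reg, if_neg hi]
    · rw [Store.setReg_reg, if_pos rfl, pow_zero]
    · rintro j hj τ ⟨h1, h2⟩
      have r3 : τ.reg 3 = P.l := (h1 3 (by decide)).trans (h 3 (by decide) (by decide) (by decide))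
      refine ⟨fun i hi => ?_, ?_⟩
      · rw [exec, Store.setReg_reg, if_neg hi, h1 i hi]
      · rw [exec, Store.setReg_reg, if_pos rfl]
        simp only [AExp.eval, r3, h2, min_self, pow_succ']
  have hout := exec_assign (f := fun i => if i = 30 then P.l ^ P.t else P.val i) (v := v) (σ := τ)
    (S := 30 :: (List.range 26).filter fun i => i ≠ 14 ∧ i ≠ 24)
    (l := [(14, .mul 5 (.reg 5) (.reg 30)), (24, .mul 13 (.reg 13) (.reg 14))]) ?_ ?_
  · intro i hi
    have := hout i (by simp; omega)
    exact this.trans (if_neg (by omega))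
  · intro i hi
    simp only [List.mem_cons, List.mem_filter, List.mem_range, decide_eq_true_eq] at hi
    rcases hi with rfl | ⟨h1, h2, h3⟩
    · exact key.2
    · exact ((key.1 i (by omega)).trans (h i h1 h2 h3)).trans (if_neg (by omega)).symm
  · refine ⟨fun σ hσ => ?_, fun σ hσ => ?_, trivial⟩
    · have r5 : σ.reg 5 = P.Z := hσ 5 (by decide)
      have r30 : σ.reg 30 = P.l ^ P.t := hσ 30 (by decide)
      simp only [AExp.eval, r5, r30, min_self]
      exact hM.symm
    · have r13 : σ.reg 13 = P.t := hσ 13 (by decide)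
      have r14 : σ.reg 14 = P.M := hσ 14 (by decide)
      simp only [AExp.eval, r13, r14, min_self]
      exact mul_comm _ _

end Cmd

/-! ### Random choices -/

/-- Independent uniform choices are jointly uniform. This merges successive draws into a single
uniform choice of the whole tape. -/
theorem PMF.uniformOfFintype_bind_map {α β γ δ : Type*} [Fintype α] [Nonempty α] [Fintype β]
    [Nonempty β] [Fintype γ] [Nonempty γ] (e : γ ≃ α × β) (f : α → β → δ) :
    ((PMF.uniformOfFintype α).bind fun a => (PMF.uniformOfFintype β).map (f a))
      = (PMF.uniformOfFintype γ).map fun c => f (e c).1 (e c).2 := by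
  have h : (PMF.uniformOfFintype γ).map e
      = (PMF.uniformOfFintype α).bind fun a => (PMF.uniformOfFintype β).map (Prod.mk a) := by
    ext ⟨a, b⟩
    have hc : Fintype.card γ = Fintype.card α * Fintype.card β := by
      rw [Fintype.card_congr e, Fintype.card_prod]
    rw [PMF.map_apply, tsum_eq_single (e.symm (a, b)), PMF.bind_apply, tsum_eq_single a,
      PMF.map_apply, tsum_eq_single b]
    · simp only [Equiv.apply_symm_apply, if_true, PMF.uniformOfFintype_apply, hc, Nat.cast_mul]
      rw [ENNReal.mul_inv] <;> simp
    · intro b' hb'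
      simp [hb'.symm]
    · intro a' ha'
      rw [PMF.map_apply]
      simp [ha'.symm]
    · intro c hc
      rw [if_neg]
      rintro h
      exact hc (by rw [h, Equiv.symm_apply_apply])
  have h2 : (PMF.uniformOfFintype γ).map (fun c => f (e c).1 (e c).2)
      = ((PMF.uniformOfFintype γ).map e).map fun x => f x.1 x.2 := by
    rw [PMF.map_comp]
    rfl
  rw [h2, h, PMF.map_bind]
  congr 1
  funext a
  rw [PMF.map_comp]
  rfl

theorem Config.step_rand (x y : ℕ) (K : List Prog) (σ : Store) :
    Config.step ⟨.rand x y :: K, σ⟩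
      = (PMF.uniformOfFintype (Fin (σ.reg y + 1))).map fun v => ⟨K, σ.setReg x v⟩ := by
  change PMF.map _ ((PMF.uniformOfFintype (Fin (σ.reg y + 1))).bind fun a => PMF.pure (a : ℕ)) = _
  rw [PMF.map_bind]
  simp only [PMF.pure_map]
  rfl

namespace Prog

/-- Fill array `3`, the content of register `24` being the number of cells, by numbers up to the
content of register `25`. -/
def drawLoop : Prog :=
  .loop 45 (.seq (.rand 47 25) (.seq (.store 3 41 47) (.seq (.add 41 41 43) (.sub 45 45 43))))

/-- A round takes `8` steps whatever is drawn, so at a fixed time the configuration is a function of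
a uniform tape. The registers used are odd ones beyond `userRegs`, so that no program register is
touched. -/
theorem run_drawLoop (k n : ℕ) : ∀ (j : ℕ) (σ : Store), σ.reg 25 = k → σ.reg 45 = n →
    σ.reg 41 = j → σ.reg 43 = 1 → ∃ F : (Fin n → Fin (k + 1)) → Store,
      (∀ K, Config.run (n * 8 + 1) ⟨drawLoop :: K, σ⟩
        = (PMF.uniformOfFintype (Fin n → Fin (k + 1))).map fun w => ⟨K, F w⟩) ∧
      ∀ w, (∀ x < userRegs, (F w).reg x = σ.reg x) ∧ (∀ b, b ≠ 3 → (F w).arr b = σ.arr b) ∧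
        (∀ c < j, (F w).arr 3 c = σ.arr 3 c) ∧ ∀ i : Fin n, (F w).arr 3 (j + i) = w i := by
  induction n with
  | zero =>
    intro j σ h25 h45 h41 h43
    refine ⟨fun _ => σ, fun K => ?_, fun w => ⟨fun _ _ => rfl, fun _ _ => rfl, fun _ _ => rfl,
      fun i => i.elim0⟩⟩
    rw [show (fun w : Fin 0 → Fin (k + 1) => (⟨K, σ⟩ : Config)) = Function.const _ ⟨K, σ⟩ from rfl,
      PMF.map_const]
    exact Runs.loop_zero h45 K
  | succ n ih =>
    intro j σ h25 h45 h41 h43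
    subst h25
    set next : Fin (σ.reg 25 + 1) → Store := fun v =>
      (((σ.setReg 47 v).setArr 3 j v).setReg 41 (j + 1)).setReg 45 n with hnext
    have hn : ∀ v, (next v).reg 25 = σ.reg 25 ∧ (next v).reg 45 = n ∧ (next v).reg 41 = j + 1 ∧
        (next v).reg 43 = 1 := by
      intro v
      simp [hnext, Store.setReg_reg, h43]
    have ih' := fun v => ih (j + 1) (next v) (hn v).1 (hn v).2.1 (hn v).2.2.1 (hn v).2.2.2
    choose F hF hF' using ih'
    refine ⟨fun w => F (w 0) (Fin.tail w), fun K => ?_, fun w => ?_⟩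
    · have hstep : Config.run 8 ⟨drawLoop :: K, σ⟩
          = (PMF.uniformOfFintype (Fin (σ.reg 25 + 1))).map
            fun v => (⟨drawLoop :: K, next v⟩ : Config) := by
        have h1 : Config.run 2 ⟨drawLoop :: K, σ⟩ = PMF.pure (⟨.rand 47 25 :: .seq (.store 3 41 47)
            (.seq (.add 41 41 43) (.sub 45 45 43)) :: drawLoop :: K, σ⟩ : Config) := by
          simp only [Config.run, Config.step, drawLoop, PMF.pure_bind, PMF.bind_pure]
          rw [if_pos (by rw [h45]; omega)]
        have h2 : ∀ τ : Store, Config.run 5 ⟨.seq (.store 3 41 47)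
            (.seq (.add 41 41 43) (.sub 45 45 43)) :: drawLoop :: K, τ⟩
            = PMF.pure (⟨drawLoop :: K, ((τ.setArr 3 (τ.reg 41) (τ.reg 47)).setReg 41
              (τ.reg 41 + τ.reg 43)).setReg 45 ((τ.setReg 41 (τ.reg 41 + τ.reg 43)).reg 45
              - (τ.setReg 41 (τ.reg 41 + τ.reg 43)).reg 43)⟩ : Config) := by
          intro τ
          simp only [Config.run, Config.step, PMF.pure_bind, PMF.bind_pure]
          rfl
        rw [show 8 = 2 + (1 + 5) from rfl, Config.run_add, h1, PMF.pure_bind, Config.run_add]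
        simp only [Config.run, Config.step_rand, PMF.bind_pure]
        rw [PMF.bind_map, ← PMF.bind_pure_comp]
        congr 1
        funext v
        simp only [Function.comp_apply]
        have h3 := h2 (σ.setReg 47 v)
        simp only [Config.run, PMF.bind_pure] at h3
        rw [h3]
        simp [hnext, Store.setReg_reg, h41, h43, h45]
      rw [show (n + 1) * 8 + 1 = 8 + (n * 8 + 1) by ring, Config.run_add, hstep, PMF.bind_map]
      simp only [Function.comp_def, hF]
      rw [PMF.uniformOfFintype_bind_map (Fin.consEquiv fun _ => Fin (σ.reg 25 + 1)).symm
        fun v w => (⟨K, F v w⟩ : Config)]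
      rfl
    · obtain ⟨h1, h2, h3, h4⟩ := hF' (w 0) (Fin.tail w)
      refine ⟨fun x hx => ?_, fun b hb => ?_, fun c hc => ?_, fun i => ?_⟩
      · rw [h1 x hx]
        have : x < 40 := hx
        simp only [hnext, Store.setReg_reg, Store.setArr_reg]
        rw [if_neg (by omega), if_neg (by omega), if_neg (by omega)]
      · rw [h2 b hb]
        simp [hnext, Store.setArr, hb]
      · rw [h3 c (by omega)]
        simp [hnext, Store.setArr, Function.update_apply]
        omega
      · refine Fin.cases ?_ (fun i => ?_) i
        · rw [Fin.val_zero, add_zero, h3 j (by omega)]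
          simp [hnext, Store.setArr]
        · have := h4 i
          rw [Fin.val_succ, show j + ((i : ℕ) + 1) = j + 1 + i by ring, this]
          rfl

/-- Draw the random numbers. -/
def draw : Prog := .seq (.const 41 0) (.seq (.const 43 1) (.seq (.add 45 24 41) drawLoop))

theorem run_draw {k n : ℕ} {σ : Store} (h25 : σ.reg 25 = k) (h24 : σ.reg 24 = n) :
    ∃ F : (Fin n → Fin (k + 1)) → Store,
      (∀ K, Config.run (n * 8 + 7) ⟨draw :: K, σ⟩
        = (PMF.uniformOfFintype (Fin n → Fin (k + 1))).map fun w => ⟨K, F w⟩) ∧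
      ∀ w, (∀ x < userRegs, (F w).reg x = σ.reg x) ∧ (∀ b, b ≠ 3 → (F w).arr b = σ.arr b) ∧
        ∀ i : Fin n, (F w).arr 3 i = w i := by
  set τ : Store := ((σ.setReg 41 0).setReg 43 1).setReg 45 n with hτ
  obtain ⟨F, h1, h2⟩ := run_drawLoop k n 0 τ (by simp [hτ, Store.setReg_reg, h25])
    (by simp [hτ, Store.setReg_reg]) (by simp [hτ, Store.setReg_reg])
    (by simp [hτ, Store.setReg_reg])
  refine ⟨F, fun K => ?_, fun w => ?_⟩
  · have hstep : Config.run 6 ⟨draw :: K, σ⟩ = PMF.pure (⟨drawLoop :: K, τ⟩ : Config) := by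
      simp only [Config.run, Config.step, draw, PMF.pure_bind, PMF.bind_pure]
      simp [hτ, Store.setReg_reg, h24]
    rw [show n * 8 + 7 = 6 + (n * 8 + 1) by ring, Config.run_add, hstep, PMF.pure_bind, h1]
  · obtain ⟨g1, g2, -, g4⟩ := h2 w
    refine ⟨fun x hx => ?_, fun b hb => ?_, fun i => ?_⟩
    · rw [g1 x hx]
      have : x < 40 := hx
      simp only [hτ, Store.setReg_reg]
      rw [if_neg (by omega), if_neg (by omega), if_neg (by omega)]
    · rw [g2 b hb]
      rfl
    · rw [← g4 i, zero_add]

theorem run_halted (n : ℕ) (σ : Store) : Config.run n ⟨[], σ⟩ = PMF.pure ⟨[], σ⟩ := by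
  induction n with
  | zero => rfl
  | succ n ih => simp [Config.run, Config.step, ih]

/-- A program which makes random choices in its middle part only. -/
theorem run_of_draw {Ω : Type*} [Fintype Ω] [Nonempty Ω] {pre mid post : Prog} {σ σ' : Store}
    {m n n' T : ℕ} {F : Ω → Store} {Q : Ω → Store → Prop} (hpre : pre.Runs σ σ' m)
    (hmid : ∀ K, Config.run n ⟨mid :: K, σ'⟩ = (PMF.uniformOfFintype Ω).map fun w => ⟨K, F w⟩)
    (hpost : ∀ w, post.Reaches (F w) n' (Q w)) (hT : m + n + n' + 2 ≤ T) :
    ∃ G : Ω → Store, (∀ w, Q w (G w)) ∧ Config.run T ⟨[.seq pre (.seq mid post)], σ⟩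
      = (PMF.uniformOfFintype Ω).map fun w => ⟨[], G w⟩ := by
  choose N hN G hG hQ using hpost
  refine ⟨G, hQ, ?_⟩
  obtain ⟨T', rfl⟩ := Nat.exists_eq_add_of_le hT
  have h1 : Config.run (1 + m + 1 + n) ⟨[.seq pre (.seq mid post)], σ⟩
      = (PMF.uniformOfFintype Ω).map fun w => (⟨[post], F w⟩ : Config) := by
    rw [Config.run_add, Config.run_add, Config.run_add]
    simp only [Config.run, Config.step, PMF.bind_pure, PMF.pure_bind]
    rw [hpre, PMF.pure_bind]
    simp only [PMF.pure_bind]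
    rw [hmid]
  rw [show m + n + n' + 2 + T' = (1 + m + 1 + n) + (n' + T') by ring, Config.run_add, h1,
    PMF.bind_map, ← PMF.bind_pure_comp]
  congr 1
  funext w
  simp only [Function.comp_apply]
  -- The deterministic tail may take different times on different tapes; as a halted machine does
  -- not move, all runs are padded to the common time.
  obtain ⟨k, hk⟩ := Nat.exists_eq_add_of_le (show N w ≤ n' + T' by have := hN w; omega)
  rw [hk, Config.run_add, hG w, PMF.pure_bind, run_halted]

end Prog

/-! ### The failure probability -/

/-- A tape of length `M * t` is the same as `M` independent blocks of length `t`. -/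
theorem card_blocks {α : Type*} [Fintype α] [DecidableEq α] (M t : ℕ) (I : Finset (Fin t → α)) :
    (Finset.univ.filter fun w : Fin (M * t) → α =>
      ∀ j : Fin M, (fun c => w (finProdFinEquiv (j, c))) ∈ I).card = I.card ^ M := by
  classical
  let e : (Fin (M * t) → α) ≃ (Fin M → Fin t → α) :=
    (Equiv.arrowCongr finProdFinEquiv.symm (Equiv.refl α)).trans (Equiv.curry _ _ _)
  rw [← Fintype.card_piFinset_const I M]
  refine Finset.card_bij' (fun w _ => e w) (fun w _ => e.symm w) ?_ ?_ ?_ ?_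
  · intro w hw
    rw [Fintype.mem_piFinset]
    exact fun j => (Finset.mem_filter.mp hw).2 j
  · intro w hw
    rw [Fintype.mem_piFinset] at hw
    rw [Finset.mem_filter]
    refine ⟨Finset.mem_univ _, fun j => ?_⟩
    have : (fun c => e.symm w (finProdFinEquiv (j, c))) = w j := by
      funext c
      simp [e]
    rw [this]
    exact hw j
  · simp
  · simp

/-- If each of at most `n` events contains a proportion `1 / n` of all blocks, then most tapes of
`M` blocks contain a block in every event. -/
theorem card_tapes_ge {α ι : Type*} [Fintype α] [DecidableEq α] [Nonempty α] {M t n J : ℕ}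
    (hn : 0 < n)
    {F : Finset ι} (hF : F.card ≤ n) {I : ι → Finset (Fin t → α)}
    (hI : ∀ f ∈ F, Fintype.card (Fin t → α) ≤ n * (I f).card) (hM : n * J ≤ M)
    (hJ : 100 * n ≤ 2 ^ J) :
    (99 / 100 : ℝ) * Fintype.card (Fin (M * t) → α) ≤ (Finset.univ.filter
      fun w : Fin (M * t) → α => ∀ f ∈ F, ∃ j : Fin M,
        (fun c => w (finProdFinEquiv (j, c))) ∈ I f).card := by
  classical
  set B : ℝ := (Fintype.card (Fin t → α) : ℝ) with hB
  have hBpos : 0 < B := by rw [hB]; exact_mod_cast Fintype.card_pos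
  have hn' : (1 : ℝ) ≤ n := by exact_mod_cast hn
  have htot : (Fintype.card (Fin (M * t) → α) : ℝ) = B ^ M := by
    rw [hB]
    simp only [Fintype.card_fun, Fintype.card_fin]
    push_cast
    rw [← pow_mul, mul_comm M t]
  have hfrac : (0 : ℝ) ≤ 1 - 1 / n := by rw [sub_nonneg, div_le_one (by linarith)]; exact hn'
  have hfrac1 : 1 - 1 / (n : ℝ) ≤ 1 := by
    have : (0 : ℝ) ≤ 1 / n := by positivity
    linarith
  -- A single event is missed by all blocks with probability at most `(1 - 1 / n) ^ (n * J) ≤ 2 ^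
  -- (-J)`.
  have hbad : ∀ f ∈ F, ((Finset.univ.filter fun w : Fin (M * t) → α => ∀ j : Fin M,
      (fun c => w (finProdFinEquiv (j, c))) ∈ (I f)ᶜ).card : ℝ) ≤ B ^ M * (1 / 2) ^ J := by
    intro f hf
    rw [card_blocks, Finset.card_compl, Nat.cast_pow, Nat.cast_sub (Finset.card_le_univ _), ← hB]
    have h1 : B ≤ n * (I f).card := by rw [hB]; exact_mod_cast hI f hf
    have h2 : B - (I f).card ≤ B * (1 - 1 / n) := by
      have : B / n ≤ (I f).card := by rw [div_le_iff₀' (by linarith)]; exact h1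
      rw [mul_sub, mul_one, mul_one_div]
      linarith
    have h3 : (0 : ℝ) ≤ B - (I f).card := by
      rw [sub_nonneg, hB]
      exact_mod_cast Finset.card_le_univ _
    calc (B - (I f).card) ^ M ≤ (B * (1 - 1 / n)) ^ M := by gcongr
      _ = B ^ M * (1 - 1 / n) ^ M := mul_pow _ _ _
      _ ≤ B ^ M * (1 - 1 / n) ^ (n * J) := by
        gcongr ?_ * ?_
        exact pow_le_pow_of_le_one hfrac hfrac1 hM
      _ = B ^ M * ((1 - 1 / n) ^ n) ^ J := by rw [pow_mul]
      _ ≤ B ^ M * (1 / 2) ^ J := by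
        gcongr
        exact pow_half_le n hn
  have hunion : (Fintype.card (Fin (M * t) → α) : ℝ) ≤ (Finset.univ.filter
      fun w : Fin (M * t) → α => ∀ f ∈ F, ∃ j : Fin M,
        (fun c => w (finProdFinEquiv (j, c))) ∈ I f).card + ∑ f ∈ F, ((Finset.univ.filter
        fun w : Fin (M * t) → α => ∀ j : Fin M,
      (fun c => w (finProdFinEquiv (j, c))) ∈ (I f)ᶜ).card : ℝ) := by
    have : (Finset.univ : Finset (Fin (M * t) → α)) ⊆ (Finset.univ.filter
      fun w : Fin (M * t) → α => ∀ f ∈ F, ∃ j : Fin M,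
        (fun c => w (finProdFinEquiv (j, c))) ∈ I f) ∪ F.biUnion fun f => Finset.univ.filter
        fun w : Fin (M * t) → α => ∀ j : Fin M,
          (fun c => w (finProdFinEquiv (j, c))) ∈ (I f)ᶜ := by
      intro w _
      by_cases hw : ∀ f ∈ F, ∃ j : Fin M, (fun c => w (finProdFinEquiv (j, c))) ∈ I f
      · exact Finset.mem_union_left _ (Finset.mem_filter.mpr ⟨Finset.mem_univ _, hw⟩)
      · push Not at hw
        obtain ⟨f, hf, hw⟩ := hw
        refine Finset.mem_union_right _ (Finset.mem_biUnion.mpr ⟨f, hf, Finset.mem_filter.mpr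
          ⟨Finset.mem_univ _, fun j => ?_⟩⟩)
        rw [Finset.mem_compl]
        exact hw j
    have h1 := (Finset.card_le_card this).trans (Finset.card_union_le _ _)
    have h2 := h1.trans (Nat.add_le_add_left Finset.card_biUnion_le _)
    rw [Finset.card_univ] at h2
    exact_mod_cast h2
  have hsum := Finset.sum_le_sum hbad
  rw [Finset.sum_const, nsmul_eq_mul] at hsum
  have hJ' : (100 : ℝ) * n ≤ 2 ^ J := by exact_mod_cast hJ
  -- The union bound over at most `n` events; `2 ^ J ≥ 100 n` leaves a failure probability of at
  -- most `1 / 100`.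
  have hsmall : (F.card : ℝ) * (B ^ M * (1 / 2) ^ J) ≤ 1 / 100 * B ^ M := by
    have h1 : (F.card : ℝ) ≤ n := by exact_mod_cast hF
    have h2 : (n : ℝ) * (1 / 2) ^ J ≤ 1 / 100 := by
      rw [one_div, inv_pow, ← div_eq_mul_inv, div_le_iff₀ (by positivity)]
      linarith
    calc (F.card : ℝ) * (B ^ M * (1 / 2) ^ J) ≤ n * (B ^ M * (1 / 2) ^ J) := by gcongr
      _ = n * (1 / 2) ^ J * B ^ M := by ring
      _ ≤ 1 / 100 * B ^ M := by gcongr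
  rw [htot] at hunion ⊢
  linarith

/-! ### The complete decoder -/

namespace Prog

/-- Compute the parameters and copy the symbols. -/
def setup : Prog :=
  .seq (Cmd.setClamp.compile 0) (.seq ((Cmd.seq Cmd.setLength (.assign Cmd.paramDefs)).compile 0)
    (.seq (Cmd.setTrials.compile 0) (Cmd.copyInput.compile 0)))

/-- Decode and report the number of polynomials found. -/
def finish : Prog := .seq (Cmd.decode.compile 0) ((Cmd.set 0 (.reg 27)).compile 0)

/-- The decoder. -/
def decoder : Prog := .seq setup (.seq draw finish)

/-- Cost bound for `setup`. -/
def setupTime (Z : ℕ) : ℕ :=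
  Cmd.setClamp.time Z + ((Cmd.seq Cmd.setLength (.assign Cmd.paramDefs)).time Z +
    (Cmd.setTrials.time Z + Cmd.copyInput.time Z + 1) + 1) + 1

/-- Cost bound for `decoder`. -/
def decoderTime (Z : ℕ) : ℕ :=
  setupTime Z + (Z * 8 + 7) + (Cmd.decode.time Z + (Cmd.set 0 (.reg 27)).time Z + 1) + 2

theorem exists_decoderTime_le : ∃ K D : ℕ, ∀ Z, decoderTime Z ≤ K * (Z + 1) ^ D := by
  obtain ⟨K, D, h⟩ := Cmd.exists_time_le (.seq Cmd.setClamp (.seq (.seq Cmd.setLength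
    (.assign Cmd.paramDefs)) (.seq Cmd.setTrials (.seq Cmd.copyInput (.seq Cmd.decode
    (.set 0 (.reg 27)))))))
  refine ⟨K + 20, D + 1, fun Z => ?_⟩
  have h1 := h Z
  have h2 : decoderTime Z ≤ K * (Z + 1) ^ D + 20 * (Z + 1) := by
    simp only [decoderTime, setupTime]
    simp only [Cmd.time] at h1 ⊢
    omega
  have h3 : (Z + 1) ^ D ≤ (Z + 1) ^ (D + 1) := Nat.pow_le_pow_right (by omega) (by omega)
  have h4 : (Z + 1) ^ 1 ≤ (Z + 1) ^ (D + 1) := Nat.pow_le_pow_right (by omega) (by omega)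
  calc _ ≤ _ := h2
    _ ≤ K * (Z + 1) ^ (D + 1) + 20 * (Z + 1) ^ (D + 1) := by
      rw [pow_one] at h4
      gcongr
    _ = _ := by ring

theorem implements_self (v : ℕ → ℕ) (σ : Store) : Implements [] v σ σ :=
  ⟨rfl, fun _ _ => rfl, by simp⟩

/-- The setup is compiled in separate pieces because a loop bound must not be written within its
piece: each piece may use as bounds registers computed by an earlier one. -/
theorem reaches_setup {P : RunParams} [Fact P.q.Prime] {b Z : ℕ}
    (hp : DecoderParams P.q P.s P.d P.l P.e P.r P.g P.N P.m b P.t) (hP : P.Fits)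
    (hr : P.r = (P.s * P.q - P.d) / (4 * P.q)) (hM : P.M = P.Z * P.l ^ P.t) (hZ : P.Z = P.q ^ 16)
    (hb : 2 ^ b ≤ 2 * P.s) (hZmax : ∀ i < 26, P.val i ≤ Z) {σ : Store}
    (hσ : ∀ i < 5, σ.reg i = P.val i) :
    setup.Reaches σ (setupTime Z) fun τ => HasParams P τ ∧ τ.arr 1 = σ.arr 1 ∧
      ∀ c < P.q * P.l * P.s, τ.arr 2 c = σ.arr 0 c := by
  let v : ℕ → ℕ := fun _ => 0
  set σ1 := Cmd.setClamp.exec v σ with hσ1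
  set σ2 := (Cmd.seq Cmd.setLength (.assign Cmd.paramDefs)).exec v σ1 with hσ2
  set σ3 := Cmd.setTrials.exec v σ2 with hσ3
  set σ4 := Cmd.copyInput.exec v σ3 with hσ4
  have h1 : ∀ i < 6, σ1.reg i = P.val i := by
    intro i hi
    rw [hσ1, Cmd.setClamp, Cmd.exec, Store.setReg_reg, AExp.eval_pow, hσ 0 (by decide)]
    split_ifs with h
    · subst h
      exact hZ.symm
    · exact hσ i (by omega)
  have h29 : (Cmd.setLength.exec v σ1).reg 29 = b := by
    have e1 : σ1.reg 1 = P.s := h1 1 (by decide)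
    obtain ⟨b', g1, g2, g3⟩ := Cmd.exec_setLength (σ := σ1) (v := v) (by rw [e1]; exact hP.s_pos)
    rw [e1] at g1 g2
    -- The conditions `s < 2 ^ b ≤ 2 s` determine `b`, so the computed value is the prescribed one.
    have key : ∀ {b b' : ℕ}, 2 ^ b ≤ 2 * P.s → P.s < 2 ^ b' → b ≤ b' := by
      intro b b' h h'
      have : 2 ^ b < 2 ^ (b' + 1) := by rw [pow_succ]; omega
      have := (Nat.pow_lt_pow_iff_right (by decide : 1 < 2)).mp this
      omega
    rw [g3]
    exact le_antisymm (key g2 hp.s_lt) (key hb g1)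
  have h2 : ∀ i < 26, i ≠ 14 → i ≠ 24 → σ2.reg i = P.val i := by
    have hag : AgreesOn (fun i => if i = 29 then b else P.val i) [0, 1, 2, 3, 4, 5, 29]
        (Cmd.setLength.exec v σ1) := by
      intro i hi
      by_cases h : i = 29
      · rw [h, h29]
        rfl
      · rw [Cmd.exec_reg_of_notMem _ (by
          simp at hi
          simp [Cmd.sets, Cmd.setLength]; omega)]
        exact (h1 i (by simp at hi; omega)).trans (if_neg h).symm
    have hout := Cmd.exec_assign hag (Cmd.assigns_paramDefs (v := v) hp hP hr)
    intro i hi h14 h24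
    have := hout i (by simp [Cmd.paramDefs]; omega)
    exact this.trans (if_neg (by omega))
  have h3 : HasParams P σ3 := Cmd.exec_setTrials hM h2
  have h4 : σ4 = σ3.fillArr 2 (P.q * P.l * P.s) fun c => σ3.arr 0 c := by
    have e16 : σ3.reg 16 = P.q * P.l * P.s := h3 16 (by decide)
    rw [hσ4, Cmd.copyInput, Cmd.exec_fill fun c => σ3.arr 0 c, e16]
    intro c _
    simp [AExp.eval, Store.fillArr_arr_of_ne]
  have harr : ∀ c, σ3.arr c = σ.arr c := by
    intro c
    rw [hσ3, Cmd.exec_arr_of_notMem _ (by simp [Cmd.writes, Cmd.setTrials, Cmd.assign]), hσ2,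
      Cmd.exec_arr_of_notMem _ (by
        simp [Cmd.writes, Cmd.setLength, Cmd.assign, Cmd.paramDefs]), hσ1,
      Cmd.exec_arr_of_notMem _ (by simp [Cmd.writes, Cmd.setClamp])]
  refine reaches_seq ((Cmd.compile_correct (ps := [0]) (by simp [userRegs]) (Z := Z) _ 0 [] v σ σ ?_
    Cmd.setClamp_ok (implements_self v σ)).mono le_rfl ?_)
  · intro n hn
    rw [List.mem_singleton.mp hn, hσ 0 (by decide)]
    exact hZmax 0 (by decide)
  rintro τ1 ⟨i1, -, -⟩
  refine reaches_seq ((Cmd.compile_correct (ps := List.range 6) (by simp [userRegs]; omega) (Z := Z)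
    _ 0 [] v σ1 τ1 ?_ Cmd.params_ok i1).mono le_rfl ?_)
  · intro n hn
    have := List.mem_range.mp hn
    rw [h1 n this]
    exact hZmax n (by omega)
  rintro τ2 ⟨i2, -, -⟩
  refine reaches_seq ((Cmd.compile_correct (ps := [3, 5, 13]) (by simp [userRegs]) (Z := Z)
    _ 0 [] v σ2 τ2 ?_ Cmd.setTrials_ok i2).mono le_rfl ?_)
  · intro n hn
    simp only [List.mem_cons, List.not_mem_nil, or_false] at hn
    rw [h2 n (by omega) (by omega) (by omega)]
    exact hZmax n (by omega)
  rintro τ3 ⟨i3, -, -⟩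
  refine (Cmd.compile_correct (ps := [16]) (by simp [userRegs]) (Z := Z)
    _ 0 [] v σ3 τ3 ?_ Cmd.copyInput_ok i3).mono le_rfl ?_
  · intro n hn
    rw [List.mem_singleton.mp hn, h3 16 (by decide)]
    exact hZmax 16 (by decide)
  rintro τ4 ⟨i4, -, -⟩
  rw [← hσ4, h4] at i4
  refine ⟨fun i hi => ?_, ?_, fun c hc => ?_⟩
  · rw [i4.reg i (by unfold userRegs; omega)]
    exact h3 i hi
  · rw [i4.arr, Store.fillArr_arr_of_ne _ _ _ _ (by decide), harr]
  · rw [i4.arr, Store.fillArr_arr, if_pos ⟨rfl, hc⟩, harr]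

end Prog

/-- Coordinate `i` of the symbol `x % l` of the list at `x / l`. -/
def inputSymbol {q s : ℕ} (l : ℕ) (w : ZMod q → List (Fin s → ZMod q)) (x i : ℕ) : ZMod q :=
  if h : i < s then (w ((x / l : ℕ) : ZMod q)).getD (x % l) 0 ⟨i, h⟩ else 0

theorem inputStore_arr_zero {q s d l e : ℕ} {w : ZMod q → List (Fin s → ZMod q)} {x i : ℕ}
    (hx : x < q * l) (hi : i < s) :
    (inputStore q s d l e w).arr 0 (x * s + i) = (inputSymbol l w x i).val := by
  have h1 : (x * s + i) / s = x := by
    rw [mul_comm, Nat.mul_add_div (by omega), Nat.div_eq_of_lt hi, add_zero]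
  have h2 : (x * s + i) % s = i := by
    rw [mul_comm, Nat.mul_add_mod, Nat.mod_eq_of_lt hi]
  have h3 : (x * s + i) / (l * s) = x / l := by
    rw [mul_comm l, ← Nat.div_div_eq_div_mul, h1]
  have h4 : x * s + i < q * l * s := by
    calc x * s + i < (x + 1) * s := by rw [Nat.succ_mul]; omega
      _ ≤ _ := Nat.mul_le_mul_right _ hx
  simp only [inputStore, if_true]
  rw [dif_pos ⟨by omega, h4⟩, inputSymbol, dif_pos hi, h1, h3]
  simp only [h2]

theorem inputStore_arr_one {q s d l e : ℕ} {w : ZMod q → List (Fin s → ZMod q)} {a : ℕ}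
    (ha : a < q) : (inputStore q s d l e w).arr 1 a = (w (a : ZMod q)).length := by
  simp [inputStore, ha]

theorem agreesAt_iff {P : RunParams} [Fact P.q.Prime] {w : ZMod P.q → List (Fin P.s → ZMod P.q)}
    (hw : ∀ a, (w a).length ≤ P.l) (f : (ZMod P.q)[X]) (a : ℕ) :
    AgreesAt P (fun a => (w (a : ZMod P.q)).length) (inputSymbol P.l w) f a ↔
      multEnc P.s f (a : ZMod P.q) ∈ w (a : ZMod P.q) := by
  rw [AgreesAt, List.mem_iff_getElem]
  constructor
  · rintro ⟨k, hk, h⟩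
    refine ⟨k, hk, ?_⟩
    funext i
    have hkl := hk.trans_le (hw _)
    have h1 : (a * P.l + k) / P.l = a := by
      rw [mul_comm, Nat.mul_add_div (by omega), Nat.div_eq_of_lt hkl, add_zero]
    have h2 : (a * P.l + k) % P.l = k := by
      rw [mul_comm, Nat.mul_add_mod, Nat.mod_eq_of_lt hkl]
    have := h i i.2
    rw [inputSymbol, dif_pos i.2, h1, h2, List.getD_eq_getElem _ _ hk] at this
    exact this.symm
  · rintro ⟨k, hk, h⟩
    refine ⟨k, hk, fun i hi => ?_⟩
    have hkl := hk.trans_le (hw _)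
    have h1 : (a * P.l + k) / P.l = a := by
      rw [mul_comm, Nat.mul_add_div (by omega), Nat.div_eq_of_lt hkl, add_zero]
    have h2 : (a * P.l + k) % P.l = k := by
      rw [mul_comm, Nat.mul_add_mod, Nat.mod_eq_of_lt hkl]
    rw [inputSymbol, dif_pos hi, h1, h2, List.getD_eq_getElem _ _ hk, h]
    rfl

/-- The number of errors is an integer, so it is at most `α q` exactly if it is at most the floor
`e`. -/
theorem isValid_iff {P : RunParams} [Fact P.q.Prime] {w : ZMod P.q → List (Fin P.s → ZMod P.q)}
    (hw : ∀ a, (w a).length ≤ P.l) {α : ℝ} (hα : 0 ≤ α) (he : P.e = ⌊α * P.q⌋₊)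
    (f : (ZMod P.q)[X]) :
    IsValid P (fun a => (w (a : ZMod P.q)).length) (inputSymbol P.l w) f ↔
      f.natDegree ≤ P.d ∧ listDist (multEnc P.s f) (fun a => (w a).toFinset) ≤ α := by
  classical
  have hq := (Fact.out : P.q.Prime).pos
  have : NeZero P.q := ⟨hq.ne'⟩
  refine and_congr_right fun _ => ?_
  have hcard : ((Finset.range P.q).filter fun a => ¬ AgreesAt P
      (fun a => (w (a : ZMod P.q)).length) (inputSymbol P.l w) f a).card
      = (Finset.univ.filter fun a => multEnc P.s f a ∉ (w a).toFinset).card := by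
    refine Finset.card_nbij' (fun a => (a : ZMod P.q)) ZMod.val ?_ ?_ ?_ ?_
    · intro a ha
      simp only [Finset.coe_filter, Finset.mem_range, Set.mem_ofPred_eq, agreesAt_iff hw,
        Finset.mem_univ, true_and, List.mem_toFinset] at ha ⊢
      exact ha.2
    · intro a ha
      simp only [Finset.coe_filter, Finset.mem_range, Set.mem_ofPred_eq, agreesAt_iff hw,
        Finset.mem_univ, true_and, List.mem_toFinset, ZMod.natCast_zmod_val] at ha ⊢
      exact ⟨ZMod.val_lt a, ha⟩
    · intro a ha
      simp only [Finset.coe_filter, Finset.mem_range, Set.mem_ofPred_eq] at ha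
      exact ZMod.val_cast_of_lt ha.1
    · intro a _
      exact ZMod.natCast_zmod_val a
  rw [hcard, he, listDist, ZMod.card, div_le_iff₀ (by exact_mod_cast hq), Nat.le_floor_iff (by positivity)]

/-- The assumption of good luck is part of the postcondition, so that the time bound holds for every
tape. -/
theorem reaches_finish {P : RunParams} [Fact P.q.Prime] {b Z : ℕ}
    (hp : DecoderParams P.q P.s P.d P.l P.e P.r P.g P.N P.m b P.t) (hP : P.Fits)
    (hZmax : ∀ i < 26, P.val i ≤ Z) {len : ℕ → ℕ}
    {y : ℕ → ℕ → ZMod P.q} {R : ℕ → ℕ} {σ : Store} (h : HasParams P σ)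
    (hlen : ∀ a < P.q, σ.arr 1 a = len a)
    (hsym : ∀ x < P.q * P.l, ∀ i < P.s, σ.arr 2 (x * P.s + i) = (y x i).val)
    (hrand : ∀ c < P.M * P.t, σ.arr 3 c = R c) (hl : ∀ a < P.q, len a ≤ P.l)
    (hR : ∀ c < P.M * P.t, R c < P.q * P.l)
    (hM : ∀ F : Finset (ZMod P.q)[X], (∀ f ∈ F, IsValid P len y f) → F.card ≤ P.M) :
    Prog.finish.Reaches σ (Cmd.decode.time Z + (Cmd.set 0 (.reg 27)).time Z + 1) fun τ =>
      (∀ f, IsValid P len y f → ∃ j < P.M, ∃ x : Fin P.t → Fin (P.q * P.l),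
        (∀ c, (x c : ℕ) = R (j * P.t + c)) ∧ Isolates P.s P.d P.l P.g P.r P.N P.m y f x) →
      ∃ Ps : List (ZMod P.q)[X], Ps.Nodup ∧ (∀ f, f ∈ Ps ↔ IsValid P len y f) ∧
        Displays P.d Ps τ := by
  let v : ℕ → ℕ := fun _ => 0
  obtain ⟨S, hS, hS', hall⟩ := exec_decode (v := v) hp hP h hlen hsym hrand hl hR hM
  set σ1 := Cmd.decode.exec v σ with hσ1
  refine Prog.reaches_seq ((Cmd.compile_correct (ps := List.range 26) (by simp [userRegs]; omega)
    (Z := Z) _ 0 [] v σ σ ?_ Cmd.decode_ok (Prog.implements_self v σ)).mono le_rfl ?_)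
  · intro n hn
    have := List.mem_range.mp hn
    rw [h n this]
    exact hZmax n this
  rintro τ1 ⟨i1, -, -⟩
  refine (Cmd.compile_correct (ps := []) (by simp) (Z := Z)
    _ 0 [] v σ1 τ1 (by simp) rfl i1).mono le_rfl ?_
  rintro τ2 ⟨i2, -, -⟩ hgood
  obtain ⟨Ps, h1, h2, h3, h4⟩ := hS
  refine ⟨Ps, h1, fun f => ⟨fun hf => hS' f ((h2 f).mp hf), fun hf => ?_⟩, ?_, fun k j hj => ?_⟩
  · obtain ⟨j, hj, x, hx, hiso⟩ := hgood f hf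
    exact (h2 f).mpr (hall f hf j hj x hx hiso)
  · rw [i2.reg 0 (by decide), Cmd.exec, Store.setReg_reg, if_pos rfl]
    exact h3
  · rw [i2.arr]
    exact h4 k k.2 j hj

/-- When the final configuration is a function of a uniform tape, the success probability is at
least the proportion of good tapes. -/
theorem Prog.solvesWithin_of_run {Ω : Type*} [Fintype Ω] [Nonempty Ω] {p : Prog} {σ : Store} {T : ℕ}
    {G : Ω → Store} (h : Config.run T ⟨[p], σ⟩ = (PMF.uniformOfFintype Ω).map fun w => ⟨[], G w⟩)
    {Good : Store → Prop} {A : Finset Ω} (hA : ∀ w ∈ A, Good (G w))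
    (hcard : (99 / 100 : ℝ) * Fintype.card Ω ≤ A.card) : p.SolvesWithin σ T (99 / 100) Good := by
  classical
  constructor
  · intro c hc
    rw [h, PMF.support_map] at hc
    obtain ⟨w, -, rfl⟩ := hc
    rfl
  · rw [h, PMF.toOuterMeasure_map_apply]
    have h1 : (PMF.uniformOfFintype Ω).toOuterMeasure (A : Set Ω)
        ≤ (PMF.uniformOfFintype Ω).toOuterMeasure
          ((fun w => (⟨[], G w⟩ : Config)) ⁻¹' {c | Good c.store}) :=
      MeasureTheory.measure_mono fun w hw => hA w (Finset.mem_coe.mp hw)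
    refine le_trans ?_ h1
    rw [PMF.toOuterMeasure_uniformOfFintype_apply]
    have hc : Fintype.card (A : Set Ω) = A.card := by simp
    have hpos : 0 < Fintype.card Ω := Fintype.card_pos
    rw [hc, ENNReal.le_div_iff_mul_le (Or.inl (by exact_mod_cast hpos.ne'))
      (Or.inl (ENNReal.natCast_ne_top _))]
    have h2 : 99 * Fintype.card Ω ≤ 100 * A.card := by
      have : (99 : ℝ) * Fintype.card Ω ≤ 100 * A.card := by linarith
      exact_mod_cast this
    rw [mul_comm, ← mul_div_assoc, ENNReal.div_le_iff_le_mul (by simp) (by simp)]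
    calc (Fintype.card Ω : ℝ≥0∞) * 99 = ((99 * Fintype.card Ω : ℕ) : ℝ≥0∞) := by
          push_cast; ring
      _ ≤ ((100 * A.card : ℕ) : ℝ≥0∞) := by exact_mod_cast h2
      _ = _ := by push_cast; ring

theorem solvesWithin_decoder {P : RunParams} [Fact P.q.Prime] {b Z J : ℕ}
    (hp : DecoderParams P.q P.s P.d P.l P.e P.r P.g P.N P.m b P.t) (hP : P.Fits)
    (hr : P.r = (P.s * P.q - P.d) / (4 * P.q)) (hM : P.M = P.Z * P.l ^ P.t) (hZ : P.Z = P.q ^ 16)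
    (hb : 2 ^ b ≤ 2 * P.s) (hZmax : ∀ i < 26, P.val i ≤ Z)
    (hJ : 2 ^ (6 * b + 1) * P.l ^ P.t * J ≤ P.M) (hJ' : 100 * (2 ^ (6 * b + 1) * P.l ^ P.t) ≤ 2 ^ J)
    {α : ℝ} (hα : 0 ≤ α) (he : P.e = ⌊α * P.q⌋₊) {w : ZMod P.q → List (Fin P.s → ZMod P.q)}
    (hw : ∀ a, (w a).length ≤ P.l) :
    Prog.decoder.SolvesWithin (inputStore P.q P.s P.d P.l P.e w) (Prog.decoderTime Z) (99 / 100)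
      (ListsAll P.q P.s P.d α w) := by
  classical
  have hql : 0 < P.q * P.l := Nat.mul_pos (Fact.out : P.q.Prime).pos hP.l_pos
  set σ := inputStore P.q P.s P.d P.l P.e w with hσ
  set len : ℕ → ℕ := fun a => (w (a : ZMod P.q)).length with hlen
  set y : ℕ → ℕ → ZMod P.q := inputSymbol P.l w with hy
  have hl : ∀ a < P.q, len a ≤ P.l := fun a _ => hw _
  obtain ⟨m, hm, σ', hpre, hpar, h1, h2⟩ := Prog.reaches_setup (σ := σ) hp hP hr hM hZ hb hZmax
    (by intro i hi; interval_cases i <;> rfl)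
  have h25 : σ'.reg 25 = P.q * P.l - 1 := hpar 25 (by decide)
  have h24 : σ'.reg 24 = P.M * P.t := hpar 24 (by decide)
  obtain ⟨F, hF, hF'⟩ := Prog.run_draw h25 h24
  have hk : P.q * P.l - 1 + 1 = P.q * P.l := by omega
  have hvalid : ∀ F : Finset (ZMod P.q)[X], (∀ f ∈ F, IsValid P len y f) →
      F.card ≤ 2 ^ (6 * b + 1) * P.l ^ P.t := fun F hF =>
    card_solutions_le hp F fun f hf => (hF f hf).isSolution hl
  have hn0 : 0 < 2 ^ (6 * b + 1) * P.l ^ P.t := by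
    have := hP.l_pos
    positivity
  have hJpos : 0 < J := by
    rcases Nat.eq_zero_or_pos J with rfl | h
    · rw [pow_zero] at hJ'; omega
    · exact h
  have hMcard : ∀ F : Finset (ZMod P.q)[X], (∀ f ∈ F, IsValid P len y f) → F.card ≤ P.M :=
    fun F hF => (hvalid F hF).trans ((Nat.le_mul_of_pos_right _ hJpos).trans hJ)
  -- The uniform bound on finite subsets gives finiteness, which makes the union bound over all
  -- valid polynomials available.
  have hfin : {f | IsValid P len y f}.Finite := by
    by_contra hinf
    obtain ⟨F, hF, hcard⟩ := Set.Infinite.exists_subset_card_eq hinf (P.M + 1)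
    have := hMcard F fun f hf => hF hf
    omega
  -- The default `0` beyond the end of the tape is never used: only cells below `M * t` belong to
  -- trials.
  let R : (Fin (P.M * P.t) → Fin (P.q * P.l - 1 + 1)) → ℕ → ℕ := fun u c =>
    if h : c < P.M * P.t then u ⟨c, h⟩ else 0
  let I : (ZMod P.q)[X] → Finset (Fin P.t → Fin (P.q * P.l - 1 + 1)) := fun f =>
    Finset.univ.filter fun x => Isolates P.s P.d P.l P.g P.r P.N P.m y f fun c => Fin.cast hk (x c)
  have hI : ∀ f ∈ hfin.toFinset, Fintype.card (Fin P.t → Fin (P.q * P.l - 1 + 1))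
      ≤ 2 ^ (6 * b + 1) * P.l ^ P.t * (I f).card := by
    intro f hf
    have h3 := card_isolates_ge hp ((hfin.mem_toFinset.mp hf).isSolution hl)
    have h4 : (I f).card = (Finset.univ.filter fun x : Fin P.t → Fin (P.q * P.l) =>
        Isolates P.s P.d P.l P.g P.r P.N P.m y f x).card := by
      refine Finset.card_equiv (Equiv.arrowCongr (Equiv.refl _) (finCongr hk)) fun x => ?_
      simp only [I, Finset.mem_filter, Finset.mem_univ, true_and]
      rfl
    rw [h4]
    simpa [hk] using h3
  obtain ⟨G, hG, hrun⟩ := Prog.run_of_draw (T := Prog.decoderTime Z) hpre hF (fun u =>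
    reaches_finish (σ := F u) (len := len) (y := y) (R := R u) (Z := Z) hp hP hZmax
    (fun i hi => ((hF' u).1 i (by unfold userRegs; omega)).trans (hpar i hi))
    (fun a ha => by rw [(hF' u).2.1 1 (by decide), h1, hσ, inputStore_arr_one ha])
    (fun x hx i hi => by
      rw [(hF' u).2.1 2 (by decide), h2, hσ, inputStore_arr_zero hx hi]
      calc x * P.s + i < (x + 1) * P.s := by rw [Nat.succ_mul]; omega
          _ ≤ _ := Nat.mul_le_mul_right _ hx)
    (fun c hc => by rw [(hF' u).2.2 ⟨c, hc⟩]; simp only [R, dif_pos hc])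
    hl (fun c hc => by
      simp only [R, dif_pos hc]
      exact (u ⟨c, hc⟩).2.trans_eq hk) hMcard) (by
    have : P.M * P.t ≤ Z := hZmax 24 (by decide)
    rw [Prog.decoderTime]
    omega)
  refine Prog.solvesWithin_of_run hrun (A := Finset.univ.filter
      fun u : Fin (P.M * P.t) → Fin (P.q * P.l - 1 + 1) => ∀ f ∈ hfin.toFinset, ∃ j : Fin P.M,
        (fun c => u (finProdFinEquiv (j, c))) ∈ I f) (fun u hu => ?_)
    (card_tapes_ge hn0 (hvalid _ fun f hf => hfin.mem_toFinset.mp hf) hI hJ hJ')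
  obtain ⟨Ps, g1, g2, g3⟩ := hG u (fun f hf => by
    obtain ⟨j, hj⟩ := (Finset.mem_filter.mp hu).2 f (hfin.mem_toFinset.mpr hf)
    refine ⟨j, j.2, fun c => Fin.cast hk (u (finProdFinEquiv (j, c))), fun c => ?_,
      (Finset.mem_filter.mp hj).2⟩
    have hlt : j * P.t + c < P.M * P.t := by
      calc (j : ℕ) * P.t + c < (j + 1) * P.t := by rw [Nat.succ_mul]; omega
        _ ≤ _ := Nat.mul_le_mul_right _ j.2
    simp only [R, dif_pos hlt, Fin.val_cast]
    congr 2
    apply Fin.ext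
    simp [finProdFinEquiv]
    ring)
  exact ⟨Ps, g1, fun f => (g2 f).trans (isValid_iff hw hα he f), g3⟩

/-! ### Choice of the parameters -/

/-- The parameters of the decoder for a code of order `s` and degree `d` over the field with `q`
elements, for lists of size `l` and `e` errors. -/
def runParams (q s d l e : ℕ) : RunParams :=
  let r := (s * q - d) / (4 * q)
  let g := s + 1 - r
  let N := (q - e) * g
  let t := 6 * s * (Nat.log 2 s + 1)
  ⟨q, s, d, l, e, r, g, N, N - d, t, q ^ 16 * l ^ t, q ^ 16⟩

section Parameters

variable {q s d l e : ℕ}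

/-- The conditions on the parameters of the code. -/
structure Admissible (q s d l e r : ℕ) : Prop where
  r_eq : r = (s * q - d) / (4 * q)
  q_ge : 17 ≤ q
  s_lt : s < q
  s_ge : 2 ≤ s
  l_pos : 0 < l
  l_lt : l < s
  r_pos : 0 < r
  degree : d + 4 * r * q ≤ s * q
  lists : l * s < (r + 1) * (r + 1)
  errors : 2 * s * e ≤ q

theorem two_pow_log_succ_le (hs : s ≠ 0) : 2 ^ (Nat.log 2 s + 1) ≤ 2 * s := by
  have := Nat.pow_log_le_self 2 hs
  rw [pow_succ]
  omega

theorem log_succ_le (hs : s ≠ 0) : Nat.log 2 s + 1 ≤ s := by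
  have h1 := Nat.pow_log_le_self 2 hs
  have h2 : Nat.log 2 s < 2 ^ Nat.log 2 s := Nat.lt_two_pow_self
  omega

theorem Admissible.params {r : ℕ} (h : Admissible q s d l e r) :
    let P := runParams q s d l e
    DecoderParams q s d l e P.r P.g P.N P.m (Nat.log 2 s + 1) P.t ∧ q * (s - r) ≤ P.N := by
  intro P
  obtain ⟨hr, hq, hsq, hs, hl, hls, hr0, hdeg, hlist, herr⟩ := h
  have eP : P.r = r := hr.symm
  have hrs : 4 * r ≤ s := by
    have : 4 * r * q ≤ s * q := by omega
    exact Nat.le_of_mul_le_mul_right this (by omega)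
  have hg : P.g = s + 1 - r := by rw [← eP]; rfl
  have hN : P.N = (q - e) * (s + 1 - r) := by rw [← hg]; rfl
  have hm : P.m = P.N - d := rfl
  obtain ⟨k, hk⟩ := Nat.exists_eq_add_of_le (show r ≤ s by omega)
  have hk' : s + 1 - r = k + 1 := by omega
  have hsk : s - r = k := by omega
  have hesk : e * (k + 1) ≤ e * s := Nat.mul_le_mul_left _ (by omega)
  have hes : 2 * (e * s) ≤ q := by
    calc 2 * (e * s) = 2 * s * e := by ring
      _ ≤ q := herr
  have heq : e ≤ q := by
    have : e * 1 ≤ e * s := Nat.mul_le_mul_left _ (by omega)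
    omega
  have hNge : q * k ≤ P.N := by
    rw [hN, hk', Nat.sub_mul]
    have : q * (k + 1) = q * k + q := by ring
    omega
  have e1 : s * q = r * q + q * k := by rw [hk]; ring
  have hr1 : 1 * q ≤ r * q := Nat.mul_le_mul_right _ hr0
  have e2 : 4 * r * q = 4 * (r * q) := by ring
  have hNd : d + 3 * (r * q) ≤ P.N := by omega
  have hmge : 3 * (r * q) ≤ P.m := by omega
  refine ⟨⟨by rw [eP]; exact hr0, by rw [eP]; exact hdeg, by rw [eP, hg]; omega, hN.trans (by rw [hg]),
    by rw [hm]; omega, by omega, ?_, herr, Nat.lt_pow_succ_log_self (by decide) s, rfl, hl⟩,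
    by rw [hsk]; exact hNge⟩
  -- There are at most `q l s < q (r + 1) ^ 2` conditions. On the other side `N ≥ q (s - r) ≥ 3 r q`
  -- and `r m ≥ 3 r ^ 2 q`, and `3 r + 3 r ^ 2 ≥ (r + 1) ^ 2`.
  have h1 : q * l * P.g ≤ q * (l * s) := by
    rw [mul_assoc]
    exact Nat.mul_le_mul_left _ (Nat.mul_le_mul_left _ (by rw [hg]; omega))
  have h2 : q * (l * s) < q * ((r + 1) * (r + 1)) := Nat.mul_lt_mul_of_pos_left hlist (by omega)
  have h3 : r * (3 * (r * q)) ≤ r * P.m := Nat.mul_le_mul_left _ hmge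
  have h4 : 3 * r * q ≤ q * k := by
    rw [mul_comm q]
    exact Nat.mul_le_mul_right _ (by omega)
  have h5 : q * ((r + 1) * (r + 1)) = r * (r * q) + 2 * (r * q) + q := by ring
  have h6 : r * (3 * (r * q)) = 3 * (r * (r * q)) := by ring
  have h7 : 3 * r * q = 3 * (r * q) := by ring
  rw [eP]
  omega

/-- As `l < s < q` and `q ≥ 17`, both linear systems have at most `q ^ 4` unknowns, so even the
squares of these numbers lie far below the clamp `q ^ 16`. -/
theorem Admissible.fits {r : ℕ} (h : Admissible q s d l e r) : (runParams q s d l e).Fits ∧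
    6 * s * (Nat.log 2 s + 1) ≤ q ^ 3 := by
  obtain ⟨hp, hNge⟩ := h.params
  set P := runParams q s d l e with hP
  obtain ⟨hr, hq, hsq, hs, hl, hls, hr0, hdeg, hlist, herr⟩ := h
  have eP : P.r = r := hr.symm
  have hrs : 4 * P.r ≤ s := by
    have : 4 * P.r * q ≤ s * q := by rw [eP]; omega
    exact Nat.le_of_mul_le_mul_right this (by omega)
  have hb := log_succ_le (show s ≠ 0 by omega)
  have hgs : P.g ≤ s := by have := hp.order; have := hp.r_pos; omega
  have hN2 : P.N ≤ q * q := by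
    rw [hp.total]
    exact Nat.mul_le_mul (Nat.sub_le _ _) (by omega)
  have hmN : P.m ≤ P.N := by have := hp.block; omega
  have hsN : s ≤ P.N := by
    refine le_trans ?_ hNge
    have : q * 1 ≤ q * (s - r) := Nat.mul_le_mul_left _ (by rw [← eP]; omega)
    omega
  have hrm : P.r * P.m ≤ q * (q * q) := Nat.mul_le_mul (by omega) (hmN.trans hN2)
  have q2 : 17 * q ≤ q * q := Nat.mul_le_mul_right _ hq
  have q3 : 17 * (q * q) ≤ q * (q * q) := Nat.mul_le_mul_right _ hq
  have q4 : 17 * (q * (q * q)) ≤ q * (q * (q * q)) := Nat.mul_le_mul_right _ hq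
  have p4 : q * (q * (q * q)) = q ^ 4 := by ring
  have hn1 : P.N + P.r * P.m ≤ q ^ 4 := by omega
  have hd2 : d + 2 ≤ q ^ 4 := by
    have : s * q ≤ q * q := Nat.mul_le_mul_right _ hsq.le
    omega
  have hts : 6 * s * (Nat.log 2 s + 1) ≤ q ^ 3 := by
    calc 6 * s * (Nat.log 2 s + 1) ≤ 6 * q * q := Nat.mul_le_mul (by omega) (by omega)
      _ = 6 * (q * q) := by ring
      _ ≤ q * (q * q) := by omega
      _ = _ := by ring
  have mono : ∀ {m n : ℕ}, m ≤ n → q ^ m ≤ q ^ n := fun h => Nat.pow_le_pow_right (by omega) h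
  have hqq : 2 * q ≤ q ^ 8 := by
    have : q * q ≤ q ^ 8 := by rw [← pow_two]; exact mono (by decide)
    omega
  have h16 : q ^ 8 + q ^ 8 ≤ q ^ 16 := by
    have e1 : q ^ 16 = q ^ 8 * q ^ 8 := by ring
    have e2 : 2 * q ^ 8 ≤ q ^ 8 * q ^ 8 := Nat.mul_le_mul_right _ (by omega)
    omega
  have sq_le : ∀ {n : ℕ}, n ≤ q ^ 4 → n * n + 2 * q ≤ q ^ 16 := by
    intro n hn
    have : n * n ≤ q ^ 4 * q ^ 4 := Nat.mul_le_mul hn hn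
    rw [← pow_add, show 4 + 4 = 8 from rfl] at this
    omega
  have mul_le : ∀ {n : ℕ}, n ≤ q ^ 4 → n * q ≤ q ^ 16 := by
    intro n hn
    calc n * q ≤ q ^ 4 * q := Nat.mul_le_mul_right _ hn
      _ = q ^ 5 := by ring
      _ ≤ _ := mono (by decide)
  refine ⟨⟨by change 0 < s; omega, hl, ?_, by omega, hp.m_pos, hp.r_pos, hp.order, hp.block, hsN, ?_, ?_, ?_,
    sq_le hn1, mul_le hn1, sq_le hd2, mul_le hd2, ?_⟩, hts⟩
  · have := hp.order
    change 0 < P.g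
    omega
  · change q * q ≤ q ^ 16
    rw [← pow_two]
    exact mono (by decide)
  · calc P.N * (q * s) ≤ q * q * (q * q) := Nat.mul_le_mul hN2 (Nat.mul_le_mul_left _ hsq.le)
      _ = q ^ 4 := by ring
      _ ≤ _ := mono (by decide)
  · calc q * l * s ≤ q * q * q := Nat.mul_le_mul (Nat.mul_le_mul_left _ (by omega)) hsq.le
      _ = q ^ 3 := by ring
      _ ≤ _ := mono (by decide)
  · calc 6 * s * (Nat.log 2 s + 1) * s ≤ q ^ 3 * q := Nat.mul_le_mul hts hsq.le
      _ = q ^ 4 := by ring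
      _ ≤ _ := mono (by decide)

/-- Bound for all parameters. -/
theorem Admissible.val_le {r : ℕ} (h : Admissible q s d l e r) :
    ∀ i < 26, (runParams q s d l e).val i ≤ q ^ 20 * l ^ (6 * s * (Nat.log 2 s + 1)) := by
  obtain ⟨hp, hNge⟩ := h.params
  obtain ⟨hP, ht⟩ := h.fits
  set P := runParams q s d l e with hPdef
  have hq := h.q_ge
  have hs := h.s_ge
  have hlt : 1 ≤ l ^ (6 * s * (Nat.log 2 s + 1)) := Nat.one_le_pow _ _ h.l_pos
  set X := l ^ (6 * s * (Nat.log 2 s + 1)) with hX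
  have hZ : P.Z ≤ q ^ 20 * X := by
    calc P.Z = q ^ 16 * 1 := (mul_one _).symm
      _ ≤ q ^ 20 * X := Nat.mul_le_mul (Nat.pow_le_pow_right (by omega) (by decide)) hlt
  have hM : P.M ≤ q ^ 20 * X := Nat.mul_le_mul (Nat.pow_le_pow_right (by omega) (by decide)) le_rfl
  have hMt : P.M * P.t ≤ q ^ 20 * X := by
    calc q ^ 16 * X * (6 * s * (Nat.log 2 s + 1)) ≤ q ^ 16 * X * q ^ 3 := Nat.mul_le_mul_left _ ht
      _ = q ^ 19 * X := by ring
      _ ≤ _ := Nat.mul_le_mul_right _ (Nat.pow_le_pow_right (by omega) (by decide))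
  have h1 := hP.q_le
  have h2 := hP.Nq_le
  have h3 := hP.inp_le
  have h4 := hP.n1_le
  have h5 := hP.n2_le
  have h6 := hP.t_le
  have h7 := hP.n2q_le
  have hspos := hP.s_pos
  have hsq : P.s < P.q := h.s_lt
  have hqpos : 0 < P.q := by omega
  have hqq : P.q * 1 ≤ P.q * P.q := Nat.mul_le_mul_left _ hqpos
  have hn1 : (P.N + P.r * P.m) * 1 ≤ (P.N + P.r * P.m) * (P.N + P.r * P.m) :=
    Nat.mul_le_mul_left _ (by have := hP.N_pos; omega)
  have hn1N : (P.N + P.r * P.m) * P.N ≤ (P.N + P.r * P.m) * (P.N + P.r * P.m) :=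
    Nat.mul_le_mul_left _ (by omega)
  have hn2 : (P.d + 2) * 1 ≤ (P.d + 2) * (P.d + 2) := Nat.mul_le_mul_left _ (by omega)
  have hql : P.q * P.l * 1 ≤ P.q * P.l * P.s := Nat.mul_le_mul_left _ hspos
  have hl : 1 * P.l ≤ P.q * P.l := Nat.mul_le_mul_right _ hqpos
  have hgs : P.g ≤ P.s := by have := hP.order; have := hP.r_pos; omega
  have hqlg : P.q * P.l * P.g ≤ P.q * P.l * P.s := Nat.mul_le_mul_left _ hgs
  have htt : P.t * 1 ≤ P.t * P.s := Nat.mul_le_mul_left _ hspos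
  have hblock := hP.block
  have horder := hP.order
  have hes : 2 * (P.e * 1) ≤ 2 * (P.e * P.s) :=
    Nat.mul_le_mul_left _ (Nat.mul_le_mul_left _ hspos)
  have herr : 2 * (P.e * P.s) ≤ P.q := by
    calc 2 * (P.e * P.s) = 2 * P.s * P.e := by ring
      _ ≤ _ := h.errors
  generalize q ^ 20 * X = B at *
  intro i hi
  interval_cases i <;> simp only [RunParams.val, List.getD_cons_zero, List.getD_cons_succ] <;> omega

theorem Admissible.two_pow_le {r : ℕ} (h : Admissible q s d l e r) :
    2 ^ (6 * (Nat.log 2 s + 1) + 1) ≤ 128 * s ^ 6 := by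
  have h1 := two_pow_log_succ_le (show s ≠ 0 by have := h.s_ge; omega)
  calc 2 ^ (6 * (Nat.log 2 s + 1) + 1) = 2 * (2 ^ (Nat.log 2 s + 1)) ^ 6 := by
        rw [pow_succ, mul_comm 6, pow_mul]; ring
    _ ≤ 2 * (2 * s) ^ 6 := Nat.mul_le_mul_left _ (Nat.pow_le_pow_left h1 6)
    _ = _ := by ring

/-- Here `J = q ^ 4`. The number of trials contains the factor `q ^ 16`, which covers both `J` and
the factor `2 ^ (6 b + 1) ≤ 128 s ^ 6 ≤ q ^ 8`; and `l ^ t` has fewer than `q ^ 4` bits. -/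
theorem Admissible.trials {r : ℕ} (h : Admissible q s d l e r) :
    2 ^ (6 * (Nat.log 2 s + 1) + 1) * l ^ (runParams q s d l e).t * q ^ 4
      ≤ (runParams q s d l e).M ∧
    100 * (2 ^ (6 * (Nat.log 2 s + 1) + 1) * l ^ (runParams q s d l e).t) ≤ 2 ^ q ^ 4 := by
  have hq := h.q_ge
  have hs := h.s_lt
  constructor
  · have h1 : 128 * s ^ 6 ≤ q ^ 8 := by
      calc 128 * s ^ 6 ≤ q * q * q ^ 6 := by
            have : 17 * 17 ≤ q * q := Nat.mul_le_mul hq hq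
            exact Nat.mul_le_mul (by omega) (Nat.pow_le_pow_left hs.le 6)
        _ = _ := by ring
    calc 2 ^ (6 * (Nat.log 2 s + 1) + 1) * l ^ (runParams q s d l e).t * q ^ 4
        ≤ q ^ 8 * l ^ (runParams q s d l e).t * q ^ 4 := by
          exact Nat.mul_le_mul_right _ (Nat.mul_le_mul_right _ (h.two_pow_le.trans h1))
      _ = q ^ 12 * l ^ (runParams q s d l e).t := by ring
      _ ≤ q ^ 16 * l ^ (runParams q s d l e).t :=
        Nat.mul_le_mul_right _ (Nat.pow_le_pow_right (by omega) (by decide))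
  · have hb := log_succ_le (show s ≠ 0 by have := h.s_ge; omega)
    have hsb : s < 2 ^ (Nat.log 2 s + 1) := Nat.lt_pow_succ_log_self (by decide) s
    have hls := h.l_lt
    set b := Nat.log 2 s + 1 with hbdef
    have h1 : l ^ (runParams q s d l e).t ≤ 2 ^ (b * (6 * s * b)) := by
      rw [pow_mul]
      exact Nat.pow_le_pow_left (by omega) _
    have h2 : 7 + (6 * b + 1) + b * (6 * s * b) ≤ q ^ 4 := by
      have e1 : b * (6 * s * b) ≤ q * (6 * q * q) :=
        Nat.mul_le_mul (by omega) (Nat.mul_le_mul (by omega) (by omega))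
      have e2 : q * (6 * q * q) = 6 * (q * q * q) := by ring
      have e3 : 17 * 17 * q ≤ q * q * q := Nat.mul_le_mul_right _ (Nat.mul_le_mul hq hq)
      have e4 : 17 * (q * q * q) ≤ q * (q * q * q) := Nat.mul_le_mul_right _ hq
      have e5 : q * (q * q * q) = q ^ 4 := by ring
      omega
    calc 100 * (2 ^ (6 * b + 1) * l ^ (runParams q s d l e).t)
        ≤ 2 ^ 7 * (2 ^ (6 * b + 1) * 2 ^ (b * (6 * s * b))) := by
          gcongr
          norm_num
      _ = 2 ^ (7 + (6 * b + 1) + b * (6 * s * b)) := by rw [pow_add, pow_add]; ring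
      _ ≤ _ := Nat.pow_le_pow_right (by decide) h2

/-- Since `d ≥ 0` forces `δ < 1`, the bounds `1 ≤ l < δ ^ 2 s / 16` imply `δ s > 16` and `s > 16`,
which excludes all degenerate cases. Rounding down in `r` gives `δ s < 4 (r + 1)`, and therefore `l
s < (δ s / 4) ^ 2 < (r + 1) ^ 2`. -/
theorem admissible_of_real {δ α : ℝ} (hδ : 0 < δ) (hsq : s < q) (hd : (d : ℝ) < (1 - δ) * s * q)
    (hl : 1 ≤ l) (hls : (l : ℝ) < δ ^ 2 * s / 16) (hα : 0 ≤ α) (hα' : α < 1 / (2 * s)) :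
    Admissible q s d l ⌊α * q⌋₊ ((s * q - d) / (4 * q)) := by
  have hq0 : 0 < q := by omega
  have hqR : (0 : ℝ) < q := by exact_mod_cast hq0
  have hl1 : (1 : ℝ) ≤ l := by exact_mod_cast hl
  have hs0 : (0 : ℝ) < s := by
    rcases Nat.eq_zero_or_pos s with rfl | h
    · norm_num at hls; linarith
    · exact_mod_cast h
  have hδ1 : δ < 1 := by
    by_contra h
    push Not at h
    have : (1 - δ) * s * q ≤ 0 := by
      rw [mul_assoc]
      exact mul_nonpos_of_nonpos_of_nonneg (by linarith) (by positivity)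
    have : (0 : ℝ) ≤ d := Nat.cast_nonneg d
    linarith
  have hδ2 : δ ^ 2 ≤ δ := by nlinarith
  have hδs : 16 < δ * s := by nlinarith
  have hs16 : (16 : ℝ) < s := by nlinarith
  have hs17 : 17 ≤ s := by
    have : 16 < s := by exact_mod_cast hs16
    omega
  have hdq : d ≤ s * q := by
    have : (d : ℝ) ≤ s * q := by nlinarith [mul_pos hs0 hqR]
    exact_mod_cast this
  set r := (s * q - d) / (4 * q) with hr
  have hr1 : s * q - d < (r + 1) * (4 * q) := by
    have := Nat.lt_mul_div_succ (s * q - d) (show 0 < 4 * q by omega)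
    rw [mul_comm (r + 1)]
    exact this
  have hr2 : r * (4 * q) ≤ s * q - d := Nat.div_mul_le_self _ _
  have hrR : δ * s < 4 * (r + 1) := by
    have h1 : (s * q : ℝ) - d < (r + 1) * (4 * q) := by
      have : ((s * q - d : ℕ) : ℝ) < ((r + 1) * (4 * q) : ℕ) := by exact_mod_cast hr1
      rw [Nat.cast_sub hdq] at this
      push_cast at this
      exact this
    have h2 : δ * s * q < 4 * (r + 1) * q := by nlinarith
    exact lt_of_mul_lt_mul_right h2 hqR.le
  refine ⟨hr, by omega, hsq, by omega, hl, ?_, ?_, ?_, ?_, ?_⟩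
  · have : (l : ℝ) < s := by nlinarith
    exact_mod_cast this
  · by_contra h
    have : r = 0 := Nat.eq_zero_of_not_pos h
    rw [this] at hrR
    norm_num at hrR
    linarith
  · have : 4 * r * q = r * (4 * q) := by ring
    omega
  · have h1 : (δ * s) * (δ * s) < (4 * (r + 1)) * (4 * (r + 1)) :=
      mul_self_lt_mul_self (by positivity) hrR
    have h2 : (l : ℝ) * s < (r + 1) * (r + 1) := by
      have : (l : ℝ) * s < δ ^ 2 * s / 16 * s := mul_lt_mul_of_pos_right hls hs0
      nlinarith
    exact_mod_cast h2
  · have h1 : (⌊α * q⌋₊ : ℝ) ≤ α * q := Nat.floor_le (by positivity)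
    have h2 : α * (2 * s) < 1 := by rwa [lt_div_iff₀ (by positivity)] at hα'
    have h3 : (2 * s * ⌊α * q⌋₊ : ℝ) ≤ q := by
      calc (2 * s * ⌊α * q⌋₊ : ℝ) ≤ 2 * s * (α * q) := by gcongr
        _ = α * (2 * s) * q := by ring
        _ ≤ 1 * q := by gcongr
        _ = q := one_mul _
    exact_mod_cast h3

end Parameters

/-! ### From explicit parameters to the stated bounds. -/

section ListSize

variable {q s d l e : ℕ}

theorem encard_le_of_forall_finset {A : Type*} {S : Set A} {L : ℕ}
    (h : ∀ F : Finset A, (∀ x ∈ F, x ∈ S) → F.card ≤ L) : S.encard ≤ L := by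
  by_contra hlt
  push Not at hlt
  obtain ⟨T, hTS, hT⟩ := Set.exists_subset_encard_eq (s := S) (k := ((L + 1 : ℕ) : ℕ∞))
    (by push_cast; exact Order.add_one_le_of_lt hlt)
  have hfin : T.Finite := Set.finite_of_encard_eq_coe hT
  have h1 := h hfin.toFinset fun x hx => hTS (hfin.mem_toFinset.1 hx)
  rw [hfin.encard_eq_coe_toFinset_card] at hT
  have h2 : hfin.toFinset.card = L + 1 := by exact_mod_cast hT
  omega

/-- Codewords are images of polynomials, so it suffices to count polynomials; injectivity of the
encoding is not needed for an upper bound. -/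
theorem Admissible.listRecoverable {r : ℕ} [hq : Fact q.Prime] {α : ℝ} (hα : 0 ≤ α)
    (h : Admissible q s d l ⌊α * q⌋₊ r) :
    ListRecoverable (multCode (ZMod q) s d) α l
      (2 ^ (6 * (Nat.log 2 s + 1) + 1) * l ^ (6 * s * (Nat.log 2 s + 1))) := by
  classical
  intro S hS
  set P := runParams q s d l ⌊α * q⌋₊ with hP
  have : Fact P.q.Prime := hq
  have hw : ∀ a : ZMod P.q, ((S a).toList).length ≤ P.l := fun a => by
    rw [Finset.length_toList]; exact hS a
  have hS' : (fun a => ((S a).toList).toFinset) = S := funext fun a => Finset.toList_toFinset _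
  have key : ∀ f : (ZMod q)[X], IsValid P (fun a => ((S a).toList).length)
      (inputSymbol P.l fun a => (S a).toList) f ↔
      f.natDegree ≤ d ∧ listDist (multEnc s f) S ≤ α := fun f => by
    have := isValid_iff (P := P) (w := fun a => (S a).toList) hw hα rfl f
    refine this.trans (Eq.to_iff ?_)
    change (f.natDegree ≤ d ∧ listDist (multEnc s f) (fun a => ((S a).toList).toFinset) ≤ α) = _
    rw [hS']
  have hsub : {c | c ∈ multCode (ZMod q) s d ∧ listDist c S ≤ α} ⊆
      multEnc s '' {f : (ZMod q)[X] | f.natDegree ≤ d ∧ listDist (multEnc s f) S ≤ α} := by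
    rintro c ⟨⟨f, hf, rfl⟩, hc⟩
    exact ⟨f, ⟨hf, hc⟩, rfl⟩
  refine (Set.encard_le_encard hsub).trans ((Set.encard_image_le _ _).trans
    (encard_le_of_forall_finset fun F hF => ?_))
  exact card_solutions_le h.params.1 F fun f hf =>
    IsValid.isSolution (P := P) (fun a _ => hw _) ((key f).2 (hF f hf))

theorem log_succ_le_logb (hs : 2 ≤ s) : ((Nat.log 2 s + 1 : ℕ) : ℝ) ≤ 2 * Real.logb 2 s := by
  have h1 : (Nat.log 2 s : ℝ) ≤ Real.logb 2 s := by
    have := Real.natLog_le_logb s 2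
    exact_mod_cast this
  have h2 : (1 : ℝ) ≤ Real.logb 2 s := by
    rw [Real.le_logb_iff_rpow_le (by norm_num) (by positivity), Real.rpow_one]
    exact_mod_cast hs
  push_cast
  linarith

theorem pow_le_rpow_logb (hl : 0 < l) (hs : 2 ≤ s) :
    (l : ℝ) ^ (6 * s * (Nat.log 2 s + 1)) ≤ (l : ℝ) ^ (12 * (s * Real.logb 2 s)) := by
  rw [← Real.rpow_natCast]
  refine Real.rpow_le_rpow_of_exponent_le (by exact_mod_cast hl) ?_
  have h1 := log_succ_le_logb hs
  have h2 : (0 : ℝ) ≤ 6 * s := by positivity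
  have h3 := mul_le_mul_of_nonneg_left h1 h2
  push_cast at h3 ⊢
  linarith

/-- The constant is `13 = 7 + 6`, from `128 s ^ 6 ≤ s ^ 7 * s ^ 6`; it also exceeds the factor `12`
in `t ≤ 12 s log₂ s`. -/
theorem Admissible.list_size_le {r : ℕ} (h : Admissible q s d l e r) {C : ℝ} (hC : 13 ≤ C) :
    ((2 ^ (6 * (Nat.log 2 s + 1) + 1) * l ^ (6 * s * (Nat.log 2 s + 1)) : ℕ) : ℝ)
      ≤ (l : ℝ) ^ (C * (s * Real.logb 2 s)) * (s : ℝ) ^ C := by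
  have hs := h.s_ge
  have hsR : (1 : ℝ) ≤ s := by exact_mod_cast (by omega : 1 ≤ s)
  have hlR : (1 : ℝ) ≤ l := by exact_mod_cast h.l_pos
  have hlog : 0 ≤ Real.logb 2 s := Real.logb_nonneg (by norm_num) hsR
  have h1 : (2 ^ (6 * (Nat.log 2 s + 1) + 1) : ℕ) ≤ s ^ 13 := by
    calc 2 ^ (6 * (Nat.log 2 s + 1) + 1) ≤ 2 ^ 7 * s ^ 6 := h.two_pow_le
      _ ≤ s ^ 7 * s ^ 6 := Nat.mul_le_mul_right _ (Nat.pow_le_pow_left hs 7)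
      _ = _ := by ring
  have h2 : ((2 ^ (6 * (Nat.log 2 s + 1) + 1) : ℕ) : ℝ) ≤ (s : ℝ) ^ C := by
    calc ((2 ^ (6 * (Nat.log 2 s + 1) + 1) : ℕ) : ℝ) ≤ (s : ℝ) ^ 13 := by exact_mod_cast h1
      _ = (s : ℝ) ^ (13 : ℝ) := by rw [← Real.rpow_natCast]; norm_num
      _ ≤ _ := Real.rpow_le_rpow_of_exponent_le hsR hC
  have h3 : (l : ℝ) ^ (6 * s * (Nat.log 2 s + 1)) ≤ (l : ℝ) ^ (C * (s * Real.logb 2 s)) := by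
    refine (pow_le_rpow_logb h.l_pos hs).trans (Real.rpow_le_rpow_of_exponent_le hlR ?_)
    exact mul_le_mul_of_nonneg_right (by linarith) (by positivity)
  rw [Nat.cast_mul, mul_comm, Nat.cast_pow l]
  exact mul_le_mul h3 h2 (by positivity) (by positivity)

/-- With `X = l ^ (s log₂ s)`, all loop bounds are at most `q ^ 20 X ^ 12`, and one more factor `q`
absorbs the summand `1`, giving `(q X) ^ 21`. The constant factor `K` is absorbed by `(q X) ^ K`, as
`q X ≥ 2`. -/
theorem Admissible.time_le {r K D : ℕ} (h : Admissible q s d l e r) {T : ℕ}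
    (hT : T ≤ K * (q ^ 20 * l ^ (6 * s * (Nat.log 2 s + 1)) + 1) ^ D) {C : ℝ}
    (hC : ((K + 21 * D : ℕ) : ℝ) ≤ C) :
    (T : ℝ) ≤ ((q : ℝ) * (l : ℝ) ^ ((s : ℝ) * Real.logb 2 s)) ^ C := by
  have hs := h.s_ge
  have hq := h.q_ge
  have hsR : (1 : ℝ) ≤ s := by exact_mod_cast (by omega : 1 ≤ s)
  have hqR : (17 : ℝ) ≤ q := by exact_mod_cast hq
  have hlR : (1 : ℝ) ≤ l := by exact_mod_cast h.l_pos
  have hlog : 0 ≤ Real.logb 2 s := Real.logb_nonneg (by norm_num) hsR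
  set X : ℝ := (l : ℝ) ^ ((s : ℝ) * Real.logb 2 s) with hX
  have hX1 : 1 ≤ X := Real.one_le_rpow hlR (by positivity)
  have hY : (l : ℝ) ^ (6 * s * (Nat.log 2 s + 1)) ≤ X ^ 12 := by
    refine (pow_le_rpow_logb h.l_pos hs).trans_eq ?_
    rw [hX, ← Real.rpow_natCast, ← Real.rpow_mul (by positivity), mul_comm]
    norm_num
  have hqX : 2 ≤ q * X := by nlinarith
  have hY1 : 1 ≤ X ^ 12 := one_le_pow₀ hX1
  have hZ : (q : ℝ) ^ 20 * (l : ℝ) ^ (6 * s * (Nat.log 2 s + 1)) + 1 ≤ (q * X) ^ 21 := by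
    have e1 : (1 : ℝ) ≤ q ^ 20 := one_le_pow₀ (by linarith)
    calc (q : ℝ) ^ 20 * (l : ℝ) ^ (6 * s * (Nat.log 2 s + 1)) + 1
        ≤ q ^ 20 * X ^ 12 + q ^ 20 * X ^ 12 := by
          gcongr
          exact one_le_mul_of_one_le_of_one_le e1 hY1
      _ = 2 * (q ^ 20 * X ^ 12) := by ring
      _ ≤ q * (q ^ 20 * X ^ 21) := by
          gcongr
          · linarith
          · norm_num
      _ = _ := by ring
  have hK : (K : ℝ) ≤ (q * X) ^ K := by
    have : (K : ℝ) ≤ 2 ^ K := by exact_mod_cast Nat.lt_two_pow_self.le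
    exact this.trans (pow_le_pow_left₀ (by norm_num) hqX K)
  calc (T : ℝ) ≤ K * ((q : ℝ) ^ 20 * (l : ℝ) ^ (6 * s * (Nat.log 2 s + 1)) + 1) ^ D := by
        exact_mod_cast hT
    _ ≤ (q * X) ^ K * ((q * X) ^ 21) ^ D := by gcongr
    _ = (q * X) ^ (K + 21 * D) := by rw [← pow_mul, ← pow_add]
    _ = (q * X) ^ ((K + 21 * D : ℕ) : ℝ) := (Real.rpow_natCast _ _).symm
    _ ≤ _ := Real.rpow_le_rpow_of_exponent_le (by linarith) hC

theorem Admissible.solvesWithin {r : ℕ} [hq : Fact q.Prime] {α : ℝ} (hα : 0 ≤ α)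
    (h : Admissible q s d l ⌊α * q⌋₊ r) {w : ZMod q → List (Fin s → ZMod q)}
    (hw : ∀ a, (w a).length ≤ l) :
    Prog.decoder.SolvesWithin (inputStore q s d l ⌊α * q⌋₊ w)
      (Prog.decoderTime (q ^ 20 * l ^ (6 * s * (Nat.log 2 s + 1)))) (99 / 100)
      (ListsAll q s d α w) := by
  have : Fact (runParams q s d l ⌊α * q⌋₊).q.Prime := hq
  exact solvesWithin_decoder (P := runParams q s d l ⌊α * q⌋₊) h.params.1 h.fits.1 rfl rfl rfl
    (two_pow_log_succ_le (by have := h.s_ge; omega)) h.val_le h.trials.1 h.trials.2 hα rfl hw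

end ListSize

theorem theorem4p3 :
    -- one absolute constant and one program for all parameters
    ∃ (C : ℝ) (prog : Prog), 0 < C ∧
      ∀ (δ α : ℝ) (q s d ℓ : ℕ) [Fact q.Prime],
        0 < δ → s < q → (d : ℝ) < (1 - δ) * s * q →
        1 ≤ ℓ → (ℓ : ℝ) < δ ^ 2 * s / 16 →
        0 ≤ α → α < 1 / (2 * s) →
        -- the combinatorial bound
        (∃ L : ℕ, (L : ℝ) ≤ (ℓ : ℝ) ^ (C * (s * Real.logb 2 s)) * (s : ℝ) ^ C ∧
          ListRecoverable (multCode (ZMod q) s d) α ℓ L) ∧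
        -- the algorithm and its running time
        (∃ T : ℕ, (T : ℝ) ≤ ((q : ℝ) * (ℓ : ℝ) ^ ((s : ℝ) * Real.logb 2 s)) ^ C ∧
          ∀ w : ZMod q → List (Fin s → ZMod q), (∀ a, (w a).length ≤ ℓ) →
            prog.SolvesWithin (inputStore q s d ℓ ⌊α * q⌋₊ w) T (99 / 100)
              (ListsAll q s d α w)) := by
  obtain ⟨K, D, hKD⟩ := Prog.exists_decoderTime_le
  -- The first summand serves the running time, the second one the list size.
  refine ⟨((K + 21 * D : ℕ) : ℝ) + 13, Prog.decoder, by positivity, ?_⟩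
  intro δ α q s d ℓ _ hδ hsq hd hℓ hℓs hα hα'
  have h := admissible_of_real hδ hsq hd hℓ hℓs hα hα'
  exact ⟨⟨_, h.list_size_le (le_add_of_nonneg_left (Nat.cast_nonneg _)), h.listRecoverable hα⟩,
    ⟨_, h.time_le (hKD _) (by linarith), fun w hw => h.solvesWithin hα hw⟩⟩
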